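/- Let $\mathcal N\subset\mathbb R^3$ be a compact smooth embedded hypersurface (without boundary). For $h>0$ and $u=(u_j)_{j\in\mathbb Z^2}$ with $u_j\in\mathbb R^3$ put $D_{+i}u_j=\frac{u_{j+e_i}-u_j}{h}$, $D_{-i}u_j=\frac{u_j-u_{j-e_i}}{h}$, $\Delta^hu_j=\sum_{i=1}^2D_{+i}D_{-i}u_j$ and $$E^h[u]=\tfrac12h^2\sum_{j}\sum_{i=1}^2\tfrac12\big(|D_{+i}u_j|^2+|D_{-i}u_j|^2\big)\in[0,\infty].$$ The $H^1$-interpolant of $u$ is the continuous map $\mathbb R^2\to\mathbb R^3$ which on each square $[j_1h,(j_1+1)h)\times[j_2h,(j_2+1)h)$ equals $$u_j+D_{+1}u_j\,(x-j_1h)+D_{+2}u_j\,(y-j_2h)+D_{+1}D_{+2}u_j\,(x-j_1h)(y-j_2h).$$ There is a constant $\epsilon_0>0$, depending only on $\mathcal N$, such that the following holds. Let $\nu$ be a smooth unit normal field of $\mathcal N$ (smoothly extended to $\mathbb R^3$), let $h_n>0$ with $h_n\to0$, and let $f^{h_n}:\mathbb Z^2\to\mathcal N$ be discrete data with $\sup_nE^{h_n}[f^{h_n}]<\epsilon_0$.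 Then for every $n$ (with $h=h_n$) the semi-discrete harmonic map heat flow $$\frac{d}{dt}u^h_j=\Delta^hu^h_j+\lambda^h_j\,\nu(u^h_j),\qquad\lambda^h_j=-\Delta^hu^h_j\cdot\nu(u^h_j),\qquad u^h_j(0)=f^h_j ,$$ has a solution $u^h_j:[0,\infty)\to\mathcal N$, $j\in\mathbb Z^2$. For any choice of such solutions, let $p_{h_n}(t)$ be the $H^1$-interpolant of $u^{h_n}(t)$. There are a subsequence $(h_{n_k})$ and maps $f:\mathbb R^2\to\mathcal N$ and $p:(0,\infty)\times\mathbb R^2\to\mathcal N$ (values in $\mathcal N$ almost everywhere) such that 1. $p_{h_{n_k}}(0)\to f$ strongly in $L^2_{loc}(\mathbb R^2)$, and $p_{h_{n_k}}(t)\to p(t)$ strongly in $H^1_{loc}(\mathbb R^2)$ for every $t>0$; 2. if moreover the initial interpolants converge globally, i.e. $\|p_{h_{n_k}}(0)-f\|_{H^1(\mathbb R^2)}\to0$, then $\|p_{h_{n_k}}(t)-p(t)\|_{H^1(\mathbb R^2)}\to0$ for every $t>0$; 3. $p$ solves the harmonic map heat flow $\partial_tp=\Delta p+(\nabla\nu(p)\cdot\nabla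 p)\,\nu(p)$, $p(0)=f$, in the sense of distributions: the weak gradient $\nabla p$ is square integrable on $K\cap\big((0,\infty)\times\mathbb R^2\big)$ for every compact $K\subset\mathbb R\times\mathbb R^2$, and for all $\phi\in C_c^\infty(\mathbb R\times\mathbb R^2;\mathbb R^3)$ $$\int_0^\infty\!\!\int_{\mathbb R^2}p\cdot\partial_t\phi+p\cdot\Delta\phi+(\nabla\nu(p)\cdot\nabla p)\,\nu(p)\cdot\phi\;dx\,dt+\int_{\mathbb R^2}f\cdot\phi(0,\cdot)\,dx=0,$$ where $\nabla\nu(p)\cdot\nabla p=\sum_{i=1}^2\big(d\nu(p)\,\partial_ip\big)\cdot\partial_ip$. -/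

import Mathlib

open Set Filter Topology MeasureTheory
open scoped ContDiff RealInnerProductSpace ENNReal

namespace HarmonicFlow

/-- The plane `ℝ²` with its Euclidean norm. -/
abbrev Plane : Type := EuclideanSpace ℝ (Fin 2)

/-- The ambient space `ℝ³` of the target, with its Euclidean norm. -/
abbrev Space : Type := EuclideanSpace ℝ (Fin 3)

/-- Indices `j = (j₁, j₂)` of the grid points `jh`. -/
abbrev Grid : Type := Fin 2 → ℤ

/-! ### The target -/

/-- `N` is a smooth embedded hypersurface of `ℝ³` without boundary: near each of its points it is
the zero set of a smooth function with nonvanishing differential. -/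
def IsSmoothHypersurface (N : Set Space) : Prop :=
  ∀ y ∈ N, ∃ (U : Set Space) (F : Space → ℝ), IsOpen U ∧ y ∈ U ∧ ContDiffOn ℝ ∞ F U ∧
    (∀ z ∈ U, fderiv ℝ F z ≠ 0) ∧ N ∩ U = {z ∈ U | F z = 0}

/-- `ν` is a smooth unit normal field of `N`, given together with some smooth extension to `ℝ³`.
For a smooth hypersurface `tangentConeAt ℝ N y` is the tangent plane `T_y N`. -/
structure IsUnitNormalField (N : Set Space) (ν : Space → Space) : Prop where
  smooth : ContDiff ℝ ∞ ν
  norm_eq_one : ∀ y ∈ N, ‖ν y‖ = 1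
  orthogonal : ∀ y ∈ N, ∀ v ∈ tangentConeAt ℝ N y, ⟪ν y, v⟫ = 0

/-! ### Difference calculus on the grid -/

/-- The unit multi-index in direction `i`. -/
def unitIndex (i : Fin 2) : Grid := Pi.single i 1

/-- Forward difference `D_{+i}`. -/
noncomputable def forwardDiff (h : ℝ) (i : Fin 2) (u : Grid → Space) : Grid → Space :=
  fun j => h⁻¹ • (u (j + unitIndex i) - u j)

/-- Backward difference `D_{-i}`. -/
noncomputable def backwardDiff (h : ℝ) (i : Fin 2) (u : Grid → Space) : Grid → Space :=
  fun j => h⁻¹ • (u j - u (j - unitIndex i))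

/-- The discrete Laplacian `Δ^h = ∑ᵢ D_{+i} D_{-i}`. -/
noncomputable def discreteLaplacian (h : ℝ) (u : Grid → Space) : Grid → Space :=
  fun j => ∑ i, forwardDiff h i (backwardDiff h i u) j

/-- The discrete Dirichlet energy
`E^h[u] = ½ h² ∑_j ∑_i ½ (|D_{+i} u_j|² + |D_{-i} u_j|²)`, possibly infinite. -/
noncomputable def discreteEnergy (h : ℝ) (u : Grid → Space) : ℝ≥0∞ :=
  ∑' j : Grid, ENNReal.ofReal
    (1 / 2 * h ^ 2 * ∑ i, 1 / 2 * (‖forwardDiff h i u j‖ ^ 2 + ‖backwardDiff h i u j‖ ^ 2))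

/-- `u` is a global solution, with values in `N`, of the semi-discrete harmonic map heat flow
`∂ₜ u_j = Δ^h u_j + λ_j ν(u_j)`, `λ_j = - Δ^h u_j · ν(u_j)`, `u_j(0) = f_j`. -/
structure IsSemidiscreteFlow (N : Set Space) (ν : Space → Space) (h : ℝ) (f : Grid → Space)
    (u : ℝ → Grid → Space) : Prop where
  initial : ∀ j, u 0 j = f j
  mem_target : ∀ t, 0 ≤ t → ∀ j, u t j ∈ N
  equation : ∀ t, 0 ≤ t → ∀ j, HasDerivWithinAt (fun s => u s j)
    (discreteLaplacian h (u t) j + (-⟪discreteLaplacian h (u t) j, ν (u t j)⟫) • ν (u t j))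
    (Ici 0) t

/-! ### The interpolant -/

/-- The index of the grid square `[j₁h, (j₁+1)h) × [j₂h, (j₂+1)h)` that contains `x`. -/
noncomputable def cellIndex (h : ℝ) (x : Plane) : Grid := fun i => ⌊x i / h⌋

/-- The piecewise bilinear `H¹`-interpolant of a grid function. -/
noncomputable def interpolant (h : ℝ) (u : Grid → Space) (x : Plane) : Space :=
  let j := cellIndex h x
  u j + (x 0 - j 0 * h) • forwardDiff h 0 u j + (x 1 - j 1 * h) • forwardDiff h 1 u j
    + ((x 0 - j 0 * h) * (x 1 - j 1 * h)) • forwardDiff h 0 (forwardDiff h 1 u) j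

/-! ### Weak gradients and Sobolev convergence -/

/-- The locally integrable maps `g 0`, `g 1` are the weak partial derivatives of the locally
integrable map `u` on the open set `Ω`. -/
structure HasWeakGradient (Ω : Set Plane) (u : Plane → Space) (g : Fin 2 → Plane → Space) :
    Prop where
  locInt : LocallyIntegrableOn u Ω
  locInt_grad : ∀ i, LocallyIntegrableOn (g i) Ω
  weak : ∀ i, ∀ φ : Plane → ℝ, ContDiff ℝ ∞ φ → HasCompactSupport φ → tsupport φ ⊆ Ω →
    ∫ x, fderiv ℝ φ x (EuclideanSpace.single i 1) • u x = - ∫ x, φ x • g i x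

/-- Strong convergence `q_k → p` in `L²(Ω)`, i.e. `‖q_k - p‖_{L²(Ω)} → 0`. -/
def TendstoInL2 (Ω : Set Plane) (q : ℕ → Plane → Space) (p : Plane → Space) : Prop :=
  (∀ k, AEStronglyMeasurable (q k) (volume.restrict Ω)) ∧
  AEStronglyMeasurable p (volume.restrict Ω) ∧
  Tendsto (fun k => eLpNorm (q k - p) 2 (volume.restrict Ω)) atTop (𝓝 0)

/-- Strong convergence `q_k → p` in `H¹(Ω)`: all maps are weakly differentiable and
`‖q_k - p‖_{H¹(Ω)} → 0`. (On `Ω = ℝ²` the maps themselves need not be square integrable, which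
maps into a hypersurface that avoids the origin never are.) -/
def TendstoInH1 (Ω : Set Plane) (q : ℕ → Plane → Space) (p : Plane → Space) : Prop :=
  ∃ (Dq : ℕ → Fin 2 → Plane → Space) (Dp : Fin 2 → Plane → Space),
    (∀ k, HasWeakGradient Ω (q k) (Dq k)) ∧ HasWeakGradient Ω p Dp ∧
    TendstoInL2 Ω q p ∧ ∀ i, TendstoInL2 Ω (fun k => Dq k i) (Dp i)

/-! ### The harmonic map heat flow in the sense of distributions -/

/-- The open half space `(0, ∞) × ℝ²`. -/
def upperHalf : Set (ℝ × Plane) := Ioi 0 ×ˢ univ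

/-- `p : (0, ∞) × ℝ² → N` solves, in the sense of distributions,
`∂ₜ p = Δ p + (∇ν(p) · ∇p) ν(p)`, `p(0) = f`, where `∇ν(p) · ∇p = ∑ᵢ ∂ᵢ(ν(p)) · ∂ᵢp`.
The test maps do not have to vanish at `t = 0`; that is how the initial condition enters. The weak
derivatives `G i` of `p` are tangent to `N`, so that the choice of the extension of `ν` does not
matter. -/
def IsDistributionalSolution (N : Set Space) (ν : Space → Space) (f : Plane → Space)
    (p : ℝ → Plane → Space) : Prop :=
  AEStronglyMeasurable f ∧ (∀ᵐ x : Plane, f x ∈ N) ∧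
  AEStronglyMeasurable (fun z : ℝ × Plane => p z.1 z.2) (volume.restrict upperHalf) ∧
  (∀ᵐ z : ℝ × Plane ∂(volume.restrict upperHalf), p z.1 z.2 ∈ N) ∧
  ∃ G : Fin 2 → ℝ → Plane → Space,
    (∀ i, ∀ K : Set (ℝ × Plane), IsCompact K →
      MemLp (fun z : ℝ × Plane => G i z.1 z.2) 2 (volume.restrict (K ∩ upperHalf))) ∧
    (∀ᵐ t : ℝ ∂(volume.restrict (Ioi 0)), HasWeakGradient univ (p t) (fun i => G i t)) ∧
    ∀ φ : ℝ × Plane → Space, ContDiff ℝ ∞ φ → HasCompactSupport φ →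
      (∫ z in upperHalf,
          (⟪p z.1 z.2, deriv (fun s => φ (s, z.2)) z.1⟫
            + ⟪p z.1 z.2, Laplacian.laplacian (fun y => φ (z.1, y)) z.2⟫
            + (∑ i, ⟪fderiv ℝ ν (p z.1 z.2) (G i z.1 z.2), G i z.1 z.2⟫)
              * ⟪ν (p z.1 z.2), φ z⟫))
        + ∫ x, ⟪f x, φ (0, x)⟫ = 0

end HarmonicFlow

open scoped NNReal

/-! In two dimensions the Dirichlet energy is invariant under scaling, so the grid with step `h` may
be replaced by the grid with unit step, run at time `h⁻² t`. There the flow is an ordinary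
differential equation in `ℓ²` for the displacement from the initial map. After a truncation its
right-hand side is Lipschitz, so it has global solutions; they stay on `N`, where the truncation is
inactive (`exists_isUnitFlow`). Uniqueness (`semidiscreteFlow_unique`) carries all estimates over to
an arbitrary solution.

The estimates rest on two facts. Chords of `N` are tangent up to second order
(`exists_abs_inner_normal_le`), so the normal part of the Laplacian of a map into `N` is quadratic
in its differences. The discrete Ladyzhenskaya inequality (`tsum_norm_pow_four_le`), together with
the equality of the norms of Hessian and Laplacian (`sum_norm_diff_sq_eq`), bounds the `ℓ²` norm of
such a quadratic quantity by the square root of the energy times the norm of the Laplacian. If the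
energy is small, the normal part is absorbed and the velocity controls the Laplacian
(`IsUnitFlow.norm_sub_tangent_le`). The same absorption, applied to the difference of the solution
at two times, shows that the velocity can grow at most by a fixed factor (`IsUnitFlow.increment_le`,
`IsUnitFlow.norm_velocity_sq_le`). As its square is the dissipation rate of the energy, it decays
like `t^(-1/2)`, and so does the Hessian (`IsUnitFlow.lapOf_decay`). Thus no energy concentrates at
positive times. Undoing the scaling gives `FlowBounds`, uniform in `h`.

Compactness is that of Riesz and Kolmogorov. The energy bounds translates of the piecewise constant
interpolants and the Hessian bounds those of their difference quotients; both are equicontinuous in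
time with values in `L²`. Hence one subsequence serves all times
(`exists_subseq_tendsto_dyadicLimit`, `FlowSeq.exists_flowLimit`). The bilinear interpolants and
their gradients differ from these step functions by `O(h)`.

If the initial interpolants converge globally, their gradients have uniformly small tails. Since
`enorm_dif_sq_le` bounds difference quotients by the gradient of the interpolant, the local energy
inequality (`IsUnitFlow.local_energy_le`) propagates this smallness to positive times
(`FlowSeq.tight`), and local convergence becomes global (`FlowLimit.tendstoInH1_univ`).

For the equation, the semi-discrete flow is tested with a smooth map and summed by parts
(`IsSemidiscreteFlow.integral_weakSlice`). The only nonlinear term is the multiplier. The sum of the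
normals at the two ends of a chord is orthogonal to it up to third order
(`exists_abs_inner_add_normal_le`), so the multiplier equals a quadratic form in the difference
quotients plus a remainder of order `h` in `L¹`. Strong `L²` convergence of the quotients gives its
limit at every positive time (`FlowLimit.tendsto_integral_multiplier`), and an `L¹` bound coming
from the energy alone permits dominated convergence in time down to `t = 0`. -/

namespace HarmonicFlow

/-! ### Chords and normals of a compact hypersurface -/

/-- Near a regular zero `y₀` of `F` the distance to the zero set of `F` is controlled by `|F|`. -/
theorem exists_dist_zeroSet_le {U : Set Space} {F : Space → ℝ} {y₀ : Space} (hU : IsOpen U)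
    (hy₀ : y₀ ∈ U) (hF : ContDiffOn ℝ ∞ F U) (hd : fderiv ℝ F y₀ ≠ 0) (h0 : F y₀ = 0) :
    ∃ r > 0, ∃ C : ℝ, 0 ≤ C ∧ ∀ y ∈ Metric.ball y₀ r, ∃ z ∈ U, F z = 0 ∧ dist y z ≤ C * |F y| := by
  obtain ⟨v, hv⟩ : ∃ v, fderiv ℝ F y₀ v = 1 := by
    obtain ⟨w, hw⟩ := DFunLike.ne_iff.1 hd
    have hw : fderiv ℝ F y₀ w ≠ 0 := by simpa using hw
    exact ⟨(fderiv ℝ F y₀ w)⁻¹ • w, by simp [hw]⟩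
  have hcd : ContinuousAt (fun z => fderiv ℝ F z v) y₀ :=
    (((hF.continuousOn_fderiv_of_isOpen hU (by simp)).continuousAt (hU.mem_nhds hy₀))).clm_apply
      continuousAt_const
  have hcF : ContinuousAt F y₀ := hF.continuousOn.continuousAt (hU.mem_nhds hy₀)
  have h1 : ∀ᶠ z in 𝓝 y₀, z ∈ U ∧ 1 / 2 < fderiv ℝ F z v :=
    (hU.eventually_mem hy₀).and (hcd.eventually_const_lt (by simp only [hv]; norm_num))
  obtain ⟨r₀, hr₀, hball⟩ := Metric.eventually_nhds_iff_ball.1 h1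
  have h2 : ∀ᶠ z in 𝓝 y₀, 2 * |F z| * ‖v‖ < r₀ / 2 := by
    have : ContinuousAt (fun z => 2 * |F z| * ‖v‖) y₀ := by fun_prop
    exact this.eventually_lt_const (by simp [h0, hr₀])
  obtain ⟨r₁, hr₁, hball₁⟩ := Metric.eventually_nhds_iff_ball.1 h2
  refine ⟨min (r₀ / 2) r₁, by positivity, 2 * ‖v‖, by positivity, fun y hy => ?_⟩
  have hyr₀ : dist y y₀ < r₀ / 2 := lt_of_lt_of_le hy (min_le_left _ _)
  have hFy := hball₁ y (Metric.mem_ball.2 (lt_of_lt_of_le (Metric.mem_ball.1 hy) (min_le_right _ _)))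
  -- The slope of `F` along `v` exceeds `1 / 2` near `y₀`, so within distance `b` in one of the two
  -- directions the value `F y` is compensated.
  set b := 2 * |F y| with hb
  have hb0 : 0 ≤ b := by positivity
  have hin : ∀ s ∈ Icc (-b) b, y + s • v ∈ Metric.ball y₀ r₀ := by
    intro s hs
    rw [Metric.mem_ball]
    calc dist (y + s • v) y₀ ≤ dist (y + s • v) y + dist y y₀ := dist_triangle _ _ _
      _ = |s| * ‖v‖ + dist y y₀ := by simp [dist_eq_norm, norm_smul]
      _ < r₀ := by
        have : |s| * ‖v‖ ≤ b * ‖v‖ := by gcongr; exact abs_le.2 hs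
        linarith
  have hder : ∀ s ∈ Icc (-b) b,
      HasDerivAt (fun s : ℝ => F (y + s • v)) (fderiv ℝ F (y + s • v) v) s := by
    intro s hs
    have hU' := (hball _ (hin s hs)).1
    have h3 : HasFDerivAt F (fderiv ℝ F (y + s • v)) (y + s • v) :=
      ((hF.contDiffAt (hU.mem_nhds hU')).differentiableAt (by simp)).hasFDerivAt
    have h4 : HasDerivAt (fun s : ℝ => y + s • v) v s := by
      simpa using ((hasDerivAt_id s).smul_const v).const_add y
    exact h3.comp_hasDerivAt s h4
  have hcont : ContinuousOn (fun s : ℝ => F (y + s • v)) (Icc (-b) b) :=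
    fun s hs => (hder s hs).continuousAt.continuousWithinAt
  have hslope : ∀ s ∈ Icc (-b) b, ∀ t ∈ Icc (-b) b, s ≤ t →
      1 / 2 * (t - s) ≤ F (y + t • v) - F (y + s • v) := by
    apply (convex_Icc (-b) b).mul_sub_le_image_sub_of_le_deriv hcont
    · exact fun s hs => (hder s (interior_subset hs)).differentiableAt.differentiableWithinAt
    · intro s hs
      rw [(hder s (interior_subset hs)).deriv]
      exact (hball _ (hin s (interior_subset hs))).2.le
  have hm0 : (0 : ℝ) ∈ Icc (-b) b := ⟨by linarith, hb0⟩
  have hmb : b ∈ Icc (-b) b := ⟨by linarith, le_rfl⟩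
  have hmb' : -b ∈ Icc (-b) b := ⟨le_rfl, by linarith⟩
  have h5 := hslope 0 hm0 b hmb hb0
  have h6 := hslope (-b) hmb' 0 hm0 (by linarith)
  simp only [zero_smul, add_zero] at h5 h6
  have habs := abs_le.1 (le_refl |F y|)
  obtain ⟨s, hs, hFs⟩ := intermediate_value_Icc (by linarith) hcont
    (show (0 : ℝ) ∈ Icc _ _ from ⟨by linarith, by linarith⟩)
  refine ⟨y + s • v, (hball _ (hin s hs)).1, hFs, ?_⟩
  have : |s| * ‖v‖ ≤ b * ‖v‖ := by gcongr; exact abs_le.2 hs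
  calc dist y (y + s • v) = |s| * ‖v‖ := by simp [dist_eq_norm, norm_smul]
    _ ≤ 2 * ‖v‖ * |F y| := by rw [hb] at this; linarith

/-- The kernel of the differential of a defining function consists of tangent vectors. -/
theorem ker_fderiv_subset_tangentCone {N U : Set Space} {F : Space → ℝ} {y₀ : Space}
    (hU : IsOpen U) (hy₀ : y₀ ∈ U) (hF : ContDiffOn ℝ ∞ F U) (hd : fderiv ℝ F y₀ ≠ 0)
    (hN : N ∩ U = {z ∈ U | F z = 0}) (h0 : F y₀ = 0) {v : Space} (hv : fderiv ℝ F y₀ v = 0) :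
    v ∈ tangentConeAt ℝ N y₀ := by
  obtain ⟨r, hr, C, hC, hz⟩ := exists_dist_zeroSet_le hU hy₀ hF hd h0
  have hFd : HasFDerivAt F (fderiv ℝ F y₀) y₀ :=
    ((hF.contDiffAt (hU.mem_nhds hy₀)).differentiableAt (by simp)).hasFDerivAt
  have hder : HasDerivAt (fun s : ℝ => F (y₀ + s • v)) 0 0 := by
    have h4 : HasDerivAt (fun s : ℝ => y₀ + s • v) v 0 := by
      simpa using ((hasDerivAt_id (0 : ℝ)).smul_const v).const_add y₀
    have h5 : HasFDerivAt F (fderiv ℝ F y₀) (y₀ + (0 : ℝ) • v) := by simpa using hFd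
    have := h5.comp_hasDerivAt (0 : ℝ) h4
    rwa [hv] at this
  have hsl : Tendsto (fun s : ℝ => s⁻¹ * F (y₀ + s • v)) (𝓝[≠] 0) (𝓝 0) := by
    have := hasDerivAt_iff_tendsto_slope_zero.1 hder
    simpa [h0] using this
  -- Points on `N` approximating the direction `v`: move `y₀ + s • v` to the zero set. Since `F (y₀
  -- + s • v)` is `o(s)`, the correction is `o(s)` as well and does not change the limit of the
  -- quotients.
  choose! z hzU hz0 hzd using hz
  have hlim0 : Tendsto (fun s : ℝ => y₀ + s • v) (𝓝[≠] 0) (𝓝 y₀) := by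
    have : ContinuousAt (fun s : ℝ => y₀ + s • v) 0 := by fun_prop
    simpa using this.tendsto.mono_left nhdsWithin_le_nhds
  have hev : ∀ᶠ s : ℝ in 𝓝[≠] 0, y₀ + s • v ∈ Metric.ball y₀ r :=
    hlim0.eventually (Metric.ball_mem_nhds _ hr)
  have hdiff : Tendsto (fun s : ℝ => s⁻¹ • (z (y₀ + s • v) - (y₀ + s • v))) (𝓝[≠] 0) (𝓝 0) := by
    apply squeeze_zero_norm' (a := fun s => C * |s⁻¹ * F (y₀ + s • v)|)
    · filter_upwards [hev] with s hs
      rw [norm_smul, ← dist_eq_norm, dist_comm, abs_mul, Real.norm_eq_abs]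
      calc |s⁻¹| * dist (y₀ + s • v) (z (y₀ + s • v)) ≤ |s⁻¹| * (C * |F (y₀ + s • v)|) := by
            gcongr; exact hzd _ hs
        _ = _ := by ring
    · simpa using (hsl.abs).const_mul C
  have hid : Tendsto (fun s : ℝ => s) (𝓝[≠] (0 : ℝ)) (𝓝 0) := nhdsWithin_le_nhds
  have hlim : Tendsto (fun s : ℝ => s⁻¹ • (z (y₀ + s • v) - y₀)) (𝓝[≠] 0) (𝓝 v) := by
    have : Tendsto (fun s : ℝ => s⁻¹ • (z (y₀ + s • v) - (y₀ + s • v)) + v) (𝓝[≠] 0) (𝓝 v) := by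
      simpa using hdiff.add_const v
    refine this.congr' ?_
    filter_upwards [self_mem_nhdsWithin] with s hs
    have hs : s ≠ 0 := hs
    simp only [smul_sub, smul_add, smul_smul, inv_mul_cancel₀ hs, one_smul]
    abel
  refine mem_tangentConeAt_of_seq (𝓝[≠] (0 : ℝ)) (fun s => s⁻¹)
    (fun s => z (y₀ + s • v) - y₀) ?_ ?_ hlim
  · have := hid.smul hlim
    rw [zero_smul] at this
    refine this.congr' ?_
    filter_upwards [self_mem_nhdsWithin] with s hs
    have hs : s ≠ 0 := hs
    simp [smul_smul, hs]
  · filter_upwards [hev] with s hs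
    have : z (y₀ + s • v) ∈ N ∩ U := by rw [hN]; exact ⟨hzU _ hs, hz0 _ hs⟩
    simpa using this.1

/-- The differential of a defining function is a multiple of the normal. -/
theorem fderiv_eq_inner_normal {N U : Set Space} {F : Space → ℝ} {ν : Space → Space} {y : Space}
    (hν : IsUnitNormalField N ν) (hU : IsOpen U) (hF : ContDiffOn ℝ ∞ F U)
    (hd : ∀ z ∈ U, fderiv ℝ F z ≠ 0) (hN : N ∩ U = {z ∈ U | F z = 0}) (hy : y ∈ N) (hyU : y ∈ U)
    (v : Space) : fderiv ℝ F y v = fderiv ℝ F y (ν y) * ⟪ν y, v⟫ := by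
  have h0 : F y = 0 := (hN ▸ (⟨hy, hyU⟩ : y ∈ N ∩ U) : y ∈ {z ∈ U | F z = 0}).2
  have hort : ∀ w, fderiv ℝ F y w = 0 → ⟪ν y, w⟫ = 0 := fun w hw =>
    hν.orthogonal y hy w (ker_fderiv_subset_tangentCone hU hyU hF (hd y hyU) hN h0 hw)
  obtain ⟨w, hw⟩ := DFunLike.ne_iff.1 (hd y hyU)
  have hw : fderiv ℝ F y w ≠ 0 := by simpa using hw
  -- The kernel of the differential lies in that of `⟪ν y, ·⟫`, so the two functionals are
  -- proportional; the vector `w` determines the factor.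
  have key : ∀ x, ⟪ν y, x⟫ * fderiv ℝ F y w = fderiv ℝ F y x * ⟪ν y, w⟫ := by
    intro x
    have := hort (fderiv ℝ F y w • x - fderiv ℝ F y x • w) (by simp [mul_comm])
    rw [inner_sub_right, inner_smul_right, inner_smul_right] at this
    linarith
  have h1 := key (ν y)
  rw [real_inner_self_eq_norm_sq, hν.norm_eq_one y hy] at h1
  apply mul_right_cancel₀ hw
  have h2 := key v
  linear_combination (fderiv ℝ F y v) * h1 - (fderiv ℝ F y (ν y)) * h2

/-- The functional `⟪ν y, ·⟫` has norm at most one, and the differential is a multiple of it. A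
lower bound for the differential is therefore one for the normal derivative, whichever normal field
is chosen. -/
theorem norm_fderiv_le_abs_normal {N U : Set Space} {F : Space → ℝ} {ν : Space → Space} {y : Space}
    (hν : IsUnitNormalField N ν) (hU : IsOpen U) (hF : ContDiffOn ℝ ∞ F U)
    (hd : ∀ z ∈ U, fderiv ℝ F z ≠ 0) (hN : N ∩ U = {z ∈ U | F z = 0}) (hy : y ∈ N) (hyU : y ∈ U) :
    ‖fderiv ℝ F y‖ ≤ |fderiv ℝ F y (ν y)| := by
  refine ContinuousLinearMap.opNorm_le_bound _ (abs_nonneg _) fun v => ?_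
  rw [fderiv_eq_inner_normal hν hU hF hd hN hy hyU v, norm_mul, Real.norm_eq_abs]
  gcongr
  calc ‖⟪ν y, v⟫‖ ≤ ‖ν y‖ * ‖v‖ := norm_inner_le_norm _ _
    _ = ‖v‖ := by rw [hν.norm_eq_one y hy, one_mul]

/-- A local estimate for nearby pairs of points of a compact set is uniform. -/
theorem exists_uniform_of_local {N : Set Space} (hN : IsCompact N) {P : ℝ → Space → Space → Prop}
    (hmono : ∀ C C' y z, C ≤ C' → P C y z → P C' y z)
    (hloc : ∀ y₀ ∈ N, ∃ r > 0, ∃ C : ℝ, ∀ y ∈ N ∩ Metric.ball y₀ r, ∀ z ∈ N ∩ Metric.ball y₀ r,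
      P C y z) :
    ∃ δ > 0, ∃ C : ℝ, 0 ≤ C ∧ ∀ y ∈ N, ∀ z ∈ N, dist y z < δ → P C y z := by
  choose! r hr C hP using hloc
  obtain ⟨t, htN, ht⟩ := hN.elim_nhds_subcover (fun y => Metric.ball y (r y / 2))
    (fun y hy => Metric.ball_mem_nhds _ (half_pos (hr y hy)))
  have hex : ∃ δ > 0, ∀ y ∈ t, δ ≤ r y / 2 := by
    rcases t.eq_empty_or_nonempty with rfl | hne
    · exact ⟨1, one_pos, by simp⟩
    · refine ⟨t.inf' hne fun y => r y / 2, ?_, fun y hy => Finset.inf'_le _ hy⟩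
      exact (Finset.lt_inf'_iff _).2 fun y hy => half_pos (hr y (htN y hy))
  obtain ⟨δ, hδ, hδt⟩ := hex
  -- The covering uses half balls and `δ` is at most every half radius: if `y` is in a half ball,
  -- then `z` is in the full one.
  refine ⟨δ, hδ, ∑ y ∈ t, |C y|, by positivity, fun y hy z hz hyz => ?_⟩
  obtain ⟨y₀, hy₀, hyb⟩ := mem_iUnion₂.1 (ht hy)
  have hyb : dist y y₀ < r y₀ / 2 := hyb
  refine hmono (C y₀) _ y z ?_ (hP y₀ (htN _ hy₀) y ⟨hy, ?_⟩ z ⟨hz, ?_⟩)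
  · exact (le_abs_self _).trans
      (Finset.single_le_sum (f := fun y => |C y|) (fun _ _ => abs_nonneg _) hy₀)
  · exact hyb.trans (half_lt_self (hr _ (htN _ hy₀)))
  · rw [Metric.mem_ball]
    have := dist_triangle z y y₀
    have := hδt y₀ hy₀
    rw [dist_comm] at hyz
    linarith

theorem two_le_infty : (2 : WithTop ℕ∞) ≤ (∞ : WithTop ℕ∞) :=
  WithTop.coe_le_coe.2 (le_top (a := (2 : ℕ∞)))

theorem one_add_one_le_infty : (1 + 1 : WithTop ℕ∞) ≤ (∞ : WithTop ℕ∞) := by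
  rw [one_add_one_eq_two]; exact two_le_infty

theorem two_add_one_le_infty : (2 + 1 : WithTop ℕ∞) ≤ (∞ : WithTop ℕ∞) := by
  rw [two_add_one_eq_three]; exact WithTop.coe_le_coe.2 (le_top (a := (3 : ℕ∞)))

theorem exists_ball_norm_sub_le {E G : Type*} [NormedAddCommGroup E] [NormedSpace ℝ E]
    [NormedAddCommGroup G] [NormedSpace ℝ G] {f : E → G} {x : E} (hf : ContDiffAt ℝ 1 f x) :
    ∃ r > 0, ∃ K : ℝ, 0 ≤ K ∧ ∀ y ∈ Metric.ball x r, ∀ z ∈ Metric.ball x r,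
      ‖f y - f z‖ ≤ K * ‖y - z‖ := by
  obtain ⟨K, t, ht, hK⟩ := hf.exists_lipschitzOnWith
  obtain ⟨r, hr, hrt⟩ := Metric.mem_nhds_iff.1 ht
  exact ⟨r, hr, K, K.2, fun y hy z hz => hK.norm_sub_le (hrt hy) (hrt hz)⟩

theorem dist_left_le_of_mem_segment {E : Type*} [NormedAddCommGroup E] [NormedSpace ℝ E]
    {x y z : E} (hx : x ∈ segment ℝ y z) : ‖x - y‖ ≤ ‖z - y‖ := by
  obtain ⟨t, ht, rfl⟩ := (segment_eq_image_lineMap ℝ y z ▸ hx : x ∈ _)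
  rw [AffineMap.lineMap_apply, vsub_eq_sub, vadd_eq_add, add_sub_cancel_right, norm_smul,
    Real.norm_eq_abs, abs_of_nonneg ht.1]
  exact mul_le_of_le_one_left (norm_nonneg _) ht.2

/-- Chords of a compact smooth hypersurface are almost tangential. -/
theorem exists_abs_inner_normal_le {N : Set Space} (hN : IsCompact N)
    (hs : IsSmoothHypersurface N) :
    ∃ C : ℝ, 0 ≤ C ∧ ∀ ν, IsUnitNormalField N ν → ∀ y ∈ N, ∀ z ∈ N,
      |⟪ν y, z - y⟫| ≤ C * ‖z - y‖ ^ 2 := by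
  -- The predicate ranges over all normal fields, so that the constant, and later the energy
  -- threshold, depends on `N` only.
  obtain ⟨δ, hδ, C, hC, h⟩ := exists_uniform_of_local hN
    (P := fun C y z => ∀ ν, IsUnitNormalField N ν → |⟪ν y, z - y⟫| ≤ C * ‖z - y‖ ^ 2)
    (fun C C' y z hCC h ν hν => (h ν hν).trans (by gcongr)) (by
      intro y₀ hy₀
      obtain ⟨U, F, hU, hyU, hF, hd, hNU⟩ := hs y₀ hy₀
      have hcd : ContDiffAt ℝ 1 (fderiv ℝ F) y₀ :=
        (hF.contDiffAt (hU.mem_nhds hyU)).fderiv_right one_add_one_le_infty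
      obtain ⟨r₁, hr₁, K, hK, hlip⟩ := exists_ball_norm_sub_le hcd
      have hpos : 0 < ‖fderiv ℝ F y₀‖ := norm_pos_iff.2 (hd _ hyU)
      obtain ⟨r₂, hr₂, hb⟩ := Metric.eventually_nhds_iff_ball.1 ((hU.eventually_mem hyU).and
        (hcd.continuousAt.norm.eventually_const_lt (half_lt_self hpos)))
      set a := ‖fderiv ℝ F y₀‖ / 2 with ha
      have ha0 : 0 < a := half_pos hpos
      refine ⟨min r₁ r₂, lt_min hr₁ hr₂, K / a, ?_⟩
      rintro y ⟨hyN, hy⟩ z ⟨hzN, hz⟩ ν hν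
      have hy1 := Metric.ball_subset_ball (min_le_left r₁ r₂) hy
      have hy2 := Metric.ball_subset_ball (min_le_right r₁ r₂) hy
      have hz1 := Metric.ball_subset_ball (min_le_left r₁ r₂) hz
      have hz2 := Metric.ball_subset_ball (min_le_right r₁ r₂) hz
      have hseg1 : segment ℝ y z ⊆ Metric.ball y₀ r₁ := (convex_ball _ _).segment_subset hy1 hz1
      have hseg2 : segment ℝ y z ⊆ Metric.ball y₀ r₂ := (convex_ball _ _).segment_subset hy2 hz2
      have hFz : ∀ x ∈ N, x ∈ U → F x = 0 := fun x hx hxU =>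
        (hNU ▸ (⟨hx, hxU⟩ : x ∈ N ∩ U) : x ∈ {z ∈ U | F z = 0}).2
      -- As `F` vanishes at both ends of the chord, its first order Taylor remainder is, up to sign,
      -- the normal derivative times `⟪ν y, z - y⟫`.
      have hT := (convex_segment y z).norm_image_sub_le_of_norm_fderiv_le'
        (f := F) (φ := fderiv ℝ F y) (C := K * ‖z - y‖)
        (fun x hx => (hF.contDiffAt (hU.mem_nhds (hb x (hseg2 hx)).1)).differentiableAt (by simp))
        (fun x hx => (hlip x (hseg1 hx) y hy1).trans (by
          gcongr; exact dist_left_le_of_mem_segment hx))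
        (left_mem_segment ℝ y z) (right_mem_segment ℝ y z)
      rw [hFz z hzN (hb z hz2).1, hFz y hyN (hb y hy2).1, sub_zero, zero_sub, norm_neg,
        fderiv_eq_inner_normal hν hU hF hd hNU hyN (hb y hy2).1, norm_mul, Real.norm_eq_abs,
        Real.norm_eq_abs] at hT
      have hlow : a ≤ |fderiv ℝ F y (ν y)| :=
        (hb y hy2).2.le.trans (norm_fderiv_le_abs_normal hν hU hF hd hNU hyN (hb y hy2).1)
      rw [div_mul_eq_mul_div, le_div_iff₀ ha0]
      calc |⟪ν y, z - y⟫| * a ≤ |⟪ν y, z - y⟫| * |fderiv ℝ F y (ν y)| := by gcongr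
        _ ≤ K * ‖z - y‖ ^ 2 := by linarith)
  -- For points at distance at least `δ` the trivial bound `‖z - y‖` is at most `δ⁻¹ * ‖z - y‖ ^ 2`.
  refine ⟨C + δ⁻¹, by positivity, fun ν hν y hy z hz => ?_⟩
  by_cases hyz : dist y z < δ
  · exact (h y hy z hz hyz ν hν).trans (by gcongr; simp [hδ.le])
  · have h1 : δ ≤ ‖z - y‖ := by rw [← dist_eq_norm, dist_comm]; exact not_lt.1 hyz
    have h2 : |⟪ν y, z - y⟫| ≤ ‖z - y‖ := by
      have := abs_real_inner_le_norm (ν y) (z - y)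
      rwa [hν.norm_eq_one y hy, one_mul] at this
    have h3 : ‖z - y‖ ≤ δ⁻¹ * ‖z - y‖ ^ 2 := by
      rw [inv_mul_eq_div, le_div_iff₀ hδ]; nlinarith [norm_nonneg (z - y)]
    nlinarith [mul_nonneg hC (sq_nonneg ‖z - y‖)]

/-- The error of the trapezoidal rule along a segment. -/
theorem abs_trapezoid_sub_le {F : Space → ℝ} {B : Set Space} {K : ℝ} (hK : 0 ≤ K)
    (hB : IsOpen B) (hconv : Convex ℝ B)
    (hF : ContDiffOn ℝ ∞ F B)
    (hlip : ∀ y ∈ B, ∀ z ∈ B,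
      ‖fderiv ℝ (fderiv ℝ F) y - fderiv ℝ (fderiv ℝ F) z‖ ≤ K * ‖y - z‖) {y z : Space}
    (hy : y ∈ B) (hz : z ∈ B) :
    |F z - F y - (1 / 2) * (fderiv ℝ F z + fderiv ℝ F y) (z - y)| ≤ K * ‖z - y‖ ^ 3 := by
  have hFa : ∀ x ∈ B, ContDiffAt ℝ ∞ F x := fun x hx => hF.contDiffAt (hB.mem_nhds hx)
  have hd1 : ∀ x ∈ B, HasFDerivAt F (fderiv ℝ F x) x := fun x hx =>
    ((hFa x hx).differentiableAt (by simp)).hasFDerivAt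
  have hd2 : ∀ x ∈ B, HasFDerivAt (fderiv ℝ F) (fderiv ℝ (fderiv ℝ F) x) x := fun x hx =>
    (((hFa x hx).fderiv_right (m := 1) one_add_one_le_infty).differentiableAt (by simp)).hasFDerivAt
  have hseg : segment ℝ y z ⊆ B := hconv.segment_subset hy hz
  have hTay : ∀ x ∈ segment ℝ y z,
      ‖fderiv ℝ F x - fderiv ℝ F y - fderiv ℝ (fderiv ℝ F) x (x - y)‖ ≤ K * ‖z - y‖ ^ 2 := by
    intro x hx
    have hxy := dist_left_le_of_mem_segment hx
    have hsub : segment ℝ y x ⊆ B := hconv.segment_subset hy (hseg hx)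
    have := (convex_segment y x).norm_image_sub_le_of_norm_fderiv_le'
      (f := fderiv ℝ F) (φ := fderiv ℝ (fderiv ℝ F) x) (C := K * ‖z - y‖)
      (fun w hw => (hd2 w (hsub hw)).differentiableAt)
      (fun w hw => (hlip w (hsub hw) x (hseg hx)).trans (by
          gcongr
          have hw' : w ∈ segment ℝ x y := by rwa [segment_symm]
          have := dist_left_le_of_mem_segment hw'
          rw [norm_sub_rev y x] at this
          exact this.trans hxy))
        (left_mem_segment ℝ y x) (right_mem_segment ℝ y x)
    calc _ ≤ K * ‖z - y‖ * ‖x - y‖ := this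
      _ ≤ K * ‖z - y‖ * ‖z - y‖ := by gcongr
      _ = _ := by ring
  -- By the symmetry of the second derivative, the derivative of `Φ` is half a first order Taylor
  -- remainder of `fderiv ℝ F`, hence quadratically small. The mean value inequality supplies the
  -- third power.
  set Φ : Space → ℝ := fun x => F x - (1 / 2) * (fderiv ℝ F x + fderiv ℝ F y) (x - y) with hΦ
  have hder : ∀ x ∈ B, HasFDerivAt Φ (fderiv ℝ F x - (1 / 2 : ℝ) •
      ((fderiv ℝ F x + fderiv ℝ F y) + (fderiv ℝ (fderiv ℝ F) x).flip (x - y))) x := by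
    intro x hx
    have h1 : HasFDerivAt (fun x => (fderiv ℝ F x + fderiv ℝ F y)) (fderiv ℝ (fderiv ℝ F) x) x :=
      (hd2 x hx).add_const _
    have h2 : HasFDerivAt (fun x : Space => x - y) (ContinuousLinearMap.id ℝ Space) x :=
      (hasFDerivAt_id x).sub_const y
    have h3 := (h1.clm_apply h2).const_mul (1 / 2 : ℝ)
    have h4 := (hd1 x hx).sub h3
    rw [ContinuousLinearMap.comp_id] at h4
    exact h4
  have hbd := (convex_segment y z).norm_image_sub_le_of_norm_hasFDerivWithin_le (f := Φ)
    (C := K * ‖z - y‖ ^ 2) (fun x hx => (hder x (hseg hx)).hasFDerivWithinAt) (by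
      intro x hx
      refine ContinuousLinearMap.opNorm_le_bound _ (by positivity) fun v => ?_
      have hsym := (hFa x (hseg hx)).isSymmSndFDerivAt (by simpa using two_le_infty) v (x - y)
      have e : (fderiv ℝ F x - (1 / 2 : ℝ) •
          ((fderiv ℝ F x + fderiv ℝ F y) + (fderiv ℝ (fderiv ℝ F) x).flip (x - y))) v
          = (1 / 2) * (fderiv ℝ F x - fderiv ℝ F y - fderiv ℝ (fderiv ℝ F) x (x - y)) v := by
        simp only [_root_.sub_apply, _root_.smul_apply,
          _root_.add_apply, ContinuousLinearMap.flip_apply, smul_eq_mul, hsym]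
        ring
      rw [e, norm_mul]
      have := (fderiv ℝ F x - fderiv ℝ F y - fderiv ℝ (fderiv ℝ F) x (x - y)).le_of_opNorm_le
        (hTay x hx) v
      have h0 : 0 ≤ K * ‖z - y‖ ^ 2 * ‖v‖ := by positivity
      rw [show ‖(1 / 2 : ℝ)‖ = 1 / 2 by norm_num]
      linarith) (left_mem_segment ℝ y z) (right_mem_segment ℝ y z)
  have e : F z - F y - (1 / 2) * (fderiv ℝ F z + fderiv ℝ F y) (z - y) = Φ z - Φ y := by
    simp [hΦ]; ring
  rw [e, ← Real.norm_eq_abs]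
  exact hbd.trans (le_of_eq (by ring))

/-- The sum of the normals at the end points of a chord is orthogonal to it up to third order. -/
theorem exists_abs_inner_add_normal_le {N : Set Space} (hN : IsCompact N)
    (hs : IsSmoothHypersurface N) {ν : Space → Space} (hν : IsUnitNormalField N ν) :
    ∃ C : ℝ, 0 ≤ C ∧ ∀ y ∈ N, ∀ z ∈ N, |⟪ν y + ν z, z - y⟫| ≤ C * ‖z - y‖ ^ 3 := by
  obtain ⟨C₁, hC₁, h₁⟩ := exists_abs_inner_normal_le hN hs
  obtain ⟨δ, hδ, C, hC, h⟩ := exists_uniform_of_local hN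
    (P := fun C y z => |⟪ν y + ν z, z - y⟫| ≤ C * ‖z - y‖ ^ 3)
    (fun C C' y z hCC h => h.trans (by gcongr)) (by
      intro y₀ hy₀
      obtain ⟨U, F, hU, hyU, hF, hd, hNU⟩ := hs y₀ hy₀
      have hFa := hF.contDiffAt (hU.mem_nhds hyU)
      have hcd : ContDiffAt ℝ 1 (fderiv ℝ F) y₀ := hFa.fderiv_right one_add_one_le_infty
      have hcd2 : ContDiffAt ℝ 1 (fderiv ℝ (fderiv ℝ F)) y₀ :=
        (hFa.fderiv_right (m := 2) two_add_one_le_infty).fderiv_right (by rw [one_add_one_eq_two])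
      have hc : ContDiffAt ℝ 1 (fun y => fderiv ℝ F y (ν y)) y₀ :=
        hcd.clm_apply (hν.smooth.contDiffAt.of_le (by simp))
      obtain ⟨r₁, hr₁, K₁, hK₁, hlip₁⟩ := exists_ball_norm_sub_le hc
      obtain ⟨r₂, hr₂, K₂, hK₂, hlip₂⟩ := exists_ball_norm_sub_le hcd2
      have hpos : 0 < ‖fderiv ℝ F y₀‖ := norm_pos_iff.2 (hd _ hyU)
      obtain ⟨r₃, hr₃, hb⟩ := Metric.eventually_nhds_iff_ball.1 ((hU.eventually_mem hyU).and
        (hcd.continuousAt.norm.eventually_const_lt (half_lt_self hpos)))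
      set a := ‖fderiv ℝ F y₀‖ / 2 with ha
      have ha0 : 0 < a := half_pos hpos
      refine ⟨min r₁ (min r₂ r₃), lt_min hr₁ (lt_min hr₂ hr₃), (2 * K₂ + K₁ * C₁) / a, ?_⟩
      rintro y ⟨hyN, hy⟩ z ⟨hzN, hz⟩
      simp only [Metric.mem_ball, lt_min_iff] at hy hz
      have hFz : ∀ x ∈ N, x ∈ U → F x = 0 := fun x hx hxU =>
        (hNU ▸ (⟨hx, hxU⟩ : x ∈ N ∩ U) : x ∈ {z ∈ U | F z = 0}).2
      have hyU := hb y hy.2.2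
      have hzU := hb z hz.2.2
      have hBU : Metric.ball y₀ (min r₂ r₃) ⊆ U := fun x hx =>
        (hb x (Metric.ball_subset_ball (min_le_right _ _) hx)).1
      have htr := abs_trapezoid_sub_le (B := Metric.ball y₀ (min r₂ r₃)) hK₂ Metric.isOpen_ball
        (convex_ball _ _) (hF.mono hBU) (fun x hx w hw => hlip₂ x
          (Metric.ball_subset_ball (min_le_left _ _) hx) w
          (Metric.ball_subset_ball (min_le_left _ _) hw)) (y := y) (z := z)
          (Metric.mem_ball.2 (lt_min hy.2.1 hy.2.2)) (Metric.mem_ball.2 (lt_min hz.2.1 hz.2.2))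
      rw [hFz z hzN hzU.1, hFz y hyN hyU.1, _root_.add_apply,
        fderiv_eq_inner_normal hν hU hF hd hNU hyN hyU.1,
        fderiv_eq_inner_normal hν hU hF hd hNU hzN hzU.1] at htr
      have hlow : a ≤ |fderiv ℝ F y (ν y)| :=
        hyU.2.le.trans (norm_fderiv_le_abs_normal hν hU hF hd hNU hyN hyU.1)
      have hcl := hlip₁ z hz.1 y hy.1
      have hnz : |⟪ν z, z - y⟫| ≤ C₁ * ‖z - y‖ ^ 2 := by
        have := h₁ ν hν z hzN y hyN
        rw [norm_sub_rev, ← neg_sub z y, inner_neg_right, abs_neg] at this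
        exact this
      set cy := fderiv ℝ F y (ν y)
      set cz := fderiv ℝ F z (ν z)
      set sy := ⟪ν y, z - y⟫
      set sz := ⟪ν z, z - y⟫
      -- The trapezoidal rule controls the sum weighted with `cy` and `cz`. Replacing `cz` by `cy`
      -- costs a Lipschitz difference times the quadratically small `sz`, which is again cubic.
      have e : cy * (sy + sz) = (cz * sz + cy * sy) - (cz - cy) * sz := by ring
      have h3 : |cz * sz + cy * sy| ≤ 2 * (K₂ * ‖z - y‖ ^ 3) := by
        have e2 : cz * sz + cy * sy = -2 * (0 - 0 - 1 / 2 * (cz * sz + cy * sy)) := by ring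
        rw [e2, abs_mul]
        norm_num at htr ⊢
        linarith
      have h4 : |(cz - cy) * sz| ≤ K₁ * ‖z - y‖ * (C₁ * ‖z - y‖ ^ 2) := by
        rw [abs_mul]; gcongr; exact hcl
      rw [inner_add_left, div_mul_eq_mul_div, le_div_iff₀ ha0]
      calc |sy + sz| * a ≤ |sy + sz| * |cy| := by gcongr
        _ = |cy * (sy + sz)| := by rw [abs_mul, mul_comm]
        _ ≤ |cz * sz + cy * sy| + |(cz - cy) * sz| := by rw [e]; exact abs_sub _ _
        _ ≤ (2 * K₂ + K₁ * C₁) * ‖z - y‖ ^ 3 := by nlinarith)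
  refine ⟨C + 2 * (δ⁻¹) ^ 2, by positivity, fun y hy z hz => ?_⟩
  by_cases hyz : dist y z < δ
  · exact (h y hy z hz hyz).trans (by gcongr; simp; positivity)
  · have h1 : δ ≤ ‖z - y‖ := by rw [← dist_eq_norm, dist_comm]; exact not_lt.1 hyz
    have h2 : |⟪ν y + ν z, z - y⟫| ≤ 2 * ‖z - y‖ := by
      refine (abs_real_inner_le_norm _ _).trans ?_
      gcongr
      refine (norm_add_le _ _).trans ?_
      rw [hν.norm_eq_one y hy, hν.norm_eq_one z hz]; norm_num
    have h3 : 1 ≤ δ⁻¹ * ‖z - y‖ := by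
      rw [inv_mul_eq_div, le_div_iff₀ hδ]; linarith
    have h4 : 1 ≤ (δ⁻¹ * ‖z - y‖) ^ 2 := one_le_pow₀ h3
    have h5 : 0 ≤ C * ‖z - y‖ ^ 3 := by positivity
    nlinarith [norm_nonneg (z - y)]

/-! ### Invariance of the hypersurface -/

/-- Curves that start on a closed hypersurface and move with tangential velocity there stay on
it. -/
theorem mem_target_of_projected_velocity {N : Set Space} (hN : IsCompact N)
    (hs : IsSmoothHypersurface N) {ν : Space → Space} (hν : IsUnitNormalField N ν)
    {y M : ℝ → Space} {T : ℝ} (hM : ContinuousOn M (Icc 0 T))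
    (hy : ∀ t ∈ Icc 0 T, HasDerivWithinAt y (M t - ⟪M t, ν (y t)⟫ • ν (y t)) (Icc 0 T) t)
    (h0 : y 0 ∈ N) : ∀ t ∈ Icc 0 T, y t ∈ N := by
  have hyc : ContinuousOn y (Icc 0 T) := fun t ht => (hy t ht).continuousWithinAt
  obtain ⟨m, hm⟩ := isCompact_Icc.exists_bound_of_continuousOn hM
  change Icc 0 T ⊆ y ⁻¹' N
  -- Continuous induction: the times spent on `N` form a closed set, and each of them is followed by
  -- a short interval of such times.
  refine IsClosed.Icc_subset_of_forall_mem_nhdsWithin ?_ h0 ?_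
  · rw [inter_comm]; exact hyc.preimage_isClosed_of_isClosed isClosed_Icc hN.isClosed
  rintro t₀ ⟨ht₀N, ht₀⟩
  have ht₀' : t₀ ∈ Icc 0 T := Ico_subset_Icc_self ht₀
  obtain ⟨U, F, hU, hyU, hF, hd, hNU⟩ := hs _ ht₀N
  have hFz : ∀ x ∈ N, x ∈ U → F x = 0 := fun x hx hxU =>
    (hNU ▸ (⟨hx, hxU⟩ : x ∈ N ∩ U) : x ∈ {z ∈ U | F z = 0}).2
  have hFN : ∀ x ∈ U, F x = 0 → x ∈ N := fun x hxU hx =>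
    (hNU.symm ▸ (⟨hxU, hx⟩ : x ∈ {z ∈ U | F z = 0}) : x ∈ N ∩ U).1
  have hFa := hF.contDiffAt (hU.mem_nhds hyU)
  obtain ⟨r₁, hr₁, C, hC, hdist⟩ := exists_dist_zeroSet_le hU hyU hF (hd _ hyU) (hFz _ ht₀N hyU)
  -- The derivative of `F` along the curve is `G (y t) (M t)`. Off `N` the vector `ν` is just an
  -- extension, so `G` need not vanish there; but it is Lipschitz and zero on `N`, hence bounded by
  -- the distance to `N` and so by `|F|`. Thus `F` along the curve satisfies a linear differential
  -- inequality with initial value zero.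
  set G : Space → (Space →L[ℝ] ℝ) := fun x =>
    fderiv ℝ F x - (fderiv ℝ F x (ν x)) • innerSL ℝ (ν x) with hG
  have hνc : ContDiffAt ℝ 1 ν (y t₀) := hν.smooth.contDiffAt.of_le (by simp)
  have hcd : ContDiffAt ℝ 1 (fderiv ℝ F) (y t₀) := hFa.fderiv_right one_add_one_le_infty
  have hGc : ContDiffAt ℝ 1 G (y t₀) := by
    refine hcd.sub ((hcd.clm_apply hνc).smul ?_)
    exact (innerSL ℝ (E := Space)).contDiff.contDiffAt.comp _ hνc
  have hG0 : ∀ x ∈ N, x ∈ U → G x = 0 := by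
    intro x hx hxU
    ext v
    simp [hG, fderiv_eq_inner_normal hν hU hF hd hNU hx hxU v]
  obtain ⟨r₂, hr₂, K, hK, hlip⟩ := exists_ball_norm_sub_le hGc
  have hev : ∀ᶠ x in 𝓝 (y t₀), x ∈ U ∧ x ∈ Metric.ball (y t₀) r₁ ∧
      x ∈ Metric.ball (y t₀) (r₂ / 2) ∧ C * |F x| < r₂ / 2 := by
    have hc : ContinuousAt (fun x => C * |F x|) (y t₀) := by
      have := hFa.continuousAt; fun_prop
    refine (hU.eventually_mem hyU).and ((Metric.isOpen_ball.eventually_mem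
      (Metric.mem_ball_self hr₁)).and ((Metric.isOpen_ball.eventually_mem
      (Metric.mem_ball_self (half_pos hr₂))).and (hc.eventually_lt_const ?_)))
    simp [hFz _ ht₀N hyU, hr₂]
  have hbound : ∀ᶠ x in 𝓝 (y t₀), x ∈ U ∧ ‖G x‖ ≤ K * C * |F x| := by
    filter_upwards [hev] with x hx
    refine ⟨hx.1, ?_⟩
    obtain ⟨z, hzU, hz0, hzd⟩ := hdist x hx.2.1
    have hzr : z ∈ Metric.ball (y t₀) r₂ := by
      have := hx.2.2.1
      rw [Metric.mem_ball] at this ⊢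
      have h3 := dist_triangle z x (y t₀)
      rw [dist_comm z x] at h3
      linarith [hx.2.2.2]
    have := hlip x (Metric.ball_subset_ball (by linarith) hx.2.2.1) z hzr
    rw [hG0 z (hFN z hzU hz0) hzU, sub_zero, ← dist_eq_norm x z] at this
    calc _ ≤ _ := this
      _ ≤ K * (C * |F x|) := by gcongr
      _ = _ := by ring
  have htime := (hyc t₀ ht₀').eventually hbound
  obtain ⟨ε, hε, hεb⟩ := Metric.mem_nhdsWithin_iff.1 htime
  set b := min T (t₀ + ε / 2) with hb
  have hb1 : t₀ < b := lt_min ht₀.2 (by linarith)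
  have hin : ∀ t ∈ Icc t₀ b, t ∈ Icc 0 T := fun t ht =>
    ⟨ht₀.1.trans ht.1, ht.2.trans (min_le_left _ _)⟩
  have hloc : ∀ t ∈ Icc t₀ b, y t ∈ U ∧ ‖G (y t)‖ ≤ K * C * |F (y t)| := by
    intro t ht
    refine hεb ⟨?_, hin t ht⟩
    rw [Metric.mem_ball, Real.dist_eq, abs_of_nonneg (by linarith [ht.1])]
    have := ht.2.trans (min_le_right _ _)
    linarith
  have hFd : ∀ t ∈ Icc t₀ b, HasDerivWithinAt (fun t => F (y t))
      (fderiv ℝ F (y t) (M t - ⟪M t, ν (y t)⟫ • ν (y t))) (Icc 0 T) t := fun t ht =>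
    ((hF.contDiffAt (hU.mem_nhds (hloc t ht).1)).differentiableAt
      (by simp)).hasFDerivAt.comp_hasDerivWithinAt t (hy t (hin t ht))
  have hzero := eq_zero_of_abs_deriv_le_mul_abs_self_of_eq_zero_right (a := t₀) (b := b)
    (f := fun t => F (y t)) (K := K * C * m)
    (fun t ht => ((hFd t ht).continuousWithinAt.mono fun s hs => hin s hs))
    (fun t ht => ((hFd t (Ico_subset_Icc_self ht)).mono_of_mem_nhdsWithin (by
      have h1 : Ico t b ⊆ Icc 0 T := fun s hs => hin s ⟨ht.1.trans hs.1, hs.2.le⟩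
      exact mem_of_superset (Ico_mem_nhdsGE ht.2) h1)))
    (hFz _ ht₀N hyU)
    (fun t ht => by
      have ht' := Ico_subset_Icc_self ht
      have e : fderiv ℝ F (y t) (M t - ⟪M t, ν (y t)⟫ • ν (y t)) = G (y t) (M t) := by
        simp only [hG, map_sub, map_smul, _root_.sub_apply,
          _root_.smul_apply, innerSL_apply_apply, smul_eq_mul]
        rw [real_inner_comm]; ring
      rw [e]
      calc ‖G (y t) (M t)‖ ≤ ‖G (y t)‖ * ‖M t‖ := (G (y t)).le_opNorm _
        _ ≤ (K * C * |F (y t)|) * m := by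
          gcongr
          · exact (hloc t ht').2
          · exact hm t (hin t ht')
        _ = _ := by rw [Real.norm_eq_abs]; ring)
  refine mem_of_superset (Ioc_mem_nhdsGT hb1) fun t ht => ?_
  have ht' := Ioc_subset_Icc_self ht
  exact hFN _ (hloc t ht').1 (hzero t ht')

/-! ### Global solutions of Lipschitz differential equations -/

/-- The radial retraction onto the closed ball of radius `R`. -/
noncomputable def ballRetraction {E : Type*} [NormedAddCommGroup E] [NormedSpace ℝ E] (R : ℝ)
    (x : E) : E := (R / max R ‖x‖) • x

section Ode
variable {E : Type*} [NormedAddCommGroup E] [NormedSpace ℝ E]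

theorem ballRetraction_of_le {R : ℝ} (hR : 0 < R) {x : E} (hx : ‖x‖ ≤ R) :
    ballRetraction R x = x := by
  rw [ballRetraction, max_eq_left hx, div_self hR.ne', one_smul]

theorem norm_ballRetraction_le_radius {R : ℝ} (hR : 0 < R) (x : E) : ‖ballRetraction R x‖ ≤ R := by
  have hm : 0 < max R ‖x‖ := lt_max_of_lt_left hR
  rw [ballRetraction, norm_smul, Real.norm_eq_abs, abs_of_pos (by positivity), div_mul_eq_mul_div,
    div_le_iff₀ hm]
  gcongr
  exact le_max_right _ _

theorem norm_ballRetraction_le {R : ℝ} (hR : 0 < R) (x : E) : ‖ballRetraction R x‖ ≤ ‖x‖ := by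
  have hm : 0 < max R ‖x‖ := lt_max_of_lt_left hR
  rw [ballRetraction, norm_smul, Real.norm_eq_abs, abs_of_pos (by positivity)]
  exact mul_le_of_le_one_left (norm_nonneg _) ((div_le_one hm).2 (le_max_left _ _))

/-- One unit of the Lipschitz constant comes from the displacement of the point, the other from the
change of the scaling factor. -/
theorem norm_ballRetraction_sub_le {R : ℝ} (hR : 0 < R) (x y : E) :
    ‖ballRetraction R x - ballRetraction R y‖ ≤ 2 * ‖x - y‖ := by
  have hx : 0 < max R ‖x‖ := lt_max_of_lt_left hR
  have hy : 0 < max R ‖y‖ := lt_max_of_lt_left hR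
  have e : ballRetraction R x - ballRetraction R y
      = (R / max R ‖x‖) • (x - y) + (R / max R ‖x‖ - R / max R ‖y‖) • y := by
    simp only [ballRetraction, smul_sub, sub_smul]; abel
  have h1 : ‖(R / max R ‖x‖) • (x - y)‖ ≤ ‖x - y‖ := by
    rw [norm_smul, Real.norm_eq_abs, abs_of_pos (by positivity)]
    exact mul_le_of_le_one_left (norm_nonneg _) ((div_le_one hx).2 (le_max_left _ _))
  have h2 : ‖(R / max R ‖x‖ - R / max R ‖y‖) • y‖ ≤ ‖x - y‖ := by
    have e2 : R / max R ‖x‖ - R / max R ‖y‖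
        = (R / max R ‖x‖) * ((max R ‖y‖ - max R ‖x‖) / max R ‖y‖) := by field_simp
    rw [norm_smul, e2, Real.norm_eq_abs, abs_mul, abs_div _ (max R ‖y‖),
      abs_of_pos (show 0 < R / max R ‖x‖ by positivity), abs_of_pos hy]
    have h3 : |max R ‖y‖ - max R ‖x‖| ≤ ‖x - y‖ := by
      rw [max_comm R, max_comm R]
      refine (abs_max_sub_max_le_abs _ _ _).trans ?_
      rw [abs_sub_comm]
      exact abs_norm_sub_norm_le x y
    calc R / max R ‖x‖ * (|max R ‖y‖ - max R ‖x‖| / max R ‖y‖) * ‖y‖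
        ≤ 1 * (‖x - y‖ / max R ‖y‖) * max R ‖y‖ := by
          gcongr
          · exact (div_le_one hx).2 (le_max_left _ _)
          · exact le_max_right _ _
      _ = ‖x - y‖ := by field_simp
  rw [e]
  linarith [norm_add_le ((R / max R ‖x‖) • (x - y)) ((R / max R ‖x‖ - R / max R ‖y‖) • y)]

variable [CompleteSpace E]

/-- A globally Lipschitz field is unbounded in general, so it is first composed with the retraction
onto a ball whose radius exceeds the Grönwall bound on `[0, T]`. The solution never leaves this ball
and therefore solves the original equation. -/
theorem exists_solution_Icc {Φ : E → E} {K : ℝ≥0} (hΦ : LipschitzWith K Φ) (x₀ : E) {T : ℝ}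
    (hT : 0 ≤ T) :
    ∃ w : ℝ → E, w 0 = x₀ ∧ ∀ t ∈ Icc 0 T, HasDerivWithinAt w (Φ (w t)) (Icc 0 T) t := by
  -- The summand one makes the radius positive even for vanishing data.
  set R : ℝ := gronwallBound ‖x₀‖ K ‖Φ 0‖ T + 1 with hR
  have hmono : Monotone (gronwallBound ‖x₀‖ K ‖Φ 0‖) :=
    gronwallBound_mono (norm_nonneg _) (norm_nonneg _) K.2
  have hR0 : 0 < R := by
    have := hmono hT
    rw [gronwallBound_x0] at this
    linarith [norm_nonneg x₀]
  have hgrow : ∀ x, ‖Φ x‖ ≤ K * ‖x‖ + ‖Φ 0‖ := by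
    intro x
    have := hΦ.norm_sub_le x 0
    rw [sub_zero] at this
    linarith [norm_le_norm_add_norm_sub' (Φ x) (Φ 0)]
  set Ψ : E → E := fun x => Φ (ballRetraction R x) with hΨ
  have hΨl : LipschitzWith (K * 2) Ψ := by
    refine hΦ.comp (LipschitzWith.of_dist_le_mul fun x y => ?_)
    simpa [dist_eq_norm] using norm_ballRetraction_sub_le hR0 x y
  set M : ℝ≥0 := (K * R + ‖Φ 0‖).toNNReal with hM
  have hMc : (M : ℝ) = K * R + ‖Φ 0‖ := Real.coe_toNNReal _ (by positivity)
  -- The retracted field is bounded by `M` and Lipschitz everywhere, so the ball in the Picard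
  -- iteration may have radius `M * T` and a single application covers the whole interval.
  have hPL : IsPicardLindelof (fun _ => Ψ) (tmin := 0) (tmax := T) ⟨0, le_rfl, hT⟩ x₀
      (M * T.toNNReal) 0 M (K * 2) := by
    refine ⟨fun t _ => hΨl.lipschitzOnWith, fun x _ => continuousOn_const, fun t _ x _ => ?_, ?_⟩
    · rw [hMc]
      refine (hgrow _).trans ?_
      gcongr
      exact norm_ballRetraction_le_radius hR0 x
    · simp [hT]
  obtain ⟨w, hw0, hw⟩ := hPL.exists_eq_forall_mem_Icc_hasDerivWithinAt₀
  have hbd : ∀ t ∈ Icc 0 T, ‖w t‖ ≤ R := by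
    intro t ht
    have := norm_le_gronwallBound_of_norm_deriv_right_le (f := w) (f' := fun t => Ψ (w t))
      (δ := ‖x₀‖) (K := K) (ε := ‖Φ 0‖) (a := 0) (b := T)
      (fun t ht => (hw t ht).continuousWithinAt)
      (fun t ht => (hw t (Ico_subset_Icc_self ht)).mono_of_mem_nhdsWithin
        (mem_of_superset (Ico_mem_nhdsGE ht.2) fun s hs => ⟨ht.1.trans hs.1, hs.2.le⟩))
      (by rw [show w 0 = x₀ from hw0]) (fun t ht => (hgrow _).trans (by
        gcongr; exact norm_ballRetraction_le hR0 _)) t ht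
    have h2 := hmono (show t - 0 ≤ T by linarith [ht.2])
    linarith
  refine ⟨w, hw0, fun t ht => ?_⟩
  have := hw t ht
  rwa [hΨ, show (fun x => Φ (ballRetraction R x)) (w t) = Φ (w t) by
    simp only [ballRetraction_of_le hR0 (hbd t ht)]] at this

/-- Lipschitz autonomous differential equations have global forward solutions. -/
theorem exists_solution_Ici {Φ : E → E} {K : ℝ≥0} (hΦ : LipschitzWith K Φ) (x₀ : E) :
    ∃ w : ℝ → E, w 0 = x₀ ∧ ∀ t, 0 ≤ t → HasDerivWithinAt w (Φ (w t)) (Ici 0) t := by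
  choose v hv0 hv using fun n : ℕ => exists_solution_Icc hΦ x₀ (T := n) n.cast_nonneg
  have hag : ∀ m n : ℕ, m ≤ n → ∀ t ∈ Icc (0 : ℝ) m, v m t = v n t := by
    intro m n hmn
    have hmn' : (m : ℝ) ≤ n := by exact_mod_cast hmn
    refine ODE_solution_unique (v := fun _ => Φ) (K := K) (fun t => hΦ)
      (fun t ht => (hv m t ht).continuousWithinAt)
      (fun t ht => (hv m t (Ico_subset_Icc_self ht)).mono_of_mem_nhdsWithin
        (mem_of_superset (Ico_mem_nhdsGE ht.2) fun s hs => ⟨ht.1.trans hs.1, hs.2.le⟩))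
      (fun t ht => ((hv n t ⟨ht.1, ht.2.trans hmn'⟩).continuousWithinAt.mono
        (Icc_subset_Icc_right hmn')))
      (fun t ht => (hv n t ⟨ht.1, ht.2.le.trans hmn'⟩).mono_of_mem_nhdsWithin
        (mem_of_superset (Ico_mem_nhdsGE (ht.2.trans_le hmn'))
          fun s hs => ⟨ht.1.trans hs.1, hs.2.le⟩))
      (by rw [hv0, hv0])
  -- With `⌊t⌋₊ + 1` the time `t` is strictly below the end of its interval, so a derivative within
  -- that interval is one within `Ici 0`.
  set w : ℝ → E := fun t => v (⌊t⌋₊ + 1) t with hw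
  have hwv : ∀ n : ℕ, ∀ t ∈ Icc (0 : ℝ) n, w t = v n t := by
    intro n t ht
    have h1 : t ∈ Icc (0 : ℝ) ((⌊t⌋₊ + 1 : ℕ) : ℝ) :=
      ⟨ht.1, by push_cast; exact (Nat.lt_floor_add_one t).le⟩
    rcases le_total (⌊t⌋₊ + 1) n with h | h
    · exact hag _ _ h t h1
    · exact (hag _ _ h t ht).symm
  refine ⟨w, by rw [hwv 0 0 ⟨le_rfl, by simp⟩, hv0], fun t ht => ?_⟩
  have hlt : t < ((⌊t⌋₊ + 1 : ℕ) : ℝ) := by push_cast; exact Nat.lt_floor_add_one t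
  have h1 := hv (⌊t⌋₊ + 1) t ⟨ht, hlt.le⟩
  rw [← hwv _ t ⟨ht, hlt.le⟩] at h1
  have h2 := h1.congr (fun s hs => hwv _ s hs) (hwv _ t ⟨ht, hlt.le⟩)
  refine h2.mono_of_mem_nhdsWithin ?_
  rw [← Ici_inter_Iic]
  exact inter_mem self_mem_nhdsWithin (mem_nhdsWithin_of_mem_nhds (Iic_mem_nhds hlt))

end Ode

/-! ### Square summable grid functions -/

/-- The Hilbert space of square summable grid functions. -/
abbrev GridL2 : Type := lp (fun _ : Grid => Space) 2

theorem memℓp_two_iff {f : Grid → Space} : Memℓp f 2 ↔ Summable fun j => ‖f j‖ ^ 2 := by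
  rw [memℓp_gen_iff (by simp)]
  simp

@[simp] theorem GridL2.add_apply (x y : GridL2) (j : Grid) : (x + y) j = x j + y j := rfl

@[simp] theorem GridL2.sub_apply (x y : GridL2) (j : Grid) : (x - y) j = x j - y j := rfl

@[simp] theorem GridL2.neg_apply (x : GridL2) (j : Grid) : (-x) j = -x j := rfl

@[simp] theorem GridL2.smul_apply (c : ℝ) (x : GridL2) (j : Grid) : (c • x) j = c • x j := rfl

theorem GridL2.ext {x y : GridL2} (h : ∀ j, x j = y j) : x = y := lp.ext (funext h)

/-- A square summable grid function as a vector of the Hilbert space. -/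
def mkL2 (f : Grid → Space) (hf : Summable fun j => ‖f j‖ ^ 2) : GridL2 := ⟨f, memℓp_two_iff.2 hf⟩

@[simp] theorem mkL2_apply (f : Grid → Space) (hf : Summable fun j => ‖f j‖ ^ 2) (j : Grid) :
    mkL2 f hf j = f j := rfl

theorem hasSum_norm_sq (x : GridL2) : HasSum (fun j => ‖x j‖ ^ 2) (‖x‖ ^ 2) := by
  have := lp.hasSum_inner (𝕜 := ℝ) x x
  simpa [real_inner_self_eq_norm_sq] using this

theorem hasSum_norm_sq_shift (x : GridL2) (k : Grid) :
    HasSum (fun j => ‖x (j + k)‖ ^ 2) (‖x‖ ^ 2) :=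
  (Equiv.addRight k).hasSum_iff.2 (hasSum_norm_sq x)

theorem norm_sq_smul_le {a : ℝ} (ha : |a| ≤ 1) (v : Space) : ‖a • v‖ ^ 2 ≤ ‖v‖ ^ 2 := by
  rw [norm_smul]
  gcongr
  exact mul_le_of_le_one_left (norm_nonneg _) ha

theorem summable_weightedShift (a : Grid → ℝ) (ha : ∀ j, |a j| ≤ 1) (k : Grid) (x : GridL2) :
    Summable fun j => ‖a j • x (j + k)‖ ^ 2 :=
  Summable.of_nonneg_of_le (fun _ => by positivity) (fun j => norm_sq_smul_le (ha j) _)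
    (hasSum_norm_sq_shift x k).summable

/-- The linear operator `x ↦ (j ↦ a_j x_{j+k})` on square summable grid functions. -/
noncomputable def weightedShiftLinear (a : Grid → ℝ) (ha : ∀ j, |a j| ≤ 1) (k : Grid) :
    GridL2 →ₗ[ℝ] GridL2 where
  toFun x := mkL2 (fun j => a j • x (j + k)) (summable_weightedShift a ha k x)
  map_add' x y := GridL2.ext fun j => by simp
  map_smul' c x := GridL2.ext fun j => by simp [smul_comm c]

theorem weightedShiftLinear_apply (a : Grid → ℝ) (ha : ∀ j, |a j| ≤ 1) (k : Grid) (x : GridL2)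
    (j : Grid) : weightedShiftLinear a ha k x j = a j • x (j + k) := rfl

theorem norm_weightedShiftLinear_le (a : Grid → ℝ) (ha : ∀ j, |a j| ≤ 1) (k : Grid) (x : GridL2) :
    ‖weightedShiftLinear a ha k x‖ ≤ 1 * ‖x‖ := by
  rw [one_mul, ← sq_le_sq₀ (norm_nonneg _) (norm_nonneg _)]
  have h := hasSum_norm_sq (weightedShiftLinear a ha k x)
  simp only [weightedShiftLinear_apply] at h
  exact hasSum_le (fun j => norm_sq_smul_le (ha j) _) h (hasSum_norm_sq_shift x k)

/-- The bounded operator `x ↦ (j ↦ a_j x_{j+k})` on square summable grid functions. -/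
noncomputable def weightedShift (a : Grid → ℝ) (ha : ∀ j, |a j| ≤ 1) (k : Grid) :
    GridL2 →L[ℝ] GridL2 :=
  (weightedShiftLinear a ha k).mkContinuous 1 (norm_weightedShiftLinear_le a ha k)

@[simp] theorem weightedShift_apply (a : Grid → ℝ) (ha : ∀ j, |a j| ≤ 1) (k : Grid) (x : GridL2)
    (j : Grid) : weightedShift a ha k x j = a j • x (j + k) := rfl

/-- The translation `x ↦ (j ↦ x_{j+k})`. -/
noncomputable def shift (k : Grid) : GridL2 →L[ℝ] GridL2 := weightedShift 1 (by simp) k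

@[simp] theorem shift_apply (k : Grid) (x : GridL2) (j : Grid) : shift k x j = x (j + k) := by
  simp [shift]

/-- Multiplication by a weight. -/
noncomputable def weight (a : Grid → ℝ) (ha : ∀ j, |a j| ≤ 1) : GridL2 →L[ℝ] GridL2 :=
  weightedShift a ha 0

@[simp] theorem weight_apply (a : Grid → ℝ) (ha : ∀ j, |a j| ≤ 1) (x : GridL2) (j : Grid) :
    weight a ha x j = a j • x j := by simp [weight]

theorem norm_shift (k : Grid) (x : GridL2) : ‖shift k x‖ = ‖x‖ := by
  rw [← sq_eq_sq₀ (norm_nonneg _) (norm_nonneg _)]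
  refine (hasSum_norm_sq _).unique ?_
  simpa [Function.comp_def] using (Equiv.addRight k).hasSum_iff.2 (hasSum_norm_sq x)

theorem inner_shift (k : Grid) (x y : GridL2) : ⟪shift k x, y⟫ = ⟪x, shift (-k) y⟫ := by
  have h1 := lp.hasSum_inner (𝕜 := ℝ) (shift k x) y
  have h2 := (Equiv.addRight k).hasSum_iff.2 (lp.hasSum_inner (𝕜 := ℝ) x (shift (-k) y))
  refine h1.unique ?_
  simpa [Function.comp_def] using h2

/-- The forward difference with unit step on square summable grid functions. -/
noncomputable def diff (i : Fin 2) : GridL2 →L[ℝ] GridL2 :=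
  shift (unitIndex i) - ContinuousLinearMap.id ℝ GridL2

/-- The adjoint of the forward difference. -/
noncomputable def diffAdj (i : Fin 2) : GridL2 →L[ℝ] GridL2 :=
  shift (-unitIndex i) - ContinuousLinearMap.id ℝ GridL2

@[simp] theorem diff_apply (i : Fin 2) (x : GridL2) (j : Grid) :
    diff i x j = x (j + unitIndex i) - x j := by simp [diff]

@[simp] theorem diffAdj_apply (i : Fin 2) (x : GridL2) (j : Grid) :
    diffAdj i x j = x (j - unitIndex i) - x j := by simp [diffAdj, sub_eq_add_neg]

theorem inner_diff (i : Fin 2) (x y : GridL2) : ⟪diff i x, y⟫ = ⟪x, diffAdj i y⟫ := by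
  simp [diff, diffAdj, inner_sub_left, inner_sub_right, inner_shift]

theorem norm_diffAdj_le (i : Fin 2) (x : GridL2) : ‖diffAdj i x‖ ≤ 2 * ‖x‖ := by
  have := norm_sub_le (shift (-unitIndex i) x) x
  rw [norm_shift] at this
  simpa [diffAdj, two_mul] using this

theorem diff_diffAdj_comm (i k : Fin 2) (x : GridL2) :
    diff i (diffAdj k x) = diffAdj k (diff i x) := by
  refine GridL2.ext fun j => ?_
  simp only [diff_apply, diffAdj_apply, sub_add_eq_add_sub]
  abel

/-- The Laplacian with unit step on square summable grid functions. -/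
noncomputable def lapL2 : GridL2 →L[ℝ] GridL2 := -∑ i, (diffAdj i).comp (diff i)

theorem lapL2_apply (x : GridL2) : lapL2 x = -∑ i, diffAdj i (diff i x) := by
  simp [lapL2]

/-! ### The flow with unit step as a differential equation in `ℓ²` -/

/-- Forward difference with unit step. -/
def dif (i : Fin 2) (u : Grid → Space) : Grid → Space := fun j => u (j + unitIndex i) - u j

/-- Discrete Laplacian with unit step. -/
def lap (u : Grid → Space) : Grid → Space := fun j =>
  ∑ i, ((u (j + unitIndex i) - u j) - (u j - u (j - unitIndex i)))

/-- The component of `x` orthogonal to the unit vector `n`. -/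
noncomputable def tangentPart (n x : Space) : Space := x - ⟪x, n⟫ • n

theorem smul_tangentPart (c : ℝ) (n x : Space) : c • tangentPart n x = tangentPart n (c • x) := by
  rw [tangentPart, tangentPart, inner_smul_left, smul_sub, smul_smul]; rfl

theorem discreteLaplacian_eq (h : ℝ) (u : Grid → Space) (j : Grid) :
    discreteLaplacian h u j = (h⁻¹ ^ 2) • lap u j := by
  simp only [discreteLaplacian, forwardDiff, backwardDiff, lap, ← smul_sub, add_sub_cancel_right,
    smul_smul, Finset.smul_sum, sq]

theorem norm_lap_le {u : Grid → Space} {R : ℝ} (h : ∀ j, ‖u j‖ ≤ R) (j : Grid) :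
    ‖lap u j‖ ≤ 8 * R := by
  rw [lap, Fin.sum_univ_two]
  have hb : ∀ i, ‖(u (j + unitIndex i) - u j) - (u j - u (j - unitIndex i))‖ ≤ 4 * R := fun i => by
    have h1 := norm_sub_le (u (j + unitIndex i) - u j) (u j - u (j - unitIndex i))
    have h2 := norm_sub_le (u (j + unitIndex i)) (u j)
    have h3 := norm_sub_le (u j) (u (j - unitIndex i))
    linarith [h j, h (j + unitIndex i), h (j - unitIndex i)]
  linarith [hb 0, hb 1, norm_add_le ((u (j + unitIndex 0) - u j) - (u j - u (j - unitIndex 0)))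
    ((u (j + unitIndex 1) - u j) - (u j - u (j - unitIndex 1)))]

theorem lap_sub (u v : Grid → Space) (j : Grid) :
    lap u j - lap v j = lap (fun j => u j - v j) j := by
  simp only [lap, Fin.sum_univ_two]; abel

/-- The projected velocity is smooth but not globally Lipschitz in the pair of position and
Laplacian, so it is cut off by a bump function. A grid map of norm at most `R` has a Laplacian of
norm at most `8 * R`, so the cut-off is not felt by maps into `N`. -/
theorem exists_truncated_field {ν : Space → Space} (hν : ContDiff ℝ ∞ ν) (R : ℝ) :
    ∃ (β : Space × Space → ℝ) (K : ℝ≥0), Continuous β ∧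
      LipschitzWith K (fun q : Space × Space => β q • tangentPart (ν q.1) q.2) ∧
      ∀ q : Space × Space, ‖q.1‖ ≤ R → ‖q.2‖ ≤ 8 * R → β q = 1 := by
  set r : ℝ := 8 * |R| + 1 with hr
  have hr0 : 0 < r := by positivity
  let b : ContDiffBump (0 : Space × Space) := ⟨r, r + 1, hr0, by linarith⟩
  have hsm : ContDiff ℝ 1 (fun q : Space × Space => b q • tangentPart (ν q.1) q.2) := by
    have h1 : ContDiff ℝ 1 (fun q : Space × Space => ν q.1) :=
      (hν.of_le (by simp)).comp contDiff_fst
    exact b.contDiff.smul (contDiff_snd.sub ((contDiff_snd.inner ℝ h1).smul h1))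
  have hcs : HasCompactSupport (fun q : Space × Space => b q • tangentPart (ν q.1) q.2) :=
    b.hasCompactSupport.smul_right
  obtain ⟨K, hK⟩ := hsm.lipschitzWith_of_hasCompactSupport hcs one_ne_zero
  refine ⟨b, K, b.continuous, hK, fun q h1 h2 => b.one_of_mem_closedBall ?_⟩
  rw [mem_closedBall_zero_iff, Prod.norm_def]
  have := le_abs_self R
  have := abs_nonneg R
  exact max_le (by change ‖q.1‖ ≤ r; linarith) (by change ‖q.2‖ ≤ r; linarith)

/-- Evaluation at a grid point. -/
noncomputable def evalL2 (j : Grid) : GridL2 →L[ℝ] Space :=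
  LinearMap.mkContinuous ⟨⟨fun x => x j, fun _ _ => rfl⟩, fun _ _ => rfl⟩ 1
    (fun x => by rw [one_mul]; exact lp.norm_apply_le_norm (by simp) x j)

@[simp] theorem evalL2_apply (j : Grid) (x : GridL2) : evalL2 j x = x j := rfl

/-- The superposition operator of a Lipschitz function. -/
theorem exists_superposition {f : Grid → Space} (L₀ : GridL2) {B : Space × Space → Space}
    {K : ℝ≥0} (hB : LipschitzWith K B) (hB0 : ∀ y, B (y, 0) = 0) :
    ∃ (Φ : GridL2 → GridL2) (K' : ℝ≥0), LipschitzWith K' Φ ∧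
      ∀ w j, Φ w j = B (f j + w j, (L₀ + lapL2 w) j) := by
  -- Vanishing for zero Laplacian makes the image square summable, although `f + w` itself is not.
  have hB1 : ∀ y x, ‖B (y, x)‖ ≤ K * ‖x‖ := fun y x => by
    have := hB.norm_sub_le (y, x) (y, 0)
    simpa [hB0, Prod.norm_def] using this
  have hsum : ∀ w : GridL2, Summable fun j => ‖B (f j + w j, (L₀ + lapL2 w) j)‖ ^ 2 := by
    intro w
    refine Summable.of_nonneg_of_le (fun _ => by positivity) (fun j => ?_)
      ((hasSum_norm_sq (L₀ + lapL2 w)).summable.mul_left ((K : ℝ) ^ 2))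
    rw [← mul_pow]
    gcongr
    exact hB1 _ _
  have hLip : LipschitzWith (K * (1 + ‖lapL2‖₊))
      (fun w => mkL2 (fun j => B (f j + w j, (L₀ + lapL2 w) j)) (hsum w)) := by
    refine LipschitzWith.of_dist_le_mul fun w w' => ?_
    rw [dist_eq_norm, dist_eq_norm, ← sq_le_sq₀ (norm_nonneg _) (by positivity)]
    have h1 := hasSum_norm_sq (mkL2 (fun j => B (f j + w j, (L₀ + lapL2 w) j)) (hsum w) -
      mkL2 (fun j => B (f j + w' j, (L₀ + lapL2 w') j)) (hsum w'))
    have h2 := ((hasSum_norm_sq (w - w')).add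
      (hasSum_norm_sq (lapL2 (w - w')))).mul_left ((K : ℝ) ^ 2)
    refine (hasSum_le (fun j => ?_) h1 h2).trans ?_
    · simp only [GridL2.sub_apply, mkL2_apply]
      have h3 := hB.norm_sub_le (f j + w j, (L₀ + lapL2 w) j) (f j + w' j, (L₀ + lapL2 w') j)
      have h4 : ‖(f j + w j, (L₀ + lapL2 w) j) - (f j + w' j, (L₀ + lapL2 w') j)‖ ^ 2
          ≤ ‖w j - w' j‖ ^ 2 + ‖lapL2 (w - w') j‖ ^ 2 := by
        have e1 : f j + w j - (f j + w' j) = w j - w' j := by abel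
        have e2 : (L₀ + lapL2 w) j - (L₀ + lapL2 w') j = lapL2 (w - w') j := by
          rw [map_sub]; simp
        rw [Prod.norm_def, Prod.mk_sub_mk, e1, e2]
        rcases max_cases ‖w j - w' j‖ ‖lapL2 (w - w') j‖ with h | h <;> rw [h.1] <;>
          nlinarith [sq_nonneg ‖w j - w' j‖, sq_nonneg ‖lapL2 (w - w') j‖]
      calc _ ≤ (K * ‖(f j + w j, (L₀ + lapL2 w) j) - (f j + w' j, (L₀ + lapL2 w') j)‖) ^ 2 := by
            gcongr
        _ ≤ _ := by rw [mul_pow]; gcongr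
    · have h5 := lapL2.le_opNorm (w - w')
      have h6 : ‖lapL2 (w - w')‖ ^ 2 ≤ (‖lapL2‖ * ‖w - w'‖) ^ 2 := by gcongr
      push_cast
      rw [mul_assoc, mul_pow]
      gcongr
      nlinarith [norm_nonneg lapL2, sq_nonneg ‖w - w'‖, mul_nonneg (norm_nonneg lapL2) (sq_nonneg ‖w - w'‖)]
  exact ⟨_, _, hLip, fun w j => rfl⟩

/-- A solution of the flow with unit step, written as a curve in `ℓ²` around its initial value
`f`, whose differences are `A i`. -/
structure IsUnitFlow (N : Set Space) (ν : Space → Space) (f : Grid → Space) (A : Fin 2 → GridL2)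
    (w v : ℝ → GridL2) : Prop where
  dif_eq : ∀ i j, A i j = dif i f j
  initial : w 0 = 0
  mem_target : ∀ t, 0 ≤ t → ∀ j, f j + w t j ∈ N
  deriv : ∀ t, 0 ≤ t → HasDerivWithinAt w (v t) (Ici 0) t
  velocity : ∀ t, 0 ≤ t → ∀ j, v t j = tangentPart (ν (f j + w t j)) (lap (fun j => f j + w t j) j)

/-- The initial map need not be square summable, but its differences `A i` are. Its Laplacian is
thus a fixed vector of `ℓ²`, and the equation for the displacement `w` is a perturbation of a
bounded linear one. -/
theorem lapL2_add_apply {f : Grid → Space} {A : Fin 2 → GridL2} (hA : ∀ i j, A i j = dif i f j)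
    (w : GridL2) (j : Grid) :
    (-∑ i, diffAdj i (A i) + lapL2 w) j = lap (fun j => f j + w j) j := by
  simp only [lapL2_apply, Fin.sum_univ_two, GridL2.add_apply, GridL2.neg_apply, diffAdj_apply,
    diff_apply, hA, dif, lap, sub_add_cancel]
  abel

/-- The truncated equation is globally solvable in `ℓ²`. At each grid point its velocity is a
projected one, so the solution stays on `N`, and there the truncation factor is one. -/
theorem exists_isUnitFlow {N : Set Space} (hN : IsCompact N) (hs : IsSmoothHypersurface N)
    {ν : Space → Space} (hν : IsUnitNormalField N ν) {f : Grid → Space} (hf : ∀ j, f j ∈ N)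
    {A : Fin 2 → GridL2} (hA : ∀ i j, A i j = dif i f j) :
    ∃ w v, IsUnitFlow N ν f A w v := by
  obtain ⟨R, hR⟩ := hN.isBounded.exists_norm_le
  obtain ⟨β, K, hβ, hK, hβ1⟩ := exists_truncated_field hν.smooth R
  obtain ⟨Φ, K', hΦ, hΦj⟩ := exists_superposition (f := f) (-∑ i, diffAdj i (A i)) hK
    (by simp [tangentPart])
  obtain ⟨w, hw0, hw⟩ := exists_solution_Ici hΦ 0
  simp only [lapL2_add_apply hA] at hΦj
  have hwc : ContinuousOn w (Ici 0) := fun t ht => (hw t ht).continuousWithinAt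
  have hlapc : ∀ j, ContinuousOn (fun t => lap (fun j => f j + w t j) j) (Ici 0) := by
    intro j
    have h1 : ContinuousOn (fun t => evalL2 j (-∑ i, diffAdj i (A i) + lapL2 (w t))) (Ici 0) :=
      (evalL2 j).continuous.comp_continuousOn
        (continuousOn_const.add (lapL2.continuous.comp_continuousOn hwc))
    simpa only [evalL2_apply, lapL2_add_apply hA] using h1
  have huc : ∀ j, ContinuousOn (fun t => f j + w t j) (Ici 0) := fun j =>
    continuousOn_const.add ((evalL2 j).continuous.comp_continuousOn hwc)
  have hmem : ∀ t, 0 ≤ t → ∀ j, f j + w t j ∈ N := by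
    intro t ht j
    -- The factor `β` is absorbed into the vector to be projected; nothing about its value is needed
    -- yet.
    refine mem_target_of_projected_velocity hN hs hν (y := fun t => f j + w t j) (T := t)
      (M := fun t => β (f j + w t j, lap (fun j => f j + w t j) j) •
        lap (fun j => f j + w t j) j) ?_ (fun s hs => ?_) (by simpa [hw0] using hf j) t ⟨ht, le_rfl⟩
    · exact ((hβ.comp_continuousOn ((huc j).prodMk (hlapc j))).smul (hlapc j)).mono
        Icc_subset_Ici_self
    · have h1 : HasDerivWithinAt (fun t => f j + w t j) (Φ (w s) j) (Ici 0) s :=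
        ((evalL2 j).hasFDerivAt.comp_hasDerivWithinAt s (hw s hs.1)).const_add (f j)
      rw [hΦj, smul_tangentPart] at h1
      exact h1.mono Icc_subset_Ici_self
  refine ⟨w, fun t => Φ (w t), hA, hw0, hmem, hw, fun t ht j => ?_⟩
  rw [hΦj]
  dsimp only
  rw [hβ1 (f j + w t j, lap (fun j => f j + w t j) j) (hR _ (hmem t ht j))
    (norm_lap_le (fun j => hR _ (hmem t ht j)) j), one_smul]

theorem semidiscreteFlow_velocity {ν : Space → Space} {u : Grid → Space} (h : ℝ) (j : Grid) :
    discreteLaplacian h u j + (-⟪discreteLaplacian h u j, ν (u j)⟫) • ν (u j)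
      = (h⁻¹ ^ 2) • tangentPart (ν (u j)) (lap u j) := by
  rw [discreteLaplacian_eq, smul_tangentPart, tangentPart, neg_smul, sub_eq_add_neg]

/-- The flow has at most one solution. -/
theorem semidiscreteFlow_unique {N : Set Space} (hN : IsCompact N) {ν : Space → Space}
    (hν : IsUnitNormalField N ν) {f : Grid → Space} {u u' : ℝ → Grid → Space} {h : ℝ}
    (hu : IsSemidiscreteFlow N ν h f u) (hu' : IsSemidiscreteFlow N ν h f u') {t : ℝ} (ht : 0 ≤ t)
    (j : Grid) : u t j = u' t j := by
  obtain ⟨R, hR⟩ := hN.isBounded.exists_norm_le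
  obtain ⟨β, K, -, hK, hβ1⟩ := exists_truncated_field hν.smooth R
  set D : ℝ := 2 * R with hD
  set κ : ℝ := h⁻¹ ^ 2 * (K * 8) with hκ
  have hR0 : 0 ≤ R := (norm_nonneg _).trans (hR _ (hu.mem_target t ht j))
  have hκ0 : 0 ≤ κ := by positivity
  have hvel : ∀ {u}, IsSemidiscreteFlow N ν h f u → ∀ s, 0 ≤ s → ∀ j,
      HasDerivWithinAt (fun s => u s j)
        (h⁻¹ ^ 2 • (β (u s j, lap (u s) j) • tangentPart (ν (u s j)) (lap (u s) j))) (Ici 0) s := by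
    intro u hu s hs j
    have := hu.equation s hs j
    rw [semidiscreteFlow_velocity] at this
    rwa [hβ1 (u s j, lap (u s) j) (hR _ (hu.mem_target s hs j))
      (norm_lap_le (fun j => hR _ (hu.mem_target s hs j)) j), one_smul]
  have hder : ∀ s, 0 ≤ s → ∀ b, (∀ j, ‖u s j - u' s j‖ ≤ b) → ∀ j,
      ‖h⁻¹ ^ 2 • (β (u s j, lap (u s) j) • tangentPart (ν (u s j)) (lap (u s) j)) -
        h⁻¹ ^ 2 • (β (u' s j, lap (u' s) j) • tangentPart (ν (u' s j)) (lap (u' s) j))‖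
        ≤ κ * b := by
    intro s hs b hb j
    have hb0 : 0 ≤ b := (norm_nonneg _).trans (hb j)
    rw [← smul_sub, norm_smul, Real.norm_eq_abs, abs_of_nonneg (by positivity), hκ, mul_assoc]
    gcongr
    refine (hK.norm_sub_le (u s j, lap (u s) j) (u' s j, lap (u' s) j)).trans ?_
    rw [mul_assoc]
    gcongr
    rw [Prod.norm_def]
    refine max_le ?_ ?_
    · exact (hb j).trans (by linarith)
    · change ‖lap (u s) j - lap (u' s) j‖ ≤ _
      rw [lap_sub]
      exact norm_lap_le hb j
  -- The difference of two arbitrary solutions is not known to be square summable, but it is bounded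
  -- since `N` is. Iterating the integral inequality at each grid point, uniformly in `j`, gives a
  -- factorial bound and avoids differentiating a supremum.
  have key : ∀ n : ℕ, ∀ s, 0 ≤ s → ∀ j, ‖u s j - u' s j‖ ≤ D * ((κ * s) ^ n / n.factorial) := by
    intro n
    induction n with
    | zero =>
      intro s hs j
      have := norm_sub_le (u s j) (u' s j)
      simp only [pow_zero, Nat.factorial_zero, Nat.cast_one, div_one, mul_one]
      linarith [hR _ (hu.mem_target s hs j), hR _ (hu'.mem_target s hs j)]
    | succ n ih =>
      intro s hs j
      have hBd : ∀ r : ℝ, HasDerivAt (fun r : ℝ => D * ((κ * r) ^ (n + 1) / (n + 1).factorial))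
          (κ * (D * ((κ * r) ^ n / n.factorial))) r := by
        intro r
        have h1 := ((((hasDerivAt_id r).const_mul κ).pow (n + 1)).div_const
          ((n + 1).factorial : ℝ)).const_mul D
        refine h1.congr_deriv ?_
        rw [Nat.factorial_succ]
        push_cast
        have := n.factorial_pos
        have h3 : ((n : ℝ) + 1) ≠ 0 := by positivity
        have h4 : (n.factorial : ℝ) ≠ 0 := by positivity
        simp only [id]
        field_simp
      have := image_norm_le_of_norm_deriv_right_le_deriv_boundary (a := 0) (b := s)
        (f := fun r => u r j - u' r j)
        (fun r hr => ((hvel hu r hr.1 j).sub (hvel hu' r hr.1 j)).continuousWithinAt.mono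
          Icc_subset_Ici_self)
        (fun r hr => ((hvel hu r hr.1 j).sub (hvel hu' r hr.1 j)).mono (Ici_subset_Ici.2 hr.1))
        (by simp [hu.initial, hu'.initial]) hBd
        (fun r hr => hder r hr.1 _ (ih r hr.1) j)
      exact this ⟨hs, le_rfl⟩
  have hlim : Tendsto (fun n : ℕ => D * ((κ * t) ^ n / n.factorial)) atTop (𝓝 0) := by
    simpa using (FloorSemiring.tendsto_pow_div_factorial_atTop (κ * t)).const_mul D
  have h0 := ge_of_tendsto' hlim fun n => key n t ht j
  exact sub_eq_zero.1 (norm_le_zero_iff.1 h0)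

/-! ### Discrete interpolation inequalities -/

/-- Telescoping from `n` to infinity: a sequence that vanishes at infinity is bounded by its total
variation. -/
theorem enorm_le_tsum_enorm_sub {a : ℤ → ℝ} (n : ℤ)
    (ha : Tendsto (fun m : ℕ => a (n + m)) atTop (𝓝 0)) :
    ‖a n‖ₑ ≤ ∑' k : ℤ, ‖a (k + 1) - a k‖ₑ := by
  have h1 : ∀ m : ℕ, ‖a n‖ₑ ≤ ‖a (n + m)‖ₑ + ∑' k : ℤ, ‖a (k + 1) - a k‖ₑ := by
    intro m
    have h2 : ∑ k ∈ Finset.range m, (a (n + (k + 1 : ℕ)) - a (n + (k : ℕ))) = a (n + m) - a n := by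
      rw [Finset.sum_range_sub (fun k : ℕ => a (n + k))]; simp
    have h3 : ‖a (n + m) - a n‖ₑ ≤ ∑' k : ℤ, ‖a (k + 1) - a k‖ₑ := by
      rw [← h2]
      refine (enorm_sum_le _ _).trans ((ENNReal.sum_le_tsum _).trans ?_)
      have hinj : Function.Injective (fun k : ℕ => n + (k : ℤ)) := fun a b h => by simpa using h
      refine le_of_eq_of_le ?_ (ENNReal.tsum_comp_le_tsum_of_injective hinj
        (fun k : ℤ => ‖a (k + 1) - a k‖ₑ))
      refine tsum_congr fun k => ?_
      simp only [Nat.cast_add, Nat.cast_one, add_assoc]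
    calc ‖a n‖ₑ = ‖a (n + m) - (a (n + m) - a n)‖ₑ := by congr 1; ring
      _ ≤ ‖a (n + m)‖ₑ + ‖a (n + m) - a n‖ₑ := enorm_sub_le
      _ ≤ _ := by gcongr
  have h4 : Tendsto (fun m : ℕ => ‖a (n + m)‖ₑ + ∑' k : ℤ, ‖a (k + 1) - a k‖ₑ) atTop
      (𝓝 (0 + ∑' k : ℤ, ‖a (k + 1) - a k‖ₑ)) := by
    refine Tendsto.add ?_ tendsto_const_nhds
    simpa [Function.comp_def] using (continuous_enorm.tendsto (0 : ℝ)).comp ha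
  rw [zero_add] at h4
  exact ge_of_tendsto' h4 h1

theorem tsum_norm_mul_norm_le (x y : GridL2) :
    Summable (fun j => ‖x j‖ * ‖y j‖) ∧ ∑' j, ‖x j‖ * ‖y j‖ ≤ ‖x‖ * ‖y‖ := by
  have hpq : (2 : ℝ≥0∞).toReal.HolderConjugate (2 : ℝ≥0∞).toReal := by
    simpa using Real.HolderConjugate.two_two
  exact ⟨lp.summable_mul hpq x y, lp.tsum_mul_le_mul_norm' hpq x y⟩

/-- The difference of two squares is the difference times the sum of the norms. Cauchy–Schwarz
applies to each of the two resulting products, since shifts are isometries. -/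
theorem tsum_enorm_sub_norm_sq_le (i : Fin 2) (x : GridL2) :
    ∑' j, ‖‖x (j + unitIndex i)‖ ^ 2 - ‖x j‖ ^ 2‖ₑ ≤ ENNReal.ofReal (2 * ‖diff i x‖ * ‖x‖) := by
  have h1 := tsum_norm_mul_norm_le (diff i x) (shift (unitIndex i) x)
  have h2 := tsum_norm_mul_norm_le (diff i x) x
  rw [norm_shift] at h1
  calc ∑' j, ‖‖x (j + unitIndex i)‖ ^ 2 - ‖x j‖ ^ 2‖ₑ
      ≤ ∑' j, ENNReal.ofReal (‖diff i x j‖ * ‖shift (unitIndex i) x j‖ + ‖diff i x j‖ * ‖x j‖) := by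
        refine ENNReal.tsum_le_tsum fun j => ?_
        rw [Real.enorm_eq_ofReal_abs]
        refine ENNReal.ofReal_le_ofReal ?_
        rw [diff_apply, shift_apply, ← mul_add, sq_sub_sq, abs_mul, mul_comm,
          abs_of_nonneg (by positivity : 0 ≤ ‖x (j + unitIndex i)‖ + ‖x j‖)]
        gcongr
        exact abs_norm_sub_norm_le _ _
    _ = ENNReal.ofReal (∑' j, (‖diff i x j‖ * ‖shift (unitIndex i) x j‖ + ‖diff i x j‖ * ‖x j‖)) :=
        (ENNReal.ofReal_tsum_of_nonneg (fun j => by positivity) (h1.1.add h2.1)).symm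
    _ ≤ _ := by
        refine ENNReal.ofReal_le_ofReal ?_
        rw [h1.1.tsum_add h2.1]
        linarith [h1.2, h2.2]

theorem tendsto_norm_sq_line (x : GridL2) (g : ℕ → Grid) (hg : Function.Injective g) :
    Tendsto (fun m => ‖x (g m)‖ ^ 2) atTop (𝓝 0) :=
  ((hasSum_norm_sq x).summable.comp_injective hg).tendsto_atTop_zero

theorem enorm_sq_le_line_zero (x : GridL2) (a b : ℤ) :
    ‖‖x ![a, b]‖ ^ 2‖ₑ ≤ ∑' k : ℤ, ‖‖x (![k, b] + unitIndex 0)‖ ^ 2 - ‖x ![k, b]‖ ^ 2‖ₑ := by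
  have h := enorm_le_tsum_enorm_sub (a := fun k => ‖x ![k, b]‖ ^ 2) a
    (tendsto_norm_sq_line x (fun m => ![a + m, b]) fun m n h => by simpa using congrFun h 0)
  refine h.trans (le_of_eq (tsum_congr fun k => ?_))
  have e : ![k, b] + unitIndex 0 = ![k + 1, b] := by
    ext i; fin_cases i <;> simp [unitIndex]
  rw [e]

theorem enorm_sq_le_line_one (x : GridL2) (a b : ℤ) :
    ‖‖x ![a, b]‖ ^ 2‖ₑ ≤ ∑' k : ℤ, ‖‖x (![a, k] + unitIndex 1)‖ ^ 2 - ‖x ![a, k]‖ ^ 2‖ₑ := by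
  have h := enorm_le_tsum_enorm_sub (a := fun k => ‖x ![a, k]‖ ^ 2) b
    (tendsto_norm_sq_line x (fun m => ![a, b + m]) fun m n h => by simpa using congrFun h 1)
  refine h.trans (le_of_eq (tsum_congr fun k => ?_))
  have e : ![a, k] + unitIndex 1 = ![a, k + 1] := by
    ext i; fin_cases i <;> simp [unitIndex]
  rw [e]

theorem tsum_grid (g : Grid → ℝ≥0∞) : ∑' j, g j = ∑' a : ℤ, ∑' b : ℤ, g ![a, b] := by
  rw [← ENNReal.tsum_prod (f := fun a b => g ![a, b]), ← (finTwoArrowEquiv ℤ).symm.tsum_eq]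
  rfl

/-- The discrete Ladyzhenskaya inequality. -/
theorem tsum_norm_pow_four_le (x : GridL2) :
    Summable (fun j => ‖x j‖ ^ 4) ∧
      ∑' j, ‖x j‖ ^ 4 ≤ 4 * ‖x‖ ^ 2 * (‖diff 0 x‖ * ‖diff 1 x‖) := by
  have h1 : ∑' j, ENNReal.ofReal (‖x j‖ ^ 4) ≤
      ENNReal.ofReal (4 * ‖x‖ ^ 2 * (‖diff 0 x‖ * ‖diff 1 x‖)) := by
    set P : Fin 2 → Grid → ℝ≥0∞ := fun i j => ‖‖x (j + unitIndex i)‖ ^ 2 - ‖x j‖ ^ 2‖ₑ with hP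
    calc ∑' j, ENNReal.ofReal (‖x j‖ ^ 4)
        = ∑' a : ℤ, ∑' b : ℤ, ‖‖x ![a, b]‖ ^ 2‖ₑ * ‖‖x ![a, b]‖ ^ 2‖ₑ := by
          rw [tsum_grid]
          refine tsum_congr fun a => tsum_congr fun b => ?_
          rw [Real.enorm_eq_ofReal (by positivity), ← ENNReal.ofReal_mul (by positivity)]
          congr 1; ring
      -- One factor `‖x‖ ^ 2` is bounded by the variation along its horizontal line, the other along
      -- its vertical line. The first bound does not depend on `a` and the second not on `b`, so the
      -- double sum factorizes.
      _ ≤ ∑' a : ℤ, ∑' b : ℤ, (∑' k : ℤ, P 0 ![k, b]) * (∑' k : ℤ, P 1 ![a, k]) := by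
          refine ENNReal.tsum_le_tsum fun a => ENNReal.tsum_le_tsum fun b => ?_
          exact mul_le_mul' (enorm_sq_le_line_zero x a b) (enorm_sq_le_line_one x a b)
      _ = (∑' b : ℤ, ∑' k : ℤ, P 0 ![k, b]) * (∑' a : ℤ, ∑' k : ℤ, P 1 ![a, k]) := by
          simp_rw [ENNReal.tsum_mul_right, ENNReal.tsum_mul_left]
      _ = (∑' j, P 0 j) * ∑' j, P 1 j := by
          rw [tsum_grid (P 0), tsum_grid (P 1), ENNReal.tsum_comm]
      _ ≤ ENNReal.ofReal (2 * ‖diff 0 x‖ * ‖x‖) * ENNReal.ofReal (2 * ‖diff 1 x‖ * ‖x‖) :=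
          mul_le_mul' (tsum_enorm_sub_norm_sq_le 0 x) (tsum_enorm_sub_norm_sq_le 1 x)
      _ = _ := by
          rw [← ENNReal.ofReal_mul (by positivity)]; congr 1; ring
  have hs : Summable (fun j => ‖x j‖ ^ 4) := by
    have h2 : ∑' j, ENNReal.ofReal (‖x j‖ ^ 4) ≠ ⊤ := (h1.trans_lt ENNReal.ofReal_lt_top).ne
    have h3 := ENNReal.summable_toReal h2
    refine h3.congr fun j => ENNReal.toReal_ofReal (by positivity)
  refine ⟨hs, ?_⟩
  rw [← ENNReal.ofReal_tsum_of_nonneg (fun _ => by positivity) hs] at h1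
  exact (ENNReal.ofReal_le_ofReal_iff (by positivity)).1 h1

theorem tsum_norm_pow_four_le' (x : GridL2) :
    ∑' j, ‖x j‖ ^ 4 ≤ 2 * ‖x‖ ^ 2 * ∑ k, ‖diff k x‖ ^ 2 := by
  refine (tsum_norm_pow_four_le x).2.trans ?_
  rw [Fin.sum_univ_two]
  nlinarith [mul_nonneg (sq_nonneg ‖x‖) (sq_nonneg (‖diff 0 x‖ - ‖diff 1 x‖))]

/-- Young's inequality at each grid point, with the weight `(4 * ‖z‖ ^ 2)⁻¹` for which the
Ladyzhenskaya inequality turns the quartic sum into a quarter of the Dirichlet term. Two such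
contributions can be absorbed when two times of a solution are compared. -/
theorem abs_inner_le_of_pointwise {z y : GridL2} {C : ℝ}
    (h : ∀ j, |⟪z j, y j⟫| ≤ C * (‖y j‖ * ‖z j‖ ^ 2)) :
    |⟪z, y⟫| ≤ 1 / 4 * ∑ k, ‖diff k z‖ ^ 2 + 2 * C ^ 2 * ‖y‖ ^ 2 * ‖z‖ ^ 2 := by
  rcases eq_or_ne z 0 with rfl | hz
  · simp
  have hz0 : 0 < ‖z‖ ^ 2 := by positivity
  set θ : ℝ := (4 * ‖z‖ ^ 2)⁻¹ with hθ
  have h4 := tsum_norm_pow_four_le' z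
  have hs4 := (tsum_norm_pow_four_le z).1
  have hbound : ∀ j, |⟪z j, y j⟫| ≤ θ / 2 * ‖z j‖ ^ 4 + C ^ 2 * (2 * ‖z‖ ^ 2) * ‖y j‖ ^ 2 := by
    intro j
    refine (h j).trans ?_
    have e : θ / 2 * ‖z j‖ ^ 4 + C ^ 2 * (2 * ‖z‖ ^ 2) * ‖y j‖ ^ 2 - C * (‖y j‖ * ‖z j‖ ^ 2)
        = θ / 2 * (‖z j‖ ^ 2 - 4 * ‖z‖ ^ 2 * (C * ‖y j‖)) ^ 2 := by
      rw [hθ]; field_simp; ring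
    have : 0 ≤ θ / 2 * (‖z j‖ ^ 2 - 4 * ‖z‖ ^ 2 * (C * ‖y j‖)) ^ 2 := by positivity
    linarith
  have hsum := (hs4.hasSum.mul_left (θ / 2)).add
    ((hasSum_norm_sq y).mul_left (C ^ 2 * (2 * ‖z‖ ^ 2)))
  have habs : |⟪z, y⟫| ≤ θ / 2 * ∑' j, ‖z j‖ ^ 4 + C ^ 2 * (2 * ‖z‖ ^ 2) * ‖y‖ ^ 2 := by
    have hi := lp.hasSum_inner (𝕜 := ℝ) z y
    refine abs_le.2 ⟨?_, ?_⟩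
    · exact hasSum_le (fun j => (abs_le.1 (hbound j)).1) hsum.neg hi
    · exact hasSum_le (fun j => (abs_le.1 (hbound j)).2) hi hsum
  have h5 : θ / 2 * ∑' j, ‖z j‖ ^ 4 ≤ θ / 2 * (2 * ‖z‖ ^ 2 * ∑ k, ‖diff k z‖ ^ 2) := by gcongr
  have h6 : θ / 2 * (2 * ‖z‖ ^ 2 * ∑ k, ‖diff k z‖ ^ 2) = 1 / 4 * ∑ k, ‖diff k z‖ ^ 2 := by
    rw [hθ]; field_simp
  linarith

/-! ### The discrete Laplacian and its normal part -/

/-- The Laplacian of a grid function with given differences. -/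
noncomputable def lapOf (D : Fin 2 → GridL2) : GridL2 := -∑ i, diffAdj i (D i)

theorem lapOf_apply {u : Grid → Space} {D : Fin 2 → GridL2} (hD : ∀ i j, D i j = dif i u j)
    (j : Grid) : lapOf D j = lap u j := by
  simp only [lapOf, Fin.sum_univ_two, GridL2.neg_apply, GridL2.add_apply, diffAdj_apply, hD, dif,
    lap, sub_add_cancel]
  abel

/-- The discrete Hessian and the discrete Laplacian have the same norm. -/
theorem sum_norm_diff_sq_eq {u : Grid → Space} {D : Fin 2 → GridL2}
    (hD : ∀ i j, D i j = dif i u j) :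
    ∑ i, ∑ k, ‖diff k (D i)‖ ^ 2 = ‖lapOf D‖ ^ 2 := by
  -- Mixed differences commute because the `D i` are differences of one and the same map; this
  -- allows the two summations by parts below.
  have hc : ∀ i k, diff k (D i) = diff i (D k) := fun i k => GridL2.ext fun j => by
    simp only [diff_apply, hD, dif, add_right_comm j (unitIndex k) (unitIndex i)]; abel
  have h1 : ∀ i k, ‖diff k (D i)‖ ^ 2 = ⟪diffAdj i (D i), diffAdj k (D k)⟫ := by
    intro i k
    rw [← real_inner_self_eq_norm_sq]
    nth_rw 2 [hc]
    rw [real_inner_comm, inner_diff, ← diff_diffAdj_comm, real_inner_comm, inner_diff]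
  rw [lapOf, norm_neg, ← real_inner_self_eq_norm_sq, sum_inner]
  refine Finset.sum_congr rfl fun i _ => ?_
  rw [inner_sum]
  exact Finset.sum_congr rfl fun k _ => h1 i k

/-- With unit step every difference operator is bounded. The crude bound serves only the error terms
of the local energy inequality. -/
theorem norm_sq_lapOf_le (D : Fin 2 → GridL2) : ‖lapOf D‖ ^ 2 ≤ 8 * ∑ i, ‖D i‖ ^ 2 := by
  rw [lapOf, norm_neg, Fin.sum_univ_two, Fin.sum_univ_two]
  have h1 := norm_add_le (diffAdj 0 (D 0)) (diffAdj 1 (D 1))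
  have h2 := norm_diffAdj_le 0 (D 0)
  have h3 := norm_diffAdj_le 1 (D 1)
  have h4 : ‖diffAdj 0 (D 0) + diffAdj 1 (D 1)‖ ≤ 2 * ‖D 0‖ + 2 * ‖D 1‖ := by linarith
  have h5 : ‖diffAdj 0 (D 0) + diffAdj 1 (D 1)‖ ^ 2 ≤ (2 * ‖D 0‖ + 2 * ‖D 1‖) ^ 2 := by gcongr
  nlinarith [sq_nonneg (‖D 0‖ - ‖D 1‖)]

theorem inner_lapL2_self (z : GridL2) : ⟪z, lapL2 z⟫ = -∑ k, ‖diff k z‖ ^ 2 := by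
  rw [lapL2_apply, inner_neg_right, inner_sum]
  congr 1
  refine Finset.sum_congr rfl fun k _ => ?_
  rw [← inner_diff, real_inner_self_eq_norm_sq]

theorem inner_tangentPart {n x : Space} (hn : ‖n‖ = 1) :
    ⟪x, tangentPart n x⟫ = ‖tangentPart n x‖ ^ 2 ∧ ⟪n, tangentPart n x⟫ = 0 := by
  have h1 : ⟪n, tangentPart n x⟫ = 0 := by
    rw [tangentPart, inner_sub_right, inner_smul_right, real_inner_self_eq_norm_sq, hn,
      real_inner_comm]; ring
  refine ⟨?_, h1⟩
  have : x = tangentPart n x + ⟪x, n⟫ • n := by simp [tangentPart]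
  nth_rw 1 [this]
  rw [inner_add_left, inner_smul_left, h1, real_inner_self_eq_norm_sq]; simp

/-- The normal component of the Laplacian of a map into the hypersurface is quadratic in its
differences. -/
theorem abs_inner_lap_normal_le {N : Set Space} {ν : Space → Space} {C : ℝ}
    (hC : ∀ y ∈ N, ∀ z ∈ N, |⟪ν y, z - y⟫| ≤ C * ‖z - y‖ ^ 2) {u : Grid → Space}
    (hu : ∀ j, u j ∈ N) (j : Grid) :
    |⟪lap u j, ν (u j)⟫| ≤ C * ∑ i, (‖dif i u j‖ ^ 2 + ‖dif i u (j - unitIndex i)‖ ^ 2) := by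
  have h1 : ∀ i, |⟪(u (j + unitIndex i) - u j) - (u j - u (j - unitIndex i)), ν (u j)⟫| ≤
      C * (‖dif i u j‖ ^ 2 + ‖dif i u (j - unitIndex i)‖ ^ 2) := by
    intro i
    have ha := hC (u j) (hu _) (u (j + unitIndex i)) (hu _)
    have hb := hC (u j) (hu _) (u (j - unitIndex i)) (hu _)
    rw [inner_sub_left, real_inner_comm]
    nth_rw 2 [real_inner_comm]
    rw [← neg_sub (u (j - unitIndex i)), inner_neg_right, sub_neg_eq_add]
    refine (abs_add_le _ _).trans ?_
    rw [mul_add]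
    refine add_le_add ha (hb.trans (le_of_eq ?_))
    rw [dif, sub_add_cancel, norm_sub_rev]
  rw [lap, sum_inner, Finset.mul_sum]
  exact (Finset.abs_sum_le_sum_abs _ _).trans (Finset.sum_le_sum fun i _ => h1 i)

/-- The normal part is pointwise quadratic in the differences, so its square is a quartic sum. The
Ladyzhenskaya inequality bounds this by the energy times the squared Hessian norm, that is, the
squared Laplacian norm. The factor in front is small with the energy, and this is the reason for the
smallness assumption. -/
theorem norm_sq_sub_tangent_le {N : Set Space} {ν : Space → Space} {C : ℝ}
    (hn : ∀ y ∈ N, ‖ν y‖ = 1)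
    (hC : ∀ y ∈ N, ∀ z ∈ N, |⟪ν y, z - y⟫| ≤ C * ‖z - y‖ ^ 2) {u : Grid → Space}
    (hu : ∀ j, u j ∈ N) {D : Fin 2 → GridL2} (hD : ∀ i j, D i j = dif i u j) {v : GridL2}
    (hv : ∀ j, v j = tangentPart (ν (u j)) (lap u j)) :
    ‖lapOf D - v‖ ^ 2 ≤ 16 * C ^ 2 * (∑ i, ‖D i‖ ^ 2) * ‖lapOf D‖ ^ 2 := by
  have hpt : ∀ j, ‖(lapOf D - v) j‖ ^ 2 ≤
      4 * C ^ 2 * ∑ i, (‖D i j‖ ^ 4 + ‖D i (j - unitIndex i)‖ ^ 4) := by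
    intro j
    have e : (lapOf D - v) j = ⟪lap u j, ν (u j)⟫ • ν (u j) := by
      rw [GridL2.sub_apply, lapOf_apply hD, hv, tangentPart, sub_sub_cancel]
    rw [e, norm_smul, hn _ (hu j), mul_one, Real.norm_eq_abs]
    have h1 := abs_inner_lap_normal_le hC hu j
    simp only [Fin.sum_univ_two, ← hD] at h1 ⊢
    set a := ‖D 0 j‖ ^ 2
    set b := ‖D 0 (j - unitIndex 0)‖ ^ 2
    set c := ‖D 1 j‖ ^ 2
    set d := ‖D 1 (j - unitIndex 1)‖ ^ 2
    have h2 : |⟪lap u j, ν (u j)⟫| ^ 2 ≤ (C * (a + b + (c + d))) ^ 2 := by gcongr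
    have h3 : (a + b + (c + d)) ^ 2 ≤ 4 * (a ^ 2 + b ^ 2 + (c ^ 2 + d ^ 2)) := by
      nlinarith [sq_nonneg (a - b), sq_nonneg (a - c), sq_nonneg (a - d), sq_nonneg (b - c),
        sq_nonneg (b - d), sq_nonneg (c - d)]
    have e1 : ‖D 0 j‖ ^ 4 = a ^ 2 := by simp only [a]; ring
    have e2 : ‖D 0 (j - unitIndex 0)‖ ^ 4 = b ^ 2 := by simp only [b]; ring
    have e3 : ‖D 1 j‖ ^ 4 = c ^ 2 := by simp only [c]; ring
    have e4 : ‖D 1 (j - unitIndex 1)‖ ^ 4 = d ^ 2 := by simp only [d]; ring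
    rw [e1, e2, e3, e4]
    calc _ ≤ _ := h2
      _ = C ^ 2 * (a + b + (c + d)) ^ 2 := by ring
      _ ≤ C ^ 2 * (4 * (a ^ 2 + b ^ 2 + (c ^ 2 + d ^ 2))) := by gcongr
      _ = _ := by ring
  have hs : HasSum (fun j => 4 * C ^ 2 * ∑ i, (‖D i j‖ ^ 4 + ‖D i (j - unitIndex i)‖ ^ 4))
      (4 * C ^ 2 * ∑ i, (∑' j, ‖D i j‖ ^ 4 + ∑' j, ‖D i j‖ ^ 4)) := by
    refine HasSum.mul_left _ (hasSum_sum fun i _ => ?_)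
    have h4 := (tsum_norm_pow_four_le (D i)).1.hasSum
    exact h4.add ((Equiv.subRight (unitIndex i)).hasSum_iff.2 h4)
  refine (hasSum_le hpt (hasSum_norm_sq _) hs).trans ?_
  have h5 : ∀ i, ∑' j, ‖D i j‖ ^ 4 ≤ 2 * (∑ i, ‖D i‖ ^ 2) * ∑ k, ‖diff k (D i)‖ ^ 2 := fun i => by
    refine (tsum_norm_pow_four_le' (D i)).trans ?_
    gcongr
    exact Finset.single_le_sum (f := fun i => ‖D i‖ ^ 2) (fun _ _ => by positivity)
      (Finset.mem_univ i)
  rw [← sum_norm_diff_sq_eq hD]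
  calc 4 * C ^ 2 * ∑ i, (∑' j, ‖D i j‖ ^ 4 + ∑' j, ‖D i j‖ ^ 4)
      ≤ 4 * C ^ 2 * ∑ i, (2 * (∑ i, ‖D i‖ ^ 2) * ∑ k, ‖diff k (D i)‖ ^ 2 +
          2 * (∑ i, ‖D i‖ ^ 2) * ∑ k, ‖diff k (D i)‖ ^ 2) := by
        gcongr with i _ <;> exact h5 _
    _ = _ := by
        simp only [Fin.sum_univ_two]; ring

/-! ### A priori estimates for the flow with unit step -/

/-- The differences of the solution at a given time. -/
noncomputable def flowDiff (A : Fin 2 → GridL2) (w : ℝ → GridL2) (t : ℝ) (i : Fin 2) : GridL2 :=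
  A i + diff i (w t)

/-- The Dirichlet energy of a grid function with given differences. -/
noncomputable def energyL2 (D : Fin 2 → GridL2) : ℝ := 1 / 2 * ∑ i, ‖D i‖ ^ 2

/-- Right-sided monotonicity criterion on `[0, ∞)`. -/
theorem antitoneOn_Ici_of_hasDerivWithinAt {g g' : ℝ → ℝ} {a : ℝ}
    (hg : ∀ t, a ≤ t → HasDerivWithinAt g (g' t) (Ici a) t) (h : ∀ t, a ≤ t → g' t ≤ 0) :
    AntitoneOn g (Ici a) := by
  refine antitoneOn_of_hasDerivWithinAt_nonpos (f' := g') (convex_Ici a)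
    (fun t ht => (hg t ht).continuousWithinAt) ?_ ?_
  · intro t ht
    rw [interior_Ici] at ht ⊢
    exact (hg t ht.le).mono Ioi_subset_Ici_self
  · intro t ht
    rw [interior_Ici] at ht
    exact h t ht.le

/-- The minimum of the right-hand side over `a` is `√(2 * X * T)`. In this form Cauchy–Schwarz for
the length of a curve can be obtained from comparison functions, without integrating speeds. -/
theorem sq_le_of_forall_le_add {q X T : ℝ} (hX : 0 ≤ X) (hT : 0 ≤ T)
    (h : ∀ a, 0 < a → q ≤ a * T / 2 + X / a) : q ^ 2 ≤ 2 * X * T ∨ q ≤ 0 := by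
  rcases le_or_gt q 0 with hq | hq
  · exact Or.inr hq
  left
  rcases hT.eq_or_lt with rfl | hT
  · exfalso
    have := h (2 * (X + 1) / q) (by positivity)
    have e : X / (2 * (X + 1) / q) = q * (X / (X + 1)) / 2 := by field_simp
    rw [e, mul_zero, zero_div, zero_add] at this
    have h2 : X / (X + 1) ≤ 1 := (div_le_one (by positivity)).2 (by linarith)
    nlinarith
  -- Instead of the minimizer, which degenerates for `X = 0`, the choice `a = q / T` is enough.
  · have := h (q / T) (by positivity)
    have e : q / T * T / 2 + X / (q / T) = q / 2 + X * T / q := by field_simp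
    rw [e] at this
    have h2 : q / 2 ≤ X * T / q := by linarith
    rw [le_div_iff₀ hq] at h2
    nlinarith

section
variable {N : Set Space} {ν : Space → Space} {f : Grid → Space} {A : Fin 2 → GridL2}
  {w v : ℝ → GridL2}

theorem IsUnitFlow.flowDiff_eq (hw : IsUnitFlow N ν f A w v) (t : ℝ) (i : Fin 2) (j : Grid) :
    flowDiff A w t i j = dif i (fun j => f j + w t j) j := by
  simp only [flowDiff, GridL2.add_apply, hw.dif_eq, diff_apply, dif]; abel

theorem IsUnitFlow.lapOf_eq (hw : IsUnitFlow N ν f A w v) (t : ℝ) :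
    lapOf (flowDiff A w t) = -∑ i, diffAdj i (A i) + lapL2 (w t) := GridL2.ext fun j => by
  rw [lapOf_apply (hw.flowDiff_eq t), lapL2_add_apply hw.dif_eq]

theorem IsUnitFlow.hasDeriv_flowDiff (hw : IsUnitFlow N ν f A w v) {t : ℝ} (ht : 0 ≤ t)
    (i : Fin 2) : HasDerivWithinAt (fun t => flowDiff A w t i) (diff i (v t)) (Ici 0) t :=
  ((diff i).hasFDerivAt.comp_hasDerivWithinAt t (hw.deriv t ht)).const_add (A i)

theorem IsUnitFlow.inner_lapOf_apply (hN : ∀ y ∈ N, ‖ν y‖ = 1) (hw : IsUnitFlow N ν f A w v)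
    {t : ℝ} (ht : 0 ≤ t) (j : Grid) : ⟪lapOf (flowDiff A w t) j, v t j⟫ = ‖v t j‖ ^ 2 := by
  rw [lapOf_apply (hw.flowDiff_eq t), hw.velocity t ht]
  exact (inner_tangentPart (hN _ (hw.mem_target t ht j))).1

theorem IsUnitFlow.inner_lapOf (hN : ∀ y ∈ N, ‖ν y‖ = 1) (hw : IsUnitFlow N ν f A w v)
    {t : ℝ} (ht : 0 ≤ t) : ⟪lapOf (flowDiff A w t), v t⟫ = ‖v t‖ ^ 2 := by
  refine (lp.hasSum_inner (𝕜 := ℝ) _ _).unique ?_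
  simpa only [hw.inner_lapOf_apply hN ht] using hasSum_norm_sq (v t)

theorem IsUnitFlow.norm_sq_lapOf (hN : ∀ y ∈ N, ‖ν y‖ = 1) (hw : IsUnitFlow N ν f A w v)
    {t : ℝ} (ht : 0 ≤ t) : ‖lapOf (flowDiff A w t)‖ ^ 2 =
      ‖v t‖ ^ 2 + ‖lapOf (flowDiff A w t) - v t‖ ^ 2 := by
  rw [norm_sub_sq_real, hw.inner_lapOf hN ht]; ring

theorem hasDerivWithinAt_half_norm_sq {x : ℝ → GridL2} {x' : GridL2} {s : Set ℝ} {t : ℝ}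
    (h : HasDerivWithinAt x x' s t) :
    HasDerivWithinAt (fun t => 1 / 2 * ‖x t‖ ^ 2) ⟪x t, x'⟫ s t := by
  refine (h.norm_sq.const_mul (1 / 2)).congr_deriv ?_
  ring

/-- The energy identity. -/
theorem IsUnitFlow.hasDeriv_energy (hN : ∀ y ∈ N, ‖ν y‖ = 1) (hw : IsUnitFlow N ν f A w v)
    {t : ℝ} (ht : 0 ≤ t) :
    HasDerivWithinAt (fun t => energyL2 (flowDiff A w t)) (-‖v t‖ ^ 2) (Ici 0) t := by
  have h1 : HasDerivWithinAt (fun t => ∑ i, 1 / 2 * ‖flowDiff A w t i‖ ^ 2)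
      (∑ i, ⟪flowDiff A w t i, diff i (v t)⟫) (Ici 0) t :=
    HasDerivWithinAt.fun_sum fun i _ => hasDerivWithinAt_half_norm_sq (hw.hasDeriv_flowDiff ht i)
  simp only [← Finset.mul_sum] at h1
  refine h1.congr_deriv ?_
  rw [← hw.inner_lapOf hN ht, lapOf, inner_neg_left, neg_neg, sum_inner]
  refine Finset.sum_congr rfl fun i _ => ?_
  rw [real_inner_comm, inner_diff, real_inner_comm]

theorem IsUnitFlow.energy_antitone (hN : ∀ y ∈ N, ‖ν y‖ = 1) (hw : IsUnitFlow N ν f A w v) :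
    AntitoneOn (fun t => energyL2 (flowDiff A w t)) (Ici 0) :=
  antitoneOn_Ici_of_hasDerivWithinAt (fun _ ht => hw.hasDeriv_energy hN ht)
    fun _ _ => neg_nonpos.2 (sq_nonneg _)

theorem IsUnitFlow.flowDiff_zero (hw : IsUnitFlow N ν f A w v) : flowDiff A w 0 = A := by
  funext i; simp [flowDiff, hw.initial]

theorem IsUnitFlow.energy_le (hN : ∀ y ∈ N, ‖ν y‖ = 1) (hw : IsUnitFlow N ν f A w v) {t : ℝ}
    (ht : 0 ≤ t) : energyL2 (flowDiff A w t) ≤ energyL2 A := by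
  have := hw.energy_antitone hN (mem_Ici.2 le_rfl) (mem_Ici.2 ht) ht
  simpa only [hw.flowDiff_zero] using this

theorem IsUnitFlow.sum_norm_flowDiff_le (hN : ∀ y ∈ N, ‖ν y‖ = 1) (hw : IsUnitFlow N ν f A w v)
    {t : ℝ} (ht : 0 ≤ t) : ∑ i, ‖flowDiff A w t i‖ ^ 2 ≤ 2 * energyL2 A := by
  have := hw.energy_le hN ht
  rw [energyL2] at this
  linarith

/-- The smallness condition makes the coefficient of the squared Laplacian at most `1 / 2`. By
Pythagoras the squared Laplacian is the sum of the squares of velocity and normal part, and the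
latter is absorbed. -/
theorem IsUnitFlow.norm_sub_tangent_le {C : ℝ} (hN : ∀ y ∈ N, ‖ν y‖ = 1)
    (hC : ∀ y ∈ N, ∀ z ∈ N, |⟪ν y, z - y⟫| ≤ C * ‖z - y‖ ^ 2) (hw : IsUnitFlow N ν f A w v)
    (hE : 64 * C ^ 2 * energyL2 A ≤ 1) {t : ℝ} (ht : 0 ≤ t) :
    ‖lapOf (flowDiff A w t) - v t‖ ^ 2 ≤ ‖v t‖ ^ 2 := by
  have h1 := norm_sq_sub_tangent_le hN hC (hw.mem_target t ht) (hw.flowDiff_eq t)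
    (hw.velocity t ht)
  have h2 := hw.norm_sq_lapOf hN ht
  have h3 := hw.sum_norm_flowDiff_le hN ht
  have h4 : 16 * C ^ 2 * (∑ i, ‖flowDiff A w t i‖ ^ 2) ≤ 1 / 2 := by
    have : 16 * C ^ 2 * (∑ i, ‖flowDiff A w t i‖ ^ 2) ≤ 16 * C ^ 2 * (2 * energyL2 A) := by gcongr
    linarith
  have h5 := mul_le_mul_of_nonneg_right h4 (sq_nonneg ‖lapOf (flowDiff A w t)‖)
  linarith

/-- Comparison of two times of a solution. -/
theorem IsUnitFlow.increment_inner_le {C : ℝ} (hN : ∀ y ∈ N, ‖ν y‖ = 1)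
    (hC : ∀ y ∈ N, ∀ z ∈ N, |⟪ν y, z - y⟫| ≤ C * ‖z - y‖ ^ 2) (hw : IsUnitFlow N ν f A w v)
    (hE : 64 * C ^ 2 * energyL2 A ≤ 1) {s t : ℝ} (hs : 0 ≤ s) (ht : 0 ≤ t) :
    ⟪w s - w t, v s - v t⟫ ≤ 2 * C ^ 2 * (‖v t‖ ^ 2 + ‖v s‖ ^ 2) * ‖w s - w t‖ ^ 2 := by
  set L := fun t => lapOf (flowDiff A w t) with hL
  -- At each grid point the displacement between the two times is a chord of `N`. Its component
  -- along the normal at either end is quadratic, so pairing it with the normal part of the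
  -- Laplacian costs only `‖z j‖ ^ 2`.
  have hone : ∀ t, 0 ≤ t → ∀ z : GridL2, (∀ j, ∃ y ∈ N, z j = y - (f j + w t j) ∨
      z j = -(y - (f j + w t j))) →
      |⟪z, L t - v t⟫| ≤ 1 / 4 * ∑ k, ‖diff k z‖ ^ 2 + 2 * C ^ 2 * ‖v t‖ ^ 2 * ‖z‖ ^ 2 := by
    intro t ht z hz
    refine (abs_inner_le_of_pointwise (C := C) fun j => ?_).trans ?_
    · set n := ν (f j + w t j)
      have hn : ‖n‖ = 1 := hN _ (hw.mem_target t ht j)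
      have e : (L t - v t) j = ⟪lap (fun j => f j + w t j) j, n⟫ • n := by
        rw [GridL2.sub_apply, lapOf_apply (hw.flowDiff_eq t), hw.velocity t ht, tangentPart,
          sub_sub_cancel]
      obtain ⟨y, hy, hzy⟩ := hz j
      have h1 : |⟪z j, n⟫| ≤ C * ‖z j‖ ^ 2 := by
        rcases hzy with h | h <;> rw [h]
        · rw [real_inner_comm]; exact hC _ (hw.mem_target t ht j) y hy
        · rw [inner_neg_left, abs_neg, norm_neg, real_inner_comm]
          exact hC _ (hw.mem_target t ht j) y hy
      rw [e, inner_smul_right, norm_smul, hn, mul_one, abs_mul, Real.norm_eq_abs]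
      calc _ ≤ |⟪lap (fun j => f j + w t j) j, n⟫| * (C * ‖z j‖ ^ 2) := by gcongr
        _ = _ := by ring
    · gcongr
      exact (sq_le_sq₀ (norm_nonneg _) (norm_nonneg _)).1 (hw.norm_sub_tangent_le hN hC hE ht)
  have h1 := hone t ht (w s - w t) fun j => ⟨f j + w s j, hw.mem_target s hs j, Or.inl (by
    rw [GridL2.sub_apply]; abel)⟩
  have h2 := hone s hs (w s - w t) fun j => ⟨f j + w t j, hw.mem_target t ht j, Or.inr (by
    rw [GridL2.sub_apply]; abel)⟩
  -- The velocity is the Laplacian without its normal part. The linear term yields minus the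
  -- Dirichlet sum of the increment, of which the two normal parts consume a quarter each.
  have e1 : v s - v t = lapL2 (w s - w t) - (L s - v s) + (L t - v t) := by
    simp only [hL, hw.lapOf_eq, map_sub]; abel
  rw [e1, inner_add_right, inner_sub_right, inner_lapL2_self]
  have h3 := (abs_le.1 h1).2
  have h4 := (abs_le.1 h2).1
  have h5 : 0 ≤ ∑ k, ‖diff k (w s - w t)‖ ^ 2 := by positivity
  linarith

/-- Grönwall's inequality with an explicit integrating factor: by the energy identity the
coefficients `‖v t‖ ^ 2` are derivatives of `-E`, so the factor is the exponential of a small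
multiple of the energies at the two times. It lies between one and two. -/
theorem IsUnitFlow.increment_le {C : ℝ} (hC0 : 0 ≤ C) (hN : ∀ y ∈ N, ‖ν y‖ = 1)
    (hC : ∀ y ∈ N, ∀ z ∈ N, |⟪ν y, z - y⟫| ≤ C * ‖z - y‖ ^ 2) (hw : IsUnitFlow N ν f A w v)
    (hE : 64 * C ^ 2 * energyL2 A ≤ 1) {a s t : ℝ} (ha : 0 ≤ a) (hs : 0 ≤ s) (hst : s ≤ t) :
    ‖w (t + a) - w t‖ ^ 2 ≤ 2 * ‖w (s + a) - w s‖ ^ 2 := by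
  set E := fun t => energyL2 (flowDiff A w t) with hEdef
  have hE0 : 0 ≤ energyL2 A := by rw [energyL2]; positivity
  have hEnn : ∀ t, 0 ≤ E t := fun t => by simp only [hEdef, energyL2]; positivity
  have hsh : ∀ {F : Type} [NormedAddCommGroup F] [NormedSpace ℝ F] {g : ℝ → F} {g' : F} {t : ℝ},
      0 ≤ t → HasDerivWithinAt g g' (Ici 0) (t + a) →
      HasDerivWithinAt (fun t => g (t + a)) g' (Ici 0) t := by
    intro F _ _ g g' t ht h
    have h1 : HasDerivWithinAt (fun t : ℝ => t + a) 1 (Ici 0) t :=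
      (hasDerivWithinAt_id t _).add_const a
    have := h.scomp t h1 (fun s hs => by
      have : (0 : ℝ) ≤ s := hs
      exact mem_Ici.2 (by linarith))
    simpa [Function.comp_def] using this
  have hanti := antitoneOn_Ici_of_hasDerivWithinAt (a := 0)
    (g := fun t => (1 / 2 * ‖w (t + a) - w t‖ ^ 2) * Real.exp (4 * C ^ 2 * (E (t + a) + E t)))
    (fun t ht => by
      have h1 := hasDerivWithinAt_half_norm_sq
        ((hsh ht (hw.deriv (t + a) (by linarith))).sub (hw.deriv t ht))
      have h2 := (((hsh ht (hw.hasDeriv_energy hN (t := t + a) (by linarith))).add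
        (hw.hasDeriv_energy hN ht)).const_mul (4 * C ^ 2)).exp
      exact h1.mul h2) (fun t ht => by
      have h3 := hw.increment_inner_le hN hC hE (s := t + a) (by linarith) ht
      simp only [Pi.add_apply, Pi.sub_apply]
      have e : ∀ p q x y : ℝ, p * x + q * (x * y) = (p + q * y) * x := fun p q x y => by ring
      rw [e]
      refine mul_nonpos_of_nonpos_of_nonneg ?_ (Real.exp_pos _).le
      linarith)
  have h1 := hanti (mem_Ici.2 hs) (mem_Ici.2 (hs.trans hst)) hst
  simp only at h1
  have h2 : 1 ≤ Real.exp (4 * C ^ 2 * (E (t + a) + E t)) :=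
    Real.one_le_exp (mul_nonneg (by positivity) (add_nonneg (hEnn _) (hEnn _)))
  have h3 : Real.exp (4 * C ^ 2 * (E (s + a) + E s)) ≤ 2 := by
    have h4 := hw.energy_le hN (t := s + a) (by linarith)
    have h5 := hw.energy_le hN hs
    have h6 : 4 * C ^ 2 * (E (s + a) + E s) ≤ 1 / 2 := by
      have : 4 * C ^ 2 * (E (s + a) + E s) ≤ 4 * C ^ 2 * (energyL2 A + energyL2 A) := by gcongr
      nlinarith [mul_nonneg (sq_nonneg C) hE0]
    have h7 : Real.exp (1 / 2) ≤ 2 := by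
      have h8 : Real.exp (1 / 2) ^ 2 ≤ 2 ^ 2 := by
        rw [← Real.exp_nat_mul]
        have := Real.exp_one_lt_d9
        norm_num at this ⊢
        linarith
      exact (sq_le_sq₀ (Real.exp_pos _).le (by norm_num)).1 h8
    exact (Real.exp_le_exp.2 h6).trans h7
  have h4 : 1 / 2 * ‖w (t + a) - w t‖ ^ 2 ≤
      1 / 2 * ‖w (t + a) - w t‖ ^ 2 * Real.exp (4 * C ^ 2 * (E (t + a) + E t)) :=
    le_mul_of_one_le_right (by positivity) h2
  have h5 : 1 / 2 * ‖w (s + a) - w s‖ ^ 2 * Real.exp (4 * C ^ 2 * (E (s + a) + E s)) ≤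
      1 / 2 * ‖w (s + a) - w s‖ ^ 2 * 2 := by gcongr
  linarith

/-- Increments over a time step `a`, divided by `a`, tend to the velocity. Working with increments
makes it unnecessary to differentiate the equation in time. -/
theorem IsUnitFlow.norm_velocity_sq_le {C : ℝ} (hC0 : 0 ≤ C) (hN : ∀ y ∈ N, ‖ν y‖ = 1)
    (hC : ∀ y ∈ N, ∀ z ∈ N, |⟪ν y, z - y⟫| ≤ C * ‖z - y‖ ^ 2) (hw : IsUnitFlow N ν f A w v)
    (hE : 64 * C ^ 2 * energyL2 A ≤ 1) {s t : ℝ} (hs : 0 ≤ s) (hst : s ≤ t) :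
    ‖v t‖ ^ 2 ≤ 2 * ‖v s‖ ^ 2 := by
  have hlim : ∀ t, 0 ≤ t → Tendsto (fun a : ℝ => ‖a⁻¹ • (w (t + a) - w t)‖ ^ 2) (𝓝[>] 0)
      (𝓝 (‖v t‖ ^ 2)) := fun t ht => by
    have h1 : HasDerivWithinAt w (v t) (Ioi t) t :=
      (hw.deriv t ht).mono fun s hs => mem_Ici.2 (ht.trans (mem_Ioi.1 hs).le)
    have h2 := (hasDerivWithinAt_iff_tendsto_slope' self_notMem_Ioi).1 h1
    have hsh : Tendsto (fun a : ℝ => t + a) (𝓝[>] 0) (𝓝[>] t) := by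
      refine tendsto_nhdsWithin_iff.2 ⟨?_, ?_⟩
      · have : ContinuousAt (fun a : ℝ => t + a) 0 := by fun_prop
        simpa using this.tendsto.mono_left nhdsWithin_le_nhds
      · filter_upwards [self_mem_nhdsWithin] with a ha
        have ha : 0 < a := ha
        exact mem_Ioi.2 (by linarith)
    have h3 : Tendsto (fun a : ℝ => a⁻¹ • (w (t + a) - w t)) (𝓝[>] 0) (𝓝 (v t)) := by
      simpa [Function.comp_def, slope_def_module] using h2.comp hsh
    exact (h3.norm.pow 2)
  refine le_of_tendsto_of_tendsto (hlim t (hs.trans hst)) ((hlim s hs).const_mul 2) ?_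
  filter_upwards [self_mem_nhdsWithin] with a ha
  have ha : 0 < a := ha
  have := hw.increment_le hC0 hN hC hE ha.le hs hst
  rw [norm_smul, norm_smul, mul_pow, mul_pow]
  nlinarith [mul_le_mul_of_nonneg_left this (sq_nonneg ‖a⁻¹‖)]

/-- Smoothing: decay of the velocity. -/
theorem IsUnitFlow.velocity_decay {C : ℝ} (hC0 : 0 ≤ C) (hN : ∀ y ∈ N, ‖ν y‖ = 1)
    (hC : ∀ y ∈ N, ∀ z ∈ N, |⟪ν y, z - y⟫| ≤ C * ‖z - y‖ ^ 2) (hw : IsUnitFlow N ν f A w v)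
    (hE : 64 * C ^ 2 * energyL2 A ≤ 1) {t : ℝ} (ht : 0 ≤ t) :
    t * ‖v t‖ ^ 2 ≤ 2 * energyL2 A := by
  -- Before time `t` the squared velocity is at least half its value at `t`, so the energy has been
  -- dissipated at least at this constant rate.
  have hanti : AntitoneOn (fun s => energyL2 (flowDiff A w s) + s * (1 / 2 * ‖v t‖ ^ 2))
      (Icc 0 t) := by
    have hd : ∀ s, 0 ≤ s → HasDerivWithinAt
        (fun s => energyL2 (flowDiff A w s) + s * (1 / 2 * ‖v t‖ ^ 2))
        (-‖v s‖ ^ 2 + 1 * (1 / 2 * ‖v t‖ ^ 2)) (Ici 0) s := fun s hs =>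
      (hw.hasDeriv_energy hN hs).add ((hasDerivWithinAt_id s _).mul_const _)
    refine antitoneOn_of_hasDerivWithinAt_nonpos (f' := fun s => -‖v s‖ ^ 2 + 1 * (1 / 2 * ‖v t‖ ^ 2))
      (convex_Icc 0 t) (fun s hs => (hd s hs.1).continuousWithinAt.mono Icc_subset_Ici_self)
      (fun s hs => ?_) (fun s hs => ?_)
    · rw [interior_Icc] at hs ⊢
      exact (hd s hs.1.le).mono fun r hr => mem_Ici.2 hr.1.le
    · rw [interior_Icc] at hs
      have := hw.norm_velocity_sq_le hC0 hN hC hE hs.1.le hs.2.le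
      linarith
  have h1 := hanti (left_mem_Icc.2 ht) (right_mem_Icc.2 ht) ht
  simp only [hw.flowDiff_zero, zero_mul, add_zero] at h1
  have h2 : 0 ≤ energyL2 (flowDiff A w t) := by rw [energyL2]; positivity
  linarith

/-- The squared Laplacian is at most twice the squared velocity, which decays. This second order
bound gives compactness of the difference quotients at positive times. -/
theorem IsUnitFlow.lapOf_decay {C : ℝ} (hC0 : 0 ≤ C) (hN : ∀ y ∈ N, ‖ν y‖ = 1)
    (hC : ∀ y ∈ N, ∀ z ∈ N, |⟪ν y, z - y⟫| ≤ C * ‖z - y‖ ^ 2) (hw : IsUnitFlow N ν f A w v)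
    (hE : 64 * C ^ 2 * energyL2 A ≤ 1) {t : ℝ} (ht : 0 ≤ t) :
    t * ‖lapOf (flowDiff A w t)‖ ^ 2 ≤ 4 * energyL2 A := by
  have h1 := hw.velocity_decay hC0 hN hC hE ht
  have h2 := hw.norm_sub_tangent_le hN hC hE ht
  rw [hw.norm_sq_lapOf hN ht]
  nlinarith [mul_le_mul_of_nonneg_left h2 ht]

/-- The local energy inequality. -/
theorem IsUnitFlow.local_energy (hN : ∀ y ∈ N, ‖ν y‖ = 1) (hw : IsUnitFlow N ν f A w v)
    {η : Grid → ℝ} (hη0 : ∀ j, 0 ≤ η j) (hη1 : ∀ j, |η j| ≤ 1) {κ : ℝ}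
    (hκ : ∀ i j, |η (j + unitIndex i) - η j| ≤ κ) {t : ℝ} (ht : 0 ≤ t) :
    ∃ e', HasDerivWithinAt
        (fun t => energyL2 (fun i => weight η hη1 (flowDiff A w t i))) e' (Ici 0) t ∧
      e' ≤ -(1 / 2) * ‖weight η hη1 (v t)‖ ^ 2 + 26 * κ ^ 2 * energyL2 A := by
  have hκ0 : 0 ≤ κ := (abs_nonneg _).trans (hκ 0 0)
  set W := weight η hη1
  set d := flowDiff A w t with hd
  have h1 : HasDerivWithinAt (fun t => ∑ i, 1 / 2 * ‖W (flowDiff A w t i)‖ ^ 2)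
      (∑ i, ⟪W (d i), W (diff i (v t))⟫) (Ici 0) t :=
    HasDerivWithinAt.fun_sum fun i _ => hasDerivWithinAt_half_norm_sq
      (W.hasFDerivAt.comp_hasDerivWithinAt t (hw.hasDeriv_flowDiff ht i))
  simp only [← Finset.mul_sum] at h1
  refine ⟨_, h1, ?_⟩
  have hWadj : ∀ x y, ⟪W x, W y⟫ = ⟪W (W x), y⟫ := fun x y => by
    refine (lp.hasSum_inner (𝕜 := ℝ) _ _).unique ?_
    convert lp.hasSum_inner (𝕜 := ℝ) (W (W x)) y using 2 with j
    simp only [W, weight_apply, inner_smul_left, inner_smul_right, conj_trivial]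
  have h2 : ∑ i, ⟪W (d i), W (diff i (v t))⟫ = ∑ i, ⟪diffAdj i (W (W (d i))), v t⟫ := by
    refine Finset.sum_congr rfl fun i _ => ?_
    rw [hWadj, real_inner_comm, inner_diff, real_inner_comm]
  rw [h2]
  have hs1 : HasSum (fun j => ∑ i, ⟪diffAdj i (W (W (d i))) j, v t j⟫)
      (∑ i, ⟪diffAdj i (W (W (d i))), v t⟫) :=
    hasSum_sum fun i _ => lp.hasSum_inner (𝕜 := ℝ) _ _
  have hs2 : HasSum (fun j => -(1 / 2) * ‖W (v t) j‖ ^ 2 + (∑ i, 9 / 2 * κ ^ 2 * ‖d i (j + -unitIndex i)‖ ^ 2)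
        + κ ^ 2 * ‖v t j‖ ^ 2)
      (-(1 / 2) * ‖W (v t)‖ ^ 2 + (∑ i, 9 / 2 * κ ^ 2 * ‖d i‖ ^ 2) + κ ^ 2 * ‖v t‖ ^ 2) :=
    (((hasSum_norm_sq _).mul_left _).add (hasSum_sum fun i _ =>
      (hasSum_norm_sq_shift (d i) (-unitIndex i)).mul_left _)).add ((hasSum_norm_sq _).mul_left _)
  have hpt : ∀ j, ∑ i, ⟪diffAdj i (W (W (d i))) j, v t j⟫ ≤
      -(1 / 2) * ‖W (v t) j‖ ^ 2 + (∑ i, 9 / 2 * κ ^ 2 * ‖d i (j + -unitIndex i)‖ ^ 2)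
        + κ ^ 2 * ‖v t j‖ ^ 2 := by
    intro j
    have hi := hw.inner_lapOf_apply hN ht j
    simp only [lapOf, Fin.sum_univ_two, GridL2.neg_apply, GridL2.add_apply, inner_neg_left,
      inner_add_left] at hi
    -- Discrete product rule: the error carries the difference of `η ^ 2` at two neighbours, which
    -- is at most `κ * (2 * η j + κ)`. Young's inequality gives a quarter of the weighted
    -- dissipation to each of the two directions, so half of the dissipation is left. The summand
    -- `κ` forces the unweighted velocity to appear.
    have hterm : ∀ i, ⟪diffAdj i (W (W (d i))) j, v t j⟫ ≤ η j ^ 2 * ⟪diffAdj i (d i) j, v t j⟫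
        + (1 / 4 * (η j * ‖v t j‖) ^ 2 + 9 / 2 * κ ^ 2 * ‖d i (j + -unitIndex i)‖ ^ 2
          + 1 / 2 * κ ^ 2 * ‖v t j‖ ^ 2) := by
      intro i
      set y := d i (j - unitIndex i) with hy
      set ξ := η (j - unitIndex i) with hξ
      have e : diffAdj i (W (W (d i))) j = η j ^ 2 • diffAdj i (d i) j + (ξ ^ 2 - η j ^ 2) • y := by
        simp only [W, diffAdj_apply, weight_apply, smul_smul, ← hy, ← hξ]
        simp only [smul_sub, sub_smul, sq]; abel
      have hξη : |ξ - η j| ≤ κ := by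
        have := hκ i (j - unitIndex i)
        rwa [sub_add_cancel, abs_sub_comm] at this
      have hsq : |ξ ^ 2 - η j ^ 2| ≤ κ * (2 * η j + κ) := by
        rw [sq_sub_sq, abs_mul, mul_comm]
        have h4 : |ξ + η j| ≤ 2 * η j + κ := by
          rw [abs_of_nonneg (add_nonneg (hη0 _) (hη0 _))]
          linarith [(abs_le.1 hξη).2]
        gcongr
      have h5 : ⟪(ξ ^ 2 - η j ^ 2) • y, v t j⟫ ≤ κ * (2 * η j + κ) * (‖y‖ * ‖v t j‖) := by
        refine (le_abs_self _).trans ?_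
        rw [inner_smul_left, abs_mul]
        gcongr
        · exact mul_nonneg hκ0 (by linarith [hη0 j])
        · simpa using hsq
        · exact abs_real_inner_le_norm _ _
      rw [e, inner_add_left, inner_smul_left, ← sub_eq_add_neg, ← hy]
      simp only [conj_trivial]
      have h6 : κ * (2 * η j + κ) * (‖y‖ * ‖v t j‖) ≤ 1 / 4 * (η j * ‖v t j‖) ^ 2 +
          9 / 2 * κ ^ 2 * ‖y‖ ^ 2 + 1 / 2 * κ ^ 2 * ‖v t j‖ ^ 2 := by
        nlinarith [sq_nonneg (1 / 2 * (η j * ‖v t j‖) - 2 * (κ * ‖y‖)),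
          sq_nonneg (κ * ‖y‖ - κ * ‖v t j‖)]
      linarith
    have hWv : ‖W (v t) j‖ ^ 2 = (η j * ‖v t j‖) ^ 2 := by
      simp only [W, weight_apply, norm_smul, mul_pow, Real.norm_eq_abs, sq_abs]
    rw [hWv]
    simp only [Fin.sum_univ_two]
    have h7 := hterm 0
    have h8 := hterm 1
    have h9 : η j ^ 2 * ⟪diffAdj 0 (d 0) j, v t j⟫ + η j ^ 2 * ⟪diffAdj 1 (d 1) j, v t j⟫
        = -(η j * ‖v t j‖) ^ 2 := by
      rw [mul_pow, ← hi]; ring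
    linarith
  refine (hasSum_le hpt hs1 hs2).trans ?_
  -- In units of `κ ^ 2` times the energy, the differences contribute 9 and the velocity, bounded by
  -- the differences, contributes 16.
  have h3 := hw.sum_norm_flowDiff_le hN ht
  have h4 : ‖v t‖ ^ 2 ≤ 8 * ∑ i, ‖d i‖ ^ 2 := by
    have := hw.norm_sq_lapOf hN ht
    have := norm_sq_lapOf_le d
    nlinarith [sq_nonneg ‖lapOf (flowDiff A w t) - v t‖]
  have h5 : κ ^ 2 * ‖v t‖ ^ 2 ≤ κ ^ 2 * (8 * ∑ i, ‖d i‖ ^ 2) := by gcongr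
  rw [← Finset.mul_sum]
  have h6 : κ ^ 2 * ∑ i, ‖d i‖ ^ 2 ≤ κ ^ 2 * (2 * energyL2 A) := by gcongr
  have h7 : 0 ≤ κ ^ 2 * energyL2 A := by
    have : 0 ≤ energyL2 A := by rw [energyL2]; positivity
    positivity
  nlinarith

/-- The first bound is the integrated local energy inequality. For the second, the weighted
displacement is at most the time integral of the weighted speed, whose square is controlled by the
dissipated local energy. -/
theorem IsUnitFlow.local_energy_le (hN : ∀ y ∈ N, ‖ν y‖ = 1) (hw : IsUnitFlow N ν f A w v)
    {η : Grid → ℝ} (hη0 : ∀ j, 0 ≤ η j) (hη1 : ∀ j, |η j| ≤ 1) {κ : ℝ}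
    (hκ : ∀ i j, |η (j + unitIndex i) - η j| ≤ κ) {s t : ℝ} (hs : 0 ≤ s) (hst : s ≤ t) :
    energyL2 (fun i => weight η hη1 (flowDiff A w t i)) ≤
      energyL2 (fun i => weight η hη1 (flowDiff A w s i)) + 26 * κ ^ 2 * energyL2 A * (t - s) ∧
    ‖weight η hη1 (w t - w s)‖ ^ 2 ≤
      2 * (energyL2 (fun i => weight η hη1 (flowDiff A w s i))
        + 26 * κ ^ 2 * energyL2 A * (t - s)) * (t - s) := by
  have hle := fun (t : ℝ) (ht : 0 ≤ t) => hw.local_energy hN hη0 hη1 hκ ht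
  choose! e' he' hle using hle
  set W := weight η hη1
  set E := fun t => energyL2 (fun i => W (flowDiff A w t i)) with hE
  set c := 26 * κ ^ 2 * energyL2 A with hc
  have hc0 : 0 ≤ c := by
    have : 0 ≤ energyL2 A := by rw [energyL2]; positivity
    positivity
  have hEnn : ∀ t, 0 ≤ E t := fun t => by simp only [hE, energyL2]; positivity
  have hanti := antitoneOn_Ici_of_hasDerivWithinAt (g := fun t => E t - t * c)
    (fun t ht => (he' t ht).sub ((hasDerivWithinAt_id t _).mul_const c)) (fun t ht => by
      have := hle t ht
      have h0 : 0 ≤ ‖W (v t)‖ ^ 2 := by positivity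
      linarith)
  have h1 := hanti (mem_Ici.2 hs) (mem_Ici.2 (hs.trans hst)) hst
  simp only at h1
  refine ⟨by linarith, ?_⟩
  -- The comparison function `B` encodes that the weighted speed is at most `a / 2` plus its square
  -- over `2 * a`, the square being paid for by the local energy.
  have h2 : ∀ a, 0 < a → ‖W (w t - w s)‖ ≤ a * (t - s) / 2 + (E s + c * (t - s)) / a := by
    intro a ha
    have := image_norm_le_of_norm_deriv_right_le_deriv_boundary' (a := s) (b := t)
      (f := fun r => W (w r - w s)) (f' := fun r => W (v r))
      (B := fun r => a / 2 * (r - s) + a⁻¹ * (c * (r - s) - E r + E s))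
      (B' := fun r => a / 2 * 1 + a⁻¹ * (c * 1 - e' r))
      (fun r hr => (W.continuous.continuousAt.comp_continuousWithinAt
        (((hw.deriv r (hs.trans hr.1)).continuousWithinAt.mono
          (Icc_subset_Ici_self.trans (Ici_subset_Ici.2 hs))).sub continuousWithinAt_const)))
      (fun r hr => W.hasFDerivAt.comp_hasDerivWithinAt r
        (((hw.deriv r (hs.trans hr.1)).mono (Ici_subset_Ici.2 (hs.trans hr.1))).sub_const (w s)))
      (by simp)
      (fun r hr => by
        have h3 := ((he' r (hs.trans hr.1)).continuousWithinAt.mono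
          (Icc_subset_Ici_self.trans (Ici_subset_Ici.2 hs)) : ContinuousWithinAt E (Icc s t) r)
        fun_prop)
      (fun r hr => by
        have h3 := (he' r (hs.trans hr.1)).mono (Ici_subset_Ici.2 (hs.trans hr.1))
        have h4 : HasDerivWithinAt (fun r => r - s) 1 (Ici r) r :=
          (hasDerivWithinAt_id r _).sub_const s
        exact (h4.const_mul (a / 2)).add
          ((((h4.const_mul c).sub h3).add_const (E s)).const_mul a⁻¹))
      (fun r hr => by
        have h5 := hle r (hs.trans hr.1)
        have h6 : ‖W (v r)‖ ≤ a / 2 + a⁻¹ * (1 / 2 * ‖W (v r)‖ ^ 2) := by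
          have e : a / 2 + a⁻¹ * (1 / 2 * ‖W (v r)‖ ^ 2) - ‖W (v r)‖
              = a⁻¹ * (1 / 2 * (‖W (v r)‖ - a) ^ 2) := by field_simp; ring
          have : 0 ≤ a⁻¹ * (1 / 2 * (‖W (v r)‖ - a) ^ 2) := by positivity
          linarith
        have h7 : a⁻¹ * (1 / 2 * ‖W (v r)‖ ^ 2) ≤ a⁻¹ * (c * 1 - e' r) := by
          gcongr; linarith
        linarith) (right_mem_Icc.2 hst)
    refine this.trans ?_
    have h8 : a⁻¹ * (c * (t - s) - E t + E s) ≤ a⁻¹ * (E s + c * (t - s)) := by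
      refine mul_le_mul_of_nonneg_left ?_ (inv_pos.2 ha).le; linarith [hEnn t]
    rw [div_eq_inv_mul (E s + c * (t - s))]
    linarith
  have hX : 0 ≤ E s + c * (t - s) := add_nonneg (hEnn s) (mul_nonneg hc0 (by linarith))
  rcases sq_le_of_forall_le_add hX (by linarith) h2 with h3 | h3
  · exact h3
  · have h4 : ‖W (w t - w s)‖ = 0 := le_antisymm h3 (norm_nonneg _)
    rw [h4]
    have : 0 ≤ t - s := by linarith
    have := mul_nonneg (mul_nonneg zero_le_two hX) this
    simpa using this

/-- The constant weight one has slope `κ = 0`, so no flux term appears and Hölder continuity in time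
with exponent one half remains. -/
theorem IsUnitFlow.norm_sub_sq_le (hN : ∀ y ∈ N, ‖ν y‖ = 1) (hw : IsUnitFlow N ν f A w v)
    {s t : ℝ} (hs : 0 ≤ s) (ht : 0 ≤ t) :
    ‖w t - w s‖ ^ 2 ≤ 2 * energyL2 A * |t - s| := by
  have hone : ∀ s t, 0 ≤ s → s ≤ t → ‖w t - w s‖ ^ 2 ≤ 2 * energyL2 A * (t - s) := by
    intro s t hs hst
    have h1 := (hw.local_energy_le hN (η := 1) (by simp) (by simp) (κ := 0) (by simp) hs hst).2
    have hW : ∀ x, weight 1 (by simp) x = x := fun x => GridL2.ext fun j => by simp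
    simp only [hW] at h1
    refine h1.trans ?_
    have h2 := hw.energy_le hN hs
    have h3 : 0 ≤ t - s := by linarith
    simp only [ne_eq, OfNat.ofNat_ne_zero, not_false_eq_true, zero_pow, mul_zero, zero_mul,
      add_zero]
    gcongr
  rcases le_total s t with h | h
  · rw [abs_of_nonneg (by linarith)]; exact hone s t hs h
  · rw [abs_sub_comm, abs_of_nonneg (by linarith), norm_sub_rev]; exact hone t s ht h

/-- Interpolation: summation by parts writes the Dirichlet sum of the increment as its inner product
with its Laplacian. Continuity in time together with the second order bound thus gives continuity of
the differences. -/
theorem IsUnitFlow.sum_norm_diff_sub_le (hw : IsUnitFlow N ν f A w v) (s t : ℝ) :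
    ∑ i, ‖diff i (w t - w s)‖ ^ 2 ≤
      ‖w t - w s‖ * (‖lapOf (flowDiff A w t)‖ + ‖lapOf (flowDiff A w s)‖) := by
  have h1 := inner_lapL2_self (w t - w s)
  have h2 : lapL2 (w t - w s) = lapOf (flowDiff A w t) - lapOf (flowDiff A w s) := by
    rw [hw.lapOf_eq, hw.lapOf_eq, map_sub]; abel
  have h3 := abs_le.1 (abs_real_inner_le_norm (w t - w s) (lapL2 (w t - w s)))
  have h4 := norm_sub_le (lapOf (flowDiff A w t)) (lapOf (flowDiff A w s))
  rw [h1, h2] at h3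
  have h5 := mul_le_mul_of_nonneg_left h4 (norm_nonneg (w t - w s))
  linarith [h3.1]

end

/-! ### A priori estimates for the flow with step `h` -/

/-- The square of the `ℓ²` norm of a grid function, possibly infinite. -/
noncomputable def gsq (v : Grid → Space) : ℝ≥0∞ := ∑' j, ‖v j‖ₑ ^ 2

theorem enorm_sq_eq_ofReal {E : Type*} [SeminormedAddCommGroup E] (x : E) :
    ‖x‖ₑ ^ 2 = ENNReal.ofReal (‖x‖ ^ 2) := by
  rw [ENNReal.ofReal_pow (norm_nonneg _), ofReal_norm]

theorem gsq_coe (x : GridL2) : gsq x = ENNReal.ofReal (‖x‖ ^ 2) := by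
  rw [← (hasSum_norm_sq x).tsum_eq, ENNReal.ofReal_tsum_of_nonneg (fun _ => by positivity)
    (hasSum_norm_sq x).summable]
  exact tsum_congr fun j => enorm_sq_eq_ofReal _

theorem summable_of_gsq_ne_top {v : Grid → Space} (h : gsq v ≠ ⊤) :
    Summable fun j => ‖v j‖ ^ 2 := by
  refine (ENNReal.summable_toReal h).congr fun j => ?_
  simp

/-- The area `h ^ 2` of a cell cancels the factor `h⁻¹` squared of the quotients, which is the scale
invariance of the energy. Dropping the backward differences costs a factor two. -/
theorem sum_gsq_dif_le_discreteEnergy {h : ℝ} (hh : 0 < h) (u : Grid → Space) :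
    ∑ i, gsq (dif i u) ≤ 4 * discreteEnergy h u := by
  simp only [gsq]
  rw [← Summable.tsum_finsetSum fun i _ => ENNReal.summable, discreteEnergy, ← ENNReal.tsum_mul_left]
  refine ENNReal.tsum_le_tsum fun j => ?_
  simp only [enorm_sq_eq_ofReal]
  rw [← ENNReal.ofReal_sum_of_nonneg fun i _ => by positivity,
    show (4 : ℝ≥0∞) = ENNReal.ofReal 4 by simp, ← ENNReal.ofReal_mul (by norm_num)]
  refine ENNReal.ofReal_le_ofReal ?_
  have e : ∀ i, ‖forwardDiff h i u j‖ ^ 2 = (h ^ 2)⁻¹ * ‖dif i u j‖ ^ 2 := fun i => by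
    rw [forwardDiff, norm_smul, mul_pow, Real.norm_eq_abs, sq_abs, inv_pow, dif]
  have h1 : ∀ i, (h ^ 2)⁻¹ * ‖dif i u j‖ ^ 2 ≤
      2 * (1 / 2 * (‖forwardDiff h i u j‖ ^ 2 + ‖backwardDiff h i u j‖ ^ 2)) := fun i => by
    rw [← e]; nlinarith [sq_nonneg ‖backwardDiff h i u j‖]
  have h2 : (h ^ 2)⁻¹ * ∑ i, ‖dif i u j‖ ^ 2 ≤
      2 * ∑ i, 1 / 2 * (‖forwardDiff h i u j‖ ^ 2 + ‖backwardDiff h i u j‖ ^ 2) := by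
    rw [Finset.mul_sum, Finset.mul_sum]; exact Finset.sum_le_sum fun i _ => h1 i
  calc ∑ i, ‖dif i u j‖ ^ 2 = h ^ 2 * ((h ^ 2)⁻¹ * ∑ i, ‖dif i u j‖ ^ 2) := by field_simp
    _ ≤ h ^ 2 * (2 * ∑ i, 1 / 2 * (‖forwardDiff h i u j‖ ^ 2 + ‖backwardDiff h i u j‖ ^ 2)) := by
      gcongr
    _ = _ := by ring

section
variable {N : Set Space} {ν : Space → Space} {f : Grid → Space} {A : Fin 2 → GridL2}
  {w v : ℝ → GridL2}

/-- Parabolic scaling: the discrete Laplacian with step `h` is `h⁻¹ ^ 2` times the one with unit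
step, and the chain rule produces the same factor. -/
theorem IsUnitFlow.isSemidiscreteFlow (hw : IsUnitFlow N ν f A w v) {h : ℝ}
    (hh : 0 < h) : IsSemidiscreteFlow N ν h f (fun t j => f j + w (h⁻¹ ^ 2 * t) j) where
  initial j := by simp [hw.initial]
  mem_target t ht j := hw.mem_target _ (by positivity) j
  equation t ht j := by
    have hs : HasDerivWithinAt (fun t : ℝ => h⁻¹ ^ 2 * t) (h⁻¹ ^ 2 * 1) (Ici 0) t :=
      (hasDerivWithinAt_id t _).const_mul _
    have h1 := (hw.deriv (h⁻¹ ^ 2 * t) (by positivity)).scomp t hs (fun s hs =>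
      mem_Ici.2 (mul_nonneg (by positivity) (mem_Ici.1 hs)))
    have h2 := ((evalL2 j).hasFDerivAt.comp_hasDerivWithinAt t h1).const_add (f j)
    refine h2.congr_deriv ?_
    rw [semidiscreteFlow_velocity, map_smul, evalL2_apply, hw.velocity _ (by positivity), mul_one]

/-- By uniqueness every solution is the rescaled unit flow, so the `ℓ²` estimates hold for any
choice of solutions. -/
theorem eq_unitFlow (hN : IsCompact N) (hν : IsUnitNormalField N ν) (hf : ∀ j, f j ∈ N)
    (hw : IsUnitFlow N ν f A w v) {h : ℝ} (hh : 0 < h) {u : ℝ → Grid → Space}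
    (hu : IsSemidiscreteFlow N ν h f u) {t : ℝ} (ht : 0 ≤ t) (j : Grid) :
    u t j = f j + w (h⁻¹ ^ 2 * t) j :=
  semidiscreteFlow_unique hN hν hu (hw.isSemidiscreteFlow hh) ht j

end

/-- The a priori estimates for a solution of the flow with step `h` of small energy. -/
structure FlowBounds (h : ℝ) (u : ℝ → Grid → Space) : Prop where
  energy : ∀ t, 0 ≤ t → ∀ i, gsq (dif i (u t)) ≤ ENNReal.ofReal 4
  time : ∀ s t, 0 ≤ s → 0 ≤ t → ENNReal.ofReal (h ^ 2) * gsq (fun j => u t j - u s j) ≤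
    ENNReal.ofReal (4 * |t - s|)
  hessian : ∀ t, 0 < t → ∀ i k, gsq (dif k (dif i (u t))) ≤ ENNReal.ofReal (8 * h ^ 2 / t)
  four : ∀ t, 0 < t → ∀ i, ∑' j, ‖dif i (u t) j‖ₑ ^ 4 ≤ ENNReal.ofReal (64 * h ^ 2 / t)
  time_grad : ∀ s t, 0 < s → 0 < t → ∀ i, gsq (fun j => dif i (u t) j - dif i (u s) j) ≤
    ENNReal.ofReal (√(4 * |t - s|) * (√(8 / t) + √(8 / s)))
  tail : ∀ (η : Grid → ℝ) (κ : ℝ), (∀ j, 0 ≤ η j) → (∀ j, |η j| ≤ 1) →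
    (∀ i j, |η (j + unitIndex i) - η j| ≤ κ) → ∀ t, 0 ≤ t →
    (∀ i, gsq (fun j => η j • dif i (u t) j) ≤
      ∑ k, gsq (fun j => η j • dif k (u 0) j) + ENNReal.ofReal (104 * κ ^ 2 * t / h ^ 2)) ∧
    ENNReal.ofReal (h ^ 2) * gsq (fun j => η j • (u t j - u 0 j)) ≤ ENNReal.ofReal t *
      (∑ k, gsq (fun j => η j • dif k (u 0) j) + ENNReal.ofReal (104 * κ ^ 2 * t / h ^ 2))

/-- All bounds are the unit step estimates at time `h⁻¹ ^ 2 * t` with the energy replaced by its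
bound 2. For example the Laplacian decay gives `8 * h ^ 2 / t`, and the quartic bound is `2 * 4 * (8
* h ^ 2 / t)` by the Ladyzhenskaya inequality. -/
theorem IsUnitFlow.flowBounds {N : Set Space} {ν : Space → Space} {f : Grid → Space}
    {A : Fin 2 → GridL2} {w v : ℝ → GridL2} {C : ℝ} (hC0 : 0 ≤ C) (hN : ∀ y ∈ N, ‖ν y‖ = 1)
    (hC : ∀ y ∈ N, ∀ z ∈ N, |⟪ν y, z - y⟫| ≤ C * ‖z - y‖ ^ 2) (hw : IsUnitFlow N ν f A w v)
    (hE : 64 * C ^ 2 * energyL2 A ≤ 1) (hE2 : energyL2 A ≤ 2) {h : ℝ} (hh : 0 < h)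
    {u : ℝ → Grid → Space} (hu : ∀ t, 0 ≤ t → ∀ j, u t j = f j + w (h⁻¹ ^ 2 * t) j) :
    FlowBounds h u := by
  have hE0 : 0 ≤ energyL2 A := by rw [energyL2]; positivity
  have hτ : ∀ t, 0 ≤ t → 0 ≤ h⁻¹ ^ 2 * t := fun t ht => by positivity
  set d : ℝ → Fin 2 → GridL2 := fun t => flowDiff A w (h⁻¹ ^ 2 * t) with hddef
  have hd : ∀ t, 0 ≤ t → ∀ i, dif i (u t) = d t i := fun t ht i => by
    funext j
    rw [hddef, hw.flowDiff_eq]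
    simp only [dif, hu t ht]
  have hsub : ∀ s t, 0 ≤ s → 0 ≤ t → (fun j => u t j - u s j) =
      ((w (h⁻¹ ^ 2 * t) - w (h⁻¹ ^ 2 * s) : GridL2) : Grid → Space) := fun s t hs ht => by
    funext j
    rw [hu t ht, hu s hs, GridL2.sub_apply]; abel
  have hdd : ∀ t, 0 ≤ t → ∀ i k, dif k (dif i (u t)) = diff k (d t i) := fun t ht i k => by
    funext j
    rw [hd t ht i, diff_apply, dif]
  have henergy : ∀ t, 0 ≤ t → ∑ i, ‖d t i‖ ^ 2 ≤ 4 := fun t ht => by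
    have := hw.sum_norm_flowDiff_le hN (hτ t ht)
    exact this.trans (by linarith)
  have henergy1 : ∀ t, 0 ≤ t → ∀ i, ‖d t i‖ ^ 2 ≤ 4 := fun t ht i =>
    (Finset.single_le_sum (f := fun i => ‖d t i‖ ^ 2) (fun _ _ => by positivity)
      (Finset.mem_univ i)).trans (henergy t ht)
  have hlap : ∀ t, 0 < t → ‖lapOf (d t)‖ ^ 2 ≤ 8 * h ^ 2 / t := fun t ht => by
    have h1 := hw.lapOf_decay hC0 hN hC hE (hτ t ht.le)
    rw [le_div_iff₀ ht]
    have e : ‖lapOf (d t)‖ ^ 2 * t = h ^ 2 * (h⁻¹ ^ 2 * t * ‖lapOf (d t)‖ ^ 2) := by field_simp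
    rw [e]
    have h2 := mul_le_mul_of_nonneg_left (h1.trans (show _ ≤ (8 : ℝ) by linarith)) (sq_nonneg h)
    linarith
  have htime : ∀ s t, 0 ≤ s → 0 ≤ t → ‖w (h⁻¹ ^ 2 * t) - w (h⁻¹ ^ 2 * s)‖ ^ 2 ≤
      (h⁻¹ ^ 2) * (4 * |t - s|) := fun s t hs ht => by
    have h1 := hw.norm_sub_sq_le hN (hτ s hs) (hτ t ht)
    rw [← mul_sub, abs_mul, abs_of_nonneg (show 0 ≤ h⁻¹ ^ 2 by positivity)] at h1
    have h2 : 2 * energyL2 A * (h⁻¹ ^ 2 * |t - s|) ≤ 4 * (h⁻¹ ^ 2 * |t - s|) := by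
      gcongr; linarith
    linarith
  have hdlap : ∀ t, 0 ≤ t → ∀ i, ∑ k, ‖diff k (d t i)‖ ^ 2 ≤ ‖lapOf (d t)‖ ^ 2 := fun t ht i => by
    rw [← sum_norm_diff_sq_eq (hw.flowDiff_eq (h⁻¹ ^ 2 * t))]
    exact Finset.single_le_sum (f := fun i => ∑ k, ‖diff k (d t i)‖ ^ 2)
      (fun _ _ => by positivity) (Finset.mem_univ i)
  refine ⟨fun t ht i => ?_, fun s t hs ht => ?_, fun t ht i k => ?_, fun t ht i => ?_,
    fun s t hs ht i => ?_, fun η κ hη0 hη1 hκ t ht => ?_⟩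
  · rw [hd t ht, gsq_coe]
    exact ENNReal.ofReal_le_ofReal (henergy1 t ht i)
  · rw [hsub s t hs ht, gsq_coe, ← ENNReal.ofReal_mul (by positivity)]
    refine ENNReal.ofReal_le_ofReal ?_
    have := mul_le_mul_of_nonneg_left (htime s t hs ht) (sq_nonneg h)
    refine this.trans (le_of_eq ?_)
    field_simp
  · rw [hdd t ht.le, gsq_coe]
    refine ENNReal.ofReal_le_ofReal (le_trans ?_ ((hdlap t ht.le i).trans (hlap t ht)))
    exact Finset.single_le_sum (f := fun k => ‖diff k (d t i)‖ ^ 2) (fun _ _ => by positivity)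
      (Finset.mem_univ k)
  · have h4 := tsum_norm_pow_four_le' (d t i)
    have hs4 := (tsum_norm_pow_four_le (d t i)).1
    have e : ∑' j, ‖dif i (u t) j‖ₑ ^ 4 = ENNReal.ofReal (∑' j, ‖d t i j‖ ^ 4) := by
      rw [ENNReal.ofReal_tsum_of_nonneg (fun _ => by positivity) hs4, hd t ht.le]
      refine tsum_congr fun j => ?_
      rw [ENNReal.ofReal_pow (norm_nonneg _), ofReal_norm]
    rw [e]
    refine ENNReal.ofReal_le_ofReal (h4.trans ?_)
    calc 2 * ‖d t i‖ ^ 2 * ∑ k, ‖diff k (d t i)‖ ^ 2 ≤ 2 * 4 * (8 * h ^ 2 / t) := by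
          gcongr
          · exact henergy1 t ht.le i
          · exact (hdlap t ht.le i).trans (hlap t ht)
      _ = _ := by ring
  · have e : (fun j => dif i (u t) j - dif i (u s) j) =
        (diff i (w (h⁻¹ ^ 2 * t) - w (h⁻¹ ^ 2 * s)) : GridL2) := by
      funext j
      rw [hd t ht.le, hd s hs.le, hddef]
      simp only [flowDiff, map_sub, GridL2.sub_apply, GridL2.add_apply]; abel
    rw [e, gsq_coe]
    refine ENNReal.ofReal_le_ofReal ?_
    refine (Finset.single_le_sum
      (f := fun i => ‖diff i (w (h⁻¹ ^ 2 * t) - w (h⁻¹ ^ 2 * s))‖ ^ 2)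
      (fun _ _ => by positivity) (Finset.mem_univ i)).trans ?_
    refine (hw.sum_norm_diff_sub_le _ _).trans ?_
    have h1 : ‖w (h⁻¹ ^ 2 * t) - w (h⁻¹ ^ 2 * s)‖ ≤ h⁻¹ * √(4 * |t - s|) := by
      rw [← sq_le_sq₀ (norm_nonneg _) (by positivity), mul_pow, Real.sq_sqrt (by positivity)]
      exact htime s t hs.le ht.le
    have h2 : ∀ t, 0 < t → ‖lapOf (d t)‖ ≤ h * √(8 / t) := fun t ht => by
      rw [← sq_le_sq₀ (norm_nonneg _) (by positivity), mul_pow, Real.sq_sqrt (by positivity)]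
      exact (hlap t ht).trans (le_of_eq (by ring))
    calc _ ≤ h⁻¹ * √(4 * |t - s|) * (h * √(8 / t) + h * √(8 / s)) := by
          gcongr
          · exact h2 t ht
          · exact h2 s hs
      _ = _ := by field_simp
  · have h1 := hw.local_energy_le hN hη0 hη1 hκ le_rfl (hτ t ht)
    rw [hw.flowDiff_zero, sub_zero] at h1
    have hd0 : d 0 = A := by simp only [hddef, mul_zero, hw.flowDiff_zero]
    have e0 : ∑ k, gsq (fun j => η j • dif k (u 0) j) + ENNReal.ofReal (104 * κ ^ 2 * t / h ^ 2) =
        ENNReal.ofReal (∑ k, ‖weight η hη1 (A k)‖ ^ 2 + 104 * κ ^ 2 * t / h ^ 2) := by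
      rw [ENNReal.ofReal_add (by positivity) (by positivity),
        ENNReal.ofReal_sum_of_nonneg fun i _ => by positivity]
      congr 1
      refine Finset.sum_congr rfl fun k _ => ?_
      rw [← gsq_coe, hd 0 le_rfl, hd0]
      congr 1
      funext j
      rw [weight_apply]
    have h3 : 26 * κ ^ 2 * energyL2 A * (h⁻¹ ^ 2 * t) ≤ 52 * κ ^ 2 * t / h ^ 2 := by
      have e : 52 * κ ^ 2 * t / h ^ 2 = 26 * κ ^ 2 * 2 * (h⁻¹ ^ 2 * t) := by field_simp; ring
      rw [e]; gcongr
    constructor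
    · intro i
      have e1 : (fun j => η j • dif i (u t) j) = (weight η hη1 (d t i) : GridL2) := by
        funext j; rw [weight_apply, hd t ht]
      rw [e0, e1, gsq_coe]
      refine ENNReal.ofReal_le_ofReal ((Finset.single_le_sum
        (f := fun i => ‖weight η hη1 (d t i)‖ ^ 2) (fun _ _ => by positivity)
        (Finset.mem_univ i)).trans ?_)
      have h2 := h1.1
      rw [energyL2, energyL2] at h2
      have e2 : 104 * κ ^ 2 * t / h ^ 2 = 2 * (52 * κ ^ 2 * t / h ^ 2) := by ring
      linarith
    · have e1 : (fun j => η j • (u t j - u 0 j)) =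
          (weight η hη1 (w (h⁻¹ ^ 2 * t) - w 0) : GridL2) := by
        funext j
        rw [weight_apply, hu t ht, hu 0 le_rfl, GridL2.sub_apply, mul_zero]
        congr 1; abel
      rw [e0, e1, gsq_coe, ← ENNReal.ofReal_mul (by positivity), ← ENNReal.ofReal_mul ht]
      refine ENNReal.ofReal_le_ofReal ?_
      have h2 := mul_le_mul_of_nonneg_left h1.2 (sq_nonneg h)
      refine h2.trans ?_
      have e3 : h ^ 2 * (2 * (energyL2 (fun i => weight η hη1 (A i)) +
          26 * κ ^ 2 * energyL2 A * (h⁻¹ ^ 2 * t)) * (h⁻¹ ^ 2 * t)) =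
          t * (2 * energyL2 (fun i => weight η hη1 (A i)) +
            2 * (26 * κ ^ 2 * energyL2 A * (h⁻¹ ^ 2 * t))) := by field_simp
      rw [e3]
      gcongr
      · rw [energyL2]; linarith
      · have e2 : 104 * κ ^ 2 * t / h ^ 2 = 2 * (52 * κ ^ 2 * t / h ^ 2) := by ring
        linarith

/-- Existence of the flow and a priori estimates for small energy. -/
theorem exists_energy_threshold {N : Set Space} (hN : IsCompact N)
    (hs : IsSmoothHypersurface N) :
    ∃ ε₀ : ℝ, 0 < ε₀ ∧ ∀ ν, IsUnitNormalField N ν → ∀ (h : ℝ) (f : Grid → Space), 0 < h →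
      (∀ j, f j ∈ N) → discreteEnergy h f < ENNReal.ofReal ε₀ →
      (∃ u, IsSemidiscreteFlow N ν h f u) ∧
        ∀ u, IsSemidiscreteFlow N ν h f u → FlowBounds h u := by
  obtain ⟨C, hC0, hC⟩ := exists_abs_inner_normal_le hN hs
  -- The unit step energy is at most twice the threshold, so the two entries of the minimum ensure
  -- energy at most 2 and the absorption condition with factor `64 * C ^ 2`. The `+ 1` covers `C =
  -- 0`.
  refine ⟨min 1 (128 * C ^ 2 + 1)⁻¹, by positivity, fun ν hν h f hh hf hE => ?_⟩
  set ε := min 1 (128 * C ^ 2 + 1)⁻¹ with hε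
  have hε0 : 0 < ε := by positivity
  have h1 : ∑ i, gsq (dif i f) ≤ ENNReal.ofReal (4 * ε) := by
    refine (sum_gsq_dif_le_discreteEnergy hh f).trans ?_
    rw [ENNReal.ofReal_mul (by norm_num)]
    gcongr
    simp
  have h2 : ∀ i, gsq (dif i f) ≠ ⊤ := fun i => by
    refine ((Finset.single_le_sum (f := fun i => gsq (dif i f)) (fun _ _ => zero_le)
      (Finset.mem_univ i)).trans (h1)).trans_lt ENNReal.ofReal_lt_top |>.ne
  set A : Fin 2 → GridL2 := fun i => mkL2 (dif i f) (summable_of_gsq_ne_top (h2 i)) with hA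
  have hAE : energyL2 A ≤ 2 * ε := by
    have h3 : ENNReal.ofReal (∑ i, ‖A i‖ ^ 2) ≤ ENNReal.ofReal (4 * ε) := by
      rw [ENNReal.ofReal_sum_of_nonneg fun i _ => by positivity]
      refine le_trans (le_of_eq (Finset.sum_congr rfl fun i _ => ?_)) h1
      rw [← gsq_coe]; rfl
    have := (ENNReal.ofReal_le_ofReal_iff (by positivity)).1 h3
    rw [energyL2]; linarith
  have hε1 : ε ≤ 1 := min_le_left _ _
  have hε2 : ε * (128 * C ^ 2 + 1) ≤ 1 := by
    have : ε ≤ (128 * C ^ 2 + 1)⁻¹ := min_le_right _ _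
    calc ε * (128 * C ^ 2 + 1) ≤ (128 * C ^ 2 + 1)⁻¹ * (128 * C ^ 2 + 1) := by gcongr
      _ = 1 := inv_mul_cancel₀ (by positivity)
  obtain ⟨w, v, hw⟩ := exists_isUnitFlow hN hs hν hf (A := A) (fun i j => rfl)
  refine ⟨⟨_, hw.isSemidiscreteFlow hh⟩, fun u hu => ?_⟩
  refine hw.flowBounds hC0 hν.norm_eq_one (fun y hy z hz => hC ν hν y hy z hz) ?_ (by linarith) hh
    (fun t ht j => eq_unitFlow hN hν hf hw hh hu ht j)
  have : 64 * C ^ 2 * energyL2 A ≤ 64 * C ^ 2 * (2 * ε) := by gcongr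
  nlinarith

/-! ### Piecewise constant functions in the plane -/

/-- The piecewise constant interpolant of a grid function. -/
noncomputable def pc (h : ℝ) (v : Grid → Space) (x : Plane) : Space := v (cellIndex h x)

theorem measurable_cellIndex (h : ℝ) : Measurable (cellIndex h) :=
  measurable_pi_lambda _ fun i => Int.measurable_floor.comp
    ((show Measurable fun x : Plane => x i by fun_prop).div_const h)

theorem measurable_pc (h : ℝ) (v : Grid → Space) : Measurable (pc h v) :=
  (measurable_of_countable v).comp (measurable_cellIndex h)

theorem stronglyMeasurable_pc (h : ℝ) (v : Grid → Space) : StronglyMeasurable (pc h v) :=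
  (measurable_pc h v).stronglyMeasurable

theorem aesm_pc (h : ℝ) (v : Grid → Space) (μ : Measure Plane) :
    AEStronglyMeasurable (pc h v) μ := (stronglyMeasurable_pc h v).aestronglyMeasurable

theorem volume_rect (a b : Fin 2 → ℝ) :
    volume {x : Plane | ∀ k, x k ∈ Ico (a k) (b k)} = ∏ k, ENNReal.ofReal (b k - a k) := by
  have h1 : {x : Plane | ∀ k, x k ∈ Ico (a k) (b k)} =
      (WithLp.ofLp : Plane → Fin 2 → ℝ) ⁻¹' (univ.pi fun k => Ico (a k) (b k)) := by
    ext x; simp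
  rw [h1, (PiLp.volume_preserving_ofLp (Fin 2)).measure_preimage
    (MeasurableSet.univ_pi fun k => measurableSet_Ico).nullMeasurableSet, Real.volume_pi_Ico]

theorem cellIndex_eq_iff {h : ℝ} (hh : 0 < h) (x : Plane) (k : Grid) :
    cellIndex h x = k ↔ ∀ i, x i ∈ Ico (k i * h) (k i * h + h) := by
  rw [funext_iff]
  refine forall_congr' fun i => ?_
  rw [cellIndex, Int.floor_eq_iff, le_div_iff₀ hh, div_lt_iff₀ hh, add_mul, one_mul, mem_Ico]

theorem volume_cell {h : ℝ} (hh : 0 < h) (k : Grid) :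
    volume (cellIndex h ⁻¹' {k}) = ENNReal.ofReal (h ^ 2) := by
  have : cellIndex h ⁻¹' {k} = {x : Plane | ∀ i, x i ∈ Ico (k i * h) (k i * h + h)} := by
    ext x; exact cellIndex_eq_iff hh x k
  rw [this, volume_rect]
  simp [ENNReal.ofReal_pow hh.le]

theorem lintegral_comp_cellIndex {h : ℝ} (hh : 0 < h) (g : Grid → ℝ≥0∞) :
    ∫⁻ x, g (cellIndex h x) = ENNReal.ofReal (h ^ 2) * ∑' j, g j := by
  rw [← lintegral_map (measurable_of_countable g) (measurable_cellIndex h), lintegral_countable',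
    ← ENNReal.tsum_mul_left]
  refine tsum_congr fun k => ?_
  rw [Measure.map_apply (measurable_cellIndex h) (measurableSet_singleton k), volume_cell hh,
    mul_comm]

theorem eLpNorm_two_sq {α E : Type*} [MeasurableSpace α] [NormedAddCommGroup E] (μ : Measure α)
    (f : α → E) : eLpNorm f 2 μ ^ 2 = ∫⁻ x, ‖f x‖ₑ ^ 2 ∂μ := by
  have := eLpNorm_nnreal_pow_eq_lintegral (f := f) (μ := μ) (p := 2) (by norm_num)
  simpa using this

theorem eLpNorm_pc_sq {h : ℝ} (hh : 0 < h) (v : Grid → Space) :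
    eLpNorm (pc h v) 2 volume ^ 2 = ENNReal.ofReal (h ^ 2) * gsq v := by
  rw [eLpNorm_two_sq]
  exact lintegral_comp_cellIndex hh fun j => ‖v j‖ₑ ^ 2

theorem cellIndex_add_smul_unit {h : ℝ} (hh : 0 < h) (x : Plane) (i : Fin 2) :
    cellIndex h (x + h • EuclideanSpace.single i 1) = cellIndex h x + unitIndex i := by
  funext k
  by_cases hk : k = i
  · subst hk
    simp [cellIndex, unitIndex, add_div, hh.ne']
  · simp [cellIndex, unitIndex, hk]

theorem pc_add_smul_unit {h : ℝ} (hh : 0 < h) (v : Grid → Space) (x : Plane) (i : Fin 2) :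
    pc h v (x + h • EuclideanSpace.single i 1) = pc h (fun j => v (j + unitIndex i)) x := by
  rw [pc, cellIndex_add_smul_unit hh, pc]

theorem cellIndex_add_le {h : ℝ} (hh : 0 < h) (x : Plane) (i : Fin 2) {s : ℝ} (hs : 0 ≤ s)
    (hsh : s ≤ h) : cellIndex h (x + s • EuclideanSpace.single i 1) = cellIndex h x ∨
      cellIndex h (x + s • EuclideanSpace.single i 1) = cellIndex h x + unitIndex i := by
  have h1 : ⌊x i / h⌋ ≤ ⌊(x i + s) / h⌋ := Int.floor_le_floor (by gcongr; linarith)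
  have h2 : ⌊(x i + s) / h⌋ ≤ ⌊x i / h⌋ + 1 := by
    rw [← Int.floor_add_one]
    refine Int.floor_le_floor ?_
    rw [add_div]; gcongr; exact (div_le_one hh).2 hsh
  have h3 : ∀ k, k ≠ i → cellIndex h (x + s • EuclideanSpace.single i 1) k = cellIndex h x k :=
    fun k hk => by simp [cellIndex, hk]
  have h4 : cellIndex h (x + s • EuclideanSpace.single i 1) i = ⌊(x i + s) / h⌋ := by
    simp [cellIndex]
  rcases (show ⌊(x i + s) / h⌋ = ⌊x i / h⌋ ∨ ⌊(x i + s) / h⌋ = ⌊x i / h⌋ + 1 by omega) with h5 | h5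
  · left; funext k
    by_cases hk : k = i
    · subst hk; rw [h4, h5]; rfl
    · exact h3 k hk
  · right; funext k
    by_cases hk : k = i
    · subst hk; rw [h4, h5]; simp [unitIndex, cellIndex]
    · rw [h3 k hk]; simp [unitIndex, hk]

/-! ### Translations -/

theorem eLpNorm_comp_add {g : Plane → Space} (hg : AEStronglyMeasurable g volume) (z : Plane) :
    eLpNorm (fun x => g (x + z)) 2 volume = eLpNorm g 2 volume :=
  eLpNorm_comp_measurePreserving (p := 2) hg (measurePreserving_add_right volume z)

theorem aesm_comp_add {g : Plane → Space} (hg : AEStronglyMeasurable g volume) (z : Plane) :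
    AEStronglyMeasurable (fun x => g (x + z)) volume :=
  hg.comp_measurePreserving (measurePreserving_add_right volume z)

/-- The `L²` norm of the increment of `g` under the translation by `z`. -/
noncomputable def incr (g : Plane → Space) (z : Plane) : ℝ≥0∞ :=
  eLpNorm (fun x => g (x + z) - g x) 2 volume

theorem incr_add_le {g : Plane → Space} (hg : AEStronglyMeasurable g volume) (z w : Plane) :
    incr g (z + w) ≤ incr g z + incr g w := by
  have e : (fun x => g (x + (z + w)) - g x) =
      (fun x => (fun y => g (y + w) - g y) (x + z)) + fun x => g (x + z) - g x := by
    funext x; simp [add_assoc]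
  have h1 : AEStronglyMeasurable (fun x => g (x + w) - g x) volume := (aesm_comp_add hg w).sub hg
  rw [incr, e]
  refine (eLpNorm_add_le (aesm_comp_add h1 z) ((aesm_comp_add hg z).sub hg) (by norm_num)).trans ?_
  rw [eLpNorm_comp_add h1 z, add_comm]; rfl

theorem incr_neg {g : Plane → Space} (hg : AEStronglyMeasurable g volume) (z : Plane) :
    incr g (-z) = incr g z := by
  have h1 : AEStronglyMeasurable (fun x => g (x + -z) - g x) volume :=
    (aesm_comp_add hg _).sub hg
  rw [incr, ← eLpNorm_comp_add h1 z, incr, ← eLpNorm_neg]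
  congr 1; funext x; simp

theorem incr_pc_le_of_le {h : ℝ} (hh : 0 < h) (v : Grid → Space) (i : Fin 2) {s : ℝ} (hs : 0 ≤ s)
    (hsh : s ≤ h) :
    incr (pc h v) (s • EuclideanSpace.single i 1) ≤ eLpNorm (pc h (dif i v)) 2 volume := by
  refine eLpNorm_mono fun x => ?_
  rcases cellIndex_add_le hh x i hs hsh with h1 | h1 <;> simp [pc, h1, dif]

/-- A translation is split into steps of length at most `h`, and each of them moves the cell index
by at most one. Rounding up the number of steps gives the summand one, which later becomes an error
of order `h`. -/
theorem incr_pc_single_le {h : ℝ} (hh : 0 < h) (v : Grid → Space) (i : Fin 2) (s : ℝ) :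
    incr (pc h v) (s • EuclideanSpace.single i 1) ≤
      ENNReal.ofReal (|s| / h + 1) * eLpNorm (pc h (dif i v)) 2 volume := by
  have hg := aesm_pc h v volume
  have main : ∀ n : ℕ, ∀ s : ℝ, 0 ≤ s → s ≤ n * h →
      incr (pc h v) (s • EuclideanSpace.single i 1) ≤
        n * eLpNorm (pc h (dif i v)) 2 volume := by
    intro n
    induction n with
    | zero =>
      intro s hs hs'
      have : s = 0 := le_antisymm (by simpa using hs') hs
      simp [this, incr]
    | succ n ih =>
      intro s hs hs'
      rcases le_total s h with hsh | hsh
      · refine (incr_pc_le_of_le hh v i hs hsh).trans ?_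
        exact le_mul_of_one_le_left zero_le (by simp)
      · have e : s • EuclideanSpace.single i (1 : ℝ) =
            (s - h) • EuclideanSpace.single i 1 + h • EuclideanSpace.single i 1 := by
          rw [← add_smul, sub_add_cancel]
        rw [e]
        refine (incr_add_le hg _ _).trans ?_
        rw [Nat.cast_add, Nat.cast_one, add_mul, one_mul]
        refine add_le_add (ih _ (by linarith) ?_) (incr_pc_le_of_le hh v i hh.le le_rfl)
        push_cast at hs'; linarith
  have pos : ∀ s : ℝ, 0 ≤ s → incr (pc h v) (s • EuclideanSpace.single i 1) ≤
      ENNReal.ofReal (s / h + 1) * eLpNorm (pc h (dif i v)) 2 volume := by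
    intro s hs
    refine (main ⌈s / h⌉₊ s hs ?_).trans ?_
    · rw [← div_le_iff₀ hh]; exact Nat.le_ceil _
    · gcongr
      rw [← ENNReal.ofReal_natCast]
      exact ENNReal.ofReal_le_ofReal (Nat.ceil_lt_add_one (by positivity)).le
  rcases le_total 0 s with hs | hs
  · rw [abs_of_nonneg hs]; exact pos s hs
  · rw [abs_of_nonpos hs, ← incr_neg hg, ← neg_smul]; exact pos _ (by linarith)

theorem incr_pc_le {h : ℝ} (hh : 0 < h) (v : Grid → Space) {D : ℝ} (hD : 0 ≤ D)
    (hv : ∀ i, gsq (dif i v) ≤ ENNReal.ofReal (D ^ 2)) (z : Plane) :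
    incr (pc h v) z ≤ ENNReal.ofReal (2 * (‖z‖ + h) * D) := by
  have e : z = z 0 • EuclideanSpace.single 0 1 + z 1 • EuclideanSpace.single 1 1 := by
    ext k; fin_cases k <;> simp
  have h1 : ∀ i, eLpNorm (pc h (dif i v)) 2 volume ≤ ENNReal.ofReal (h * D) := fun i => by
    rw [← ENNReal.pow_le_pow_left_iff (two_ne_zero), eLpNorm_pc_sq hh,
      ← ENNReal.ofReal_pow (by positivity), mul_pow, ENNReal.ofReal_mul (by positivity)]
    gcongr; exact hv i
  have h2 : ∀ i, incr (pc h v) (z i • EuclideanSpace.single i 1) ≤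
      ENNReal.ofReal ((‖z‖ + h) * D) := fun i => by
    refine (incr_pc_single_le hh v i _).trans ((mul_le_mul_right (h1 i) _).trans ?_)
    rw [← ENNReal.ofReal_mul (by positivity)]
    refine ENNReal.ofReal_le_ofReal ?_
    have : |z i| ≤ ‖z‖ := PiLp.norm_apply_le z i
    calc (|z i| / h + 1) * (h * D) = (|z i| + h) * D := by field_simp
      _ ≤ _ := by gcongr
  calc incr (pc h v) z = incr (pc h v) (z 0 • EuclideanSpace.single 0 1 +
        z 1 • EuclideanSpace.single 1 1) := by rw [← e]
    _ ≤ _ := (incr_add_le (aesm_pc h v volume) _ _).trans (add_le_add (h2 0) (h2 1))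
    _ = _ := by rw [← ENNReal.ofReal_add (by positivity) (by positivity)]; congr 1; ring

/-! ### Compactness in `L²_loc` -/

theorem ENNReal_tendsto_zero_of_approx {a c : ℕ → ℝ≥0∞} {b : ℕ → ℕ → ℝ≥0∞}
    (hab : ∀ m n, a n ≤ b m n + c m) (hb : ∀ m, Tendsto (b m) atTop (𝓝 0))
    (hc : Tendsto c atTop (𝓝 0)) : Tendsto a atTop (𝓝 0) := by
  rw [ENNReal.tendsto_nhds_zero] at hc ⊢
  intro ε hε
  have hε2 : 0 < ε / 2 := ENNReal.half_pos hε.ne'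
  obtain ⟨m, hm⟩ := (hc _ hε2).exists
  filter_upwards [(ENNReal.tendsto_nhds_zero.1 (hb m)) _ hε2] with n hn
  exact (hab m n).trans ((add_le_add hn hm).trans (ENNReal.add_halves ε).le)

theorem enorm_integral_sq_le {α : Type*} [MeasurableSpace α] {μ : Measure α} {f : α → Space}
    (hf : AEStronglyMeasurable f μ) :
    ‖∫ x, f x ∂μ‖ₑ ^ 2 ≤ μ univ * ∫⁻ x, ‖f x‖ₑ ^ 2 ∂μ := by
  have h1 : ‖∫ x, f x ∂μ‖ₑ ≤ eLpNorm f 1 μ := by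
    rw [eLpNorm_one_eq_lintegral_enorm]; exact enorm_integral_le_lintegral_enorm f
  have h2 := eLpNorm_le_eLpNorm_mul_rpow_measure_univ (μ := μ) (p := 1) (q := 2) (by norm_num) hf
  have h3 : ‖∫ x, f x ∂μ‖ₑ ^ 2 ≤ (eLpNorm f 2 μ * μ univ ^ ((1 : ℝ) / 2)) ^ 2 := by
    refine pow_le_pow_left₀ zero_le (h1.trans (h2.trans (le_of_eq ?_))) 2
    norm_num
  refine h3.trans (le_of_eq ?_)
  rw [mul_pow, eLpNorm_two_sq, mul_comm, ← ENNReal.rpow_natCast, ← ENNReal.rpow_mul]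
  norm_num

/-- The mean value of `g` over a cell of the grid with step `δ`. -/
noncomputable def avg (δ : ℝ) (g : Plane → Space) (k : Grid) : Space :=
  (δ ^ 2)⁻¹ • ∫ x in cellIndex δ ⁻¹' {k}, g x

theorem measurableSet_cell (δ : ℝ) (k : Grid) : MeasurableSet (cellIndex δ ⁻¹' {k}) :=
  measurable_cellIndex δ (measurableSet_singleton k)

theorem integrableOn_cell {δ : ℝ} (hδ : 0 < δ) {g : Plane → Space} (hg : StronglyMeasurable g)
    {B : ℝ} (hb : ∀ x, ‖g x‖ ≤ B) (k : Grid) : IntegrableOn g (cellIndex δ ⁻¹' {k}) := by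
  refine Measure.integrableOn_of_bounded (M := B) ?_ hg.aestronglyMeasurable
    (Eventually.of_forall hb)
  rw [volume_cell hδ]; exact ENNReal.ofReal_ne_top

theorem enorm_avg_sq_le {δ : ℝ} (hδ : 0 < δ) {g : Plane → Space} (hg : StronglyMeasurable g)
    (k : Grid) : ‖avg δ g k‖ₑ ^ 2 ≤ (ENNReal.ofReal (δ ^ 2))⁻¹ *
      ∫⁻ x in cellIndex δ ⁻¹' {k}, ‖g x‖ₑ ^ 2 := by
  have h1 : ENNReal.ofReal (δ ^ 2) ≠ 0 := by simpa using by positivity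
  rw [avg, enorm_smul, mul_pow]
  refine (mul_le_mul_right (enorm_integral_sq_le hg.aestronglyMeasurable) _).trans ?_
  rw [Measure.restrict_apply_univ, volume_cell hδ, ← mul_assoc]
  gcongr
  rw [enorm_inv (by positivity), Real.enorm_eq_ofReal (by positivity), sq, mul_assoc,
    ENNReal.inv_mul_cancel h1 ENNReal.ofReal_ne_top, mul_one]

theorem avg_sub {δ : ℝ} (hδ : 0 < δ) {g g' : Plane → Space} (hg : StronglyMeasurable g)
    (hg' : StronglyMeasurable g') (hb : ∃ B, ∀ x, ‖g x‖ ≤ B) (hb' : ∃ B, ∀ x, ‖g' x‖ ≤ B)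
    (k : Grid) : avg δ (fun x => g x - g' x) k = avg δ g k - avg δ g' k := by
  obtain ⟨B, hB⟩ := hb
  obtain ⟨B', hB'⟩ := hb'
  rw [avg, integral_sub (integrableOn_cell hδ hg hB k) (integrableOn_cell hδ hg' hB' k), smul_sub]
  rfl

theorem avg_const {δ : ℝ} (hδ : 0 < δ) (c : Space) (k : Grid) : avg δ (fun _ => c) k = c := by
  rw [avg, setIntegral_const, Measure.real, volume_cell hδ, ENNReal.toReal_ofReal (by positivity),
    smul_smul, inv_mul_cancel₀ (by positivity), one_smul]

theorem norm_avg_le {δ : ℝ} (hδ : 0 < δ) {g : Plane → Space}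
    {B : ℝ} (hb : ∀ x, ‖g x‖ ≤ B) (k : Grid) : ‖avg δ g k‖ ≤ B := by
  rw [avg, norm_smul, norm_inv, Real.norm_of_nonneg (by positivity : (0:ℝ) ≤ δ ^ 2)]
  have h1 := norm_setIntegral_le_of_norm_le_const (μ := volume) (s := cellIndex δ ⁻¹' {k})
    (f := g) (C := B) (by rw [volume_cell hδ]; exact ENNReal.ofReal_lt_top) (fun x _ => hb x)
  rw [Measure.real, volume_cell hδ, ENNReal.toReal_ofReal (by positivity)] at h1
  rw [inv_mul_le_iff₀ (by positivity)]
  linarith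

/-- A Poincaré inequality on the cells of a grid. -/
theorem eLpNorm_sub_pc_avg_le {δ : ℝ} (hδ : 0 < δ) {g : Plane → Space} (hg : StronglyMeasurable g)
    (hb : ∃ B, ∀ x, ‖g x‖ ≤ B) {K : ℝ≥0∞} (hK : ∀ z, ‖z‖ ≤ 2 * δ → incr g z ≤ K) :
    eLpNorm (fun x => g x - pc δ (avg δ g) x) 2 volume ≤ 2 * K := by
  -- `Z` contains all differences of two points of one cell. Its area is four times that of a cell,
  -- which explains the factor two in the final bound.
  set Z : Set Plane := {x : Plane | ∀ k, x k ∈ Ico ((fun _ => -δ : Fin 2 → ℝ) k)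
    ((fun _ => δ : Fin 2 → ℝ) k)} with hZ
  have hZm : MeasurableSet Z := by
    have : Z = ⋂ k, (fun x : Plane => x k) ⁻¹' Ico (-δ) δ := by ext; simp [hZ]
    rw [this]
    exact MeasurableSet.iInter fun k =>
      (show Measurable fun x : Plane => x k by fun_prop) measurableSet_Ico
  have hZv : volume Z = 4 * ENNReal.ofReal (δ ^ 2) := by
    rw [hZ, volume_rect, show (4 : ℝ≥0∞) = ENNReal.ofReal 4 by simp,
      ← ENNReal.ofReal_mul (by norm_num)]
    simp only [Fin.prod_univ_two]
    rw [← ENNReal.ofReal_mul (by linarith)]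
    congr 1; ring
  have hZn : ∀ z ∈ Z, ‖z‖ ≤ 2 * δ := fun z hz => by
    rw [EuclideanSpace.norm_eq, Real.sqrt_le_left (by positivity), Fin.sum_univ_two]
    have h0 := hz 0
    have h1 := hz 1
    simp only [mem_Ico, Real.norm_eq_abs, sq_abs] at h0 h1 ⊢
    nlinarith [mul_nonneg (by linarith : 0 ≤ δ - z 0) (by linarith : 0 ≤ δ + z 0),
      mul_nonneg (by linarith : 0 ≤ δ - z 1) (by linarith : 0 ≤ δ + z 1)]
  have hne : ENNReal.ofReal (δ ^ 2) ≠ 0 := by simpa using by positivity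
  -- The deviation from the mean is a mean of differences over the cell; enlarging the domain to `Z`
  -- makes it independent of `x`, and Tonelli produces translation increments.
  have key : ∀ x, ‖g x - pc δ (avg δ g) x‖ₑ ^ 2 ≤ (ENNReal.ofReal (δ ^ 2))⁻¹ *
      ∫⁻ z in Z, ‖g (x + z) - g x‖ₑ ^ 2 := fun x => by
    have h1 : g x - pc δ (avg δ g) x = -avg δ (fun y => g y - g x) (cellIndex δ x) := by
      rw [avg_sub hδ hg stronglyMeasurable_const hb ⟨‖g x‖, fun _ => le_rfl⟩, avg_const hδ, pc]
      abel
    rw [h1, enorm_neg]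
    refine (enorm_avg_sq_le hδ (hg.sub stronglyMeasurable_const) _).trans ?_
    refine mul_le_mul_right ?_ _
    rw [← lintegral_indicator (measurableSet_cell δ _), ← lintegral_indicator hZm,
      ← lintegral_add_left_eq_self _ x]
    refine lintegral_mono fun z => ?_
    by_cases hz : x + z ∈ cellIndex δ ⁻¹' {cellIndex δ x}
    · have hzZ : z ∈ Z := fun k => by
        have e1 := (cellIndex_eq_iff hδ (x + z) (cellIndex δ x)).1 hz k
        have e2 := (cellIndex_eq_iff hδ x (cellIndex δ x)).1 rfl k
        simp only [mem_Ico, PiLp.add_apply] at e1 e2 ⊢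
        constructor <;> linarith
      rw [indicator_of_mem hz, indicator_of_mem hzZ]
      exact le_rfl
    · rw [indicator_of_notMem hz]; exact zero_le
  have hm : Measurable fun q : Plane × Plane => ‖g (q.1 + q.2) - g q.1‖ₑ ^ 2 :=
    (((hg.comp_measurable (measurable_fst.add measurable_snd)).sub
      (hg.comp_measurable measurable_fst)).enorm).pow_const 2
  rw [← ENNReal.pow_le_pow_left_iff two_ne_zero, eLpNorm_two_sq]
  calc ∫⁻ x, ‖g x - pc δ (avg δ g) x‖ₑ ^ 2
      ≤ ∫⁻ x, (ENNReal.ofReal (δ ^ 2))⁻¹ * ∫⁻ z in Z, ‖g (x + z) - g x‖ₑ ^ 2 :=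
        lintegral_mono key
    _ = (ENNReal.ofReal (δ ^ 2))⁻¹ * ∫⁻ x, ∫⁻ z in Z, ‖g (x + z) - g x‖ₑ ^ 2 :=
        lintegral_const_mul' _ _ (ENNReal.inv_ne_top.2 hne)
    _ = (ENNReal.ofReal (δ ^ 2))⁻¹ * ∫⁻ z in Z, incr g z ^ 2 := by
        rw [lintegral_lintegral_swap hm.aemeasurable]
        simp only [incr, eLpNorm_two_sq]
    _ ≤ (ENNReal.ofReal (δ ^ 2))⁻¹ * ∫⁻ z in Z, K ^ 2 := by
        gcongr 1
        exact setLIntegral_mono measurable_const fun z hz =>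
          pow_le_pow_left₀ zero_le (hK z (hZn z hz)) 2
    _ = (2 * K) ^ 2 := by
        rw [setLIntegral_const, hZv, mul_pow, mul_left_comm, mul_comm 4 (ENNReal.ofReal _),
          ← mul_assoc (ENNReal.ofReal _)⁻¹, ENNReal.inv_mul_cancel hne ENNReal.ofReal_ne_top]
        norm_num [mul_comm]

theorem finite_cellIndex_ball (δ R : ℝ) (hδ : 0 < δ) :
    (cellIndex δ '' Metric.ball 0 R).Finite := by
  refine (Set.finite_Icc (fun _ => ⌊-R / δ⌋ : Grid) (fun _ => ⌊R / δ⌋ : Grid)).subset ?_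
  rintro _ ⟨x, hx, rfl⟩
  rw [mem_ball_zero_iff] at hx
  have h1 : ∀ k, |x k| ≤ R := fun k => (PiLp.norm_apply_le x k).trans hx.le
  exact ⟨fun k => Int.floor_le_floor (by gcongr; linarith [neg_abs_le (x k), h1 k]),
    fun k => Int.floor_le_floor (by gcongr; linarith [le_abs_self (x k), h1 k])⟩

/-- Only finitely many cells meet a ball, so convergence of the value on each cell is uniform there.
-/
theorem tendsto_eLpNorm_pc_sub {δ : ℝ} (hδ : 0 < δ) {a : ℕ → Grid → Space} {b : Grid → Space}
    (hab : ∀ k, Tendsto (fun n => a n k) atTop (𝓝 (b k))) (R : ℝ) :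
    Tendsto (fun n => eLpNorm (fun x => pc δ (a n) x - pc δ b x) 2
      (volume.restrict (Metric.ball 0 R))) atTop (𝓝 0) := by
  set M : ℝ≥0∞ := (volume.restrict (Metric.ball (0 : Plane) R)) univ ^ (2 : ℝ≥0∞).toReal⁻¹ with hM
  have hMtop : M ≠ ⊤ := by
    refine ENNReal.rpow_ne_top_of_nonneg (by positivity) ?_
    rw [Measure.restrict_apply_univ]; exact measure_ball_lt_top.ne
  have hfin := finite_cellIndex_ball δ R hδ
  set c : ℕ → ℝ := fun n => ∑ k ∈ hfin.toFinset, ‖a n k - b k‖ with hc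
  have hc0 : Tendsto c atTop (𝓝 0) := by
    have : Tendsto c atTop (𝓝 (∑ k ∈ hfin.toFinset, 0)) := tendsto_finsetSum _ fun k _ =>
      tendsto_iff_norm_sub_tendsto_zero.1 (hab k)
    simpa using this
  have hle : ∀ n, eLpNorm (fun x => pc δ (a n) x - pc δ b x) 2
      (volume.restrict (Metric.ball 0 R)) ≤ M * ENNReal.ofReal (c n) := fun n => by
    refine eLpNorm_le_of_ae_bound ?_
    filter_upwards [ae_restrict_mem measurableSet_ball] with x hx
    exact Finset.single_le_sum (f := fun k => ‖a n k - b k‖) (fun _ _ => norm_nonneg _)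
      (hfin.mem_toFinset.2 ⟨x, hx, rfl⟩)
  have h0 : Tendsto (fun n => M * ENNReal.ofReal (c n)) atTop (𝓝 0) := by
    have := ENNReal.Tendsto.const_mul (ENNReal.tendsto_ofReal hc0) (Or.inr hMtop)
    simpa using this
  exact tendsto_of_tendsto_of_tendsto_of_le_of_le tendsto_const_nhds h0 (fun _ => zero_le) hle

/-- The limit of the dyadic step functions with values `A m` on the cells of size `2⁻ᵐ`. -/
noncomputable def dyadicLimit (A : ℕ → Grid → Space) (x : Plane) : Space :=
  limUnder atTop fun m => A m (cellIndex ((1 / 2 : ℝ) ^ m) x)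

/-- By the Poincaré inequality `g n` is within `2 * D * (2 * δ + h n)` of its means over cells of
size `δ`. As these means converge in `n`, the limiting dyadic step functions are Cauchy in `L²` with
geometric rate. Hence they converge almost everywhere, so their pointwise limit `dyadicLimit` is
also their `L²` limit, and approximating first in `n` and then in `m` yields the claim. -/
theorem tendsto_of_tendsto_avg {g : ℕ → Plane → Space} (hg : ∀ n, StronglyMeasurable (g n))
    (hb : ∀ n, ∃ B, ∀ x, ‖g n x‖ ≤ B) {h : ℕ → ℝ} (h0 : Tendsto h atTop (𝓝 0))
    (hpos : ∀ n, 0 < h n) {D : ℝ} (hD : 0 ≤ D)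
    (hincr : ∀ n z, incr (g n) z ≤ ENNReal.ofReal (D * (‖z‖ + h n)))
    {A : ℕ → Grid → Space}
    (hA : ∀ m k, Tendsto (fun n => avg ((1 / 2 : ℝ) ^ m) (g n) k) atTop (𝓝 (A m k))) (R : ℝ) :
    Tendsto (fun n => eLpNorm (fun x => g n x - dyadicLimit A x) 2
      (volume.restrict (Metric.ball 0 R))) atTop (𝓝 0) := by
  set μ := (volume.restrict (Metric.ball (0 : Plane) R)) with hμ
  set δ : ℕ → ℝ := fun m => (1 / 2 : ℝ) ^ m with hδ
  have hδ0 : ∀ m, 0 < δ m := fun m => by positivity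
  set S : ℕ → Plane → Space := fun m => pc (δ m) (A m) with hS
  set P : ℕ → ℕ → Plane → Space := fun m n => pc (δ m) (avg (δ m) (g n)) with hP
  have hSm : ∀ m, AEStronglyMeasurable (S m) μ := fun m => aesm_pc _ _ _
  have hPm : ∀ m n, AEStronglyMeasurable (P m n) μ := fun m n => aesm_pc _ _ _
  have hgm : ∀ n, AEStronglyMeasurable (g n) μ := fun n => (hg n).aestronglyMeasurable
  have h1 : ∀ m n, eLpNorm (g n - P m n) 2 μ ≤ ENNReal.ofReal (2 * D * (2 * δ m + h n)) := by
    intro m n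
    refine (eLpNorm_mono_measure _ Measure.restrict_le_self).trans ?_
    refine (eLpNorm_sub_pc_avg_le (hδ0 m) (hg n) (hb n)
      (K := ENNReal.ofReal (D * (2 * δ m + h n))) fun z hz => (hincr n z).trans
        (ENNReal.ofReal_le_ofReal (by gcongr))).trans (le_of_eq ?_)
    rw [show (2 : ℝ≥0∞) = ENNReal.ofReal 2 by simp, ← ENNReal.ofReal_mul (by norm_num), mul_assoc]
  have h2 : ∀ m, Tendsto (fun n => eLpNorm (P m n - S m) 2 μ) atTop (𝓝 0) := fun m =>
    tendsto_eLpNorm_pc_sub (hδ0 m) (hA m) R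
  have hlim : ∀ m, Tendsto (fun n => ENNReal.ofReal (2 * D * (2 * δ m + h n))) atTop
      (𝓝 (ENNReal.ofReal (2 * D * (2 * δ m + 0)))) := fun m =>
    ENNReal.tendsto_ofReal ((h0.const_add _).const_mul _)
  have h3 : ∀ m m', eLpNorm (S m - S m') 2 μ ≤ ENNReal.ofReal (4 * D * (δ m + δ m')) := by
    intro m m'
    have hle : ∀ n, eLpNorm (S m - S m') 2 μ ≤ (eLpNorm (P m n - S m) 2 μ +
        ENNReal.ofReal (2 * D * (2 * δ m + h n))) + (eLpNorm (P m' n - S m') 2 μ +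
        ENNReal.ofReal (2 * D * (2 * δ m' + h n))) := fun n => by
      have e1 : ∀ m, eLpNorm (S m - g n) 2 μ ≤ eLpNorm (P m n - S m) 2 μ +
          ENNReal.ofReal (2 * D * (2 * δ m + h n)) := fun m => by
        rw [← neg_sub (g n), eLpNorm_neg,
          show g n - S m = (P m n - S m) + (g n - P m n) by abel]
        exact (eLpNorm_add_le ((hPm m n).sub (hSm m)) ((hgm n).sub (hPm m n))
          (by norm_num)).trans (add_le_add le_rfl (h1 m n))
      have e2 : S m - S m' = (S m - g n) - (S m' - g n) := by abel
      rw [e2]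
      exact (eLpNorm_sub_le ((hSm m).sub (hgm n)) ((hSm m').sub (hgm n)) (by norm_num)).trans
        (add_le_add (e1 m) (e1 m'))
    refine (ge_of_tendsto' (((h2 m).add (hlim m)).add ((h2 m').add (hlim m'))) hle).trans
      (le_of_eq ?_)
    rw [zero_add, zero_add, ← ENNReal.ofReal_add (by have := hδ0 m; positivity)
      (by have := hδ0 m'; positivity)]
    congr 1; ring
  -- The summand one makes the Cauchy estimate strict also when `D = 0`.
  set B : ℕ → ℝ≥0∞ := fun m => ENNReal.ofReal ((8 * D + 1) * δ m) with hB
  have hBs : ∑' m, B m ≠ ⊤ := by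
    have hs : Summable fun m => (8 * D + 1) * δ m :=
      (summable_geometric_of_lt_one (by norm_num) (by norm_num)).mul_left _
    exact hs.tsum_ofReal_ne_top
  have hcau : ∀ N n m, N ≤ n → N ≤ m → eLpNorm (S n - S m) 2 μ < B N := by
    intro N n m hn hm
    refine (h3 n m).trans_lt ((ENNReal.ofReal_lt_ofReal_iff (by have := hδ0 N; positivity)).2 ?_)
    have a1 : δ n ≤ δ N := pow_le_pow_of_le_one (by norm_num) (by norm_num) hn
    have a2 : δ m ≤ δ N := pow_le_pow_of_le_one (by norm_num) (by norm_num) hm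
    nlinarith [hδ0 N, mul_le_mul_of_nonneg_left (add_le_add a1 a2) hD]
  have hae : ∀ᵐ x ∂μ, Tendsto (fun m => S m x) atTop (𝓝 (dyadicLimit A x)) := by
    filter_upwards [Lp.ae_tendsto_of_cauchy_eLpNorm hSm (by norm_num) hBs hcau] with x hx
    exact tendsto_nhds_limUnder hx
  have h4 := Lp.cauchy_tendsto_of_tendsto hSm _ hBs hcau hae
  have hVm : AEStronglyMeasurable (dyadicLimit A) μ := aestronglyMeasurable_of_tendsto_ae _ hSm hae
  have h5 : Tendsto (fun m => ENNReal.ofReal (4 * D * δ m) + eLpNorm (S m - dyadicLimit A) 2 μ)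
      atTop (𝓝 0) := by
    have : Tendsto δ atTop (𝓝 0) :=
      tendsto_pow_atTop_nhds_zero_of_lt_one (by norm_num) (by norm_num)
    have := (ENNReal.tendsto_ofReal (this.const_mul (4 * D))).add h4
    simpa using this
  refine ENNReal_tendsto_zero_of_approx (b := fun m n => eLpNorm (P m n - S m) 2 μ +
    ENNReal.ofReal (2 * D * h n)) (c := fun m => ENNReal.ofReal (4 * D * δ m) +
    eLpNorm (S m - dyadicLimit A) 2 μ) (fun m n => ?_) (fun m => ?_) h5
  · have e : (fun x => g n x - dyadicLimit A x) =
        (g n - P m n) + (P m n - S m) + (S m - dyadicLimit A) := by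
      funext x; simp
    rw [e]
    refine (eLpNorm_add_le (((hgm n).sub (hPm m n)).add ((hPm m n).sub (hSm m)))
      ((hSm m).sub hVm) (by norm_num)).trans ?_
    refine (add_le_add ((eLpNorm_add_le ((hgm n).sub (hPm m n)) ((hPm m n).sub (hSm m))
      (by norm_num)).trans (add_le_add (h1 m n) le_rfl)) le_rfl).trans (le_of_eq ?_)
    rw [mul_add, ENNReal.ofReal_add (by have := hδ0 m; positivity) (by have := hpos n; positivity)]
    rw [show 2 * D * (2 * δ m) = 4 * D * δ m by ring]
    abel
  · have := (h2 m).add (ENNReal.tendsto_ofReal (h0.const_mul (2 * D)))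
    simpa using this

/-! ### Compactness for time dependent functions -/

theorem norm_avg_le_of_eLpNorm {δ : ℝ} (hδ : 0 < δ) {g : Plane → Space}
    (hg : StronglyMeasurable g) {K : ℝ} (hK : 0 ≤ K)
    (h : eLpNorm g 2 volume ≤ ENNReal.ofReal K) (k : Grid) : ‖avg δ g k‖ ≤ K / δ := by
  have h1 : ‖avg δ g k‖ₑ ^ 2 ≤ ENNReal.ofReal ((K / δ) ^ 2) := by
    refine (enorm_avg_sq_le hδ hg k).trans ?_
    have h2 : ∫⁻ x in cellIndex δ ⁻¹' {k}, ‖g x‖ₑ ^ 2 ≤ ENNReal.ofReal (K ^ 2) := by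
      refine (setLIntegral_le_lintegral _ _).trans ?_
      rw [← eLpNorm_two_sq, ENNReal.ofReal_pow hK]
      exact pow_le_pow_left₀ zero_le h 2
    refine (mul_le_mul_right h2 _).trans (le_of_eq ?_)
    rw [← ENNReal.ofReal_inv_of_pos (by positivity), ← ENNReal.ofReal_mul (by positivity)]
    congr 1; field_simp
  rw [enorm_sq_eq_ofReal, ENNReal.ofReal_le_ofReal_iff (by positivity)] at h1
  exact (sq_le_sq₀ (norm_nonneg _) (by positivity)).1 h1

theorem cauchySeq_of_approx {x : ℕ → Space}
    (h : ∀ ε > 0, ∃ y : ℕ → Space, CauchySeq y ∧ ∀ n, ‖x n - y n‖ ≤ ε) : CauchySeq x := by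
  rw [Metric.cauchySeq_iff]
  intro ε hε
  obtain ⟨y, hy, hxy⟩ := h (ε / 4) (by positivity)
  obtain ⟨M, hM⟩ := Metric.cauchySeq_iff.1 hy (ε / 4) (by positivity)
  refine ⟨M, fun m hm n hn => ?_⟩
  have h1 := hM m hm n hn
  have h2 := hxy m
  have h3 := hxy n
  rw [← dist_eq_norm] at h2 h3
  have h4 := dist_triangle4 (x m) (y m) (y n) (x n)
  rw [dist_comm (y n) (x n)] at h4
  linarith

/-- The means at rational times over dyadic cells are countably many bounded sequences, so
Tychonoff's theorem gives one subsequence along which all of them converge. Equicontinuity in time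
extends the convergence of the means to every time in `S`, and the spatial translation bounds turn
it into `L²` convergence on balls. Thus the subsequence does not depend on the time. -/
theorem exists_subseq_tendsto_dyadicLimit {g : ℕ → ℝ → Plane → Space} {S : Set ℝ}
    (hmeas : ∀ n, StronglyMeasurable (Function.uncurry (g n)))
    (hb : ∀ n t, ∃ B, ∀ x, ‖g n t x‖ ≤ B) {h : ℕ → ℝ} (h0 : Tendsto h atTop (𝓝 0))
    (hpos : ∀ n, 0 < h n) {D : ℝ → ℝ} (hD : ∀ t ∈ S, 0 ≤ D t)
    (hincr : ∀ t ∈ S, ∀ n z, incr (g n t) z ≤ ENNReal.ofReal (D t * (‖z‖ + h n)))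
    (havg : ∀ t ∈ S, ∀ δ > 0, ∃ B, ∀ n k, ‖avg δ (g n t) k‖ ≤ B)
    (htime : ∀ t ∈ S, ∀ ε > 0, ∃ q : ℚ, (q : ℝ) ∈ S ∧
      ∀ n, eLpNorm (fun x => g n t x - g n q x) 2 volume ≤ ENNReal.ofReal ε) :
    ∃ (σ : ℕ → ℕ) (V : ℝ → Plane → Space), StrictMono σ ∧
      StronglyMeasurable (Function.uncurry V) ∧ ∀ t ∈ S, ∀ R,
        Tendsto (fun n => eLpNorm (fun x => g (σ n) t x - V t x) 2
          (volume.restrict (Metric.ball 0 R))) atTop (𝓝 0) := by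
  have hgt : ∀ n t, StronglyMeasurable (g n t) := fun n t =>
    (hmeas n).comp_measurable measurable_prodMk_left
  set δ : ℕ → ℝ := fun m => (1 / 2 : ℝ) ^ m with hδ
  have hδ0 : ∀ m, 0 < δ m := fun m => by positivity
  let ι := {q : ℚ // (q : ℝ) ∈ S} × ℕ × Grid
  let X : ℕ → ι → Space := fun n i => avg (δ i.2.1) (g n i.1.1) i.2.2
  choose! B hB using havg
  have hcomp : IsCompact (univ.pi fun i : ι => Metric.closedBall (0 : Space) (B i.1.1 (δ i.2.1))) :=
    isCompact_univ_pi fun i => isCompact_closedBall _ _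
  obtain ⟨a, -, σ, hσ, hconv⟩ := hcomp.tendsto_subseq (x := X) fun n i _ =>
    mem_closedBall_zero_iff.2 (hB _ i.1.2 _ (hδ0 _) n i.2.2)
  have hrat : ∀ q : ℚ, (q : ℝ) ∈ S → ∀ m k,
      CauchySeq fun n => avg (δ m) (g (σ n) q) k := fun q hq m k =>
    ((tendsto_pi_nhds.1 hconv) (⟨q, hq⟩, m, k)).cauchySeq
  have hcau : ∀ t ∈ S, ∀ m k, CauchySeq fun n => avg (δ m) (g (σ n) t) k := by
    intro t ht m k
    refine cauchySeq_of_approx fun ε hε => ?_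
    obtain ⟨q, hq, hqε⟩ := htime t ht (ε * δ m) (mul_pos hε (hδ0 m))
    refine ⟨_, hrat q hq m k, fun n => ?_⟩
    rw [← avg_sub (hδ0 m) (hgt _ _) (hgt _ _) (hb _ _) (hb _ _)]
    refine (norm_avg_le_of_eLpNorm (hδ0 m) ((hgt _ _).sub (hgt _ _))
      (mul_pos hε (hδ0 m)).le (hqε _) k).trans (le_of_eq ?_)
    rw [mul_div_cancel_right₀ _ (hδ0 m).ne']
  let A : ℝ → ℕ → Grid → Space := fun t m k =>
    limUnder atTop fun n => avg (δ m) (g (σ n) t) k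
  refine ⟨σ, fun t => dyadicLimit (A t), hσ, ?_, fun t ht R => ?_⟩
  -- The limit is an iterated pointwise limit of functions measurable in time and space, which gives
  -- joint measurability of a representative.
  · refine StronglyMeasurable.limUnder fun m => ?_
    refine StronglyMeasurable.limUnder fun n => ?_
    have h1 : ∀ k, Measurable fun t => avg (δ m) (g (σ n) t) k := fun k =>
      ((StronglyMeasurable.integral_prod_right (ν := volume.restrict (cellIndex (δ m) ⁻¹' {k}))
        (hmeas (σ n))).const_smul ((δ m ^ 2)⁻¹)).measurable
    have h2 : Measurable fun q : ℝ × Grid => avg (δ m) (g (σ n) q.1) q.2 :=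
      measurable_from_prod_countable_left h1
    exact (h2.comp (measurable_fst.prodMk
      ((measurable_cellIndex (δ m)).comp measurable_snd))).stronglyMeasurable
  · exact tendsto_of_tendsto_avg (fun n => hgt (σ n) t) (fun n => hb _ _)
      (h0.comp hσ.tendsto_atTop) (fun n => hpos _) (hD t ht) (fun n z => hincr t ht _ z)
      (fun m k => tendsto_nhds_limUnder (cauchySeq_tendsto_of_complete (hcau t ht m k))) R

/-! ### Sequences of flows -/

/-- A sequence of grid functions with steps `h n → 0` and the a priori estimates of the flow. -/
structure FlowSeq (N : Set Space) (h : ℕ → ℝ) (u : ℕ → ℝ → Grid → Space) : Prop where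
  pos : ∀ n, 0 < h n
  lim : Tendsto h atTop (𝓝 0)
  mem : ∀ n t, 0 ≤ t → ∀ j, u n t j ∈ N
  cont : ∀ n j, ContinuousOn (fun t => u n t j) (Ici 0)
  bounds : ∀ n, FlowBounds (h n) (u n)

theorem FlowSeq.comp {N : Set Space} {h : ℕ → ℝ} {u : ℕ → ℝ → Grid → Space} (H : FlowSeq N h u)
    {σ : ℕ → ℕ} (hσ : StrictMono σ) : FlowSeq N (h ∘ σ) (u ∘ σ) where
  pos n := H.pos _
  lim := H.lim.comp hσ.tendsto_atTop
  mem n := H.mem _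
  cont n := H.cont _
  bounds n := H.bounds _

theorem gsq_smul (c : ℝ) (v : Grid → Space) :
    gsq (fun j => c • v j) = ENNReal.ofReal (c ^ 2) * gsq v := by
  rw [gsq, gsq, ← ENNReal.tsum_mul_left]
  refine tsum_congr fun j => ?_
  rw [enorm_smul, mul_pow, enorm_sq_eq_ofReal c, Real.norm_eq_abs, sq_abs]

theorem eLpNorm_pc_le {h : ℝ} (hh : 0 < h) {v : Grid → Space} {K : ℝ} (hK : 0 ≤ K)
    (hv : ENNReal.ofReal (h ^ 2) * gsq v ≤ ENNReal.ofReal (K ^ 2)) :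
    eLpNorm (pc h v) 2 volume ≤ ENNReal.ofReal K := by
  rw [← ENNReal.pow_le_pow_left_iff two_ne_zero, eLpNorm_pc_sq hh, ← ENNReal.ofReal_pow hK]
  exact hv

/-- The discrete partial derivative of a grid function, as a function on the plane. -/
noncomputable def pcD (h : ℝ) (i : Fin 2) (v : Grid → Space) : Plane → Space :=
  pc h (forwardDiff h i v)

theorem forwardDiff_eq (h : ℝ) (i : Fin 2) (v : Grid → Space) :
    forwardDiff h i v = fun j => h⁻¹ • dif i v j := rfl

theorem ofReal_sq_mul_gsq_inv_smul {h : ℝ} (hh : 0 < h) (v : Grid → Space) :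
    ENNReal.ofReal (h ^ 2) * gsq (fun j => h⁻¹ • v j) = gsq v := by
  rw [gsq_smul, ← mul_assoc, ← ENNReal.ofReal_mul (by positivity)]
  have : h ^ 2 * h⁻¹ ^ 2 = 1 := by field_simp
  rw [this, ENNReal.ofReal_one, one_mul]

theorem eLpNorm_pcD_sq {h : ℝ} (hh : 0 < h) (i : Fin 2) (v : Grid → Space) :
    eLpNorm (pcD h i v) 2 volume ^ 2 = gsq (dif i v) := by
  rw [pcD, eLpNorm_pc_sq hh, forwardDiff_eq, ofReal_sq_mul_gsq_inv_smul hh]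

theorem dif_smul (i : Fin 2) (c : ℝ) (v : Grid → Space) :
    dif i (fun j => c • v j) = fun j => c • dif i v j := by
  funext j; simp [dif, smul_sub]

section
variable {N : Set Space} {h : ℕ → ℝ} {u : ℕ → ℝ → Grid → Space}

/-- Nothing is known at negative times; freezing the solution at its initial value there gives a
function measurable on the whole line. -/
theorem FlowSeq.measurable_comp (H : FlowSeq N h u) (n : ℕ) (j : Grid) :
    Measurable fun t => u n (max t 0) j := by
  refine Continuous.measurable ?_
  exact (H.cont n j).comp_continuous (continuous_id.max continuous_const) fun t =>
    mem_Ici.2 (le_max_right _ _)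

theorem stronglyMeasurable_uncurry_pc {h : ℝ} {v : ℝ → Grid → Space}
    (hv : ∀ j, Measurable fun t => v t j) :
    StronglyMeasurable (Function.uncurry fun t => pc h (v t)) := by
  have h2 : Measurable fun q : ℝ × Grid => v q.1 q.2 := measurable_from_prod_countable_left hv
  exact (h2.comp (measurable_fst.prodMk
    ((measurable_cellIndex h).comp measurable_snd))).stronglyMeasurable

/-- Translations are controlled by the energy alone, so compactness of the maps includes the initial
time. -/
theorem FlowSeq.exists_limit_map (hN : IsCompact N) (H : FlowSeq N h u) :
    ∃ (σ : ℕ → ℕ) (V : ℝ → Plane → Space), StrictMono σ ∧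
      StronglyMeasurable (Function.uncurry V) ∧ ∀ t, 0 ≤ t → ∀ R,
        Tendsto (fun n => eLpNorm (fun x => pc (h (σ n)) (u (σ n) t) x - V t x) 2
          (volume.restrict (Metric.ball 0 R))) atTop (𝓝 0) := by
  obtain ⟨B, hB⟩ := hN.isBounded.exists_norm_le
  have hb : ∀ n t x, ‖pc (h n) (u n (max t 0)) x‖ ≤ B := fun n t x =>
    hB _ (H.mem n _ (le_max_right _ _) _)
  have key : ∃ (σ : ℕ → ℕ) (V : ℝ → Plane → Space), StrictMono σ ∧
      StronglyMeasurable (Function.uncurry V) ∧ ∀ t ∈ Ici (0 : ℝ), ∀ R,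
        Tendsto (fun n => eLpNorm (fun x => pc (h (σ n)) (u (σ n) (max t 0)) x - V t x) 2
          (volume.restrict (Metric.ball 0 R))) atTop (𝓝 0) := by
   refine exists_subseq_tendsto_dyadicLimit
    (g := fun n t => pc (h n) (u n (max t 0))) (S := Ici 0) (h := h) (D := fun _ => 4)
    (fun n => stronglyMeasurable_uncurry_pc (H.measurable_comp n)) (fun n t => ⟨B, hb n t⟩)
    H.lim H.pos (fun _ _ => by norm_num) (fun t ht n z => ?_)
    (fun t ht δ hδ => ⟨B, fun n k => norm_avg_le hδ (hb n t) k⟩) (fun t ht ε hε => ?_)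
   · rw [max_eq_left (mem_Ici.1 ht)]
     refine (incr_pc_le (H.pos n) _ (D := 2) (by norm_num) (fun i => ?_) z).trans
       (le_of_eq (by ring_nf))
     exact ((H.bounds n).energy t ht i).trans (by norm_num)
   · rw [mem_Ici] at ht
     -- The squared `L²` distance at times `t` and `q` is at most `4 * |t - q|`; a rational to the
     -- right of `t` stays in the half line.
     obtain ⟨q, hq1, hq2⟩ := exists_rat_btwn (show t < t + ε ^ 2 / 4 by linarith [sq_pos_of_pos hε])
     refine ⟨q, mem_Ici.2 (ht.trans hq1.le), fun n => ?_⟩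
     rw [max_eq_left ht, max_eq_left (ht.trans hq1.le)]
     refine eLpNorm_pc_le (H.pos n) (v := fun j => u n t j - u n q j) hε.le ?_
     refine ((H.bounds n).time q t (ht.trans hq1.le) ht).trans (ENNReal.ofReal_le_ofReal ?_)
     rw [abs_sub_comm, abs_of_pos (by linarith)]
     linarith
  obtain ⟨σ, V, hσ, hV, hlim⟩ := key
  refine ⟨σ, V, hσ, hV, fun t ht R => ?_⟩
  have := hlim t ht R
  simpa only [max_eq_left ht] using this

/-- Translations of difference quotients are controlled by the second differences, whose bound blows
up at the initial time; hence the restriction to positive times. -/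
theorem FlowSeq.exists_limit_grad (hN : IsCompact N) (H : FlowSeq N h u) (i : Fin 2) :
    ∃ (σ : ℕ → ℕ) (V : ℝ → Plane → Space), StrictMono σ ∧
      StronglyMeasurable (Function.uncurry V) ∧ ∀ t, 0 < t → ∀ R,
        Tendsto (fun n => eLpNorm (fun x => pcD (h (σ n)) i (u (σ n) t) x - V t x) 2
          (volume.restrict (Metric.ball 0 R))) atTop (𝓝 0) := by
  obtain ⟨B, hB⟩ := hN.isBounded.exists_norm_le
  have hb : ∀ n t x, ‖pcD (h n) i (u n (max t 0)) x‖ ≤ |(h n)⁻¹| * (B + B) := fun n t x => by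
    rw [pcD, pc, forwardDiff, norm_smul, Real.norm_eq_abs]
    gcongr
    exact norm_sub_le_of_le (hB _ (H.mem n _ (le_max_right _ _) _))
      (hB _ (H.mem n _ (le_max_right _ _) _))
  have hm : ∀ n, StronglyMeasurable
      (Function.uncurry fun t => pcD (h n) i (u n (max t 0))) := fun n =>
    stronglyMeasurable_uncurry_pc fun j =>
      ((H.measurable_comp n (j + unitIndex i)).sub (H.measurable_comp n j)).const_smul (h n)⁻¹
  have key : ∃ (σ : ℕ → ℕ) (V : ℝ → Plane → Space), StrictMono σ ∧
      StronglyMeasurable (Function.uncurry V) ∧ ∀ t ∈ Ioi (0 : ℝ), ∀ R,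
        Tendsto (fun n => eLpNorm (fun x => pcD (h (σ n)) i (u (σ n) (max t 0)) x - V t x) 2
          (volume.restrict (Metric.ball 0 R))) atTop (𝓝 0) := by
   refine exists_subseq_tendsto_dyadicLimit
    (g := fun n t => pcD (h n) i (u n (max t 0))) (S := Ioi 0) (h := h)
    (D := fun t => 2 * √(8 / t))
    hm (fun n t => ⟨_, hb n t⟩)
    H.lim H.pos (fun _ _ => by positivity) (fun t ht n z => ?_)
    (fun t ht δ hδ => ⟨2 / δ, fun n k => ?_⟩) (fun t ht ε hε => ?_)
   · rw [mem_Ioi] at ht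
     have hh := H.pos n
     rw [max_eq_left ht.le]
     refine (incr_pc_le hh _ (D := √(8 / t)) (by positivity) (fun k => ?_) z).trans
       (le_of_eq (by ring_nf))
     rw [forwardDiff_eq, dif_smul, gsq_smul, Real.sq_sqrt (by positivity)]
     refine (mul_le_mul_right ((H.bounds n).hessian t ht i k) _).trans (le_of_eq ?_)
     rw [← ENNReal.ofReal_mul (by positivity)]
     congr 1; field_simp
   · rw [mem_Ioi] at ht
     rw [max_eq_left ht.le]
     refine norm_avg_le_of_eLpNorm hδ (stronglyMeasurable_pc _ _) (by norm_num) ?_ k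
     rw [← ENNReal.pow_le_pow_left_iff two_ne_zero, ← pcD, eLpNorm_pcD_sq (H.pos n),
       ← ENNReal.ofReal_pow (by norm_num)]
     exact ((H.bounds n).energy t ht.le i).trans (by norm_num)
   · rw [mem_Ioi] at ht
     set c : ℝ := 2 * √(8 / t) + 1 with hc
     have hc0 : 0 < c := by positivity
     -- Chosen so that `√(4 * η) = ε ^ 2 / c`. A rational time later than `t` does not increase the
     -- factor `√(8 / t)`.
     set η : ℝ := (ε ^ 2 / c) ^ 2 / 4 with hη
     have hη0 : 0 < η := by positivity
     obtain ⟨q, hq1, hq2⟩ := exists_rat_btwn (show t < t + η by linarith)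
     refine ⟨q, mem_Ioi.2 (ht.trans hq1), fun n => ?_⟩
     rw [max_eq_left ht.le, max_eq_left (ht.trans hq1).le]
     have e : (fun x => pcD (h n) i (u n t) x - pcD (h n) i (u n q) x) =
         pc (h n) (fun j => (h n)⁻¹ • (dif i (u n t) j - dif i (u n q) j)) := by
       funext x; simp only [pcD, pc, forwardDiff_eq, smul_sub]
     rw [e]
     refine eLpNorm_pc_le (H.pos n) hε.le ?_
     rw [ofReal_sq_mul_gsq_inv_smul (H.pos n)]
     refine ((H.bounds n).time_grad q t (ht.trans hq1) ht i).trans (ENNReal.ofReal_le_ofReal ?_)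
     have h1 : √(4 * |t - q|) ≤ ε ^ 2 / c := by
       rw [Real.sqrt_le_left (by positivity), abs_sub_comm, abs_of_pos (by linarith)]
       linarith
     have h2 : √(8 / q) ≤ √(8 / t) := Real.sqrt_le_sqrt (by gcongr)
     calc √(4 * |t - q|) * (√(8 / t) + √(8 / q)) ≤ ε ^ 2 / c * c := by
           gcongr; rw [hc]; linarith
       _ = ε ^ 2 := div_mul_cancel₀ _ hc0.ne'
  obtain ⟨σ, V, hσ, hV, hlim⟩ := key
  refine ⟨σ, V, hσ, hV, fun t ht R => ?_⟩
  have := hlim t ht R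
  simpa only [max_eq_left ht.le] using this

/-- A sequence of flows that converges, together with its first derivatives, in `L²_loc`. -/
structure FlowLimit (N : Set Space) (h : ℕ → ℝ) (u : ℕ → ℝ → Grid → Space)
    (p : ℝ → Plane → Space) (G : Fin 2 → ℝ → Plane → Space) : Prop extends FlowSeq N h u where
  meas : StronglyMeasurable (Function.uncurry p)
  meas_grad : ∀ i, StronglyMeasurable (Function.uncurry (G i))
  tendsto : ∀ t, 0 ≤ t → ∀ R, Tendsto (fun n => eLpNorm (fun x => pc (h n) (u n t) x - p t x) 2
    (volume.restrict (Metric.ball 0 R))) atTop (𝓝 0)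
  tendsto_grad : ∀ i t, 0 < t → ∀ R, Tendsto (fun n => eLpNorm
    (fun x => pcD (h n) i (u n t) x - G i t x) 2 (volume.restrict (Metric.ball 0 R))) atTop (𝓝 0)

theorem FlowSeq.exists_flowLimit (hN : IsCompact N) (H : FlowSeq N h u) :
    ∃ (σ : ℕ → ℕ) (p : ℝ → Plane → Space) (G : Fin 2 → ℝ → Plane → Space), StrictMono σ ∧
      FlowLimit N (h ∘ σ) (u ∘ σ) p G := by
  obtain ⟨σ, p, hσ, hp, hplim⟩ := H.exists_limit_map hN
  obtain ⟨σ₀, G₀, hσ₀, hG₀, hlim₀⟩ := (H.comp hσ).exists_limit_grad hN 0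
  obtain ⟨σ₁, G₁, hσ₁, hG₁, hlim₁⟩ := ((H.comp hσ).comp hσ₀).exists_limit_grad hN 1
  refine ⟨σ ∘ σ₀ ∘ σ₁, p, ![G₀, G₁], hσ.comp (hσ₀.comp hσ₁),
    { toFlowSeq := H.comp (hσ.comp (hσ₀.comp hσ₁))
      meas := hp
      meas_grad := fun i => by fin_cases i <;> assumption
      tendsto := fun t ht R => (hplim t ht R).comp (hσ₀.comp hσ₁).tendsto_atTop
      tendsto_grad := fun i t ht R => ?_ }⟩
  fin_cases i
  · exact (hlim₀ t ht R).comp hσ₁.tendsto_atTop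
  · exact hlim₁ t ht R

end

/-! ### The weak gradient of the interpolant -/

/-- The piecewise linear interpolant of a sequence with step `h`. -/
noncomputable def linInterp (h : ℝ) (a : ℤ → Space) (r : ℝ) : Space :=
  a ⌊r / h⌋ + (r - ⌊r / h⌋ * h) • h⁻¹ • (a (⌊r / h⌋ + 1) - a ⌊r / h⌋)

/-- The formula of a cell remains valid at its right end, where the floor already belongs to the
next cell. This is the continuity of the interpolant. -/
theorem linInterp_eq_of_mem {h : ℝ} (hh : 0 < h) (a : ℤ → Space) {m : ℤ} {r : ℝ}
    (hr : r ∈ Icc (m * h) (m * h + h)) :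
    linInterp h a r = a m + (r - m * h) • h⁻¹ • (a (m + 1) - a m) := by
  rcases eq_or_lt_of_le hr.2 with h1 | h1
  · have : r / h = (m + 1 : ℤ) := by rw [h1]; push_cast; field_simp
    rw [linInterp, this, Int.floor_intCast, h1, smul_smul, smul_smul]
    have e1 : (↑m * h + h - ↑(m + 1) * h) * h⁻¹ = 0 := by push_cast; ring
    have e2 : (↑m * h + h - ↑m * h) * h⁻¹ = 1 := by field_simp; ring
    rw [e1, e2]; simp
  · have : ⌊r / h⌋ = m := by
      rw [Int.floor_eq_iff, le_div_iff₀ hh, div_lt_iff₀ hh]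
      exact ⟨hr.1, by linarith⟩
    rw [linInterp, this]

theorem hasDerivAt_affine (a b : Space) (c r : ℝ) :
    HasDerivAt (fun r : ℝ => a + (r - c) • b) b r := by
  simpa using (((hasDerivAt_id r).sub_const c).smul_const b).const_add a

theorem linInterp_right {h : ℝ} (hh : 0 < h) (a : ℤ → Space) (r : ℝ) :
    HasDerivWithinAt (linInterp h a) (h⁻¹ • (a (⌊r / h⌋ + 1) - a ⌊r / h⌋)) (Ici r) r := by
  set m := ⌊r / h⌋ with hm
  have h1 : m * h ≤ r := (le_div_iff₀ hh).1 (Int.floor_le _)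
  have h2 : r < m * h + h := by
    have := (div_lt_iff₀ hh).1 (Int.lt_floor_add_one (r / h)); rw [← hm] at this; linarith
  refine ((hasDerivAt_affine (a m) (h⁻¹ • (a (m + 1) - a m)) (m * h) r).hasDerivWithinAt
    ).congr_of_eventuallyEq_of_mem ?_ self_mem_Ici
  filter_upwards [Icc_mem_nhdsGE h2] with s hs
  exact linInterp_eq_of_mem hh a ⟨h1.trans hs.1, hs.2⟩

theorem continuous_linInterp {h : ℝ} (hh : 0 < h) (a : ℤ → Space) :
    Continuous (linInterp h a) := by
  refine continuous_iff_continuousAt.2 fun r => continuousAt_iff_continuous_left_right.2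
    ⟨?_, (linInterp_right hh a r).continuousWithinAt⟩
  -- The cell approached from the left, that is, the one with `m * h < r ≤ m * h + h`.
  set m := ⌈r / h⌉ - 1 with hm
  have h1 : m * h < r := by
    rw [← lt_div_iff₀ hh, hm]; push_cast; linarith [Int.ceil_lt_add_one (r / h)]
  have h2 : r ≤ m * h + h := by
    have := (div_le_iff₀ hh).1 (Int.le_ceil (r / h)); rw [hm]; push_cast; linarith
  refine (hasDerivAt_affine (a m) (h⁻¹ • (a (m + 1) - a m)) (m * h) r).continuousAt
    |>.continuousWithinAt.congr_of_eventuallyEq_of_mem ?_ self_mem_Iic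
  filter_upwards [Icc_mem_nhdsLE h1] with s hs
  exact linInterp_eq_of_mem hh a ⟨hs.1, hs.2.trans h2⟩

/-- The offset of the `i`-th coordinate in its grid cell. -/
noncomputable def cellFrac (h : ℝ) (i : Fin 2) (x : Plane) : ℝ := x i - cellIndex h x i * h

theorem measurable_cellFrac (h : ℝ) (i : Fin 2) : Measurable (cellFrac h i) := by
  have h1 : Measurable fun x : Plane => (cellIndex h x i : ℝ) :=
    (measurable_of_countable fun k : Grid => (k i : ℝ)).comp (measurable_cellIndex h)
  have h2 : Measurable fun x : Plane => x i := by fun_prop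
  exact h2.sub (h1.mul_const h)

theorem cellFrac_nonneg {h : ℝ} (hh : 0 < h) (i : Fin 2) (x : Plane) : 0 ≤ cellFrac h i x := by
  have := ((cellIndex_eq_iff hh x _).1 rfl i).1
  rw [cellFrac]; linarith

theorem cellFrac_le {h : ℝ} (hh : 0 < h) (i : Fin 2) (x : Plane) : cellFrac h i x ≤ h := by
  have := ((cellIndex_eq_iff hh x _).1 rfl i).2
  rw [cellFrac]; linarith

/-- The gradient of the bilinear interpolant. -/
noncomputable def interpGrad (h : ℝ) (u : Grid → Space) (i : Fin 2) (x : Plane) : Space :=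
  pcD h i u x + cellFrac h i.rev x • pc h (forwardDiff h i (forwardDiff h i.rev u)) x

theorem forwardDiff_comm (h : ℝ) (i k : Fin 2) (u : Grid → Space) :
    forwardDiff h i (forwardDiff h k u) = forwardDiff h k (forwardDiff h i u) := by
  funext j
  simp only [forwardDiff]
  rw [← smul_sub, ← smul_sub, add_right_comm j]
  congr 2; abel

/-- Bilinearity with one coordinate singled out: in the `i`-th coordinate the interpolant is affine
on each cell, and its slope is `interpGrad h u i`. -/
theorem interpolant_eq (h : ℝ) (u : Grid → Space) (i : Fin 2) (x : Plane) :
    interpolant h u x = pc h u x + cellFrac h i.rev x • pcD h i.rev u x +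
      cellFrac h i x • interpGrad h u i x := by
  fin_cases i
  · simp only [interpolant, interpGrad, pc, pcD, cellFrac, smul_add, smul_smul]
    simp only [Fin.rev, Fin.zero_eta, Fin.isValue]
    simp
    abel
  · simp only [interpolant, interpGrad, pc, pcD, cellFrac, smul_add, smul_smul]
    simp only [Fin.rev, Fin.mk_one, Fin.isValue]
    simp
    rw [forwardDiff_comm h 1 0, mul_comm (x.ofLp 1 - _)]
    abel

theorem measurable_interpGrad (h : ℝ) (u : Grid → Space) (i : Fin 2) :
    Measurable (interpGrad h u i) :=
  (measurable_pc _ _).add ((measurable_cellFrac _ _).smul (measurable_pc _ _))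

theorem measurable_interpolant (h : ℝ) (u : Grid → Space) : Measurable (interpolant h u) := by
  have : interpolant h u = fun x => pc h u x + cellFrac h 1 x • pcD h 1 u x +
      cellFrac h 0 x • interpGrad h u 0 x := funext fun x => interpolant_eq h u 0 x
  rw [this]
  exact ((measurable_pc _ _).add ((measurable_cellFrac _ _).smul (measurable_pc _ _))).add
    ((measurable_cellFrac _ _).smul (measurable_interpGrad _ _ _))

theorem cellIndex_add_smul (h : ℝ) (x : Plane) (i : Fin 2) (s : ℝ) :
    cellIndex h (x + s • EuclideanSpace.single i 1) =
      Function.update (cellIndex h x) i ⌊(x i + s) / h⌋ := by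
  funext k
  by_cases hk : k = i
  · subst hk; simp [cellIndex]
  · simp [cellIndex, hk]

theorem cellFrac_rev_add_smul (h : ℝ) (x : Plane) (i : Fin 2) (s : ℝ) :
    cellFrac h i.rev (x + s • EuclideanSpace.single i 1) = cellFrac h i.rev x := by
  have hi : i.rev ≠ i := by fin_cases i <;> decide
  rw [cellFrac, cellFrac, cellIndex_add_smul, Function.update_of_ne hi]
  simp [hi]

theorem update_add_unitIndex (k : Grid) (i : Fin 2) (m : ℤ) :
    Function.update k i m + unitIndex i = Function.update k i (m + 1) := by
  funext l
  by_cases hl : l = i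
  · subst hl; simp [unitIndex]
  · simp [unitIndex, hl]

theorem interpGrad_line (h : ℝ) (u : Grid → Space) (i : Fin 2) (x : Plane) (s : ℝ) :
    let a : ℤ → Space := fun m => u (Function.update (cellIndex h x) i m) + cellFrac h i.rev x •
      forwardDiff h i.rev u (Function.update (cellIndex h x) i m)
    interpGrad h u i (x + s • EuclideanSpace.single i 1) =
      h⁻¹ • (a (⌊(x i + s) / h⌋ + 1) - a ⌊(x i + s) / h⌋) := by
  intro a
  rw [interpGrad, cellFrac_rev_add_smul, pcD, pc, pc, cellIndex_add_smul]
  simp only [a, ← update_add_unitIndex]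
  rw [forwardDiff, forwardDiff, smul_comm (cellFrac _ _ _), ← smul_add, smul_sub]
  congr 1; abel

/-- On a line parallel to an axis the transverse offset is constant, so the bilinear interpolant is
a piecewise linear one in a single variable. Continuity and the right derivative follow from the
one-dimensional facts. -/
theorem interpolant_line (h : ℝ) (u : Grid → Space) (i : Fin 2) (x : Plane) (s : ℝ) :
    interpolant h u (x + s • EuclideanSpace.single i 1) = linInterp h
      (fun m => u (Function.update (cellIndex h x) i m) + cellFrac h i.rev x •
        forwardDiff h i.rev u (Function.update (cellIndex h x) i m)) (x i + s) := by
  rw [interpolant_eq h u i, interpGrad_line, cellFrac_rev_add_smul, linInterp, pcD, pc, pc,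
    cellIndex_add_smul]
  congr 2
  rw [cellFrac, cellIndex_add_smul]
  simp

theorem continuous_interpolant_line {h : ℝ} (hh : 0 < h) (u : Grid → Space) (i : Fin 2)
    (x : Plane) : Continuous fun s : ℝ => interpolant h u (x + s • EuclideanSpace.single i 1) := by
  simp only [interpolant_line]
  exact (continuous_linInterp hh _).comp (continuous_const.add continuous_id)

theorem hasDerivWithinAt_interpolant_line {h : ℝ} (hh : 0 < h) (u : Grid → Space) (i : Fin 2)
    (x : Plane) (s : ℝ) :
    HasDerivWithinAt (fun s : ℝ => interpolant h u (x + s • EuclideanSpace.single i 1))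
      (interpGrad h u i (x + s • EuclideanSpace.single i 1)) (Ici s) s := by
  simp only [interpolant_line, interpGrad_line]
  have h1 : HasDerivWithinAt (fun s : ℝ => x i + s) 1 (Ici s) s :=
    ((hasDerivAt_id s).const_add _).hasDerivWithinAt
  have h2 := (linInterp_right hh (fun m => u (Function.update (cellIndex h x) i m) +
    cellFrac h i.rev x • forwardDiff h i.rev u (Function.update (cellIndex h x) i m))
    (x i + s)).scomp s h1 (fun r hr => by simpa using hr)
  rw [one_smul] at h2
  exact h2

/-- A function whose integrals over unit segments in a fixed direction are the increments of an
integrable function has integral zero. -/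
theorem integral_eq_zero_of_segments {F H : Plane → Space} (hF : Integrable F) (hH : Integrable H)
    (e : Plane) (hFH : ∀ x, ∫ s in (0 : ℝ)..1, F (x + s • e) = H (x + e) - H x)
    (hm : Measurable F) : ∫ x, F x = 0 := by
  have hint : Integrable (Function.uncurry fun (x : Plane) (s : ℝ) => F (x + s • e))
      (volume.prod (volume.restrict (Ioc (0 : ℝ) 1))) := by
    have hsm : Measurable (Function.uncurry fun (x : Plane) (s : ℝ) => F (x + s • e)) :=
      hm.comp (measurable_fst.add (measurable_snd.smul_const e))
    rw [integrable_prod_iff' hsm.aestronglyMeasurable]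
    refine ⟨Eventually.of_forall fun s => hF.comp_add_right (s • e), ?_⟩
    have : (fun s : ℝ => ∫ x, ‖Function.uncurry (fun (x : Plane) (s : ℝ) => F (x + s • e)) (x, s)‖)
        = fun _ => ∫ x, ‖F x‖ := by
      funext s
      exact integral_add_right_eq_self (μ := volume) (fun x => ‖F x‖) (s • e)
    rw [this]
    exact integrable_const _
  -- Integrating over `x` first, translation invariance gives the integral of `F` for every `s`;
  -- integrating over `s` first gives two integrals of `H` that cancel.
  have h1 := integral_integral_swap hint
  have h2 : ∀ s : ℝ, ∫ x, F (x + s • e) = ∫ x, F x := fun s =>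
    integral_add_right_eq_self (μ := volume) F (s • e)
  simp only [h2, setIntegral_const] at h1
  have h3 : ∀ x, ∫ s in Ioc (0 : ℝ) 1, F (x + s • e) = H (x + e) - H x := fun x => by
    rw [← hFH, intervalIntegral.integral_of_le zero_le_one]
  simp only [h3] at h1
  rw [integral_sub (hH.comp_add_right e) hH, integral_add_right_eq_self (μ := volume) H e,
    sub_self] at h1
  simpa using h1.symm

theorem exists_norm_interpGrad_le {h : ℝ} (hh : 0 < h) {u : Grid → Space} {B : ℝ}
    (hu : ∀ j, ‖u j‖ ≤ B) (i : Fin 2) : ∃ C, ∀ x, ‖interpGrad h u i x‖ ≤ C := by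
  have h1 : ∀ {v : Grid → Space} {B : ℝ} (k : Fin 2), (∀ j, ‖v j‖ ≤ B) →
      ∀ j, ‖forwardDiff h k v j‖ ≤ h⁻¹ * (B + B) := fun k hv j => by
    rw [forwardDiff, norm_smul, norm_inv, Real.norm_of_nonneg hh.le]
    gcongr
    exact norm_sub_le_of_le (hv _) (hv _)
  refine ⟨h⁻¹ * (B + B) + h * (h⁻¹ * (h⁻¹ * (B + B) + h⁻¹ * (B + B))), fun x => ?_⟩
  refine norm_add_le_of_le (h1 _ hu _) ?_
  rw [norm_smul, Real.norm_of_nonneg (cellFrac_nonneg hh _ _)]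
  exact mul_le_mul (cellFrac_le hh _ _) (h1 _ (h1 _ hu) _) (norm_nonneg _) hh.le

theorem exists_norm_interpolant_le {h : ℝ} (hh : 0 < h) {u : Grid → Space} {B : ℝ}
    (hu : ∀ j, ‖u j‖ ≤ B) : ∃ C, ∀ x, ‖interpolant h u x‖ ≤ C := by
  obtain ⟨C, hC⟩ := exists_norm_interpGrad_le hh hu 0
  refine ⟨B + h * (h⁻¹ * (B + B)) + h * C, fun x => ?_⟩
  rw [interpolant_eq h u 0]
  refine norm_add_le_of_le (norm_add_le_of_le (hu _) ?_) ?_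
  · rw [norm_smul, Real.norm_of_nonneg (cellFrac_nonneg hh _ _)]
    refine mul_le_mul (cellFrac_le hh _ _) ?_ (norm_nonneg _) hh.le
    rw [pcD, pc, forwardDiff, norm_smul, norm_inv, Real.norm_of_nonneg hh.le]
    gcongr
    exact norm_sub_le_of_le (hu _) (hu _)
  · rw [norm_smul, Real.norm_of_nonneg (cellFrac_nonneg hh _ _)]
    exact mul_le_mul (cellFrac_le hh _ _) (hC _) (norm_nonneg _) hh.le

theorem locallyIntegrable_of_bounded {F : Plane → Space} (hm : Measurable F) {C : ℝ}
    (hC : ∀ x, ‖F x‖ ≤ C) : LocallyIntegrable F := by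
  refine (locallyIntegrable_const (μ := volume) (C : ℝ)).mono hm.aestronglyMeasurable
    (Eventually.of_forall fun x => (hC x).trans (le_abs_self C))

theorem integrable_smul_of_bounded {ψ : Plane → ℝ} (hψ : Continuous ψ) (hs : HasCompactSupport ψ)
    {F : Plane → Space} (hF : LocallyIntegrable F) : Integrable fun x => ψ x • F x :=
  hF.integrable_smul_left_of_hasCompactSupport hψ hs

/-- The product of test function and interpolant is continuous on lines parallel to the axes and has
a right derivative everywhere. The fundamental theorem on unit segments, averaged over all
positions, replaces a summation of boundary terms over cells. -/
theorem hasWeakGradient_interpolant {h : ℝ} (hh : 0 < h) {u : Grid → Space} {B : ℝ}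
    (hu : ∀ j, ‖u j‖ ≤ B) : HasWeakGradient univ (interpolant h u) (interpGrad h u) := by
  obtain ⟨C, hC⟩ := exists_norm_interpolant_le hh hu
  have hq := locallyIntegrable_of_bounded (measurable_interpolant h u) hC
  have hg : ∀ i, LocallyIntegrable (interpGrad h u i) := fun i =>
    locallyIntegrable_of_bounded (measurable_interpGrad h u i)
      (exists_norm_interpGrad_le hh hu i).choose_spec
  refine ⟨locallyIntegrableOn_univ.2 hq, fun i => locallyIntegrableOn_univ.2 (hg i),
    fun i φ hφ hφs _ => ?_⟩
  set e : Plane := EuclideanSpace.single i 1 with he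
  have hc1 : Continuous fun x => fderiv ℝ φ x e :=
    (hφ.continuous_fderiv (by simp)).clm_apply continuous_const
  have hs1 : HasCompactSupport fun x => fderiv ℝ φ x e := hφs.fderiv_apply ℝ e
  have i1 := integrable_smul_of_bounded hc1 hs1 hq
  have i2 := integrable_smul_of_bounded hφ.continuous hφs (hg i)
  have hm1 : Measurable fun x => fderiv ℝ φ x e • interpolant h u x :=
    hc1.measurable.smul (measurable_interpolant h u)
  have hm2 : Measurable fun x => φ x • interpGrad h u i x :=
    hφ.continuous.measurable.smul (measurable_interpGrad h u i)
  obtain ⟨C', hC'⟩ := exists_norm_interpGrad_le hh hu i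
  obtain ⟨M1, hM1⟩ := hc1.bounded_above_of_compact_support hs1
  obtain ⟨M2, hM2⟩ := hφ.continuous.bounded_above_of_compact_support hφs
  have key := integral_eq_zero_of_segments (i1.add i2)
    (integrable_smul_of_bounded hφ.continuous hφs hq) e (fun x => ?_) (hm1.add hm2)
  · simp only [Pi.add_apply] at key
    rw [integral_add i1 i2] at key
    exact eq_neg_of_add_eq_zero_left key
  · have hd : ∀ s : ℝ, HasDerivAt (fun s : ℝ => φ (x + s • e)) (fderiv ℝ φ (x + s • e) e) s :=
      fun s => by
        have h1 : HasDerivAt (fun s : ℝ => x + s • e) e s := by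
          simpa using ((hasDerivAt_id s).smul_const e).const_add x
        exact ((hφ.differentiable (by simp)) _).hasFDerivAt.comp_hasDerivAt s h1
    have hcl : Continuous fun s : ℝ => φ (x + s • e) :=
      hφ.continuous.comp (by fun_prop)
    have := intervalIntegral.integral_eq_sub_of_hasDeriv_right (a := 0) (b := 1)
      (f := fun s : ℝ => φ (x + s • e) • interpolant h u (x + s • e))
      (f' := fun s : ℝ => fderiv ℝ φ (x + s • e) e • interpolant h u (x + s • e) +
        φ (x + s • e) • interpGrad h u i (x + s • e))
      (hcl.smul (continuous_interpolant_line hh u i x)).continuousOn (fun s _ => ?_) ?_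
    · simpa using this
    · have h1 := (hd s).hasDerivWithinAt.smul
        ((hasDerivWithinAt_interpolant_line hh u i x s).mono Ioi_subset_Ici_self)
      refine h1.congr_deriv (add_comm _ _)
    · refine (intervalIntegrable_const (c := M1 * C + M2 * C')).mono_fun
        ((hm1.add hm2).comp (by fun_prop : Measurable fun s : ℝ => x + s • e)).aestronglyMeasurable
        (Eventually.of_forall fun s => ?_)
      refine le_trans (norm_add_le_of_le ?_ ?_) (le_abs_self _)
      · rw [norm_smul]
        exact mul_le_mul (hM1 _) (hC _) (norm_nonneg _) ((norm_nonneg _).trans (hM1 0))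
      · rw [norm_smul]
        exact mul_le_mul (hM2 _) (hC' _) (norm_nonneg _) ((norm_nonneg _).trans (hM2 0))

/-! ### Comparison of the two interpolants -/

theorem eLpNorm_smul_le_of_abs_le {c : Plane → ℝ} {f : Plane → Space} {C : ℝ}
    (hc : ∀ x, |c x| ≤ C) (μ : Measure Plane) :
    eLpNorm (fun x => c x • f x) 2 μ ≤ ENNReal.ofReal C * eLpNorm f 2 μ := by
  refine eLpNorm_le_mul_eLpNorm_of_ae_le_mul (Eventually.of_forall fun x => ?_) 2
  rw [norm_smul, Real.norm_eq_abs]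
  exact mul_le_mul_of_nonneg_right (hc x) (norm_nonneg _)

theorem abs_cellFrac_le {h : ℝ} (hh : 0 < h) (i : Fin 2) (x : Plane) : |cellFrac h i x| ≤ h := by
  rw [abs_of_nonneg (cellFrac_nonneg hh i x)]; exact cellFrac_le hh i x

theorem eLpNorm_pcD_le {h : ℝ} (hh : 0 < h) {u : Grid → Space} {D : ℝ} (hD : 0 ≤ D)
    (hu : ∀ i, gsq (dif i u) ≤ ENNReal.ofReal (D ^ 2)) (i : Fin 2) :
    eLpNorm (pcD h i u) 2 volume ≤ ENNReal.ofReal D := by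
  rw [← ENNReal.pow_le_pow_left_iff two_ne_zero, eLpNorm_pcD_sq hh, ← ENNReal.ofReal_pow hD]
  exact hu i

/-- The mixed difference is `h⁻¹` times the difference of a first quotient and its translate, and
the offset in front is at most `h`. So the energy alone suffices, and the bound holds at the initial
time as well. -/
theorem eLpNorm_interpGrad_le {h : ℝ} (hh : 0 < h) {u : Grid → Space} {D : ℝ} (hD : 0 ≤ D)
    (hu : ∀ i, gsq (dif i u) ≤ ENNReal.ofReal (D ^ 2)) (i : Fin 2) :
    eLpNorm (interpGrad h u i) 2 volume ≤ ENNReal.ofReal (3 * D) := by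
  have hP := eLpNorm_pcD_le hh hD hu
  have hm := fun i => aesm_pc h (forwardDiff h i u) volume
  have e : interpGrad h u i = pcD h i u + fun x => (cellFrac h i.rev x / h) •
      (pcD h i.rev u (x + h • EuclideanSpace.single i 1) - pcD h i.rev u x) := by
    funext x
    rw [Pi.add_apply, interpGrad, pcD, pcD, pc_add_smul_unit hh]
    simp only [pc]
    rw [show forwardDiff h i (forwardDiff h i.rev u) (cellIndex h x) = h⁻¹ •
      (forwardDiff h i.rev u (cellIndex h x + unitIndex i) -
        forwardDiff h i.rev u (cellIndex h x)) from rfl, smul_smul, ← div_eq_mul_inv]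
  have h2 : eLpNorm (fun x => (cellFrac h i.rev x / h) •
      (pcD h i.rev u (x + h • EuclideanSpace.single i 1) - pcD h i.rev u x)) 2 volume ≤
      ENNReal.ofReal D + ENNReal.ofReal D := by
    refine (eLpNorm_smul_le_of_abs_le (C := 1) (fun x => ?_) _).trans ?_
    · rw [abs_div, abs_of_pos hh, div_le_one hh]; exact abs_cellFrac_le hh _ _
    · rw [ENNReal.ofReal_one, one_mul]
      refine (eLpNorm_sub_le (aesm_comp_add (hm _) _) (hm _) (by norm_num)).trans ?_
      rw [eLpNorm_comp_add (hm _)]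
      exact add_le_add (hP _) (hP _)
  have hm2 : AEStronglyMeasurable (fun x => (cellFrac h i.rev x / h) •
      (pcD h i.rev u (x + h • EuclideanSpace.single i 1) - pcD h i.rev u x)) volume :=
    ((measurable_cellFrac h i.rev).div_const h).aestronglyMeasurable.smul
      ((aesm_comp_add (hm _) _).sub (hm _))
  rw [e]
  refine (eLpNorm_add_le (hm _) hm2 (by norm_num)).trans
    ((add_le_add (hP i) h2).trans (le_of_eq ?_))
  rw [← ENNReal.ofReal_add hD hD, ← ENNReal.ofReal_add hD (by positivity)]
  congr 1; ring

theorem eLpNorm_interpolant_sub_pc_le {h : ℝ} (hh : 0 < h) {u : Grid → Space} {D : ℝ} (hD : 0 ≤ D)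
    (hu : ∀ i, gsq (dif i u) ≤ ENNReal.ofReal (D ^ 2)) :
    eLpNorm (fun x => interpolant h u x - pc h u x) 2 volume ≤ ENNReal.ofReal (4 * D * h) := by
  have e : (fun x => interpolant h u x - pc h u x) = (fun x => cellFrac h 1 x • pcD h 1 u x) +
      fun x => cellFrac h 0 x • interpGrad h u 0 x := by
    funext x
    rw [interpolant_eq h u 0]
    simp [add_assoc]
  rw [e]
  refine (eLpNorm_add_le ((measurable_cellFrac h 1).aestronglyMeasurable.smul (aesm_pc _ _ _))
    ((measurable_cellFrac h 0).smul (measurable_interpGrad h u 0)).aestronglyMeasurable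
    (by norm_num)).trans ?_
  refine (add_le_add ((eLpNorm_smul_le_of_abs_le (abs_cellFrac_le hh 1) _).trans
    (mul_le_mul_right (eLpNorm_pcD_le hh hD hu 1) _))
    ((eLpNorm_smul_le_of_abs_le (abs_cellFrac_le hh 0) _).trans
    (mul_le_mul_right (eLpNorm_interpGrad_le hh hD hu 0) _))).trans (le_of_eq ?_)
  rw [← ENNReal.ofReal_mul hh.le, ← ENNReal.ofReal_mul hh.le,
    ← ENNReal.ofReal_add (by positivity) (by positivity)]
  congr 1; ring

/-- The two gradients differ by an offset of size `h` times the mixed second quotient, so here the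
second order bound at positive times is used. -/
theorem eLpNorm_interpGrad_sub_pcD_le {h : ℝ} (hh : 0 < h) {u : Grid → Space} {K : ℝ} (hK : 0 ≤ K)
    (hu : ∀ i k, gsq (dif k (dif i u)) ≤ ENNReal.ofReal (h ^ 2 * K ^ 2)) (i : Fin 2) :
    eLpNorm (fun x => interpGrad h u i x - pcD h i u x) 2 volume ≤ ENNReal.ofReal (K * h) := by
  have e : (fun x => interpGrad h u i x - pcD h i u x) = fun x => cellFrac h i.rev x •
      pc h (forwardDiff h i (forwardDiff h i.rev u)) x := by
    funext x; simp [interpGrad]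
  rw [e]
  refine (eLpNorm_smul_le_of_abs_le (abs_cellFrac_le hh _) _).trans ?_
  rw [mul_comm K, ENNReal.ofReal_mul hh.le]
  refine mul_le_mul_right (eLpNorm_pc_le hh hK ?_) _
  rw [forwardDiff_eq, ofReal_sq_mul_gsq_inv_smul hh, forwardDiff_eq, dif_smul, gsq_smul]
  refine (mul_le_mul_right (hu _ _) _).trans (le_of_eq ?_)
  rw [← ENNReal.ofReal_mul (by positivity)]
  congr 1; field_simp

/-! ### Limits of weak gradients -/

theorem tendsto_integral_of_norm_sub_le {E : Type*} [NormedAddCommGroup E] [NormedSpace ℝ E]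
    {a : ℕ → Plane → E} {b : Plane → E} {q : ℕ → Plane → Space} {p : Plane → Space} {M R : ℝ}
    (ha : ∀ n, Integrable (a n)) (hb : AEStronglyMeasurable b)
    (hq : ∀ n, AEStronglyMeasurable (fun x => q n x - p x) (volume.restrict (Metric.ball 0 R)))
    (hle : ∀ n x, ‖a n x - b x‖ ≤ M * ‖q n x - p x‖)
    (hout : ∀ n, ∀ x ∉ Metric.ball (0 : Plane) R, a n x = b x)
    (hlim : Tendsto (fun n => eLpNorm (fun x => q n x - p x) 2
      (volume.restrict (Metric.ball 0 R))) atTop (𝓝 0)) :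
    Tendsto (fun n => ∫ x, a n x) atTop (𝓝 (∫ x, b x)) := by
  set V : ℝ≥0∞ := (volume.restrict (Metric.ball (0 : Plane) R)) univ ^ (1 / (1 : ℝ≥0∞).toReal -
    1 / (2 : ℝ≥0∞).toReal) with hV
  have hVtop : V ≠ ⊤ := by
    refine ENNReal.rpow_ne_top_of_nonneg (by norm_num) ?_
    rw [Measure.restrict_apply_univ]; exact measure_ball_lt_top.ne
  refine tendsto_integral_of_L1' b hb (Eventually.of_forall ha) ?_
  refine tendsto_of_tendsto_of_tendsto_of_le_of_le tendsto_const_nhds (h := fun n =>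
    ENNReal.ofReal M * (eLpNorm (fun x => q n x - p x) 2 (volume.restrict (Metric.ball 0 R)) * V))
    ?_ (fun _ => zero_le) fun n => ?_
  · have := ENNReal.Tendsto.const_mul (ENNReal.Tendsto.mul_const hlim (Or.inr hVtop))
      (Or.inr (ENNReal.ofReal_ne_top (r := M)))
    simpa using this
  · have h1 : eLpNorm (a n - b) 1 volume =
        eLpNorm (a n - b) 1 (volume.restrict (Metric.ball 0 R)) := by
      rw [← eLpNorm_indicator_eq_eLpNorm_restrict measurableSet_ball]
      congr 1
      refine (indicator_eq_self.2 fun x hx => ?_).symm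
      by_contra hx'
      exact hx (by simp [hout n x hx'])
    show eLpNorm (a n - b) 1 volume ≤ _
    rw [h1]
    refine (eLpNorm_le_mul_eLpNorm_of_ae_le_mul (g := fun x => q n x - p x) (c := M)
      (Eventually.of_forall fun x => hle n x) 1).trans ?_
    exact mul_le_mul_right (eLpNorm_le_eLpNorm_mul_rpow_measure_univ (by norm_num) (hq n)) _

theorem HasWeakGradient.mono {Ω Ω' : Set Plane} {u : Plane → Space} {g : Fin 2 → Plane → Space}
    (H : HasWeakGradient Ω u g) (h : Ω' ⊆ Ω) : HasWeakGradient Ω' u g where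
  locInt := H.locInt.mono_set h
  locInt_grad i := (H.locInt_grad i).mono_set h
  weak i φ hφ hs hΩ := H.weak i φ hφ hs (hΩ.trans h)

theorem locallyIntegrable_of_tendsto {q : ℕ → Plane → Space} {p : Plane → Space}
    (hq : ∀ n R, MemLp (q n) 2 (volume.restrict (Metric.ball 0 R))) (hp : AEStronglyMeasurable p)
    (hlim : ∀ R, Tendsto (fun n => eLpNorm (fun x => q n x - p x) 2
      (volume.restrict (Metric.ball 0 R))) atTop (𝓝 0)) : LocallyIntegrable p := by
  rw [locallyIntegrable_iff]
  intro K hK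
  obtain ⟨R, hR⟩ := hK.isBounded.subset_ball 0
  obtain ⟨n, hn⟩ := ((ENNReal.tendsto_nhds_zero.1 (hlim R)) 1 (by norm_num)).exists
  have h1 : MemLp (fun x => q n x - p x) 2 (volume.restrict (Metric.ball 0 R)) :=
    ⟨(hq n R).1.sub hp.restrict, hn.trans_lt ENNReal.one_lt_top⟩
  have h2 : MemLp p 2 (volume.restrict (Metric.ball 0 R)) := by
    have := (hq n R).sub h1
    refine this.ae_eq (Eventually.of_forall fun x => by simp)
  have : IsFiniteMeasure (volume.restrict (Metric.ball (0 : Plane) R)) :=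
    ⟨by rw [Measure.restrict_apply_univ]; exact measure_ball_lt_top⟩
  exact IntegrableOn.mono_set (h2.integrable (by norm_num)) hR

theorem tendsto_integral_smul {q : ℕ → Plane → Space} {p : Plane → Space}
    (hq : ∀ n, LocallyIntegrable (q n)) (hp : AEStronglyMeasurable p)
    (hlim : ∀ R, Tendsto (fun n => eLpNorm (fun x => q n x - p x) 2
      (volume.restrict (Metric.ball 0 R))) atTop (𝓝 0))
    {ψ : Plane → ℝ} (hψ : Continuous ψ) (hs : HasCompactSupport ψ) :
    Tendsto (fun n => ∫ x, ψ x • q n x) atTop (𝓝 (∫ x, ψ x • p x)) := by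
  obtain ⟨R, hR⟩ := hs.isCompact.isBounded.subset_ball 0
  obtain ⟨M, hM⟩ := hψ.bounded_above_of_compact_support hs
  refine tendsto_integral_of_norm_sub_le (R := R) (M := M)
    (fun n => integrable_smul_of_bounded hψ hs (hq n))
    (hψ.aestronglyMeasurable.smul hp) (fun n => ((hq n).aestronglyMeasurable.sub hp).restrict)
    (fun n x => ?_) (fun n x hx => ?_) (hlim R)
  · rw [← smul_sub, norm_smul]
    exact mul_le_mul_of_nonneg_right (hM x) (norm_nonneg _)
  · have : ψ x = 0 := by
      by_contra h0
      exact hx (hR (subset_tsupport _ h0))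
    simp [this]

theorem hasWeakGradient_of_tendsto {q : ℕ → Plane → Space} {p : Plane → Space}
    {Dq : ℕ → Fin 2 → Plane → Space} {G : Fin 2 → Plane → Space}
    (H : ∀ n, HasWeakGradient univ (q n) (Dq n)) (hp : LocallyIntegrable p)
    (hG : ∀ i, LocallyIntegrable (G i))
    (hlim : ∀ R, Tendsto (fun n => eLpNorm (fun x => q n x - p x) 2
      (volume.restrict (Metric.ball 0 R))) atTop (𝓝 0))
    (hlimG : ∀ i R, Tendsto (fun n => eLpNorm (fun x => Dq n i x - G i x) 2
      (volume.restrict (Metric.ball 0 R))) atTop (𝓝 0)) : HasWeakGradient univ p G where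
  locInt := locallyIntegrableOn_univ.2 hp
  locInt_grad i := locallyIntegrableOn_univ.2 (hG i)
  weak i φ hφ hs hΩ := by
    have hc1 : Continuous fun x => fderiv ℝ φ x (EuclideanSpace.single i 1) :=
      (hφ.continuous_fderiv (by simp)).clm_apply continuous_const
    have h1 := tendsto_integral_smul (fun n => locallyIntegrableOn_univ.1 (H n).locInt)
      hp.aestronglyMeasurable hlim hc1 (hs.fderiv_apply ℝ _)
    have h2 := tendsto_integral_smul (fun n => locallyIntegrableOn_univ.1 ((H n).locInt_grad i))
      (hG i).aestronglyMeasurable (hlimG i) hφ.continuous hs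
    refine tendsto_nhds_unique h1 (h2.neg.congr fun n => ?_)
    exact ((H n).weak i φ hφ hs hΩ).symm

/-- The fundamental lemma of the calculus of variations. It identifies the abstract weak gradients
in the hypothesis of global convergence with `interpGrad`. -/
theorem HasWeakGradient.ae_eq {u : Plane → Space} {g g' : Fin 2 → Plane → Space}
    (H : HasWeakGradient univ u g) (H' : HasWeakGradient univ u g') (i : Fin 2) :
    g i =ᵐ[volume] g' i := by
  have h1 := locallyIntegrableOn_univ.1 (H.locInt_grad i)
  have h2 := locallyIntegrableOn_univ.1 (H'.locInt_grad i)
  have := ae_eq_zero_of_integral_contDiff_smul_eq_zero (h1.sub h2) fun φ hφ hs => by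
    simp only [Pi.sub_apply, smul_sub]
    rw [integral_sub (integrable_smul_of_bounded hφ.continuous hs h1)
      (integrable_smul_of_bounded hφ.continuous hs h2)]
    have e1 := H.weak i φ hφ hs (subset_univ _)
    have e2 := H'.weak i φ hφ hs (subset_univ _)
    rw [sub_eq_zero, ← neg_inj, ← e1, e2]
  filter_upwards [this] with x hx
  exact sub_eq_zero.1 hx

/-! ### Local convergence of the interpolants -/

section
variable {N : Set Space} {h : ℕ → ℝ} {u : ℕ → ℝ → Grid → Space} {p : ℝ → Plane → Space}
  {G : Fin 2 → ℝ → Plane → Space}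

theorem FlowSeq.energy (H : FlowSeq N h u) (n : ℕ) {t : ℝ} (ht : 0 ≤ t) (i : Fin 2) :
    gsq (dif i (u n t)) ≤ ENNReal.ofReal (2 ^ 2) :=
  ((H.bounds n).energy t ht i).trans (by norm_num)

theorem tendsto_ofReal_mul_zero {h : ℕ → ℝ} (h0 : Tendsto h atTop (𝓝 0)) (c : ℝ) :
    Tendsto (fun n => ENNReal.ofReal (c * h n)) atTop (𝓝 0) := by
  simpa using ENNReal.tendsto_ofReal (h0.const_mul c)

theorem FlowSeq.tendsto_interpolant_sub (H : FlowSeq N h u) {t : ℝ} (ht : 0 ≤ t) :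
    Tendsto (fun n => eLpNorm (fun x => interpolant (h n) (u n t) x - pc (h n) (u n t) x) 2 volume)
      atTop (𝓝 0) :=
  tendsto_of_tendsto_of_tendsto_of_le_of_le tendsto_const_nhds
    (tendsto_ofReal_mul_zero H.lim (4 * 2)) (fun _ => zero_le) fun n =>
      eLpNorm_interpolant_sub_pc_le (H.pos n) (by norm_num) (H.energy n ht)

theorem FlowSeq.tendsto_interpGrad_sub (H : FlowSeq N h u) {t : ℝ} (ht : 0 < t) (i : Fin 2) :
    Tendsto (fun n => eLpNorm (fun x => interpGrad (h n) (u n t) i x -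
      pcD (h n) i (u n t) x) 2 volume) atTop (𝓝 0) :=
  tendsto_of_tendsto_of_tendsto_of_le_of_le tendsto_const_nhds
    (tendsto_ofReal_mul_zero H.lim √(8 / t)) (fun _ => zero_le) fun n =>
      eLpNorm_interpGrad_sub_pcD_le (H.pos n) (by positivity) (fun i k => by
        rw [Real.sq_sqrt (by positivity)]
        exact ((H.bounds n).hessian t ht i k).trans (le_of_eq (by ring_nf))) i

/-- Convergence is not affected by a perturbation that tends to zero in `L²`. -/
theorem tendsto_eLpNorm_of_sub {q q' : ℕ → Plane → Space} {p : Plane → Space} {μ : Measure Plane}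
    (hq : ∀ n, AEStronglyMeasurable (q n) μ) (hq' : ∀ n, AEStronglyMeasurable (q' n) μ)
    (hp : AEStronglyMeasurable p μ)
    (h1 : Tendsto (fun n => eLpNorm (fun x => q n x - q' n x) 2 volume) atTop (𝓝 0))
    (hμ : μ ≤ volume)
    (h2 : Tendsto (fun n => eLpNorm (fun x => q' n x - p x) 2 μ) atTop (𝓝 0)) :
    Tendsto (fun n => eLpNorm (fun x => q n x - p x) 2 μ) atTop (𝓝 0) := by
  have h3 := h1.add h2
  rw [add_zero] at h3
  refine tendsto_of_tendsto_of_tendsto_of_le_of_le tendsto_const_nhds h3 (fun _ => zero_le)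
    fun n => ?_
  have e : (fun x => q n x - p x) = (fun x => q n x - q' n x) + fun x => q' n x - p x := by
    funext x; simp
  rw [e]
  exact (eLpNorm_add_le ((hq n).sub (hq' n)) ((hq' n).sub hp) (by norm_num)).trans
    (add_le_add (eLpNorm_mono_measure _ hμ) le_rfl)

theorem FlowLimit.aesm (H : FlowLimit N h u p G) (t : ℝ) (μ : Measure Plane) :
    AEStronglyMeasurable (p t) μ :=
  (H.meas.comp_measurable measurable_prodMk_left).aestronglyMeasurable

theorem FlowLimit.aesm_grad (H : FlowLimit N h u p G) (i : Fin 2) (t : ℝ) (μ : Measure Plane) :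
    AEStronglyMeasurable (G i t) μ :=
  ((H.meas_grad i).comp_measurable measurable_prodMk_left).aestronglyMeasurable

theorem aesm_interpolant (h : ℝ) (u : Grid → Space) (μ : Measure Plane) :
    AEStronglyMeasurable (interpolant h u) μ := (measurable_interpolant h u).aestronglyMeasurable

theorem aesm_interpGrad (h : ℝ) (u : Grid → Space) (i : Fin 2) (μ : Measure Plane) :
    AEStronglyMeasurable (interpGrad h u i) μ := (measurable_interpGrad h u i).aestronglyMeasurable

theorem FlowLimit.tendsto_interpolant (H : FlowLimit N h u p G) {t : ℝ} (ht : 0 ≤ t) (R : ℝ) :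
    Tendsto (fun n => eLpNorm (fun x => interpolant (h n) (u n t) x - p t x) 2
      (volume.restrict (Metric.ball 0 R))) atTop (𝓝 0) :=
  tendsto_eLpNorm_of_sub (fun n => aesm_interpolant _ _ _) (fun n => aesm_pc _ _ _) (H.aesm _ _)
    (H.tendsto_interpolant_sub ht) Measure.restrict_le_self (H.tendsto t ht R)

theorem FlowLimit.tendsto_interpGrad (H : FlowLimit N h u p G) {t : ℝ} (ht : 0 < t) (i : Fin 2)
    (R : ℝ) : Tendsto (fun n => eLpNorm (fun x => interpGrad (h n) (u n t) i x - G i t x) 2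
      (volume.restrict (Metric.ball 0 R))) atTop (𝓝 0) :=
  tendsto_eLpNorm_of_sub (fun n => aesm_interpGrad _ _ _ _) (fun n => aesm_pc _ _ _)
    (H.aesm_grad _ _ _) (H.tendsto_interpGrad_sub ht i) Measure.restrict_le_self
    (H.tendsto_grad i t ht R)

theorem FlowSeq.hasWeakGradient_interpolant (hN : IsCompact N) (H : FlowSeq N h u) (n : ℕ) {t : ℝ}
    (ht : 0 ≤ t) :
    HasWeakGradient univ (interpolant (h n) (u n t)) (interpGrad (h n) (u n t)) := by
  obtain ⟨B, hB⟩ := hN.isBounded.exists_norm_le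
  exact HarmonicFlow.hasWeakGradient_interpolant (H.pos n) fun j => hB _ (H.mem n t ht j)

theorem memLp_pcD {h : ℝ} (hh : 0 < h) {u : Grid → Space} {D : ℝ} (hD : 0 ≤ D)
    (hu : ∀ i, gsq (dif i u) ≤ ENNReal.ofReal (D ^ 2)) (i : Fin 2) : MemLp (pcD h i u) 2 :=
  ⟨aesm_pc _ _ _, (eLpNorm_pcD_le hh hD hu i).trans_lt ENNReal.ofReal_lt_top⟩

theorem FlowLimit.locallyIntegrable (hN : IsCompact N) (H : FlowLimit N h u p G) {t : ℝ}
    (ht : 0 ≤ t) : LocallyIntegrable (p t) := by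
  obtain ⟨B, hB⟩ := hN.isBounded.exists_norm_le
  refine locallyIntegrable_of_tendsto (fun n R => ?_) (H.aesm t _) (H.tendsto t ht)
  have : IsFiniteMeasure (volume.restrict (Metric.ball (0 : Plane) R)) :=
    ⟨by rw [Measure.restrict_apply_univ]; exact measure_ball_lt_top⟩
  exact MemLp.of_bound (aesm_pc _ _ _) B (Eventually.of_forall fun x => hB _ (H.mem n t ht _))

theorem FlowLimit.locallyIntegrable_grad (H : FlowLimit N h u p G) (i : Fin 2) {t : ℝ}
    (ht : 0 < t) : LocallyIntegrable (G i t) :=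
  locallyIntegrable_of_tendsto
    (fun n R => (memLp_pcD (H.pos n) (by norm_num) (H.energy n ht.le) i).restrict _)
    (H.aesm_grad i t _) (H.tendsto_grad i t ht)

theorem FlowLimit.hasWeakGradient (hN : IsCompact N) (H : FlowLimit N h u p G) {t : ℝ}
    (ht : 0 < t) : HasWeakGradient univ (p t) (fun i => G i t) :=
  hasWeakGradient_of_tendsto (fun n => H.hasWeakGradient_interpolant hN n ht.le)
    (H.locallyIntegrable hN ht.le) (fun i => H.locallyIntegrable_grad i ht)
    (H.tendsto_interpolant ht.le) (H.tendsto_interpGrad ht)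

theorem FlowLimit.tendstoInH1_ball (hN : IsCompact N) (H : FlowLimit N h u p G) {t : ℝ}
    (ht : 0 < t) (R : ℝ) :
    TendstoInH1 (Metric.ball 0 R) (fun n => interpolant (h n) (u n t)) (p t) :=
  ⟨fun n => interpGrad (h n) (u n t), fun i => G i t,
    fun n => (H.hasWeakGradient_interpolant hN n ht.le).mono (subset_univ _),
    (H.hasWeakGradient hN ht).mono (subset_univ _),
    ⟨fun n => aesm_interpolant _ _ _, H.aesm _ _, H.tendsto_interpolant ht.le R⟩,
    fun i => ⟨fun n => aesm_interpGrad _ _ _ _, H.aesm_grad _ _ _, H.tendsto_interpGrad ht i R⟩⟩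

end

/-! ### Global convergence -/

theorem eLpNorm_le_restrict_add_compl {f : Plane → Space} (hf : AEStronglyMeasurable f)
    {s : Set Plane} (hs : MeasurableSet s) :
    eLpNorm f 2 volume ≤ eLpNorm f 2 (volume.restrict s) + eLpNorm f 2 (volume.restrict sᶜ) := by
  rw [← eLpNorm_indicator_eq_eLpNorm_restrict hs, ← eLpNorm_indicator_eq_eLpNorm_restrict hs.compl]
  calc eLpNorm f 2 volume = eLpNorm (s.indicator f + sᶜ.indicator f) 2 volume := by
        rw [indicator_self_add_compl]
    _ ≤ _ := eLpNorm_add_le (hf.indicator hs) (hf.indicator hs.compl) (by norm_num)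

theorem eLpNorm_restrict_le_of_forall_ball {f : Plane → Space} {S : Set Plane} {ε : ℝ≥0∞}
    (hS : MeasurableSet S)
    (h : ∀ R : ℝ, eLpNorm f 2 (volume.restrict (Metric.ball 0 R ∩ S)) ≤ ε) :
    eLpNorm f 2 (volume.restrict S) ≤ ε := by
  rw [← ENNReal.pow_le_pow_left_iff two_ne_zero, eLpNorm_two_sq]
  have e : volume.restrict S =
      (volume.restrict S).restrict (⋃ n : ℕ, Metric.ball (0 : Plane) n) := by
    rw [Metric.iUnion_ball_nat, Measure.restrict_univ]
  have hmono : Monotone fun n : ℕ => Metric.ball (0 : Plane) n := fun m n hmn =>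
    Metric.ball_subset_ball (by exact_mod_cast hmn)
  rw [e, setLIntegral_iUnion_of_directed _ hmono.directed_le]
  refine iSup_le fun n => ?_
  rw [Measure.restrict_restrict measurableSet_ball, ← eLpNorm_two_sq]
  exact pow_le_pow_left₀ zero_le (h n) 2

/-- Local `L²` convergence and uniform smallness at infinity give global convergence. -/
theorem tendsto_eLpNorm_of_tight {g : ℕ → Plane → Space} {p : Plane → Space}
    (hg : ∀ n, AEStronglyMeasurable (g n)) (hp : AEStronglyMeasurable p)
    (hlim : ∀ R, Tendsto (fun n => eLpNorm (fun x => g n x - p x) 2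
      (volume.restrict (Metric.ball 0 R))) atTop (𝓝 0))
    (ht : ∀ ε > 0, ∃ R, ∀ᶠ n in atTop,
      eLpNorm (g n) 2 (volume.restrict (Metric.ball 0 R)ᶜ) ≤ ε) :
    Tendsto (fun n => eLpNorm (fun x => g n x - p x) 2 volume) atTop (𝓝 0) := by
  rw [ENNReal.tendsto_nhds_zero]
  intro ε hε
  have hε3 : 0 < ε / 3 := ENNReal.div_pos hε.ne' (by norm_num)
  obtain ⟨R, hR⟩ := ht _ hε3
  set S : Set Plane := (Metric.ball 0 R)ᶜ with hS
  have hSm : MeasurableSet S := measurableSet_ball.compl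
  -- The limit inherits the tail bound: it holds on every bounded piece by local convergence, hence
  -- on the whole complement by exhaustion.
  have hpS : eLpNorm p 2 (volume.restrict S) ≤ ε / 3 := by
    refine eLpNorm_restrict_le_of_forall_ball hSm fun R' => ?_
    have h1 : Tendsto (fun n => eLpNorm (fun x => g n x - p x) 2
        (volume.restrict (Metric.ball 0 R')) + ε / 3) atTop (𝓝 (0 + ε / 3)) :=
      (hlim R').add tendsto_const_nhds
    rw [zero_add] at h1
    refine ge_of_tendsto h1 ?_
    filter_upwards [hR] with n hn
    have e : p = g n - fun x => g n x - p x := by funext x; simp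
    calc eLpNorm p 2 (volume.restrict (Metric.ball 0 R' ∩ S))
        = eLpNorm (g n - fun x => g n x - p x) 2 (volume.restrict (Metric.ball 0 R' ∩ S)) := by
          rw [← e]
      _ ≤ eLpNorm (g n) 2 (volume.restrict (Metric.ball 0 R' ∩ S)) +
          eLpNorm (fun x => g n x - p x) 2 (volume.restrict (Metric.ball 0 R' ∩ S)) :=
        eLpNorm_sub_le (hg n).restrict ((hg n).sub hp).restrict (by norm_num)
      _ ≤ ε / 3 + eLpNorm (fun x => g n x - p x) 2 (volume.restrict (Metric.ball 0 R')) :=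
        add_le_add ((eLpNorm_mono_measure _ (Measure.restrict_mono inter_subset_right le_rfl)).trans
          hn) (eLpNorm_mono_measure _ (Measure.restrict_mono inter_subset_left le_rfl))
      _ = _ := add_comm _ _
  filter_upwards [hR, (ENNReal.tendsto_nhds_zero.1 (hlim R)) _ hε3] with n hn1 hn2
  refine (eLpNorm_le_restrict_add_compl ((hg n).sub hp) (measurableSet_ball (x := 0) (ε := R))).trans
    ?_
  refine (add_le_add hn2 ((eLpNorm_sub_le (hg n).restrict hp.restrict (by norm_num)).trans
    (add_le_add hn1 hpS))).trans (le_of_eq ?_)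
  rw [← add_assoc, ENNReal.add_thirds]

theorem exists_eLpNorm_compl_ball_le {f : Plane → Space} (hf : MemLp f 2) {ε : ℝ≥0∞} (hε : 0 < ε) :
    ∃ R₀ : ℝ, ∀ R ≥ R₀, eLpNorm f 2 (volume.restrict (Metric.ball 0 R)ᶜ) ≤ ε := by
  have hfin : ∫⁻ x, ‖f x‖ₑ ^ 2 ≠ ⊤ := by
    rw [← eLpNorm_two_sq]; exact ENNReal.pow_ne_top hf.2.ne
  have h1 : Tendsto (fun n : ℕ => ∫⁻ x in (Metric.ball (0 : Plane) n)ᶜ, ‖f x‖ₑ ^ 2) atTop (𝓝 0) := by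
    have h2 := tendsto_lintegral_of_dominated_convergence' (μ := volume)
      (F := fun (n : ℕ) => ((Metric.ball (0 : Plane) n)ᶜ).indicator fun x => ‖f x‖ₑ ^ 2)
      (f := fun _ => 0) (fun x => ‖f x‖ₑ ^ 2)
      (fun n => (hf.1.enorm.pow_const 2).indicator measurableSet_ball.compl)
      (fun n => Eventually.of_forall fun x => indicator_le_self _ _ x) hfin
      (Eventually.of_forall fun x => ?_)
    · simp only [lintegral_zero, lintegral_indicator measurableSet_ball.compl] at h2
      exact h2
    · obtain ⟨n, hn⟩ := exists_nat_gt ‖x‖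
      refine tendsto_const_nhds.congr' ?_
      filter_upwards [eventually_ge_atTop n] with m hm
      rw [indicator_of_notMem]
      simp only [mem_compl_iff, mem_ball_zero_iff, not_not]
      exact hn.trans_le (by exact_mod_cast hm)
  obtain ⟨n, hn⟩ := ((ENNReal.tendsto_nhds_zero.1 h1) (ε ^ 2) (by positivity)).exists
  refine ⟨n, fun R hR => ?_⟩
  refine (eLpNorm_mono_measure _ (Measure.restrict_mono (compl_subset_compl.2
    (Metric.ball_subset_ball hR)) le_rfl)).trans ?_
  rwa [← ENNReal.pow_le_pow_left_iff two_ne_zero, eLpNorm_two_sq]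

/-! ### The gradient of the interpolant controls the difference quotients -/

/-- An affine function of `c` cannot be small throughout the interval: if the slope is at most `4 *
‖a‖ / h`, its norm is still at least `‖a‖ / 2` near zero, and otherwise the slope dominates beyond
the midpoint. -/
theorem exists_le_norm_add_smul (a b : Space) {h : ℝ} (hh : 0 < h) :
    ∃ α : ℝ, 0 ≤ α ∧ α + 1 / 8 ≤ 1 ∧
      ∀ c ∈ Ico (α * h) (α * h + h / 8), ‖a‖ / 2 ≤ ‖a + c • b‖ := by
  rcases le_total (‖b‖ * h) (4 * ‖a‖) with h1 | h1
  · refine ⟨0, le_rfl, by norm_num, fun c hc => ?_⟩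
    have h2 := norm_sub_norm_le a (-(c • b))
    rw [sub_neg_eq_add, norm_neg, norm_smul, Real.norm_of_nonneg (by linarith [hc.1])] at h2
    have h3 : c * ‖b‖ ≤ h / 8 * ‖b‖ := by
      have := hc.2; gcongr; linarith
    linarith
  · refine ⟨1 / 2, by norm_num, by norm_num, fun c hc => ?_⟩
    have h2 := norm_sub_norm_le (c • b) (-a)
    rw [sub_neg_eq_add, norm_neg, norm_smul, Real.norm_of_nonneg (by linarith [hc.1]),
      add_comm] at h2
    have h3 : 1 / 2 * h * ‖b‖ ≤ c * ‖b‖ := by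
      have := hc.1; gcongr
    linarith [norm_nonneg a]

/-- On a cell the gradient is `a` plus the transverse offset times `b`. It has norm at least `‖a‖ /
2` on a strip of area `h ^ 2 / 8`, and the product of the two factors gives 32. In this way tail
bounds for the interpolated initial data reach the grid. -/
theorem enorm_dif_sq_le {h : ℝ} (hh : 0 < h) (u : Grid → Space) (i : Fin 2) (j : Grid) :
    ‖dif i u j‖ₑ ^ 2 ≤ 32 * ∫⁻ x in cellIndex h ⁻¹' {j}, ‖interpGrad h u i x‖ₑ ^ 2 := by
  set a := forwardDiff h i u j with ha
  set b := forwardDiff h i (forwardDiff h i.rev u) j with hb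
  obtain ⟨α, hα0, hα1, hα⟩ := exists_le_norm_add_smul a b hh
  have hi : i ≠ i.rev := by fin_cases i <;> decide
  set lo : Fin 2 → ℝ := fun k => if k = i then j k * h else j k * h + α * h with hlo
  set hi' : Fin 2 → ℝ := fun k => if k = i then j k * h + h else j k * h + α * h + h / 8 with hhi
  set Q : Set Plane := {x : Plane | ∀ k, x k ∈ Ico (lo k) (hi' k)} with hQ
  have hQv : volume Q = ENNReal.ofReal (h ^ 2 / 8) := by
    rw [hQ, volume_rect]
    have e1 : ENNReal.ofReal (hi' i - lo i) = ENNReal.ofReal h := by simp [hlo, hhi]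
    have e2 : ENNReal.ofReal (hi' i.rev - lo i.rev) = ENNReal.ofReal (h / 8) := by
      simp [hlo, hhi, hi.symm]
    have e3 : ∏ k, ENNReal.ofReal (hi' k - lo k) =
        ENNReal.ofReal (hi' i - lo i) * ENNReal.ofReal (hi' i.rev - lo i.rev) := by
      rw [Fin.prod_univ_two]
      fin_cases i
      · rfl
      · exact mul_comm _ _
    rw [e3, e1, e2, ← ENNReal.ofReal_mul hh.le]
    congr 1; ring
  have hQc : Q ⊆ cellIndex h ⁻¹' {j} := fun x hx => by
    refine (cellIndex_eq_iff hh x j).2 fun k => ?_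
    have hk := hx k
    by_cases hki : k = i
    · simpa [hlo, hhi, hki] using hk
    · simp only [hlo, hhi, hki, if_false, mem_Ico] at hk ⊢
      have : 0 ≤ α * h := by positivity
      have h8 : (α + 1 / 8) * h ≤ 1 * h := by gcongr
      constructor <;> linarith
  have hQx : ∀ x ∈ Q, ENNReal.ofReal (‖a‖ ^ 2 / 4) ≤ ‖interpGrad h u i x‖ₑ ^ 2 := fun x hx => by
    have hc : cellIndex h x = j := hQc hx
    rw [enorm_sq_eq_ofReal]
    refine ENNReal.ofReal_le_ofReal ?_
    rw [interpGrad, pcD, pc, pc, hc, ← ha, ← hb]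
    have h1 := hα (cellFrac h i.rev x) (by
      have hk := hx i.rev
      simp only [hlo, hhi, hi.symm, if_false, mem_Ico] at hk
      rw [cellFrac, hc, mem_Ico]
      constructor <;> linarith [hk.1, hk.2])
    calc ‖a‖ ^ 2 / 4 = (‖a‖ / 2) ^ 2 := by ring
      _ ≤ _ := by gcongr
  have e0 : ‖dif i u j‖ₑ ^ 2 = 32 * (ENNReal.ofReal (‖a‖ ^ 2 / 4) * volume Q) := by
    rw [hQv, ← ENNReal.ofReal_mul (by positivity), show (32 : ℝ≥0∞) = ENNReal.ofReal 32 by simp,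
      ← ENNReal.ofReal_mul (by norm_num), enorm_sq_eq_ofReal, ha, forwardDiff_eq, norm_smul,
      norm_inv, Real.norm_of_nonneg hh.le]
    congr 1; field_simp; ring
  rw [e0]
  refine mul_le_mul_right ?_ _
  calc ENNReal.ofReal (‖a‖ ^ 2 / 4) * volume Q = ∫⁻ _ in Q, ENNReal.ofReal (‖a‖ ^ 2 / 4) :=
        (setLIntegral_const _ _).symm
    _ ≤ ∫⁻ x in Q, ‖interpGrad h u i x‖ₑ ^ 2 :=
        setLIntegral_mono ((measurable_interpGrad h u i).enorm.pow_const 2) hQx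
    _ ≤ _ := lintegral_mono_set hQc

theorem tsum_setLIntegral_cell (h : ℝ) (F : Plane → ℝ≥0∞) :
    ∑' j, ∫⁻ x in cellIndex h ⁻¹' {j}, F x = ∫⁻ x, F x := by
  rw [← lintegral_iUnion (measurableSet_cell h) fun i j hij =>
    Disjoint.preimage _ (by simpa using hij)]
  rw [← preimage_iUnion, iUnion_of_singleton, preimage_univ, Measure.restrict_univ]

/-! ### Cut-off functions on the grid -/

/-- A cut-off function that vanishes where `|jh| ≤ R` and equals `1` where `|jh| ≥ 2R`. -/
noncomputable def cutoff (R h : ℝ) (j : Grid) : ℝ := min (max (‖j‖ * h / R - 1) 0) 1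

theorem cutoff_nonneg (R h : ℝ) (j : Grid) : 0 ≤ cutoff R h j :=
  le_min (le_max_right _ _) zero_le_one

theorem cutoff_le_one (R h : ℝ) (j : Grid) : cutoff R h j ≤ 1 := min_le_right _ _

theorem abs_cutoff_le_one (R h : ℝ) (j : Grid) : |cutoff R h j| ≤ 1 := by
  rw [abs_of_nonneg (cutoff_nonneg R h j)]; exact cutoff_le_one R h j

theorem abs_cutoff_sub_le {R h : ℝ} (hR : 0 < R) (hh : 0 < h) (i : Fin 2) (j : Grid) :
    |cutoff R h (j + unitIndex i) - cutoff R h j| ≤ h / R := by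
  have h0 : ‖unitIndex i‖ ≤ 1 := by
    refine (pi_norm_le_iff_of_nonneg zero_le_one).2 fun k => ?_
    by_cases hk : k = i
    · subst hk; simp [unitIndex]
    · simp [unitIndex, hk]
  have h1 : |‖j + unitIndex i‖ - ‖j‖| ≤ 1 :=
    (abs_norm_sub_norm_le _ _).trans (by simpa using h0)
  have e : ‖j + unitIndex i‖ * h / R - 1 - (‖j‖ * h / R - 1) =
      (‖j + unitIndex i‖ - ‖j‖) * (h / R) := by ring
  refine (abs_min_sub_min_le_max _ _ _ _).trans (max_le ((abs_max_sub_max_le_abs _ _ _).trans ?_)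
    (by rw [sub_self, abs_zero]; positivity))
  rw [e, abs_mul, abs_of_pos (by positivity : 0 < h / R)]
  exact mul_le_of_le_one_left (by positivity) h1

/-- Some coordinate of `x` is at least half its norm, so at least `3 * R`, and the corner of the
cell loses at most `h ≤ R`. The remaining `2 * R` is where the cut-off has reached one. -/
theorem cutoff_eq_one {R h : ℝ} (hR : 0 < R) (hh : 0 < h) (hhR : h ≤ R) {x : Plane}
    (hx : x ∉ Metric.ball (0 : Plane) (6 * R)) : cutoff R h (cellIndex h x) = 1 := by
  have h1 : 6 * R ≤ ‖x‖ := by simpa using hx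
  have h2 : ∃ k, 3 * R ≤ |x k| := by
    by_contra! hc
    have h3 : ‖x‖ < 6 * R := by
      rw [EuclideanSpace.norm_eq, Real.sqrt_lt' (by positivity), Fin.sum_univ_two]
      have a0 := hc 0
      have a1 := hc 1
      simp only [Real.norm_eq_abs]
      nlinarith [abs_nonneg (x 0), abs_nonneg (x 1)]
    linarith
  obtain ⟨k, hk⟩ := h2
  have h4 := (cellIndex_eq_iff hh x _).1 rfl k
  have h5 : |x k| ≤ |(cellIndex h x k : ℝ)| * h + h := by
    have h6 := abs_add_le ((cellIndex h x k : ℝ) * h) (x k - cellIndex h x k * h)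
    rw [add_sub_cancel, abs_mul, abs_of_pos hh,
      abs_of_nonneg (show 0 ≤ x k - cellIndex h x k * h by linarith [h4.1])] at h6
    linarith [h4.2]
  have h6 : |(cellIndex h x k : ℝ)| ≤ ‖cellIndex h x‖ := norm_le_pi_norm (cellIndex h x) k
  have h7 : 2 * R ≤ ‖cellIndex h x‖ * h := by
    have : |(cellIndex h x k : ℝ)| * h ≤ ‖cellIndex h x‖ * h := by gcongr
    linarith
  have h8 : 1 ≤ ‖cellIndex h x‖ * h / R - 1 := by
    rw [le_sub_iff_add_le, le_div_iff₀ hR]; linarith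
  exact min_eq_right (h8.trans (le_max_left _ _))

theorem notMem_ball_of_cutoff_ne_zero {R h : ℝ} (hR : 0 < R) (hh : 0 < h) (hhR : h ≤ R / 2)
    {x : Plane} (hx : cutoff R h (cellIndex h x) ≠ 0) : x ∉ Metric.ball (0 : Plane) (R / 2) := by
  intro hx'
  rw [mem_ball_zero_iff] at hx'
  refine hx ?_
  have h1 : ‖cellIndex h x‖ * h ≤ R := by
    rw [← le_div_iff₀ hh]
    refine (pi_norm_le_iff_of_nonneg (by positivity)).2 fun k => ?_
    have h4 := (cellIndex_eq_iff hh x _).1 rfl k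
    have h5 : |x k| ≤ ‖x‖ := PiLp.norm_apply_le x k
    rw [le_div_iff₀ hh]
    have h6 : ‖cellIndex h x k‖ * h = |(cellIndex h x k : ℝ) * h| := by
      rw [abs_mul, abs_of_pos hh]; rfl
    rw [h6, abs_le]
    have := abs_le.1 h5
    constructor <;> linarith [h4.1, h4.2, this.1, this.2]
  have h2 : ‖cellIndex h x‖ * h / R - 1 ≤ 0 := by
    rw [sub_nonpos, div_le_one hR]; exact h1
  rw [cutoff, max_eq_right h2]; simp

theorem gsq_cutoff_le {R h : ℝ} (hR : 0 < R) (hh : 0 < h) (hhR : h ≤ R / 2) (u : Grid → Space)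
    (i : Fin 2) : gsq (fun j => cutoff R h j • dif i u j) ≤
      32 * eLpNorm (interpGrad h u i) 2 (volume.restrict (Metric.ball 0 (R / 2))ᶜ) ^ 2 := by
  rw [eLpNorm_two_sq, ← lintegral_indicator measurableSet_ball.compl, ← tsum_setLIntegral_cell h,
    ← ENNReal.tsum_mul_left]
  refine ENNReal.tsum_le_tsum fun j => ?_
  by_cases hj : cutoff R h j = 0
  · simp [hj]
  · have h1 : ‖cutoff R h j • dif i u j‖ₑ ^ 2 ≤ ‖dif i u j‖ₑ ^ 2 := by
      rw [enorm_sq_eq_ofReal, enorm_sq_eq_ofReal, norm_smul]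
      refine ENNReal.ofReal_le_ofReal ?_
      gcongr
      exact mul_le_of_le_one_left (norm_nonneg _) (abs_cutoff_le_one R h j)
    refine h1.trans ((enorm_dif_sq_le hh u i j).trans (mul_le_mul_right ?_ _))
    refine (setLIntegral_congr_fun (measurableSet_cell h j) fun x hx => ?_).le
    have hxj : cellIndex h x = j := hx
    rw [indicator_of_mem]
    exact notMem_ball_of_cutoff_ne_zero hR hh hhR (by rwa [hxj])

theorem eLpNorm_pc_compl_ball_sq_le {R h : ℝ} (hR : 0 < R) (hh : 0 < h) (hhR : h ≤ R)
    (v : Grid → Space) : eLpNorm (pc h v) 2 (volume.restrict (Metric.ball 0 (6 * R))ᶜ) ^ 2 ≤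
      ENNReal.ofReal (h ^ 2) * gsq (fun j => cutoff R h j • v j) := by
  rw [← eLpNorm_pc_sq hh, eLpNorm_two_sq, eLpNorm_two_sq]
  refine le_trans (setLIntegral_mono' measurableSet_ball.compl fun x hx => ?_)
    (setLIntegral_le_lintegral (Metric.ball 0 (6 * R))ᶜ _)
  simp only [pc]
  rw [cutoff_eq_one hR hh hhR hx, one_smul]

section
variable {N : Set Space} {h : ℕ → ℝ} {u : ℕ → ℝ → Grid → Space} {p : ℝ → Plane → Space}
  {G : Fin 2 → ℝ → Plane → Space}

/-- The initial gradients converge in `L²` and therefore have uniformly small tails. With slope `h /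
R` of the cut-off the flux term becomes `104 * t / R ^ 2`, independent of `n` and small for large
`R`: in finite time energy cannot come in from a bounded region in a noticeable amount. -/
theorem FlowSeq.tight (H : FlowSeq N h u) {Df : Fin 2 → Plane → Space}
    (hDf : ∀ i, AEStronglyMeasurable (Df i))
    (hlim : ∀ i, Tendsto (fun n => eLpNorm (fun x => interpGrad (h n) (u n 0) i x - Df i x) 2
      volume) atTop (𝓝 0)) {t : ℝ} (ht : 0 ≤ t) {ε : ℝ≥0∞} (hε : 0 < ε) (hε' : ε ≠ ⊤) :
    ∃ R, 0 < R ∧ ∀ᶠ n in atTop, h n ≤ R ∧ ∑ k, gsq (fun j => cutoff R (h n) j • dif k (u n 0) j) +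
      ENNReal.ofReal (104 * (h n / R) ^ 2 * t / h n ^ 2) ≤ ε := by
  -- One `δ` is for the distance to the limit gradient, the other for the tail of that limit; 64 is
  -- the constant 32 for each of the two directions.
  obtain ⟨δ, hδ0, hδ⟩ : ∃ δ : ℝ≥0∞, 0 < δ ∧ 64 * (δ + δ) ^ 2 ≤ ε / 2 := by
    have h1 : Tendsto (fun δ : ℝ≥0∞ => 64 * (δ + δ) ^ 2) (𝓝 0) (𝓝 (64 * (0 + 0) ^ 2)) := by
      refine ENNReal.Tendsto.const_mul ?_ (Or.inr (by norm_num))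
      exact ENNReal.Tendsto.pow (tendsto_id.add tendsto_id)
    simp only [add_zero, ne_eq, OfNat.ofNat_ne_zero, not_false_eq_true, zero_pow, mul_zero] at h1
    have h2 := (ENNReal.tendsto_nhds_zero.1 h1) (ε / 2) (ENNReal.half_pos hε.ne')
    obtain ⟨δ, hδ1, hδ2⟩ := ((h2.filter_mono nhdsWithin_le_nhds).and
      (self_mem_nhdsWithin (a := (0 : ℝ≥0∞)) (s := Ioi 0))).exists
    exact ⟨δ, hδ2, hδ1⟩
  have hDfL : ∀ i, MemLp (Df i) 2 := fun i => by
    refine ⟨hDf i, ?_⟩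
    obtain ⟨n, hn⟩ := ((ENNReal.tendsto_nhds_zero.1 (hlim i)) 1 (by norm_num)).exists
    have e : Df i = interpGrad (h n) (u n 0) i - fun x => interpGrad (h n) (u n 0) i x - Df i x := by
      funext x; simp
    rw [e]
    refine (eLpNorm_sub_le (aesm_interpGrad _ _ _ _) ((aesm_interpGrad _ _ _ _).sub (hDf i))
      (by norm_num)).trans_lt (ENNReal.add_lt_top.2 ⟨?_, hn.trans_lt ENNReal.one_lt_top⟩)
    exact (eLpNorm_interpGrad_le (H.pos n) (by norm_num) (H.energy n le_rfl) i).trans_lt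
      ENNReal.ofReal_lt_top
  choose R₀ hR₀ using fun i => exists_eLpNorm_compl_ball_le (hDfL i) hδ0
  obtain ⟨R₁, hR₁⟩ : ∃ R₁ : ℝ, ∀ R ≥ R₁, ENNReal.ofReal (104 * t / R ^ 2) ≤ ε / 2 := by
    have h1 : Tendsto (fun R : ℝ => ENNReal.ofReal (104 * t / R ^ 2)) atTop (𝓝 0) := by
      have : Tendsto (fun R : ℝ => 104 * t / R ^ 2) atTop (𝓝 0) :=
        tendsto_const_nhds.div_atTop (tendsto_pow_atTop two_ne_zero)
      simpa using ENNReal.tendsto_ofReal this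
    exact eventually_atTop.1 ((ENNReal.tendsto_nhds_zero.1 h1) _ (ENNReal.half_pos hε.ne'))
  set R : ℝ := max 1 (max R₁ (max (2 * R₀ 0) (2 * R₀ 1))) with hRdef
  have hR : 0 < R := lt_max_of_lt_left one_pos
  have hRR₁ : R₁ ≤ R := (le_max_left _ _).trans (le_max_right _ _)
  have hRR₀ : ∀ i, R₀ i ≤ R / 2 := fun i => by
    have : 2 * R₀ i ≤ R := by
      fin_cases i
      · exact (le_max_left _ _).trans ((le_max_right _ _).trans (le_max_right _ _))
      · exact (le_max_right _ _).trans ((le_max_right _ _).trans (le_max_right _ _))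
    linarith
  refine ⟨R, hR, ?_⟩
  have hev : ∀ i, ∀ᶠ n in atTop, eLpNorm (fun x => interpGrad (h n) (u n 0) i x - Df i x) 2
      volume ≤ δ := fun i => (ENNReal.tendsto_nhds_zero.1 (hlim i)) δ hδ0
  filter_upwards [hev 0, hev 1, H.lim.eventually (gt_mem_nhds (half_pos hR))] with n hn0 hn1 hnh
  have hn : ∀ i, eLpNorm (fun x => interpGrad (h n) (u n 0) i x - Df i x) 2 volume ≤ δ := fun i => by
    fin_cases i <;> assumption
  refine ⟨by linarith, ?_⟩
  have hg : ∀ i, gsq (fun j => cutoff R (h n) j • dif i (u n 0) j) ≤ 32 * (δ + δ) ^ 2 := fun i => by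
    refine (gsq_cutoff_le hR (H.pos n) hnh.le _ i).trans (mul_le_mul_right ?_ _)
    refine pow_le_pow_left₀ zero_le ?_ 2
    have e : interpGrad (h n) (u n 0) i = (fun x => interpGrad (h n) (u n 0) i x - Df i x) +
        Df i := by funext x; simp
    rw [e]
    exact (eLpNorm_add_le ((aesm_interpGrad _ _ _ _).sub (hDf i).restrict) (hDf i).restrict
      (by norm_num)).trans (add_le_add ((eLpNorm_mono_measure _ Measure.restrict_le_self).trans
        (hn i)) (hR₀ i _ (hRR₀ i)))
  have e1 : 104 * (h n / R) ^ 2 * t / h n ^ 2 = 104 * t / R ^ 2 := by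
    have := (H.pos n).ne'
    field_simp
  rw [e1, Fin.sum_univ_two]
  refine (add_le_add (add_le_add (hg 0) (hg 1)) (hR₁ R hRR₁)).trans ?_
  rw [← add_mul, show (32 : ℝ≥0∞) + 32 = 64 by norm_num]
  exact (add_le_add hδ le_rfl).trans (ENNReal.add_halves ε).le

/-- Gradients have uniformly small tails and so converge globally. The maps need not be square
integrable, so the tail argument is applied to their displacement from the initial maps, to which
the assumed initial convergence is added. -/
theorem FlowLimit.tendstoInH1_univ (hN : IsCompact N) (H : FlowLimit N h u p G)
    (h0 : TendstoInH1 univ (fun n => interpolant (h n) (u n 0)) (p 0)) {t : ℝ} (ht : 0 < t) :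
    TendstoInH1 univ (fun n => interpolant (h n) (u n t)) (p t) := by
  obtain ⟨Dq, Df, hDq, -, ⟨-, -, hlim⟩, hD⟩ := h0
  rw [Measure.restrict_univ] at hlim
  have hDf : ∀ i, AEStronglyMeasurable (Df i) := fun i => by
    simpa only [Measure.restrict_univ] using (hD i).2.1
  have hDlim : ∀ i, Tendsto (fun n => eLpNorm (fun x => interpGrad (h n) (u n 0) i x - Df i x) 2
      volume) atTop (𝓝 0) := fun i => by
    have := (hD i).2.2
    rw [Measure.restrict_univ] at this
    refine this.congr fun n => eLpNorm_congr_ae ?_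
    filter_upwards [(hDq n).ae_eq (H.hasWeakGradient_interpolant hN n le_rfl) i] with x hx
    simp [hx]
  have hsqrt : ∀ ε : ℝ≥0∞, 0 < ε → ∀ c : ℝ, 0 < c → ∃ ε' : ℝ≥0∞, 0 < ε' ∧ ε' ≠ ⊤ ∧
      ENNReal.ofReal c * ε' ≤ ε ^ 2 := fun ε hε c hc => by
    refine ⟨min 1 (ε ^ 2 / ENNReal.ofReal c), lt_min one_pos (ENNReal.div_pos (by positivity)
      ENNReal.ofReal_ne_top), (min_le_left _ _).trans_lt ENNReal.one_lt_top |>.ne, ?_⟩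
    refine (mul_le_mul_right (min_le_right _ _) _).trans ENNReal.mul_div_le
  have tail := fun n R (hR : 0 < R) => (H.bounds n).tail (cutoff R (h n)) (h n / R)
    (cutoff_nonneg R (h n)) (abs_cutoff_le_one R (h n)) (abs_cutoff_sub_le hR (H.pos n)) t ht.le
  have hgrad : ∀ i, Tendsto (fun n => eLpNorm (fun x => pcD (h n) i (u n t) x - G i t x) 2 volume)
      atTop (𝓝 0) := fun i => by
    refine tendsto_eLpNorm_of_tight (fun n => aesm_pc _ _ _) (H.aesm_grad i t _)
      (H.tendsto_grad i t ht) fun ε hε => ?_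
    obtain ⟨ε', h1, h2, h3⟩ := hsqrt ε hε 1 one_pos
    rw [ENNReal.ofReal_one, one_mul] at h3
    obtain ⟨R, hR, hev⟩ := H.tight hDf hDlim ht.le h1 h2
    refine ⟨6 * R, ?_⟩
    filter_upwards [hev] with n hn
    rw [← ENNReal.pow_le_pow_left_iff two_ne_zero]
    refine (eLpNorm_pc_compl_ball_sq_le hR (H.pos n) hn.1 _).trans ?_
    have e : (fun j => cutoff R (h n) j • forwardDiff (h n) i (u n t) j) =
        fun j => (h n)⁻¹ • (cutoff R (h n) j • dif i (u n t) j) := by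
      funext j; rw [forwardDiff_eq, smul_comm]
    rw [e, ofReal_sq_mul_gsq_inv_smul (H.pos n)]
    exact ((tail n R hR).1 i).trans (hn.2.trans h3)
  have hmap : Tendsto (fun n => eLpNorm (fun x => (pc (h n) (u n t) x - pc (h n) (u n 0) x) -
      (p t x - p 0 x)) 2 volume) atTop (𝓝 0) := by
    refine tendsto_eLpNorm_of_tight (p := fun x => p t x - p 0 x)
      (fun n => (aesm_pc _ _ _).sub (aesm_pc _ _ _)) ((H.aesm t _).sub (H.aesm 0 _)) (fun R => ?_)
      fun ε hε => ?_
    · have h1 := (H.tendsto t ht.le R).add (H.tendsto 0 le_rfl R)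
      rw [add_zero] at h1
      refine tendsto_of_tendsto_of_tendsto_of_le_of_le tendsto_const_nhds h1 (fun _ => zero_le)
        fun n => ?_
      refine le_trans (le_of_eq ?_) (eLpNorm_sub_le ((aesm_pc _ _ _).sub (H.aesm t _))
        ((aesm_pc _ _ _).sub (H.aesm 0 _)) (by norm_num))
      congr 1; funext x; simp only [Pi.sub_apply]; abel
    · obtain ⟨ε', h1, h2, h3⟩ := hsqrt ε hε t ht
      obtain ⟨R, hR, hev⟩ := H.tight hDf hDlim ht.le h1 h2
      refine ⟨6 * R, ?_⟩
      filter_upwards [hev] with n hn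
      rw [← ENNReal.pow_le_pow_left_iff two_ne_zero]
      refine (eLpNorm_pc_compl_ball_sq_le hR (H.pos n) hn.1 (fun j => u n t j - u n 0 j)).trans ?_
      exact ((tail n R hR).2).trans ((mul_le_mul_right hn.2 _).trans h3)
  have hpc0 : Tendsto (fun n => eLpNorm (fun x => pc (h n) (u n 0) x - p 0 x) 2 volume) atTop
      (𝓝 0) := by
    refine tendsto_eLpNorm_of_sub (fun n => aesm_pc _ _ _) (fun n => aesm_interpolant _ _ _)
      (H.aesm 0 _) ?_ le_rfl hlim
    refine (H.tendsto_interpolant_sub le_rfl).congr fun n => ?_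
    rw [← eLpNorm_neg]; congr 1; funext x; simp
  have hpct : Tendsto (fun n => eLpNorm (fun x => pc (h n) (u n t) x - p t x) 2 volume) atTop
      (𝓝 0) := by
    have h1 := hmap.add hpc0
    rw [add_zero] at h1
    refine tendsto_of_tendsto_of_tendsto_of_le_of_le tendsto_const_nhds h1 (fun _ => zero_le)
      fun n => ?_
    refine le_trans (le_of_eq ?_) (eLpNorm_add_le (((aesm_pc _ _ _).sub (aesm_pc _ _ _)).sub
      ((H.aesm t _).sub (H.aesm 0 _))) ((aesm_pc _ _ _).sub (H.aesm 0 _)) (by norm_num))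
    congr 1; funext x; simp only [Pi.add_apply]; abel
  refine ⟨fun n => interpGrad (h n) (u n t), fun i => G i t,
    fun n => H.hasWeakGradient_interpolant hN n ht.le, H.hasWeakGradient hN ht,
    ⟨fun n => aesm_interpolant _ _ _, H.aesm _ _, ?_⟩,
    fun i => ⟨fun n => aesm_interpGrad _ _ _ _, H.aesm_grad _ _ _, ?_⟩⟩
  · rw [Measure.restrict_univ]
    exact tendsto_eLpNorm_of_sub (fun n => aesm_interpolant _ _ _) (fun n => aesm_pc _ _ _)
      (H.aesm _ _) (H.tendsto_interpolant_sub ht.le) le_rfl hpct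
  · rw [Measure.restrict_univ]
    exact tendsto_eLpNorm_of_sub (fun n => aesm_interpGrad _ _ _ _) (fun n => aesm_pc _ _ _)
      (H.aesm_grad _ _ _) (H.tendsto_interpGrad_sub ht i) le_rfl (hgrad i)

end

/-! ### Test functions -/

section
variable {E F : Type*} [NormedAddCommGroup E] [NormedSpace ℝ E] [NormedAddCommGroup F]
  [NormedSpace ℝ F]

/-- The mean value inequality is used twice, starting at zero; the sharp factor one half is not
needed. -/
theorem norm_le_mul_sq_of_second_deriv {r r' r'' : ℝ → F} {h ε : ℝ} (hh : 0 ≤ h) (hε : 0 ≤ ε)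
    (h1 : ∀ s, HasDerivAt r (r' s) s) (h2 : ∀ s, HasDerivAt r' (r'' s) s) (h3 : r 0 = 0)
    (h4 : r' 0 = 0) (h5 : ∀ s ∈ Icc 0 h, ‖r'' s‖ ≤ ε) : ‖r h‖ ≤ ε * h ^ 2 := by
  have b1 : ∀ s ∈ Icc 0 h, ‖r' s‖ ≤ ε * h := fun s hs => by
    have := norm_image_sub_le_of_norm_deriv_le_segment' (f := r') (f' := r'') (a := 0) (b := h)
      (C := ε) (fun x _ => (h2 x).hasDerivWithinAt) (fun x hx => h5 x ⟨hx.1, hx.2.le⟩) s hs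
    rw [h4, sub_zero, sub_zero] at this
    exact this.trans (by gcongr; exact hs.2)
  have := norm_image_sub_le_of_norm_deriv_le_segment' (f := r) (f' := r') (a := 0) (b := h)
      (C := ε * h) (fun x _ => (h1 x).hasDerivWithinAt) (fun x hx => b1 x ⟨hx.1, hx.2.le⟩) h
      ⟨hh, le_rfl⟩
  rw [h3, sub_zero, sub_zero] at this
  exact this.trans (le_of_eq (by ring))

/-- The second derivative of `φ` in the direction `v`. -/
noncomputable def secondDeriv (φ : E → F) (v : E) (z : E) : F :=
  fderiv ℝ (fun z => fderiv ℝ φ z v) z v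

/-- The second difference quotient of `φ`. -/
noncomputable def secondDiff (h : ℝ) (φ : E → F) (v : E) (z : E) : F :=
  (h⁻¹ ^ 2) • (φ (z + h • v) + φ (z - h • v) - (2 : ℝ) • φ z)

theorem contDiff_fderiv_apply {φ : E → F} (hφ : ContDiff ℝ ∞ φ) (v : E) :
    ContDiff ℝ ∞ fun z => fderiv ℝ φ z v :=
  (hφ.fderiv_right (m := ∞) (by simp)).clm_apply contDiff_const

theorem continuous_secondDeriv {φ : E → F} (hφ : ContDiff ℝ ∞ φ) (v : E) :
    Continuous (secondDeriv φ v) := (contDiff_fderiv_apply (contDiff_fderiv_apply hφ v) v).continuous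

theorem hasCompactSupport_secondDeriv {φ : E → F} (hs : HasCompactSupport φ) (v : E) :
    HasCompactSupport (secondDeriv φ v) := (hs.fderiv_apply ℝ v).fderiv_apply ℝ v

theorem norm_secondDiff_sub_le {φ : E → F} (hφ : ContDiff ℝ ∞ φ) (v z : E) {h ε : ℝ} (hh : 0 < h)
    (hε : ∀ s ∈ Icc (-h) h, ‖secondDeriv φ v (z + s • v) - secondDeriv φ v z‖ ≤ ε) :
    ‖secondDiff h φ v z - secondDeriv φ v z‖ ≤ 2 * ε := by
  have hε0 : 0 ≤ ε := (norm_nonneg _).trans (hε 0 ⟨by linarith, hh.le⟩)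
  set g := fun z => fderiv ℝ φ z v with hg
  have hline : ∀ c s : ℝ, HasDerivAt (fun s : ℝ => z + (c * s) • v) (c • v) s := fun c s => by
    simpa using (((hasDerivAt_id s).const_mul c).smul_const v).const_add z
  have d1 : ∀ c s : ℝ, HasDerivAt (fun s : ℝ => φ (z + (c * s) • v)) (c • g (z + (c * s) • v)) s :=
    fun c s => by
      have := ((hφ.differentiable (by simp)) (z + (c * s) • v)).hasFDerivAt.comp_hasDerivAt s
        (hline c s)
      rw [map_smul] at this
      exact this
  have d2 : ∀ c s : ℝ, HasDerivAt (fun s : ℝ => g (z + (c * s) • v))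
      (c • secondDeriv φ v (z + (c * s) • v)) s := fun c s => by
    have := (((contDiff_fderiv_apply hφ v).differentiable (by simp))
      (z + (c * s) • v)).hasFDerivAt.comp_hasDerivAt s (hline c s)
    rw [map_smul] at this
    exact this
  have hsq : ∀ s : ℝ, HasDerivAt (fun s : ℝ => s ^ 2) (2 * s) s := fun s => by
    simpa using hasDerivAt_pow 2 s
  have hlin : ∀ s : ℝ, HasDerivAt (fun s : ℝ => 2 * s) 2 s := fun s => by
    simpa using (hasDerivAt_id s).const_mul (2 : ℝ)
  -- Adding the values on both sides of `z` cancels the first derivative, and subtracting the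
  -- quadratic polynomial leaves the oscillation of the second derivative, once from each side.
  have key := norm_le_mul_sq_of_second_deriv (h := h) (ε := 2 * ε)
    (r := fun s => φ (z + (1 * s) • v) + φ (z + (-1 * s) • v) - (2 : ℝ) • φ z -
      s ^ 2 • secondDeriv φ v z)
    (r' := fun s => (1 : ℝ) • g (z + (1 * s) • v) + (-1 : ℝ) • g (z + (-1 * s) • v) -
      (2 * s) • secondDeriv φ v z)
    (r'' := fun s => (1 : ℝ) • (1 : ℝ) • secondDeriv φ v (z + (1 * s) • v) +
      (-1 : ℝ) • (-1 : ℝ) • secondDeriv φ v (z + (-1 * s) • v) - (2 : ℝ) • secondDeriv φ v z)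
    hh.le (by positivity)
    (fun s => ((((d1 1 s).add (d1 (-1) s)).sub_const _).sub ((hsq s).smul_const _)))
    (fun s => ((((d2 1 s).const_smul (1 : ℝ)).add ((d2 (-1) s).const_smul (-1 : ℝ))).sub
      ((hlin s).smul_const _))) (by simp [two_smul]) (by simp) (fun s hs => ?_)
  · have e : secondDiff h φ v z - secondDeriv φ v z = (h⁻¹ ^ 2) • (φ (z + (1 * h) • v) +
        φ (z + (-1 * h) • v) - (2 : ℝ) • φ z - h ^ 2 • secondDeriv φ v z) := by
      rw [smul_sub _ _ (h ^ 2 • _), smul_smul, secondDiff]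
      have : h⁻¹ ^ 2 * h ^ 2 = 1 := by field_simp
      rw [this, one_smul, one_mul, neg_one_mul, neg_smul, sub_eq_add_neg z]
    rw [e, norm_smul, Real.norm_of_nonneg (by positivity)]
    calc h⁻¹ ^ 2 * _ ≤ h⁻¹ ^ 2 * (2 * ε * h ^ 2) := by gcongr
      _ = 2 * ε := by field_simp
  · have a1 := hε s ⟨by linarith [hs.1], hs.2⟩
    have a2 := hε (-s) ⟨by linarith [hs.2], by linarith [hs.1]⟩
    have e : (1 : ℝ) • (1 : ℝ) • secondDeriv φ v (z + (1 * s) • v) +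
        (-1 : ℝ) • (-1 : ℝ) • secondDeriv φ v (z + (-1 * s) • v) - (2 : ℝ) • secondDeriv φ v z =
        (secondDeriv φ v (z + s • v) - secondDeriv φ v z) +
        (secondDeriv φ v (z + (-s) • v) - secondDeriv φ v z) := by
      simp only [one_mul, neg_one_mul, one_smul, neg_one_smul, neg_neg, two_smul]; abel
    rw [e, two_mul]
    exact norm_add_le_of_le a1 a2

theorem tendstoUniformly_secondDiff {φ : E → F} (hφ : ContDiff ℝ ∞ φ) (hs : HasCompactSupport φ)
    (v : E) {ε : ℝ} (hε : 0 < ε) : ∃ δ > 0, ∀ h, 0 < h → h < δ → ∀ z,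
      ‖secondDiff h φ v z - secondDeriv φ v z‖ ≤ ε := by
  have huc := (hasCompactSupport_secondDeriv hs v).uniformContinuous_of_continuous
    (continuous_secondDeriv hφ v)
  obtain ⟨δ, hδ, hδ'⟩ := Metric.uniformContinuous_iff.1 huc (ε / 2) (by positivity)
  refine ⟨δ / (‖v‖ + 1), by positivity, fun h hh hhδ z => ?_⟩
  rw [lt_div_iff₀ (by positivity)] at hhδ
  refine (norm_secondDiff_sub_le hφ v z hh (ε := ε / 2) fun s hs => ?_).trans (by linarith)
  rw [← dist_eq_norm]
  refine (hδ' ?_).le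
  rw [dist_eq_norm, add_sub_cancel_left, norm_smul, Real.norm_eq_abs]
  have : |s| ≤ h := abs_le.2 hs
  calc |s| * ‖v‖ ≤ h * ‖v‖ := by gcongr
    _ ≤ h * (‖v‖ + 1) := by gcongr; linarith
    _ < δ := hhδ

end

/-- The direction of the `i`-th space coordinate in space-time. -/
noncomputable def spaceDir (i : Fin 2) : ℝ × Plane := (0, EuclideanSpace.single i 1)

theorem deriv_time_eq {φ : ℝ × Plane → Space} (hφ : ContDiff ℝ ∞ φ) (t : ℝ) (x : Plane) :
    deriv (fun s => φ (s, x)) t = fderiv ℝ φ (t, x) (1, 0) := by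
  have h1 : HasDerivAt (fun s : ℝ => (s, x)) ((1 : ℝ), (0 : Plane)) t :=
    (hasDerivAt_id t).prodMk (hasDerivAt_const t x)
  exact (((hφ.differentiable (by simp)) (t, x)).hasFDerivAt.comp_hasDerivAt t h1).deriv

theorem laplacian_eq_sum_secondDeriv {φ : ℝ × Plane → Space} (hφ : ContDiff ℝ ∞ φ) (t : ℝ)
    (x : Plane) : Laplacian.laplacian (fun y => φ (t, y)) x =
      ∑ i, secondDeriv φ (spaceDir i) (t, x) := by
  set f : Plane → Space := fun y => φ (t, y) with hf
  have hin : ∀ y, HasFDerivAt (fun y : Plane => (t, y)) (ContinuousLinearMap.inr ℝ ℝ Plane) y :=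
    fun y => hasFDerivAt_prodMk_right t y
  have hfs : ContDiff ℝ ∞ f := hφ.comp (contDiff_const.prodMk contDiff_id)
  have h1 : ∀ y v, fderiv ℝ f y v = fderiv ℝ φ (t, y) (0, v) := fun y v => by
    have := (((hφ.differentiable (by simp)) (t, y)).hasFDerivAt.comp y (hin y)).fderiv
    have e : fderiv ℝ f y = (fderiv ℝ φ (t, y)).comp (ContinuousLinearMap.inr ℝ ℝ Plane) := this
    rw [e]; simp
  rw [InnerProductSpace.laplacian_eq_iteratedFDeriv_orthonormalBasis f
    (EuclideanSpace.basisFun (Fin 2) ℝ)]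
  refine Finset.sum_congr rfl fun i _ => ?_
  rw [iteratedFDeriv_two_apply]
  simp only [EuclideanSpace.basisFun_apply, Matrix.cons_val_zero, Matrix.cons_val_one]
  set v : Plane := EuclideanSpace.single i 1 with hv
  have h2 : fderiv ℝ (fderiv ℝ f) x v v = fderiv ℝ (fun y => fderiv ℝ f y v) x v := by
    have hd : DifferentiableAt ℝ (fderiv ℝ f) x :=
      ((hfs.fderiv_right (m := ∞) (by simp)).differentiable (by simp)) x
    rw [fderiv_clm_apply hd (differentiableAt_const v)]
    simp
  rw [h2]
  simp only [h1]
  have h3 := (((contDiff_fderiv_apply hφ (spaceDir i)).differentiable (by simp))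
    (t, x)).hasFDerivAt.comp x (hin x)
  have e : fderiv ℝ (fun y => fderiv ℝ φ (t, y) (0, v)) x =
      (fderiv ℝ (fun z => fderiv ℝ φ z (spaceDir i)) (t, x)).comp
        (ContinuousLinearMap.inr ℝ ℝ Plane) := h3.fderiv
  rw [e]; simp [secondDeriv, spaceDir, hv]

/-! ### The Lagrange multiplier -/

/-- The Lagrange multiplier `λ_j` of the semi-discrete flow. -/
noncomputable def multiplier (h : ℝ) (ν : Space → Space) (v : Grid → Space) (j : Grid) : ℝ :=
  -⟪discreteLaplacian h v j, ν (v j)⟫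

theorem exists_norm_taylor_le {N : Set Space} (hN : IsCompact N) {ν : Space → Space}
    (hν : ContDiff ℝ ∞ ν) : ∃ C : ℝ, 0 ≤ C ∧ ∀ y ∈ N, ∀ z ∈ N,
      ‖ν z - ν y - fderiv ℝ ν y (z - y)‖ ≤ C * ‖z - y‖ ^ 2 := by
  obtain ⟨R, hR⟩ := hN.isBounded.subset_closedBall 0
  have h1 : ContDiff ℝ ∞ (fderiv ℝ ν) := hν.fderiv_right (m := ∞) (by simp)
  obtain ⟨K, hK⟩ := h1.contDiffOn.exists_lipschitzOnWith (by simp)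
    (convex_closedBall (0 : Space) R) (isCompact_closedBall _ _)
  refine ⟨K, K.2, fun y hy z hz => ?_⟩
  have hseg : segment ℝ y z ⊆ Metric.closedBall (0 : Space) R :=
    (convex_closedBall _ _).segment_subset (hR hy) (hR hz)
  have := (convex_segment y z).norm_image_sub_le_of_norm_hasFDerivWithin_le' (f := ν)
    (f' := fderiv ℝ ν) (φ := fderiv ℝ ν y) (C := K * ‖z - y‖)
    (fun x _ => ((hν.differentiable (by simp)) x).hasFDerivAt.hasFDerivWithinAt)
    (fun x hx => ?_) (left_mem_segment ℝ y z) (right_mem_segment ℝ y z)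
  · exact this.trans (le_of_eq (by ring))
  · refine (hK.norm_sub_le (hseg hx) (hR hy)).trans ?_
    have h3 := dist_left_le_of_mem_segment hx
    exact mul_le_mul_of_nonneg_left h3 K.2

/-- Write `-ν y` as half of `ν z - ν y` minus half of `ν y + ν z`. The first half gives the
derivative of the normal up to a quadratic error, and paired with the chord the second half is
cubic. This yields the coefficient one half of the quadratic form. -/
theorem exists_abs_normal_taylor_le {N : Set Space} (hN : IsCompact N)
    (hs : IsSmoothHypersurface N) {ν : Space → Space} (hν : IsUnitNormalField N ν) :
    ∃ C : ℝ, 0 ≤ C ∧ ∀ y ∈ N, ∀ z ∈ N,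
      |-⟪ν y, z - y⟫ - 1 / 2 * ⟪fderiv ℝ ν y (z - y), z - y⟫| ≤ C * ‖z - y‖ ^ 3 := by
  obtain ⟨C₁, hC₁, h₁⟩ := exists_abs_inner_add_normal_le hN hs hν
  obtain ⟨C₂, hC₂, h₂⟩ := exists_norm_taylor_le hN hν.smooth
  refine ⟨1 / 2 * C₁ + 1 / 2 * C₂, by positivity, fun y hy z hz => ?_⟩
  have e : -⟪ν y, z - y⟫ - 1 / 2 * ⟪fderiv ℝ ν y (z - y), z - y⟫ =
      1 / 2 * ⟪ν z - ν y - fderiv ℝ ν y (z - y), z - y⟫ - 1 / 2 * ⟪ν y + ν z, z - y⟫ := by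
    simp only [inner_sub_left, inner_add_left]; ring
  have b1 : |⟪ν z - ν y - fderiv ℝ ν y (z - y), z - y⟫| ≤ C₂ * ‖z - y‖ ^ 3 :=
    (abs_real_inner_le_norm _ _).trans (by
      calc _ ≤ C₂ * ‖z - y‖ ^ 2 * ‖z - y‖ := by gcongr; exact h₂ y hy z hz
        _ = _ := by ring)
  rw [e]
  refine (abs_sub _ _).trans ?_
  rw [abs_mul, abs_mul, abs_of_pos (by norm_num : (0 : ℝ) < 1 / 2)]
  linarith [h₁ y hy z hz]

theorem inner_discreteLaplacian (h : ℝ) (v : Grid → Space) (j : Grid) (n : Space) :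
    ⟪discreteLaplacian h v j, n⟫ = (h⁻¹ ^ 2) *
      ∑ i, (⟪n, dif i v j⟫ + ⟪n, -dif i v (j - unitIndex i)⟫) := by
  rw [discreteLaplacian_eq, real_inner_smul_left, lap, sum_inner]
  congr 1
  refine Finset.sum_congr rfl fun i _ => ?_
  simp only [dif, sub_add_cancel]
  rw [← inner_add_right, real_inner_comm, sub_eq_add_neg]

/-- The quadratic form in the limit of the multiplier, in terms of difference quotients. -/
noncomputable def multiplierQuad (h : ℝ) (ν : Space → Space) (v : Grid → Space) (j : Grid) : ℝ :=
  ∑ i, 1 / 2 * (⟪fderiv ℝ ν (v j) (forwardDiff h i v j), forwardDiff h i v j⟫ +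
    ⟪fderiv ℝ ν (v j) (forwardDiff h i v (j - unitIndex i)), forwardDiff h i v (j - unitIndex i)⟫)

/-- The Laplacian is a sum of chords from the grid point to its neighbours, so the expansion of the
normal component applies to each. The quadratic form is even, hence the sign of the backward chord
does not matter. -/
theorem abs_multiplier_sub_quad_le {N : Set Space} {ν : Space → Space} {C : ℝ}
    (hC : ∀ y ∈ N, ∀ z ∈ N, |-⟪ν y, z - y⟫ - 1 / 2 * ⟪fderiv ℝ ν y (z - y), z - y⟫| ≤
      C * ‖z - y‖ ^ 3) {h : ℝ} {v : Grid → Space} (hv : ∀ j, v j ∈ N) (j : Grid) :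
    |multiplier h ν v j - multiplierQuad h ν v j| ≤ C * h⁻¹ ^ 2 *
      ∑ i, (‖dif i v j‖ ^ 3 + ‖dif i v (j - unitIndex i)‖ ^ 3) := by
  have e : multiplier h ν v j - multiplierQuad h ν v j = h⁻¹ ^ 2 * ∑ i,
      ((-⟪ν (v j), dif i v j⟫ - 1 / 2 * ⟪fderiv ℝ ν (v j) (dif i v j), dif i v j⟫) +
      (-⟪ν (v j), -dif i v (j - unitIndex i)⟫ - 1 / 2 *
        ⟪fderiv ℝ ν (v j) (-dif i v (j - unitIndex i)), -dif i v (j - unitIndex i)⟫)) := by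
    rw [multiplier, multiplierQuad, inner_discreteLaplacian,
      Finset.mul_sum, Finset.mul_sum, ← Finset.sum_neg_distrib, ← Finset.sum_sub_distrib]
    refine Finset.sum_congr rfl fun i _ => ?_
    simp only [forwardDiff_eq, map_smul, real_inner_smul_left, real_inner_smul_right, map_neg,
      inner_neg_neg]
    ring
  rw [e, abs_mul, abs_of_nonneg (by positivity : 0 ≤ h⁻¹ ^ 2), mul_comm C, mul_assoc]
  refine mul_le_mul_of_nonneg_left ?_ (by positivity)
  rw [Finset.mul_sum]
  refine (Finset.abs_sum_le_sum_abs _ _).trans (Finset.sum_le_sum fun i _ => ?_)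
  have h1 := hC (v j) (hv _) (v (j + unitIndex i)) (hv _)
  have h2 := hC (v j) (hv _) (v (j - unitIndex i)) (hv _)
  have e2 : v (j - unitIndex i) - v j = -dif i v (j - unitIndex i) := by simp [dif]
  rw [e2] at h2
  rw [mul_add]
  refine (abs_add_le _ _).trans (add_le_add h1 (h2.trans ?_))
  rw [norm_neg]

theorem abs_multiplier_le {N : Set Space} {ν : Space → Space} {C : ℝ}
    (hC : ∀ y ∈ N, ∀ z ∈ N, |⟪ν y, z - y⟫| ≤ C * ‖z - y‖ ^ 2) {h : ℝ} {v : Grid → Space}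
    (hv : ∀ j, v j ∈ N) (j : Grid) :
    |multiplier h ν v j| ≤ C * h⁻¹ ^ 2 *
      ∑ i, (‖dif i v j‖ ^ 2 + ‖dif i v (j - unitIndex i)‖ ^ 2) := by
  rw [multiplier, abs_neg, discreteLaplacian_eq, real_inner_smul_left, abs_mul,
    abs_of_nonneg (by positivity : 0 ≤ h⁻¹ ^ 2), mul_comm C, mul_assoc]
  exact mul_le_mul_of_nonneg_left (abs_inner_lap_normal_le hC hv j) (by positivity)

/-- The area of a cell cancels `h⁻¹ ^ 2`, and forward and backward sums agree after a shift. The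
power two serves the bound of the multiplier and the power three its remainder. -/
theorem lintegral_comp_cellIndex_le {h : ℝ} (hh : 0 < h) {v : Grid → Space} {m : Grid → ℝ} {C : ℝ}
    (hC : 0 ≤ C) (k : ℕ) (hm : ∀ j, |m j| ≤ C * h⁻¹ ^ 2 *
      ∑ i, (‖dif i v j‖ ^ k + ‖dif i v (j - unitIndex i)‖ ^ k)) :
    ∫⁻ x, ‖m (cellIndex h x)‖ₑ ≤ ENNReal.ofReal (2 * C) * ∑ i, ∑' j, ‖dif i v j‖ₑ ^ k := by
  rw [lintegral_comp_cellIndex hh fun j => ‖m j‖ₑ, ← ENNReal.tsum_mul_left]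
  have h1 : ∀ j, ENNReal.ofReal (h ^ 2) * ‖m j‖ₑ ≤ ENNReal.ofReal C *
      ∑ i, (‖dif i v j‖ₑ ^ k + ‖dif i v (j - unitIndex i)‖ₑ ^ k) := fun j => by
    have e : ∀ x : Space, ‖x‖ₑ ^ k = ENNReal.ofReal (‖x‖ ^ k) := fun x => by
      rw [ENNReal.ofReal_pow (norm_nonneg _), ofReal_norm]
    simp only [e]
    rw [Finset.sum_congr rfl fun i _ => (ENNReal.ofReal_add (by positivity)
      (by positivity)).symm, ← ENNReal.ofReal_sum_of_nonneg fun i _ => by positivity,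
      ← ENNReal.ofReal_mul hC, ← ofReal_norm, ← ENNReal.ofReal_mul (by positivity)]
    refine ENNReal.ofReal_le_ofReal ?_
    calc h ^ 2 * ‖m j‖ ≤ h ^ 2 * (C * h⁻¹ ^ 2 *
          ∑ i, (‖dif i v j‖ ^ k + ‖dif i v (j - unitIndex i)‖ ^ k)) := by
          gcongr; exact hm j
      _ = _ := by field_simp
  refine (ENNReal.tsum_le_tsum h1).trans ?_
  rw [ENNReal.tsum_mul_left, Summable.tsum_finsetSum fun i _ => ENNReal.summable,
    ENNReal.ofReal_mul (by norm_num), mul_comm (ENNReal.ofReal 2), mul_assoc]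
  refine mul_le_mul_right ?_ _
  rw [Finset.mul_sum]
  refine Finset.sum_le_sum fun i _ => ?_
  rw [ENNReal.tsum_add]
  have := (Equiv.subRight (unitIndex i)).tsum_eq fun j => ‖dif i v j‖ₑ ^ k
  simp only [Equiv.subRight_apply] at this
  rw [this, ← two_mul]
  simp

/-- By Young's inequality a cube is at most `h` times the square plus `h⁻¹` times the fourth power.
The quartic sum is of order `h ^ 2` at positive times, so the cubic remainder vanishes in the limit.
-/
theorem tsum_enorm_cube_le {h : ℝ} (hh : 0 < h) (v : Grid → Space) {a b : ℝ} (ha : 0 ≤ a)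
    (hb : 0 ≤ b) (h2 : gsq v ≤ ENNReal.ofReal a)
    (h4 : ∑' j, ‖v j‖ₑ ^ 4 ≤ ENNReal.ofReal (b * h ^ 2)) :
    ∑' j, ‖v j‖ₑ ^ 3 ≤ ENNReal.ofReal ((a + b) * h) := by
  have e : ∀ (x : Space) (k : ℕ), ‖x‖ₑ ^ k = ENNReal.ofReal (‖x‖ ^ k) := fun x k => by
    rw [ENNReal.ofReal_pow (norm_nonneg _), ofReal_norm]
  have h1 : ∀ j, ‖v j‖ₑ ^ 3 ≤ ENNReal.ofReal h * ‖v j‖ₑ ^ 2 + ENNReal.ofReal h⁻¹ * ‖v j‖ₑ ^ 4 :=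
    fun j => by
    rw [e, e, e, ← ENNReal.ofReal_mul hh.le, ← ENNReal.ofReal_mul (by positivity),
      ← ENNReal.ofReal_add (by positivity) (by positivity)]
    refine ENNReal.ofReal_le_ofReal ?_
    set r := ‖v j‖ with hr
    have h0 : 0 ≤ h⁻¹ * (r ^ 2 * (h - r) ^ 2) := by positivity
    have h3 : h⁻¹ * (r ^ 2 * (h - r) ^ 2) = h * r ^ 2 + h⁻¹ * r ^ 4 - 2 * r ^ 3 := by
      field_simp; ring
    have h5 : 0 ≤ r ^ 3 := pow_nonneg (norm_nonneg _) 3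
    linarith
  refine (ENNReal.tsum_le_tsum h1).trans ?_
  rw [ENNReal.tsum_add, ENNReal.tsum_mul_left, ENNReal.tsum_mul_left]
  refine (add_le_add (mul_le_mul_right h2 _) (mul_le_mul_right h4 _)).trans (le_of_eq ?_)
  rw [← ENNReal.ofReal_mul hh.le, ← ENNReal.ofReal_mul (by positivity),
    ← ENNReal.ofReal_add (by positivity) (by positivity)]
  congr 1; field_simp

/-! ### Limits of quadratic forms -/

theorem eLpNorm_bilinear_le {μ : Measure Plane} {A : Plane → Space →L[ℝ] Space} {M : ℝ≥0}
    (hM : ∀ᵐ x ∂μ, ‖A x‖ ≤ M) {f g : Plane → Space} (hf : AEStronglyMeasurable f μ)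
    (hg : AEStronglyMeasurable g μ) :
    eLpNorm (fun x => ⟪A x (f x), g x⟫) 1 μ ≤ M * eLpNorm f 2 μ * eLpNorm g 2 μ := by
  refine (eLpNorm_mono_ae (g := fun x => (M : ℝ) * ‖f x‖ * ‖g x‖) ?_).trans
    (eLpNorm_le_eLpNorm_mul_eLpNorm'_of_norm hf hg (fun a b => (M : ℝ) * ‖a‖ * ‖b‖) M
      (Eventually.of_forall fun x => ?_))
  · filter_upwards [hM] with x hx
    rw [Real.norm_of_nonneg (by positivity : 0 ≤ (M : ℝ) * ‖f x‖ * ‖g x‖)]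
    refine (norm_inner_le_norm _ _).trans (mul_le_mul_of_nonneg_right ?_ (norm_nonneg _))
    exact (A x).le_of_opNorm_le hx _
  · rw [Real.norm_of_nonneg (by positivity)]

/-- With the limit `G` inserted in both slots, bounded pointwise convergence of the coefficients
suffices. Replacing `d n` by `G` in one slot after the other costs its `L²` distance to `G`. -/
theorem tendsto_integral_quadratic {μ : Measure Plane} {A : ℕ → Plane → Space →L[ℝ] Space}
    {B : Plane → Space →L[ℝ] Space} {M : ℝ≥0} (hA : ∀ n, AEStronglyMeasurable (A n) μ)
    (hM : ∀ n, ∀ᵐ x ∂μ, ‖A n x‖ ≤ M) (hAB : ∀ᵐ x ∂μ, Tendsto (fun n => A n x) atTop (𝓝 (B x)))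
    {d : ℕ → Plane → Space} {G : Plane → Space} (hd : ∀ n, MemLp (d n) 2 μ) (hG : MemLp G 2 μ)
    (hdG : Tendsto (fun n => eLpNorm (fun x => d n x - G x) 2 μ) atTop (𝓝 0)) :
    Tendsto (fun n => ∫ x, ⟪A n x (d n x), d n x⟫ ∂μ) atTop (𝓝 (∫ x, ⟪B x (G x), G x⟫ ∂μ)) := by
  have hm : ∀ n {f g : Plane → Space}, AEStronglyMeasurable f μ → AEStronglyMeasurable g μ →
      AEStronglyMeasurable (fun x => ⟪A n x (f x), g x⟫) μ := fun n f g hf hg =>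
    ((ContinuousLinearMap.id ℝ (Space →L[ℝ] Space)).aestronglyMeasurable_comp₂ (hA n) hf).inner hg
  have hint : ∀ n {f g : Plane → Space}, MemLp f 2 μ → MemLp g 2 μ →
      Integrable (fun x => ⟪A n x (f x), g x⟫) μ := fun n f g hf hg =>
    memLp_one_iff_integrable.1 ⟨hm n hf.1 hg.1, (eLpNorm_bilinear_le (hM n) hf.1 hg.1).trans_lt
      (ENNReal.mul_lt_top (ENNReal.mul_lt_top ENNReal.coe_lt_top hf.2) hg.2)⟩
  have h1 : Tendsto (fun n => ∫ x, ⟪A n x (G x), G x⟫ ∂μ) atTop (𝓝 (∫ x, ⟪B x (G x), G x⟫ ∂μ)) := by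
    refine tendsto_integral_of_dominated_convergence (fun x => M * ‖G x‖ ^ 2)
      (fun n => hm n hG.1 hG.1) ((hG.integrable_norm_pow two_ne_zero).const_mul _)
      (fun n => ?_) ?_
    · filter_upwards [hM n] with x hx
      refine (norm_inner_le_norm _ _).trans ?_
      rw [sq, ← mul_assoc]
      exact mul_le_mul_of_nonneg_right ((A n x).le_of_opNorm_le hx _) (norm_nonneg _)
    · filter_upwards [hAB] with x hx
      exact (((ContinuousLinearMap.apply ℝ Space (G x)).continuous.tendsto _).comp hx).inner
        tendsto_const_nhds
  have h2 : Tendsto (fun n => ∫ x, ⟪A n x (d n x), d n x⟫ ∂μ - ∫ x, ⟪A n x (G x), G x⟫ ∂μ) atTop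
      (𝓝 0) := by
    rw [tendsto_zero_iff_enorm_tendsto_zero]
    set e : ℕ → ℝ≥0∞ := fun n => eLpNorm (fun x => d n x - G x) 2 μ with he
    have hlim : Tendsto (fun n => M * e n * (e n + eLpNorm G 2 μ) + M * eLpNorm G 2 μ * e n) atTop
        (𝓝 (M * 0 * (0 + eLpNorm G 2 μ) + M * eLpNorm G 2 μ * 0)) := by
      refine Tendsto.add (ENNReal.Tendsto.mul (ENNReal.Tendsto.const_mul hdG
        (Or.inr ENNReal.coe_ne_top)) (Or.inr ?_) (hdG.add tendsto_const_nhds) (Or.inr (by simp)))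
        (ENNReal.Tendsto.const_mul hdG (Or.inr (ENNReal.mul_ne_top ENNReal.coe_ne_top hG.2.ne)))
      simpa using hG.2.ne
    simp only [mul_zero, zero_mul, add_zero] at hlim
    refine tendsto_of_tendsto_of_tendsto_of_le_of_le tendsto_const_nhds hlim (fun _ => zero_le)
      fun n => ?_
    have hδ : MemLp (fun x => d n x - G x) 2 μ := (hd n).sub hG
    have hdn : eLpNorm (d n) 2 μ ≤ e n + eLpNorm G 2 μ := by
      have e1 : d n = (fun x => d n x - G x) + G := by funext x; simp
      calc eLpNorm (d n) 2 μ = eLpNorm ((fun x => d n x - G x) + G) 2 μ := by rw [← e1]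
        _ ≤ _ := eLpNorm_add_le hδ.1 hG.1 (by norm_num)
    have e2 : (fun x => ⟪A n x (d n x), d n x⟫ - ⟪A n x (G x), G x⟫) =
        (fun x => ⟪A n x (d n x - G x), d n x⟫) + fun x => ⟪A n x (G x), d n x - G x⟫ := by
      funext x
      simp only [Pi.add_apply, map_sub, inner_sub_left, inner_sub_right]; ring
    rw [← integral_sub (hint n (hd n) (hd n)) (hint n hG hG), e2]
    refine (enorm_integral_le_lintegral_enorm _).trans ?_
    rw [← eLpNorm_one_eq_lintegral_enorm]
    refine (eLpNorm_add_le (hm n hδ.1 (hd n).1) (hm n hG.1 hδ.1) le_rfl).trans (add_le_add ?_ ?_)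
    · refine (eLpNorm_bilinear_le (hM n) hδ.1 (hd n).1).trans ?_
      exact mul_le_mul_right hdn _
    · exact eLpNorm_bilinear_le (hM n) hG.1 hδ.1
  have := h2.add h1
  simpa using this

/-! ### The limit of the Lagrange multipliers -/

/-- The integrand of the nonlinear term. -/
noncomputable def curvTerm (ν : Space → Space) (φ w d : Plane → Space) (x : Plane) : ℝ :=
  ⟪fderiv ℝ ν (w x) (d x), d x⟫ * ⟪ν (w x), φ x⟫

/-- The coefficient of the quadratic form in the nonlinear term. -/
noncomputable def curvCoeff (ν : Space → Space) (φ w : Plane → Space) (x : Plane) :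
    Space →L[ℝ] Space := ⟪ν (w x), φ x⟫ • fderiv ℝ ν (w x)

theorem curvTerm_eq (ν : Space → Space) (φ w d : Plane → Space) (x : Plane) :
    curvTerm ν φ w d x = ⟪curvCoeff ν φ w x (d x), d x⟫ := by
  rw [curvTerm, curvCoeff, _root_.smul_apply, real_inner_smul_left, mul_comm]

section
variable {N : Set Space} {ν : Space → Space}

theorem aesm_curvCoeff (hν : IsUnitNormalField N ν) {φ w : Plane → Space} (hφ : Continuous φ)
    {μ : Measure Plane} (hw : AEStronglyMeasurable w μ) :
    AEStronglyMeasurable (curvCoeff ν φ w) μ := by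
  have h1 : Continuous fun y => fderiv ℝ ν y := hν.smooth.continuous_fderiv (by simp)
  have h2 : AEStronglyMeasurable (fun x => fderiv ℝ ν (w x)) μ :=
    h1.comp_aestronglyMeasurable hw
  have h3 : AEStronglyMeasurable (fun x => ⟪ν (w x), φ x⟫) μ :=
    (hν.smooth.continuous.comp_aestronglyMeasurable hw).inner hφ.aestronglyMeasurable
  exact h3.smul h2

theorem exists_norm_fderiv_le (hN : IsCompact N) (hν : IsUnitNormalField N ν) :
    ∃ K : ℝ≥0, ∀ y ∈ N, ‖fderiv ℝ ν y‖ ≤ K := by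
  have h1 : Continuous fun y => fderiv ℝ ν y := hν.smooth.continuous_fderiv (by simp)
  obtain ⟨K, hK⟩ := hN.bddAbove_image (continuous_norm.comp h1).continuousOn
  exact ⟨K.toNNReal, fun y hy => (hK (mem_image_of_mem _ hy)).trans (Real.le_coe_toNNReal K)⟩

theorem exists_norm_curvCoeff_le (hN : IsCompact N) (hν : IsUnitNormalField N ν)
    {φ : Plane → Space} (hφ : Continuous φ) (hs : HasCompactSupport φ) :
    ∃ M : ℝ≥0, ∀ (w : Plane → Space) (x : Plane), w x ∈ N → ‖curvCoeff ν φ w x‖ ≤ M := by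
  obtain ⟨K, hK⟩ := exists_norm_fderiv_le hN hν
  obtain ⟨M, hM⟩ := hφ.bounded_above_of_compact_support hs
  refine ⟨M.toNNReal * K, fun w x hx => ?_⟩
  rw [curvCoeff, norm_smul, NNReal.coe_mul]
  refine mul_le_mul ?_ (hK _ hx) (norm_nonneg _) NNReal.zero_le_coe
  refine (norm_inner_le_norm _ _).trans ?_
  rw [hν.norm_eq_one _ hx, one_mul]
  exact (hM x).trans (Real.le_coe_toNNReal M)

theorem curvTerm_eq_zero {φ : Plane → Space} {R : ℝ} (hR : tsupport φ ⊆ Metric.ball 0 R)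
    (w d : Plane → Space) {x : Plane} (hx : x ∉ Metric.ball (0 : Plane) R) :
    curvTerm ν φ w d x = 0 := by
  have : φ x = 0 := by
    by_contra h0
    exact hx (hR (subset_tsupport _ h0))
  simp [curvTerm, this]

theorem integrable_curvTerm (hN : IsCompact N) (hν : IsUnitNormalField N ν) {φ w d : Plane → Space}
    (hφ : Continuous φ) (hs : HasCompactSupport φ) (hw : AEStronglyMeasurable w)
    (hwN : ∀ᵐ x, w x ∈ N) (hd : ∀ R, MemLp d 2 (volume.restrict (Metric.ball 0 R))) :
    Integrable (curvTerm ν φ w d) := by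
  obtain ⟨R, hR⟩ := hs.isCompact.isBounded.subset_ball 0
  obtain ⟨M, hM⟩ := exists_norm_curvCoeff_le hN hν hφ hs
  rw [← integrableOn_iff_integrable_of_support_subset (s := Metric.ball 0 R) fun x hx => by
    by_contra h0
    exact hx (curvTerm_eq_zero hR w d h0)]
  have e : curvTerm ν φ w d = fun x => ⟪curvCoeff ν φ w x (d x), d x⟫ :=
    funext fun x => curvTerm_eq ν φ w d x
  rw [e]
  have hm := aesm_curvCoeff hν hφ (hw.restrict (s := Metric.ball 0 R))
  refine memLp_one_iff_integrable.1 ⟨((ContinuousLinearMap.id ℝ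
    (Space →L[ℝ] Space)).aestronglyMeasurable_comp₂ hm (hd R).1).inner (hd R).1, ?_⟩
  exact (eLpNorm_bilinear_le (ae_restrict_of_ae (hwN.mono fun x hx => hM w x hx)) (hd R).1
    (hd R).1).trans_lt (ENNReal.mul_lt_top (ENNReal.mul_lt_top ENNReal.coe_lt_top (hd R).2)
      (hd R).2)

theorem exists_seq_tendsto_ae {q : ℕ → Plane → Space} {p : Plane → Space} {μ : Measure Plane}
    (hq : ∀ n, AEStronglyMeasurable (q n) μ) (hp : AEStronglyMeasurable p μ)
    (hlim : Tendsto (fun n => eLpNorm (fun x => q n x - p x) 2 μ) atTop (𝓝 0)) :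
    ∃ ns : ℕ → ℕ, StrictMono ns ∧ ∀ᵐ x ∂μ, Tendsto (fun n => q (ns n) x) atTop (𝓝 (p x)) :=
  (tendstoInMeasure_of_tendsto_eLpNorm two_ne_zero hq hp hlim).exists_seq_tendsto_ae

theorem ae_mem_of_tendsto (hN : IsClosed N) {q : ℕ → Plane → Space} {p : Plane → Space}
    (hq : ∀ n, AEStronglyMeasurable (q n)) (hqN : ∀ n x, q n x ∈ N) (hp : AEStronglyMeasurable p)
    (hlim : ∀ R, Tendsto (fun n => eLpNorm (fun x => q n x - p x) 2
      (volume.restrict (Metric.ball 0 R))) atTop (𝓝 0)) : ∀ᵐ x, p x ∈ N := by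
  have h1 : ∀ R : ℝ, ∀ᵐ x ∂(volume.restrict (Metric.ball (0 : Plane) R)), p x ∈ N := fun R => by
    obtain ⟨ns, -, h⟩ := exists_seq_tendsto_ae (fun n => (hq n).restrict) hp.restrict (hlim R)
    filter_upwards [h] with x hx
    exact hN.mem_of_tendsto hx (Eventually.of_forall fun n => hqN _ _)
  rw [← Measure.restrict_univ (μ := (volume : Measure Plane)), ← Metric.iUnion_ball_nat 0,
    ae_restrict_iUnion_iff]
  exact fun n => h1 n

theorem tendsto_integral_curvTerm (hN : IsCompact N) (hν : IsUnitNormalField N ν)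
    {φ : Plane → Space} (hφ : Continuous φ) (hs : HasCompactSupport φ)
    {w : ℕ → Plane → Space} {p : Plane → Space} (hw : ∀ n, AEStronglyMeasurable (w n))
    (hwN : ∀ n x, w n x ∈ N) (hp : AEStronglyMeasurable p)
    (hlim : ∀ R, Tendsto (fun n => eLpNorm (fun x => w n x - p x) 2
      (volume.restrict (Metric.ball 0 R))) atTop (𝓝 0))
    {d : ℕ → Plane → Space} {G : Plane → Space}
    (hd : ∀ n R, MemLp (d n) 2 (volume.restrict (Metric.ball 0 R)))
    (hG : ∀ R, MemLp G 2 (volume.restrict (Metric.ball 0 R)))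
    (hdG : ∀ R, Tendsto (fun n => eLpNorm (fun x => d n x - G x) 2
      (volume.restrict (Metric.ball 0 R))) atTop (𝓝 0)) :
    Tendsto (fun n => ∫ x, curvTerm ν φ (w n) (d n) x) atTop (𝓝 (∫ x, curvTerm ν φ p G x)) := by
  obtain ⟨R, hR⟩ := hs.isCompact.isBounded.subset_ball 0
  obtain ⟨M, hM⟩ := exists_norm_curvCoeff_le hN hν hφ hs
  have hset : ∀ w d : Plane → Space, ∫ x, curvTerm ν φ w d x =
      ∫ x in Metric.ball 0 R, ⟪curvCoeff ν φ w x (d x), d x⟫ := fun w d => by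
    rw [← setIntegral_eq_integral_of_forall_compl_eq_zero fun x hx =>
      curvTerm_eq_zero (ν := ν) hR w d hx]
    exact integral_congr_ae (Eventually.of_forall fun x => curvTerm_eq ν φ w d x)
  simp only [hset]
  -- Convergence in `L²` makes the coefficients converge almost everywhere only along subsequences,
  -- but the limit is the same for all of them.
  refine tendsto_of_subseq_tendsto fun ns hns => ?_
  obtain ⟨ms, hms, hae⟩ := exists_seq_tendsto_ae (fun n => (hw (ns n)).restrict) hp.restrict
    ((hlim R).comp hns)
  refine ⟨ms, tendsto_integral_quadratic (M := M)
    (fun n => aesm_curvCoeff hν hφ (hw _).restrict)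
    (fun n => Eventually.of_forall fun x => hM _ x (hwN _ x)) ?_ (fun n => hd _ R) (hG R)
    ((hdG R).comp (hns.comp hms.tendsto_atTop))⟩
  filter_upwards [hae] with x hx
  have h1 : Continuous fun y => fderiv ℝ ν y := hν.smooth.continuous_fderiv (by simp)
  exact (((hν.smooth.continuous.tendsto _).comp hx).inner tendsto_const_nhds).smul
    ((h1.tendsto _).comp hx)

variable {h : ℕ → ℝ} {u : ℕ → ℝ → Grid → Space} {p : ℝ → Plane → Space}
  {G : Fin 2 → ℝ → Plane → Space}

/-- The energy bound passes to the limit. That it depends neither on the time nor on the radius is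
what makes the gradient square integrable down to `t = 0`. -/
theorem FlowLimit.eLpNorm_grad_le (H : FlowLimit N h u p G) (i : Fin 2) {t : ℝ} (ht : 0 < t)
    (R : ℝ) : eLpNorm (G i t) 2 (volume.restrict (Metric.ball 0 R)) ≤ ENNReal.ofReal 2 := by
  have h1 := (H.tendsto_grad i t ht R).add_const (ENNReal.ofReal 2)
  rw [zero_add] at h1
  refine ge_of_tendsto' h1 fun n => ?_
  have e : G i t = pcD (h n) i (u n t) - fun x => pcD (h n) i (u n t) x - G i t x := by
    funext x; simp
  calc eLpNorm (G i t) 2 (volume.restrict (Metric.ball 0 R))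
      = eLpNorm (pcD (h n) i (u n t) - fun x => pcD (h n) i (u n t) x - G i t x) 2
        (volume.restrict (Metric.ball 0 R)) := by rw [← e]
    _ ≤ _ := eLpNorm_sub_le (aesm_pc _ _ _) ((aesm_pc _ _ _).sub (H.aesm_grad _ _ _)) (by norm_num)
    _ ≤ _ := by
      rw [add_comm]
      exact add_le_add le_rfl ((eLpNorm_mono_measure _ Measure.restrict_le_self).trans
        (eLpNorm_pcD_le (H.pos n) (by norm_num) (H.energy n ht.le) i))

theorem FlowLimit.memLp_grad (H : FlowLimit N h u p G) (i : Fin 2) {t : ℝ} (ht : 0 < t) (R : ℝ) :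
    MemLp (G i t) 2 (volume.restrict (Metric.ball 0 R)) :=
  ⟨H.aesm_grad _ _ _, (H.eLpNorm_grad_le i ht R).trans_lt ENNReal.ofReal_lt_top⟩

theorem FlowLimit.ae_mem (hN : IsCompact N) (H : FlowLimit N h u p G) {t : ℝ} (ht : 0 ≤ t) :
    ∀ᵐ x, p t x ∈ N :=
  ae_mem_of_tendsto hN.isClosed (fun n => aesm_pc (h n) (u n t) _) (fun n x => H.mem n t ht _)
    (H.aesm t _) (H.tendsto t ht)

/-- The backward difference quotient, as a translate of the forward one. -/
noncomputable def pcDback (h : ℝ) (i : Fin 2) (v : Grid → Space) (x : Plane) : Space :=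
  forwardDiff h i v (cellIndex h x - unitIndex i)

theorem pcDback_eq {h : ℝ} (hh : 0 < h) (i : Fin 2) (v : Grid → Space) (x : Plane) :
    pcDback h i v x = pcD h i v (x + -(h • EuclideanSpace.single i 1)) := by
  rw [pcDback, pcD, pc]
  congr 1
  rw [sub_eq_iff_eq_add, ← cellIndex_add_smul_unit hh]
  congr 1; abel

theorem memLp_pcDback {h : ℝ} (hh : 0 < h) {v : Grid → Space} {D : ℝ} (hD : 0 ≤ D)
    (hv : ∀ i, gsq (dif i v) ≤ ENNReal.ofReal (D ^ 2)) (i : Fin 2) : MemLp (pcDback h i v) 2 := by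
  have e : pcDback h i v = fun x => pcD h i v (x + -(h • EuclideanSpace.single i 1)) :=
    funext fun x => pcDback_eq hh i v x
  rw [e]
  exact (memLp_pcD hh hD hv i).comp_measurePreserving (measurePreserving_add_right volume _)

/-- The backward quotient is the forward one translated by `h`, and the second order bound makes
this translation negligible. -/
theorem FlowLimit.tendsto_pcDback (H : FlowLimit N h u p G) (i : Fin 2) {t : ℝ} (ht : 0 < t)
    (R : ℝ) : Tendsto (fun n => eLpNorm (fun x => pcDback (h n) i (u n t) x - G i t x) 2
      (volume.restrict (Metric.ball 0 R))) atTop (𝓝 0) := by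
  have hb : ∀ n, MemLp (pcDback (h n) i (u n t)) 2 := fun n =>
    memLp_pcDback (H.pos n) (by norm_num) (H.energy n ht.le) i
  refine tendsto_eLpNorm_of_sub (fun n => (hb n).1.restrict) (fun n => aesm_pc _ _ _)
    (H.aesm_grad i t _) ?_ Measure.restrict_le_self (H.tendsto_grad i t ht R)
  refine tendsto_of_tendsto_of_tendsto_of_le_of_le tendsto_const_nhds
    (tendsto_ofReal_mul_zero H.lim (4 * √(8 / t))) (fun _ => zero_le) fun n => ?_
  have hh := H.pos n
  simp only [pcDback_eq hh]
  refine (incr_pc_le hh _ (D := √(8 / t)) (by positivity) (fun k => ?_) _).trans (le_of_eq ?_)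
  · rw [forwardDiff_eq, dif_smul, gsq_smul, Real.sq_sqrt (by positivity)]
    refine (mul_le_mul_right ((H.bounds n).hessian t ht i k) _).trans (le_of_eq ?_)
    rw [← ENNReal.ofReal_mul (by positivity)]
    congr 1; field_simp
  · rw [norm_neg, norm_smul, Real.norm_of_nonneg hh.le, PiLp.norm_single, norm_one]
    congr 1; ring

theorem measurable_comp_cellIndex (h : ℝ) (m : Grid → ℝ) :
    Measurable fun x => m (cellIndex h x) :=
  (measurable_of_countable m).comp (measurable_cellIndex h)

theorem tendsto_integral_mul_of_lintegral {m b : ℕ → Plane → ℝ} {M : ℝ}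
    (hM : ∀ n x, |b n x| ≤ M)
    (hlim : Tendsto (fun n => ∫⁻ x, ‖m n x‖ₑ) atTop (𝓝 0)) :
    Tendsto (fun n => ∫ x, m n x * b n x) atTop (𝓝 0) := by
  rw [tendsto_zero_iff_enorm_tendsto_zero]
  have h1 : Tendsto (fun n => ENNReal.ofReal M * ∫⁻ x, ‖m n x‖ₑ) atTop (𝓝 0) := by
    simpa using ENNReal.Tendsto.const_mul hlim (Or.inr (ENNReal.ofReal_ne_top (r := M)))
  refine tendsto_of_tendsto_of_tendsto_of_le_of_le tendsto_const_nhds h1 (fun _ => zero_le)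
    fun n => (enorm_integral_le_lintegral_enorm _).trans ?_
  rw [← lintegral_const_mul' _ _ ENNReal.ofReal_ne_top]
  refine lintegral_mono fun x => ?_
  rw [enorm_mul, mul_comm]
  refine mul_le_mul_left ?_ _
  rw [← ofReal_norm]
  exact ENNReal.ofReal_le_ofReal (hM n x)

/-- Up to a remainder that vanishes in `L¹`, the multiplier is the mean of the quadratic forms in
forward and backward quotients. Both quotients converge strongly to the same gradient, so the two
halves add up. -/
theorem FlowLimit.tendsto_integral_multiplier (hN : IsCompact N) (hs : IsSmoothHypersurface N)
    (hν : IsUnitNormalField N ν) (H : FlowLimit N h u p G) {t : ℝ} (ht : 0 < t)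
    {φ : Plane → Space} (hφ : Continuous φ) (hφs : HasCompactSupport φ) :
    Tendsto (fun n => ∫ x, multiplier (h n) ν (u n t) (cellIndex (h n) x) *
      ⟪ν (pc (h n) (u n t) x), φ x⟫) atTop
      (𝓝 (∫ x, (∑ i, ⟪fderiv ℝ ν (p t x) (G i t x), G i t x⟫) * ⟪ν (p t x), φ x⟫)) := by
  obtain ⟨C, hC0, hC⟩ := exists_abs_normal_taylor_le hN hs hν
  obtain ⟨M, hM⟩ := hφ.bounded_above_of_compact_support hφs
  set w : ℕ → Plane → Space := fun n => pc (h n) (u n t) with hw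
  have hwm : ∀ n, AEStronglyMeasurable (w n) := fun n => aesm_pc _ _ _
  have hwN : ∀ n x, w n x ∈ N := fun n x => H.mem n t ht.le _
  have hb : ∀ n x, |⟪ν (w n x), φ x⟫| ≤ M := fun n x => by
    refine (abs_real_inner_le_norm _ _).trans ?_
    rw [hν.norm_eq_one _ (hwN n x), one_mul]
    exact hM x
  have hd : ∀ i n R, MemLp (pcD (h n) i (u n t)) 2 (volume.restrict (Metric.ball 0 R)) :=
    fun i n R => (memLp_pcD (H.pos n) (by norm_num) (H.energy n ht.le) i).restrict _
  have hd' : ∀ i n R, MemLp (pcDback (h n) i (u n t)) 2 (volume.restrict (Metric.ball 0 R)) :=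
    fun i n R => (memLp_pcDback (H.pos n) (by norm_num) (H.energy n ht.le) i).restrict _
  have h1 : Tendsto (fun n => ∑ i, 1 / 2 * ((∫ x, curvTerm ν φ (w n) (pcD (h n) i (u n t)) x) +
      ∫ x, curvTerm ν φ (w n) (pcDback (h n) i (u n t)) x)) atTop
      (𝓝 (∑ i, 1 / 2 * ((∫ x, curvTerm ν φ (p t) (G i t) x) +
        ∫ x, curvTerm ν φ (p t) (G i t) x))) := by
    refine tendsto_finsetSum _ fun i _ => Tendsto.const_mul _ (Tendsto.add ?_ ?_)
    · exact tendsto_integral_curvTerm hN hν hφ hφs hwm hwN (H.aesm t _) (H.tendsto t ht.le)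
        (hd i) (H.memLp_grad i ht) (H.tendsto_grad i t ht)
    · exact tendsto_integral_curvTerm hN hν hφ hφs hwm hwN (H.aesm t _) (H.tendsto t ht.le)
        (hd' i) (H.memLp_grad i ht) (H.tendsto_pcDback i ht)
  set rem : ℕ → Plane → ℝ := fun n x => multiplier (h n) ν (u n t) (cellIndex (h n) x) -
    multiplierQuad (h n) ν (u n t) (cellIndex (h n) x) with hrem
  have hremlim : Tendsto (fun n => ∫⁻ x, ‖rem n x‖ₑ) atTop (𝓝 0) := by
    have h2 : ∀ n, ∫⁻ x, ‖rem n x‖ₑ ≤ ENNReal.ofReal (2 * C) *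
        ∑ _i : Fin 2, ENNReal.ofReal ((4 + 64 / t) * h n) := fun n => by
      refine (lintegral_comp_cellIndex_le (H.pos n) (m := fun j => multiplier (h n) ν (u n t) j -
        multiplierQuad (h n) ν (u n t) j) hC0 3
        (abs_multiplier_sub_quad_le hC (H.mem n t ht.le))).trans ?_
      refine mul_le_mul_right (Finset.sum_le_sum fun i _ => ?_) _
      refine tsum_enorm_cube_le (H.pos n) _ (by norm_num) (by positivity)
        ((H.bounds n).energy t ht.le i) (((H.bounds n).four t ht i).trans (le_of_eq ?_))
      congr 1; ring
    have h3 : Tendsto (fun n => ENNReal.ofReal (2 * C) *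
        ∑ _i : Fin 2, ENNReal.ofReal ((4 + 64 / t) * h n)) atTop (𝓝 (ENNReal.ofReal (2 * C) *
          ∑ _i : Fin 2, 0)) :=
      ENNReal.Tendsto.const_mul (tendsto_finsetSum _ fun i _ => tendsto_ofReal_mul_zero H.lim _)
        (Or.inr ENNReal.ofReal_ne_top)
    simp only [Finset.sum_const_zero, mul_zero] at h3
    exact tendsto_of_tendsto_of_tendsto_of_le_of_le tendsto_const_nhds h3 (fun _ => zero_le) h2
  have h4 := tendsto_integral_mul_of_lintegral (m := rem) hb hremlim
  have hint : ∀ n i, Integrable (curvTerm ν φ (w n) (pcD (h n) i (u n t))) := fun n i =>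
    integrable_curvTerm hN hν hφ hφs (hwm n) (Eventually.of_forall (hwN n)) (hd i n)
  have hint' : ∀ n i, Integrable (curvTerm ν φ (w n) (pcDback (h n) i (u n t))) := fun n i =>
    integrable_curvTerm hN hν hφ hφs (hwm n) (Eventually.of_forall (hwN n)) (hd' i n)
  have hintp : ∀ i, Integrable (curvTerm ν φ (p t) (G i t)) := fun i =>
    integrable_curvTerm hN hν hφ hφs (H.aesm t _) (H.ae_mem hN ht.le) (H.memLp_grad i ht)
  have hremint : ∀ᶠ n in atTop, Integrable fun x => rem n x * ⟪ν (w n x), φ x⟫ := by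
    filter_upwards [(ENNReal.tendsto_nhds_zero.1 hremlim) 1 one_pos] with n hn
    have hm : Measurable (rem n) := measurable_comp_cellIndex (h n) fun j =>
      multiplier (h n) ν (u n t) j - multiplierQuad (h n) ν (u n t) j
    have h5 : Integrable (rem n) := ⟨hm.aestronglyMeasurable, hn.trans_lt ENNReal.one_lt_top⟩
    refine h5.mul_bdd (c := M) ?_ (Eventually.of_forall (hb n))
    exact (hν.smooth.continuous.comp_aestronglyMeasurable (hwm n)).inner hφ.aestronglyMeasurable
  have hlimit : ∑ i, 1 / 2 * ((∫ x, curvTerm ν φ (p t) (G i t) x) +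
      ∫ x, curvTerm ν φ (p t) (G i t) x) =
      ∫ x, (∑ i, ⟪fderiv ℝ ν (p t x) (G i t x), G i t x⟫) * ⟪ν (p t x), φ x⟫ := by
    have e : ∀ x, (∑ i, ⟪fderiv ℝ ν (p t x) (G i t x), G i t x⟫) * ⟪ν (p t x), φ x⟫ =
        ∑ i, curvTerm ν φ (p t) (G i t) x := fun x => by simp only [Finset.sum_mul, curvTerm]
    simp only [e]
    rw [integral_finsetSum _ fun i _ => hintp i]
    exact Finset.sum_congr rfl fun i _ => by ring
  have h6 := h1.add h4
  rw [add_zero, hlimit] at h6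
  refine h6.congr' ?_
  filter_upwards [hremint] with n hn
  have hsum : Integrable fun x => ∑ i, 1 / 2 * (curvTerm ν φ (w n) (pcD (h n) i (u n t)) x +
      curvTerm ν φ (w n) (pcDback (h n) i (u n t)) x) :=
    integrable_finsetSum _ fun i _ => ((hint n i).add (hint' n i)).const_mul _
  have e : ∀ x, multiplier (h n) ν (u n t) (cellIndex (h n) x) * ⟪ν (w n x), φ x⟫ =
      (∑ i, 1 / 2 * (curvTerm ν φ (w n) (pcD (h n) i (u n t)) x +
        curvTerm ν φ (w n) (pcDback (h n) i (u n t)) x)) + rem n x * ⟪ν (w n x), φ x⟫ := fun x => by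
    have e2 : ∑ i, 1 / 2 * (curvTerm ν φ (w n) (pcD (h n) i (u n t)) x +
        curvTerm ν φ (w n) (pcDback (h n) i (u n t)) x) =
        multiplierQuad (h n) ν (u n t) (cellIndex (h n) x) * ⟪ν (w n x), φ x⟫ := by
      rw [multiplierQuad, Finset.sum_mul]
      refine Finset.sum_congr rfl fun i _ => ?_
      simp only [curvTerm, hw, pcD, pc, pcDback]; ring
    rw [e2, hrem]; ring
  refine Eq.trans ?_ (integral_congr_ae (Eventually.of_forall fun x => (e x).symm))
  have hi : ∀ i, Integrable fun x => 1 / 2 * (curvTerm ν φ (w n) (pcD (h n) i (u n t)) x +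
      curvTerm ν φ (w n) (pcDback (h n) i (u n t)) x) := fun i =>
    ((hint n i).add (hint' n i)).const_mul (1 / 2)
  rw [integral_add hsum hn, integral_finsetSum _ fun i _ => hi i]
  congr 1
  refine Finset.sum_congr rfl fun i _ => ?_
  rw [integral_const_mul, integral_add (hint n i) (hint' n i)]

/-- The quadratic bound of the multiplier and the energy bound give an estimate uniform in `n` and
in `t`, in contrast to the convergence proof. It is the majorant for the integration in time. -/
theorem FlowSeq.norm_integral_multiplier_le (H : FlowSeq N h u) (hν : IsUnitNormalField N ν)
    {C : ℝ} (hC0 : 0 ≤ C)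
    (hC : ∀ y ∈ N, ∀ z ∈ N, |⟪ν y, z - y⟫| ≤ C * ‖z - y‖ ^ 2) (n : ℕ) {t : ℝ} (ht : 0 ≤ t)
    {φ : Plane → Space} {M : ℝ} (hM0 : 0 ≤ M) (hM : ∀ x, ‖φ x‖ ≤ M) :
    ‖∫ x, multiplier (h n) ν (u n t) (cellIndex (h n) x) * ⟪ν (pc (h n) (u n t) x), φ x⟫‖ ≤
      M * (16 * C) := by
  have h1 : ∫⁻ x, ‖multiplier (h n) ν (u n t) (cellIndex (h n) x)‖ₑ ≤ ENNReal.ofReal (16 * C) := by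
    refine (lintegral_comp_cellIndex_le (H.pos n) hC0 2
      (abs_multiplier_le hC (H.mem n t ht))).trans ?_
    refine (mul_le_mul_right (Finset.sum_le_sum fun i _ => (H.bounds n).energy t ht i) _).trans
      (le_of_eq ?_)
    rw [← ENNReal.ofReal_sum_of_nonneg fun i _ => by norm_num,
      ← ENNReal.ofReal_mul (by positivity)]
    congr 1; simp; ring
  have h2 : ‖∫ x, multiplier (h n) ν (u n t) (cellIndex (h n) x) *
      ⟪ν (pc (h n) (u n t) x), φ x⟫‖ₑ ≤ ENNReal.ofReal (M * (16 * C)) := by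
    refine (enorm_integral_le_lintegral_enorm _).trans ?_
    rw [ENNReal.ofReal_mul hM0]
    refine le_trans ?_ (mul_le_mul_right h1 _)
    rw [← lintegral_const_mul' _ _ ENNReal.ofReal_ne_top]
    refine lintegral_mono fun x => ?_
    rw [enorm_mul, mul_comm]
    refine mul_le_mul_left ?_ _
    rw [← ofReal_norm]
    refine ENNReal.ofReal_le_ofReal ((norm_inner_le_norm _ _).trans ?_)
    rw [pc, hν.norm_eq_one _ (H.mem n t ht _), one_mul]
    exact hM x
  rw [← ofReal_norm, ENNReal.ofReal_le_ofReal_iff (by positivity)] at h2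
  exact h2

end

/-! ### The weak form of the semi-discrete flow -/

theorem integrable_inner_of_bound {α : Type*} [TopologicalSpace α] [MeasurableSpace α]
    [OpensMeasurableSpace α] [SecondCountableTopology α] {μ : Measure α}
    [IsFiniteMeasureOnCompacts μ] {F ψ : α → Space} {B : ℝ}
    (hF : AEStronglyMeasurable F μ) (hB : ∀ᵐ x ∂μ, ‖F x‖ ≤ B) (hψ : Continuous ψ)
    (hs : HasCompactSupport ψ) : Integrable (fun x => ⟪F x, ψ x⟫) μ := by
  refine ((hψ.norm.integrable_of_hasCompactSupport hs.norm).const_mul B).mono'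
    (hF.inner hψ.aestronglyMeasurable) ?_
  filter_upwards [hB] with x hx
  exact (norm_inner_le_norm _ _).trans (mul_le_mul_of_nonneg_right hx (norm_nonneg _))

theorem norm_integral_inner_le {F ψ : Plane → Space} {B M R : ℝ} (hB0 : 0 ≤ B)
    (hB : ∀ x, ‖F x‖ ≤ B) (hM : ∀ x, ‖ψ x‖ ≤ M)
    (hψ : ∀ x ∉ Metric.ball (0 : Plane) R, ψ x = 0) :
    ‖∫ x, ⟪F x, ψ x⟫‖ ≤ B * M * volume.real (Metric.ball (0 : Plane) R) := by
  rw [← setIntegral_eq_integral_of_forall_compl_eq_zero (s := Metric.ball 0 R) fun x hx => by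
    rw [hψ x hx, inner_zero_right]]
  refine norm_setIntegral_le_of_norm_le_const measure_ball_lt_top fun x _ => ?_
  exact (norm_inner_le_norm _ _).trans (mul_le_mul (hB x) (hM x) (norm_nonneg _) hB0)

theorem integral_inner_comp_add (F ψ : Plane → Space) (z : Plane) :
    ∫ x, ⟪F (x + z), ψ x⟫ = ∫ x, ⟪F x, ψ (x - z)⟫ := by
  rw [← integral_add_right_eq_self (μ := volume) (fun x => ⟪F x, ψ (x - z)⟫) z]
  simp

section
variable {φ : ℝ × Plane → Space}

theorem exists_radius (hs : HasCompactSupport φ) : ∃ R : ℝ, 0 < R ∧ tsupport φ ⊆ Metric.ball 0 R := by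
  obtain ⟨R, hR⟩ := hs.isCompact.isBounded.subset_ball 0
  exact ⟨max R 1, lt_max_of_lt_right one_pos, hR.trans (Metric.ball_subset_ball (le_max_left _ _))⟩

theorem eq_zero_of_le_abs {R : ℝ} (hR : tsupport φ ⊆ Metric.ball 0 R) {t : ℝ} (x : Plane)
    (ht : R ≤ |t|) : φ (t, x) = 0 := by
  by_contra h0
  have := hR (subset_tsupport _ h0)
  rw [mem_ball_zero_iff, Prod.norm_def, max_lt_iff] at this
  exact absurd this.1 (by simpa using ht)

theorem eq_zero_of_le_norm {R : ℝ} (hR : tsupport φ ⊆ Metric.ball 0 R) (t : ℝ) {x : Plane}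
    (hx : R ≤ ‖x‖) : φ (t, x) = 0 := by
  by_contra h0
  have := hR (subset_tsupport _ h0)
  rw [mem_ball_zero_iff, Prod.norm_def, max_lt_iff] at this
  exact absurd this.2 (by simpa using hx)

theorem hasCompactSupport_slice (hs : HasCompactSupport φ) (t : ℝ) :
    HasCompactSupport fun x => φ (t, x) := by
  obtain ⟨R, -, hR⟩ := exists_radius hs
  refine HasCompactSupport.intro (isCompact_closedBall (0 : Plane) R) fun x hx => ?_
  rw [mem_closedBall_zero_iff, not_le] at hx
  exact eq_zero_of_le_norm hR t hx.le

theorem continuous_slice (hφ : Continuous φ) (t : ℝ) : Continuous fun x => φ (t, x) :=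
  hφ.comp (by fun_prop)

/-- The discrete Laplacian of a test map. -/
noncomputable def testLap (h : ℝ) (φ : ℝ × Plane → Space) (z : ℝ × Plane) : Space :=
  ∑ i, secondDiff h φ (spaceDir i) z

theorem add_smul_spaceDir (t : ℝ) (x : Plane) (h : ℝ) (i : Fin 2) :
    ((t, x) : ℝ × Plane) + h • spaceDir i = (t, x + h • EuclideanSpace.single i 1) := by
  simp [spaceDir]

theorem sub_smul_spaceDir (t : ℝ) (x : Plane) (h : ℝ) (i : Fin 2) :
    ((t, x) : ℝ × Plane) - h • spaceDir i = (t, x - h • EuclideanSpace.single i 1) := by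
  simp [spaceDir]

theorem pc_discreteLaplacian {h : ℝ} (hh : 0 < h) (v : Grid → Space) (x : Plane) :
    discreteLaplacian h v (cellIndex h x) = ∑ i, (h⁻¹ ^ 2) •
      (pc h v (x + h • EuclideanSpace.single i 1) + pc h v (x + -(h • EuclideanSpace.single i 1)) -
        (2 : ℝ) • pc h v x) := by
  rw [discreteLaplacian_eq, lap, Finset.smul_sum]
  refine Finset.sum_congr rfl fun i _ => ?_
  have e : cellIndex h (x + -(h • EuclideanSpace.single i 1)) = cellIndex h x - unitIndex i := by
    rw [eq_sub_iff_add_eq, ← cellIndex_add_smul_unit hh]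
    congr 1; abel
  rw [pc_add_smul_unit hh, pc, pc, pc, e, two_smul]
  congr 1; abel

/-- Summation by parts in the form of translation invariance of the integral: each shift is moved
from the step function to the test map. -/
theorem integral_inner_discreteLaplacian {h : ℝ} (hh : 0 < h) {v : Grid → Space} {B : ℝ}
    (hv : ∀ j, ‖v j‖ ≤ B) (hφ : Continuous φ) (hs : HasCompactSupport φ) (t : ℝ) :
    ∫ x, ⟪discreteLaplacian h v (cellIndex h x), φ (t, x)⟫ =
      ∫ x, ⟪pc h v x, testLap h φ (t, x)⟫ := by
  set ψ : Plane → Space := fun x => φ (t, x) with hψ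
  have hψc : Continuous ψ := continuous_slice hφ t
  have hψs : HasCompactSupport ψ := hasCompactSupport_slice hs t
  set W := pc h v with hW
  have hWb : ∀ x, ‖W x‖ ≤ B := fun x => hv _
  have i0 : ∀ z, Integrable fun x => ⟪W (x + z), ψ x⟫ := fun z =>
    integrable_inner_of_bound (aesm_comp_add (aesm_pc h v _) z)
      (Eventually.of_forall fun x => hWb _) hψc hψs
  have i0' : Integrable fun x => ⟪W x, ψ x⟫ := by simpa using i0 0
  have i1 : ∀ z, Integrable fun x => ⟪W x, ψ (x - z)⟫ := fun z => by
    have := (i0 z).comp_add_right (-z)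
    simpa [← sub_eq_add_neg] using this
  have e1 : ∀ x, ⟪discreteLaplacian h v (cellIndex h x), ψ x⟫ = ∑ i, (h⁻¹ ^ 2) *
      (⟪W (x + h • EuclideanSpace.single i 1), ψ x⟫ +
        ⟪W (x + -(h • EuclideanSpace.single i 1)), ψ x⟫ - 2 * ⟪W x, ψ x⟫) := fun x => by
    rw [pc_discreteLaplacian hh, sum_inner]
    refine Finset.sum_congr rfl fun i _ => ?_
    rw [real_inner_smul_left, inner_sub_left, inner_add_left, real_inner_smul_left]
  have e2 : ∀ x, ⟪W x, testLap h φ (t, x)⟫ = ∑ i, (h⁻¹ ^ 2) *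
      (⟪W x, ψ (x - h • EuclideanSpace.single i 1)⟫ +
        ⟪W x, ψ (x - -(h • EuclideanSpace.single i 1))⟫ - 2 * ⟪W x, ψ x⟫) := fun x => by
    rw [testLap, inner_sum]
    refine Finset.sum_congr rfl fun i _ => ?_
    rw [secondDiff, add_smul_spaceDir, sub_smul_spaceDir, real_inner_smul_right, inner_sub_right,
      inner_add_right, real_inner_smul_right, sub_neg_eq_add]
    ring
  have j1 : ∀ i, Integrable fun x => (h⁻¹ ^ 2) * (⟪W (x + h • EuclideanSpace.single i 1), ψ x⟫ +
      ⟪W (x + -(h • EuclideanSpace.single i 1)), ψ x⟫ - 2 * ⟪W x, ψ x⟫) := fun i =>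
    (((i0 _).add (i0 _)).sub (i0'.const_mul 2)).const_mul _
  have j2 : ∀ i, Integrable fun x => (h⁻¹ ^ 2) * (⟪W x, ψ (x - h • EuclideanSpace.single i 1)⟫ +
      ⟪W x, ψ (x - -(h • EuclideanSpace.single i 1))⟫ - 2 * ⟪W x, ψ x⟫) := fun i =>
    (((i1 _).add (i1 _)).sub (i0'.const_mul 2)).const_mul _
  rw [integral_congr_ae (Eventually.of_forall e1), integral_congr_ae (Eventually.of_forall e2),
    integral_finsetSum _ fun i _ => j1 i, integral_finsetSum _ fun i _ => j2 i]
  refine Finset.sum_congr rfl fun i _ => ?_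
  rw [integral_const_mul, integral_const_mul]
  congr 1
  have k1 : ∀ z w, Integrable fun x => ⟪W (x + z), ψ x⟫ + ⟪W (x + w), ψ x⟫ := fun z w =>
    (i0 z).add (i0 w)
  have k2 : ∀ z w, Integrable fun x => ⟪W x, ψ (x - z)⟫ + ⟪W x, ψ (x - w)⟫ := fun z w =>
    (i1 z).add (i1 w)
  rw [integral_sub (k1 _ _) (i0'.const_mul 2), integral_sub (k2 _ _) (i0'.const_mul 2),
    integral_add (i0 _) (i0 _), integral_add (i1 _) (i1 _), integral_inner_comp_add,
    integral_inner_comp_add]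

/-- The time derivative of a test map. -/
noncomputable def timeDeriv (φ : ℝ × Plane → Space) (z : ℝ × Plane) : Space :=
  fderiv ℝ φ z (1, 0)

variable {N : Set Space} {ν : Space → Space} {h : ℝ} {f : Grid → Space} {U : ℝ → Grid → Space}

/-- The right-hand side of the semi-discrete flow. -/
noncomputable def flowVelocity (h : ℝ) (ν : Space → Space) (v : Grid → Space) (j : Grid) : Space :=
  discreteLaplacian h v j + multiplier h ν v j • ν (v j)

theorem norm_discreteLaplacian_le {v : Grid → Space} {B : ℝ} (hv : ∀ j, ‖v j‖ ≤ B) (j : Grid) :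
    ‖discreteLaplacian h v j‖ ≤ h⁻¹ ^ 2 * (8 * B) := by
  rw [discreteLaplacian_eq, norm_smul, Real.norm_of_nonneg (by positivity)]
  gcongr
  exact norm_lap_le hv j

theorem abs_multiplier_le_of_bound (hν : IsUnitNormalField N ν) {v : Grid → Space}
    (hvN : ∀ j, v j ∈ N) {B : ℝ} (hv : ∀ j, ‖v j‖ ≤ B) (j : Grid) :
    |multiplier h ν v j| ≤ h⁻¹ ^ 2 * (8 * B) := by
  rw [multiplier, abs_neg]
  refine (abs_real_inner_le_norm _ _).trans ?_
  rw [hν.norm_eq_one _ (hvN j), mul_one]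
  exact norm_discreteLaplacian_le hv j

theorem norm_multiplier_smul_le (hν : IsUnitNormalField N ν) {v : Grid → Space}
    (hvN : ∀ j, v j ∈ N) {B : ℝ} (hv : ∀ j, ‖v j‖ ≤ B) (j : Grid) :
    ‖multiplier h ν v j • ν (v j)‖ ≤ h⁻¹ ^ 2 * (8 * B) := by
  rw [norm_smul, hν.norm_eq_one _ (hvN j), mul_one]
  exact abs_multiplier_le_of_bound hν hvN hv j

/-- The spatial integral in the weak form of the semi-discrete flow. -/
noncomputable def weakSlice (h : ℝ) (ν : Space → Space) (φ : ℝ × Plane → Space) (v : Grid → Space)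
    (t : ℝ) : ℝ :=
  (∫ x, ⟪pc h v x, timeDeriv φ (t, x)⟫) + (∫ x, ⟪pc h v x, testLap h φ (t, x)⟫) +
    ∫ x, multiplier h ν v (cellIndex h x) * ⟪ν (pc h v x), φ (t, x)⟫

theorem continuous_timeDeriv (hφ : ContDiff ℝ ∞ φ) : Continuous (timeDeriv φ) :=
  (contDiff_fderiv_apply hφ _).continuous

theorem hasCompactSupport_timeDeriv (hs : HasCompactSupport φ) :
    HasCompactSupport (timeDeriv φ) := hs.fderiv_apply ℝ _

theorem tsupport_timeDeriv_subset : tsupport (timeDeriv φ) ⊆ tsupport φ :=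
  tsupport_fderiv_apply_subset ℝ _

theorem integral_flowVelocity (hν : IsUnitNormalField N ν) (hh : 0 < h) {v : Grid → Space}
    (hvN : ∀ j, v j ∈ N) {B : ℝ} (hv : ∀ j, ‖v j‖ ≤ B) (hφ : ContDiff ℝ ∞ φ)
    (hs : HasCompactSupport φ) (t : ℝ) :
    ∫ x, (⟪pc h v x, timeDeriv φ (t, x)⟫ + ⟪flowVelocity h ν v (cellIndex h x), φ (t, x)⟫) =
      weakSlice h ν φ v t := by
  have hψc := continuous_slice hφ.continuous t
  have hψs := hasCompactSupport_slice hs t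
  have i1 : Integrable fun x => ⟪pc h v x, timeDeriv φ (t, x)⟫ :=
    integrable_inner_of_bound (aesm_pc h v _) (Eventually.of_forall fun x => hv _)
      (continuous_slice (continuous_timeDeriv hφ) t)
      (hasCompactSupport_slice (hasCompactSupport_timeDeriv hs) t)
  have i2 : Integrable fun x => ⟪pc h (discreteLaplacian h v) x, φ (t, x)⟫ :=
    integrable_inner_of_bound (aesm_pc h _ _)
      (Eventually.of_forall fun x => norm_discreteLaplacian_le hv _) hψc hψs
  have i3 : Integrable fun x => ⟪pc h (fun j => multiplier h ν v j • ν (v j)) x, φ (t, x)⟫ :=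
    integrable_inner_of_bound (aesm_pc h _ _)
      (Eventually.of_forall fun x => norm_multiplier_smul_le hν hvN hv _) hψc hψs
  have e : ∀ x, ⟪flowVelocity h ν v (cellIndex h x), φ (t, x)⟫ =
      ⟪pc h (discreteLaplacian h v) x, φ (t, x)⟫ +
        ⟪pc h (fun j => multiplier h ν v j • ν (v j)) x, φ (t, x)⟫ := fun x => by
    rw [flowVelocity, inner_add_left]; rfl
  have i23 : Integrable fun x => ⟪pc h (discreteLaplacian h v) x, φ (t, x)⟫ +
      ⟪pc h (fun j => multiplier h ν v j • ν (v j)) x, φ (t, x)⟫ := i2.add i3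
  simp only [e]
  rw [integral_add i1 i23, integral_add i2 i3, weakSlice, add_assoc]
  congr 2
  · exact integral_inner_discreteLaplacian hh hv hφ.continuous hs t
  · refine integral_congr_ae (Eventually.of_forall fun x => ?_)
    simp only [pc, real_inner_smul_left]

theorem measurable_flowVelocity (hν : IsUnitNormalField N ν) {V : ℝ → Grid → Space}
    (hV : ∀ j, Measurable fun t => V t j) (j : Grid) :
    Measurable fun t => flowVelocity h ν (V t) j := by
  have h1 : Measurable fun t => discreteLaplacian h (V t) j := by
    simp only [discreteLaplacian, forwardDiff, backwardDiff]
    exact Finset.measurable_fun_sum _ fun i _ =>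
      ((((hV _).sub (hV _)).const_smul (h⁻¹)).sub
        (((hV _).sub (hV _)).const_smul (h⁻¹))).const_smul (h⁻¹)
  have h2 : Measurable fun t => ν (V t j) := hν.smooth.continuous.measurable.comp (hV j)
  have h3 : Measurable fun t => multiplier h ν (V t) j := (Measurable.inner (𝕜 := ℝ) h1 h2).neg
  exact h1.add (h3.smul h2)

theorem integrable_of_bounded_support {α : Type*} [TopologicalSpace α] [MeasurableSpace α]
    [BorelSpace α] {μ : Measure α} [IsFiniteMeasureOnCompacts μ] {K : Set α} (hK : IsCompact K)
    {F : α → ℝ} (hF : AEStronglyMeasurable F μ) {C : ℝ} (hC : ∀ x, ‖F x‖ ≤ C)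
    (hFK : ∀ x ∉ K, F x = 0) : Integrable F μ := by
  rw [← integrableOn_iff_integrable_of_support_subset (s := K) fun x hx => by
    by_contra h0
    exact hx (hFK x h0)]
  exact Measure.integrableOn_of_bounded (M := C) hK.measure_lt_top.ne hF
    (Eventually.of_forall hC)

/-- For fixed `x` the integrand is the time derivative of the inner product of solution and test
map, so it integrates to the initial value. Fubini's theorem exchanges this with the integral over
`x`; for fixed `h` all terms are bounded with compact support. -/
theorem IsSemidiscreteFlow.integral_weakSlice (hN : IsCompact N) (hν : IsUnitNormalField N ν)
    (hh : 0 < h) (hU : IsSemidiscreteFlow N ν h f U) (hφ : ContDiff ℝ ∞ φ)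
    (hs : HasCompactSupport φ) :
    IntegrableOn (fun t => weakSlice h ν φ (U t) t) (Ioi 0) ∧
    ∫ t in Ioi 0, weakSlice h ν φ (U t) t = - ∫ x, ⟪pc h f x, φ (0, x)⟫ := by
  obtain ⟨B, hB⟩ := hN.isBounded.exists_norm_le
  obtain ⟨R, hR0, hR⟩ := exists_radius hs
  set V : ℝ → Grid → Space := fun t => U (max t 0) with hV
  have hVN : ∀ t j, V t j ∈ N := fun t j => hU.mem_target _ (le_max_right _ _) j
  have hVB : ∀ t j, ‖V t j‖ ≤ B := fun t j => hB _ (hVN t j)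
  have hB0 : 0 ≤ B := (norm_nonneg _).trans (hVB 0 0)
  have hVm : ∀ j, Measurable fun t => V t j := fun j => by
    have hc : ContinuousOn (fun t => U t j) (Ici 0) := fun t ht =>
      (hU.equation t ht j).continuousWithinAt
    exact (hc.comp_continuous (continuous_id.max continuous_const) fun t =>
      mem_Ici.2 (le_max_right _ _)).measurable
  set C : ℝ := h⁻¹ ^ 2 * (8 * B) + h⁻¹ ^ 2 * (8 * B) with hC
  have hvel : ∀ t j, ‖flowVelocity h ν (V t) j‖ ≤ C := fun t j =>
    norm_add_le_of_le (norm_discreteLaplacian_le (hVB t) j)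
      (norm_multiplier_smul_le hν (hVN t) (hVB t) j)
  obtain ⟨M, hM⟩ := hφ.continuous.bounded_above_of_compact_support hs
  obtain ⟨M', hM'⟩ := (continuous_timeDeriv hφ).bounded_above_of_compact_support
    (hasCompactSupport_timeDeriv hs)
  have hR' : tsupport (timeDeriv φ) ⊆ Metric.ball 0 R := tsupport_timeDeriv_subset.trans hR
  set Ψ : ℝ × Plane → ℝ := fun z => ⟪pc h (V z.1) z.2, timeDeriv φ z⟫ +
    ⟪pc h (flowVelocity h ν (V z.1)) z.2, φ z⟫ with hΨ
  have hΨm : Measurable Ψ := by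
    have h1 := (stronglyMeasurable_uncurry_pc (h := h) hVm).measurable
    have h2 := (stronglyMeasurable_uncurry_pc (h := h)
      (v := fun t => flowVelocity h ν (V t)) (measurable_flowVelocity hν hVm)).measurable
    exact (h1.inner (continuous_timeDeriv hφ).measurable).add
      (h2.inner hφ.continuous.measurable)
  have hΨb : ∀ z, ‖Ψ z‖ ≤ B * M' + C * M := fun z => by
    refine norm_add_le_of_le ((norm_inner_le_norm _ _).trans ?_)
      ((norm_inner_le_norm _ _).trans ?_)
    · exact mul_le_mul (hVB _ _) (hM' z) (norm_nonneg _) hB0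
    · exact mul_le_mul (hvel _ _) (hM z) (norm_nonneg _) (by positivity)
  have hΨ0 : ∀ t x, R ≤ |t| → Ψ (t, x) = 0 := fun t x ht => by
    simp only [hΨ, eq_zero_of_le_abs hR x ht, eq_zero_of_le_abs hR' x ht, inner_zero_right,
      add_zero]
  have hΨi : Integrable (Function.uncurry fun t x => Ψ (t, x))
      ((volume.restrict (Ioi (0 : ℝ))).prod (volume : Measure Plane)) := by
    have h1 : Integrable Ψ (volume : Measure (ℝ × Plane)) := by
      refine integrable_of_bounded_support (isCompact_closedBall (0 : ℝ × Plane) R)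
        hΨm.aestronglyMeasurable hΨb fun z hz => ?_
      have e : ∀ {g : ℝ × Plane → Space}, tsupport g ⊆ Metric.ball 0 R → g z = 0 := fun {g} hg => by
        by_contra h0
        exact hz (Metric.ball_subset_closedBall (hg (subset_tsupport _ h0)))
      simp only [hΨ, e hR, e hR', inner_zero_right, add_zero]
    have h2 : (volume.restrict (Ioi (0 : ℝ))).prod (volume : Measure Plane) =
        (volume : Measure (ℝ × Plane)).restrict (Ioi 0 ×ˢ univ) := by
      rw [Measure.volume_eq_prod, ← Measure.prod_restrict, Measure.restrict_univ]
    rw [h2]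
    exact h1.restrict
  have hslice : ∀ t ∈ Ioi (0 : ℝ), ∫ x, Ψ (t, x) = weakSlice h ν φ (U t) t := fun t ht => by
    have e : V t = U t := by simp only [hV, max_eq_left (mem_Ioi.1 ht).le]
    rw [← e]
    exact integral_flowVelocity hν hh (hVN t) (hVB t) hφ hs t
  have htime : ∀ x, ∫ t in Ioi 0, Ψ (t, x) = -⟪pc h f x, φ (0, x)⟫ := fun x => by
    set j := cellIndex h x with hj
    have hd : ∀ t, 0 ≤ t → HasDerivWithinAt (fun t => ⟪U t j, φ (t, x)⟫)
        (⟪U t j, timeDeriv φ (t, x)⟫ + ⟪flowVelocity h ν (U t) j, φ (t, x)⟫) (Ici 0) t :=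
      fun t ht => by
      have h1 : HasDerivAt (fun s : ℝ => (s, x)) ((1 : ℝ), (0 : Plane)) t :=
        (hasDerivAt_id t).prodMk (hasDerivAt_const t x)
      have h2 : HasDerivAt (fun s => φ (s, x)) (timeDeriv φ (t, x)) t :=
        ((hφ.differentiable (by simp)) (t, x)).hasFDerivAt.comp_hasDerivAt t h1
      exact (hU.equation t ht j).inner ℝ h2.hasDerivWithinAt
    have hi : Integrable fun t : ℝ => Ψ (t, x) :=
      integrable_of_bounded_support (isCompact_Icc (a := -R) (b := R))
        (hΨm.comp measurable_prodMk_right).aestronglyMeasurable (fun t => hΨb _) fun t ht =>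
          hΨ0 t x (by
            by_contra hlt
            exact ht (abs_le.1 (not_le.1 hlt).le))
    have e : ∀ t ∈ Ioi (0 : ℝ), Ψ (t, x) =
        ⟪U t j, timeDeriv φ (t, x)⟫ + ⟪flowVelocity h ν (U t) j, φ (t, x)⟫ := fun t ht => by
      simp only [hΨ, hV, max_eq_left (mem_Ioi.1 ht).le, pc, hj]
    have hfin := integral_Ioi_of_hasDerivAt_of_tendsto (f := fun t => ⟪U t j, φ (t, x)⟫)
      (f' := fun t => Ψ (t, x)) (a := 0) (m := 0) (hd 0 le_rfl).continuousWithinAt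
      (fun t ht => by
        rw [e t ht]
        exact (hd t (mem_Ioi.1 ht).le).hasDerivAt (Ici_mem_nhds ht)) hi.integrableOn ?_
    · rw [hfin, hU.initial, zero_sub]; rfl
    · refine tendsto_const_nhds.congr' ?_
      filter_upwards [eventually_ge_atTop R] with t ht
      rw [eq_zero_of_le_abs hR x (ht.trans (le_abs_self t)), inner_zero_right]
  constructor
  · refine IntegrableOn.congr_fun (f := fun t => ∫ x, Ψ (t, x)) hΨi.integral_prod_left hslice
      measurableSet_Ioi
  · rw [← setIntegral_congr_fun measurableSet_Ioi hslice, integral_integral_swap hΨi,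
      ← integral_neg]
    exact integral_congr_ae (Eventually.of_forall htime)

end

/-! ### Passage to the limit in the weak form -/

section
variable {φ : ℝ × Plane → Space}

theorem tendsto_integral_inner {q : ℕ → Plane → Space} {p ψ : Plane → Space} {B : ℝ}
    (hq : ∀ n, AEStronglyMeasurable (q n)) (hB : ∀ n x, ‖q n x‖ ≤ B) (hp : AEStronglyMeasurable p)
    (hlim : ∀ R, Tendsto (fun n => eLpNorm (fun x => q n x - p x) 2
      (volume.restrict (Metric.ball 0 R))) atTop (𝓝 0))
    (hψ : Continuous ψ) (hs : HasCompactSupport ψ) :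
    Tendsto (fun n => ∫ x, ⟪q n x, ψ x⟫) atTop (𝓝 (∫ x, ⟪p x, ψ x⟫)) := by
  obtain ⟨R, hR⟩ := hs.isCompact.isBounded.subset_ball 0
  obtain ⟨M, hM⟩ := hψ.bounded_above_of_compact_support hs
  refine tendsto_integral_of_norm_sub_le (R := R) (M := M)
    (fun n => integrable_inner_of_bound (hq n) (Eventually.of_forall (hB n)) hψ hs)
    (hp.inner hψ.aestronglyMeasurable) (fun n => ((hq n).sub hp).restrict)
    (fun n x => ?_) (fun n x hx => ?_) (hlim R)
  · rw [← inner_sub_left, mul_comm]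
    exact (norm_inner_le_norm _ _).trans (mul_le_mul_of_nonneg_left (hM x) (norm_nonneg _))
  · have : ψ x = 0 := by
      by_contra h0
      exact hx (hR (subset_tsupport _ h0))
    rw [this, inner_zero_right, inner_zero_right]

/-- The spatial Laplacian of a test map. -/
noncomputable def spaceLap (φ : ℝ × Plane → Space) (z : ℝ × Plane) : Space :=
  ∑ i, secondDeriv φ (spaceDir i) z

theorem continuous_spaceLap (hφ : ContDiff ℝ ∞ φ) : Continuous (spaceLap φ) :=
  continuous_finsetSum _ fun i _ => continuous_secondDeriv hφ (spaceDir i)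

theorem spaceLap_eq_zero {z : ℝ × Plane} (hz : z ∉ tsupport φ) : spaceLap φ z = 0 := by
  refine Finset.sum_eq_zero fun i _ => ?_
  by_contra h0
  exact hz ((tsupport_fderiv_apply_subset ℝ _).trans (tsupport_fderiv_apply_subset ℝ _)
    (subset_tsupport _ h0))

theorem tsupport_spaceLap_subset : tsupport (spaceLap φ) ⊆ tsupport φ :=
  closure_minimal (fun z hz => by
    by_contra h0
    exact hz (spaceLap_eq_zero h0)) (isClosed_tsupport φ)

theorem hasCompactSupport_spaceLap (hs : HasCompactSupport φ) :
    HasCompactSupport (spaceLap φ) :=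
  hs.isCompact.of_isClosed_subset (isClosed_tsupport _) tsupport_spaceLap_subset

theorem tendstoUniformly_testLap (hφ : ContDiff ℝ ∞ φ) (hs : HasCompactSupport φ) {ε : ℝ}
    (hε : 0 < ε) : ∃ δ > 0, ∀ h, 0 < h → h < δ → ∀ z, ‖testLap h φ z - spaceLap φ z‖ ≤ ε := by
  choose δ hδ H using fun i => tendstoUniformly_secondDiff hφ hs (spaceDir i) (half_pos hε)
  refine ⟨min (δ 0) (δ 1), lt_min (hδ 0) (hδ 1), fun h h0 h1 z => ?_⟩
  rw [testLap, spaceLap, ← Finset.sum_sub_distrib, Fin.sum_univ_two]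
  refine (norm_add_le_of_le (H 0 h h0 (h1.trans_le (min_le_left _ _)) z)
    (H 1 h h0 (h1.trans_le (min_le_right _ _)) z)).trans (by rw [add_halves])

theorem continuous_testLap (hφ : Continuous φ) (h : ℝ) : Continuous (testLap h φ) := by
  unfold testLap secondDiff
  fun_prop

theorem testLap_eq_zero_of_le_abs {R : ℝ} (hR : tsupport φ ⊆ Metric.ball 0 R) (h : ℝ) {t : ℝ}
    (x : Plane) (ht : R ≤ |t|) : testLap h φ (t, x) = 0 := by
  refine Finset.sum_eq_zero fun i _ => ?_
  rw [secondDiff, add_smul_spaceDir, sub_smul_spaceDir, eq_zero_of_le_abs hR _ ht,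
    eq_zero_of_le_abs hR _ ht, eq_zero_of_le_abs hR _ ht]
  simp

theorem testLap_eq_zero_of_le_norm {R : ℝ} (hR : tsupport φ ⊆ Metric.ball 0 R) {h : ℝ}
    (h0 : 0 ≤ h) (h1 : h ≤ 1) (t : ℝ) {x : Plane} (hx : R + 1 ≤ ‖x‖) :
    testLap h φ (t, x) = 0 := by
  have hn : ∀ i : Fin 2, ‖h • (EuclideanSpace.single i 1 : Plane)‖ ≤ 1 := fun i => by
    rw [norm_smul, PiLp.norm_single, norm_one, mul_one, Real.norm_of_nonneg h0]
    exact h1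
  refine Finset.sum_eq_zero fun i _ => ?_
  have a1 : R ≤ ‖x + h • (EuclideanSpace.single i 1 : Plane)‖ := by
    have := norm_sub_le (x + h • (EuclideanSpace.single i 1 : Plane))
      (h • EuclideanSpace.single i 1)
    rw [add_sub_cancel_right] at this
    linarith [hn i]
  have a2 : R ≤ ‖x - h • (EuclideanSpace.single i 1 : Plane)‖ := by
    linarith [hn i, norm_sub_norm_le x (h • (EuclideanSpace.single i 1 : Plane))]
  rw [secondDiff, add_smul_spaceDir, sub_smul_spaceDir, eq_zero_of_le_norm hR _ a1,
    eq_zero_of_le_norm hR _ a2, eq_zero_of_le_norm hR _ (by linarith : R ≤ ‖x‖)]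
  simp

/-- The spatial integral in the weak form of the harmonic map heat flow. -/
noncomputable def limitSlice (ν : Space → Space) (φ : ℝ × Plane → Space) (w : Plane → Space)
    (g : Fin 2 → Plane → Space) (t : ℝ) : ℝ :=
  (∫ x, ⟪w x, timeDeriv φ (t, x)⟫) + (∫ x, ⟪w x, spaceLap φ (t, x)⟫) +
    ∫ x, (∑ i, ⟪fderiv ℝ ν (w x) (g i x), g i x⟫) * ⟪ν (w x), φ (t, x)⟫

variable {N : Set Space} {ν : Space → Space} {h : ℕ → ℝ} {u : ℕ → ℝ → Grid → Space}
  {p : ℝ → Plane → Space} {G : Fin 2 → ℝ → Plane → Space}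

theorem norm_integral_inner_testLap_sub_le {h : ℝ} {v : Grid → Space} {B : ℝ} (hv : ∀ j, ‖v j‖ ≤ B)
    (hφ : ContDiff ℝ ∞ φ) (hs : HasCompactSupport φ) {R : ℝ}
    (hR : tsupport φ ⊆ Metric.ball 0 R) (h0 : 0 ≤ h) (h1 : h ≤ 1) {ε : ℝ}
    (hε : ∀ z, ‖testLap h φ z - spaceLap φ z‖ ≤ ε) (t : ℝ) :
    ‖(∫ x, ⟪pc h v x, testLap h φ (t, x)⟫) - ∫ x, ⟪pc h v x, spaceLap φ (t, x)⟫‖ ≤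
      B * ε * volume.real (Metric.ball (0 : Plane) (R + 1)) := by
  have hB0 : 0 ≤ B := (norm_nonneg _).trans (hv 0)
  have z1 : ∀ x ∉ Metric.ball (0 : Plane) (R + 1), testLap h φ (t, x) = 0 := fun x hx => by
    rw [mem_ball_zero_iff, not_lt] at hx
    exact testLap_eq_zero_of_le_norm hR h0 h1 t hx
  have z2 : ∀ x ∉ Metric.ball (0 : Plane) (R + 1), spaceLap φ (t, x) = 0 := fun x hx => by
    rw [mem_ball_zero_iff, not_lt] at hx
    exact eq_zero_of_le_norm (tsupport_spaceLap_subset.trans hR) t (by linarith)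
  have hb : ∀ᵐ x, ‖pc h v x‖ ≤ B := Eventually.of_forall fun x => hv _
  rw [← integral_sub]
  · simp only [← inner_sub_right]
    exact norm_integral_inner_le hB0 (fun x => hv _) (fun x => hε (t, x)) fun x hx => by
      rw [z1 x hx, z2 x hx, sub_zero]
  · refine integrable_inner_of_bound (aesm_pc h v _) hb
      (continuous_slice (continuous_testLap hφ.continuous h) t)
      (HasCompactSupport.intro (isCompact_closedBall (0 : Plane) (R + 1)) fun x hx => ?_)
    exact z1 x fun hx' => hx (Metric.ball_subset_closedBall hx')
  · exact integrable_inner_of_bound (aesm_pc h v _) hb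
      (continuous_slice (continuous_spaceLap hφ) t)
      (hasCompactSupport_slice (hasCompactSupport_spaceLap hs) t)

theorem FlowLimit.tendsto_weakSlice (hN : IsCompact N) (hsm : IsSmoothHypersurface N)
    (hν : IsUnitNormalField N ν) (H : FlowLimit N h u p G) (hφ : ContDiff ℝ ∞ φ)
    (hs : HasCompactSupport φ) {t : ℝ} (ht : 0 < t) :
    Tendsto (fun n => weakSlice (h n) ν φ (u n t) t) atTop
      (𝓝 (limitSlice ν φ (p t) (fun i => G i t) t)) := by
  obtain ⟨B, hB⟩ := hN.isBounded.exists_norm_le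
  obtain ⟨R, hR0, hR⟩ := exists_radius hs
  have hb : ∀ n j, ‖u n t j‖ ≤ B := fun n j => hB _ (H.mem n t ht.le j)
  have hB0 : 0 ≤ B := (norm_nonneg _).trans (hb 0 0)
  have key : ∀ ψ : ℝ × Plane → Space, Continuous ψ → HasCompactSupport ψ →
      Tendsto (fun n => ∫ x, ⟪pc (h n) (u n t) x, ψ (t, x)⟫) atTop
        (𝓝 (∫ x, ⟪p t x, ψ (t, x)⟫)) := fun ψ hψ hψs =>
    tendsto_integral_inner (fun n => aesm_pc _ _ _) (fun n x => hb n _) (H.aesm t _)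
      (H.tendsto t ht.le) (continuous_slice hψ t) (hasCompactSupport_slice hψs t)
  refine ((key _ (continuous_timeDeriv hφ) (hasCompactSupport_timeDeriv hs)).add ?_).add
    (H.tendsto_integral_multiplier hN hsm hν ht (continuous_slice hφ.continuous t)
      (hasCompactSupport_slice hs t))
  -- The discrete Laplacian of the test map is replaced by the true one, to which it is uniformly
  -- close; both vanish outside a common ball once `h n ≤ 1`.
  refine tendsto_of_tendsto_of_dist
    (key _ (continuous_spaceLap hφ) (hasCompactSupport_spaceLap hs)) ?_
  rw [Metric.tendsto_atTop]
  intro ε hε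
  set V := volume.real (Metric.ball (0 : Plane) (R + 1)) with hV
  have hV0 : 0 ≤ V := measureReal_nonneg
  obtain ⟨δ, hδ, hlap⟩ := tendstoUniformly_testLap hφ hs
    (div_pos hε (by positivity : 0 < B * V + 1))
  obtain ⟨n₀, hn₀⟩ := eventually_atTop.1 (H.lim.eventually_lt_const (lt_min hδ one_pos))
  refine ⟨n₀, fun n hn => ?_⟩
  have hlt := lt_min_iff.1 (hn₀ n hn)
  rw [Real.dist_0_eq_abs, abs_of_nonneg dist_nonneg, dist_comm, dist_eq_norm]
  refine (norm_integral_inner_testLap_sub_le (hb n) hφ hs hR (H.pos n).le hlt.2.le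
    (hlap _ (H.pos n) hlt.1) t).trans_lt ?_
  rw [← hV, mul_right_comm, mul_div_assoc', div_lt_iff₀ (by positivity)]
  nlinarith [mul_nonneg hB0 hV0]

theorem weakSlice_eq_zero {R : ℝ} (hR : tsupport φ ⊆ Metric.ball 0 R) (h : ℝ) (v : Grid → Space)
    {t : ℝ} (ht : R ≤ |t|) : weakSlice h ν φ v t = 0 := by
  simp only [weakSlice, eq_zero_of_le_abs (tsupport_timeDeriv_subset.trans hR) _ ht,
    testLap_eq_zero_of_le_abs hR h _ ht, eq_zero_of_le_abs hR _ ht, inner_zero_right, mul_zero,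
    integral_zero, add_zero]

/-- The bound has to hold for all times simultaneously. Only large `n` qualify, because the discrete
Laplacian of the test map must be close to the true one and supported in a fixed ball. -/
theorem FlowSeq.exists_norm_weakSlice_le (hN : IsCompact N) (hsm : IsSmoothHypersurface N)
    (hν : IsUnitNormalField N ν) (H : FlowSeq N h u) (hφ : ContDiff ℝ ∞ φ)
    (hs : HasCompactSupport φ) :
    ∃ C, ∀ᶠ n in atTop, ∀ t, 0 ≤ t → ‖weakSlice (h n) ν φ (u n t) t‖ ≤ C := by
  obtain ⟨B, hB⟩ := hN.isBounded.exists_norm_le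
  obtain ⟨R, hR0, hR⟩ := exists_radius hs
  obtain ⟨C, hC0, hC⟩ := exists_abs_inner_normal_le hN hsm
  obtain ⟨M, hM⟩ := hφ.continuous.bounded_above_of_compact_support hs
  obtain ⟨M₁, hM₁⟩ := (continuous_timeDeriv hφ).bounded_above_of_compact_support
    (hasCompactSupport_timeDeriv hs)
  obtain ⟨M₂, hM₂⟩ := (continuous_spaceLap hφ).bounded_above_of_compact_support
    (hasCompactSupport_spaceLap hs)
  have hM0 : 0 ≤ M := (norm_nonneg _).trans (hM 0)
  obtain ⟨δ, hδ, hlap⟩ := tendstoUniformly_testLap hφ hs one_pos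
  set V := volume.real (Metric.ball (0 : Plane) (R + 1)) with hV
  refine ⟨B * M₁ * V + B * (M₂ + 1) * V + M * (16 * C), ?_⟩
  filter_upwards [H.lim.eventually_lt_const (lt_min hδ one_pos)] with n hn t ht
  have hlt := lt_min_iff.1 hn
  have hb : ∀ x, ‖pc (h n) (u n t) x‖ ≤ B := fun x => hB _ (H.mem n t ht _)
  have hB0 : 0 ≤ B := (norm_nonneg _).trans (hb 0)
  refine norm_add_le_of_le (norm_add_le_of_le ?_ ?_)
    (H.norm_integral_multiplier_le hν hC0 (hC ν hν) n ht hM0 fun x => hM _)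
  · refine norm_integral_inner_le hB0 hb (fun x => hM₁ _) fun x hx => ?_
    rw [mem_ball_zero_iff, not_lt] at hx
    exact eq_zero_of_le_norm (tsupport_timeDeriv_subset.trans hR) t (by linarith)
  · refine norm_integral_inner_le hB0 hb (fun x => ?_) fun x hx => ?_
    · have := norm_add_le_of_le (hM₂ (t, x)) (hlap _ (H.pos n) hlt.1 (t, x))
      rwa [add_sub_cancel] at this
    · rw [mem_ball_zero_iff, not_lt] at hx
      exact testLap_eq_zero_of_le_norm hR (H.pos n).le hlt.2.le t hx

/-- The slices converge at each positive time and are dominated by a constant up to the time where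
the test map vanishes, so dominated convergence applies. No convergence of gradients at `t = 0` is
used. -/
theorem FlowLimit.integral_limitSlice (hN : IsCompact N) (hsm : IsSmoothHypersurface N)
    (hν : IsUnitNormalField N ν) (H : FlowLimit N h u p G)
    (hU : ∀ n, IsSemidiscreteFlow N ν (h n) (u n 0) (u n)) (hφ : ContDiff ℝ ∞ φ)
    (hs : HasCompactSupport φ) :
    (∫ t in Ioi 0, limitSlice ν φ (p t) (fun i => G i t) t) + ∫ x, ⟪p 0 x, φ (0, x)⟫ = 0 := by
  obtain ⟨B, hB⟩ := hN.isBounded.exists_norm_le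
  obtain ⟨R, hR0, hR⟩ := exists_radius hs
  obtain ⟨C, hC⟩ := H.exists_norm_weakSlice_le hN hsm hν hφ hs
  have h1 : Tendsto (fun n => ∫ t in Ioi 0, weakSlice (h n) ν φ (u n t) t) atTop
      (𝓝 (∫ t in Ioi 0, limitSlice ν φ (p t) (fun i => G i t) t)) := by
    refine tendsto_integral_filter_of_dominated_convergence ((Iio R).indicator fun _ => C)
      (Eventually.of_forall fun n =>
        ((hU n).integral_weakSlice hN hν (H.pos n) hφ hs).1.aestronglyMeasurable)
      ?_ ?_ ?_
    · filter_upwards [hC] with n hn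
      filter_upwards [ae_restrict_mem measurableSet_Ioi] with t ht
      rw [mem_Ioi] at ht
      by_cases htR : t < R
      · rw [indicator_of_mem (mem_Iio.2 htR)]
        exact hn t ht.le
      · rw [indicator_of_notMem (by simpa using htR), weakSlice_eq_zero hR, norm_zero]
        exact (not_lt.1 htR).trans (le_abs_self t)
    · rw [integrable_indicator_iff measurableSet_Iio]
      refine integrableOn_const (hs := ?_) (by simp)
      rw [Measure.restrict_apply measurableSet_Iio]
      exact ((measure_mono fun t ht => ⟨ht.2, ht.1⟩ : _ ≤ volume (Ioo 0 R)).trans_lt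
        measure_Ioo_lt_top).ne
    · filter_upwards [ae_restrict_mem measurableSet_Ioi] with t ht
      exact H.tendsto_weakSlice hN hsm hν hφ hs ht
  have h2 : Tendsto (fun n => ∫ x, ⟪pc (h n) (u n 0) x, φ (0, x)⟫) atTop
      (𝓝 (∫ x, ⟪p 0 x, φ (0, x)⟫)) :=
    tendsto_integral_inner (fun n => aesm_pc _ _ _) (fun n x => hB _ (H.mem n 0 le_rfl _))
      (H.aesm 0 _) (H.tendsto 0 le_rfl) (continuous_slice hφ.continuous 0)
      (hasCompactSupport_slice hs 0)
  refine tendsto_nhds_unique (h1.add h2) (tendsto_const_nhds.congr fun n => ?_)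
  rw [((hU n).integral_weakSlice hN hν (H.pos n) hφ hs).2, neg_add_cancel]

end

/-! ### The limit is a distributional solution -/

section
variable {N : Set Space} {ν : Space → Space} {h : ℕ → ℝ} {u : ℕ → ℝ → Grid → Space}
  {p : ℝ → Plane → Space} {G : Fin 2 → ℝ → Plane → Space} {φ : ℝ × Plane → Space}

theorem restrict_upperHalf : (volume : Measure (ℝ × Plane)).restrict upperHalf =
    (volume.restrict (Ioi (0 : ℝ))).prod (volume : Measure Plane) := by
  rw [upperHalf, Measure.volume_eq_prod, ← Measure.prod_restrict, Measure.restrict_univ]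

theorem FlowLimit.ae_mem_upperHalf (hN : IsCompact N) (H : FlowLimit N h u p G) :
    ∀ᵐ z : ℝ × Plane ∂(volume.restrict upperHalf), p z.1 z.2 ∈ N := by
  rw [restrict_upperHalf]
  have hm : MeasurableSet {z : ℝ × Plane | p z.1 z.2 ∈ N} :=
    H.meas.measurable hN.isClosed.measurableSet
  rw [Measure.ae_prod_iff_ae_ae hm]
  filter_upwards [ae_restrict_mem measurableSet_Ioi] with t ht
  exact H.ae_mem hN (mem_Ioi.1 ht).le

theorem FlowLimit.memLp_grad_upperHalf (H : FlowLimit N h u p G) (i : Fin 2)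
    {K : Set (ℝ × Plane)} (hK : IsCompact K) :
    MemLp (fun z : ℝ × Plane => G i z.1 z.2) 2 (volume.restrict (K ∩ upperHalf)) := by
  obtain ⟨R, hR⟩ := hK.isBounded.subset_ball 0
  have hsub : K ∩ upperHalf ⊆ Ioo (0 : ℝ) R ×ˢ Metric.ball (0 : Plane) R := fun z hz => by
    have h1 := hR hz.1
    rw [mem_ball_zero_iff, Prod.norm_def, max_lt_iff] at h1
    exact ⟨⟨hz.2.1, (le_abs_self _).trans_lt h1.1⟩, mem_ball_zero_iff.2 h1.2⟩
  refine MemLp.mono_measure (Measure.restrict_mono hsub le_rfl) ?_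
  refine ⟨(H.meas_grad i).aestronglyMeasurable, ?_⟩
  refine lt_top_iff_ne_top.2 fun htop => ?_
  suffices hlt : eLpNorm (fun z : ℝ × Plane => G i z.1 z.2) 2
      (volume.restrict (Ioo (0 : ℝ) R ×ˢ Metric.ball (0 : Plane) R)) ^ 2 < ⊤ by
    simp [htop] at hlt
  rw [eLpNorm_two_sq, Measure.volume_eq_prod,
    ← Measure.prod_restrict,
    lintegral_prod (fun z : ℝ × Plane => ‖G i z.1 z.2‖ₑ ^ 2)
      ((H.meas_grad i).measurable.enorm.pow_const 2).aemeasurable]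
  calc ∫⁻ t in Ioo (0 : ℝ) R, ∫⁻ x in Metric.ball (0 : Plane) R, ‖G i t x‖ₑ ^ 2
      ≤ ∫⁻ t in Ioo (0 : ℝ) R, ENNReal.ofReal 2 ^ 2 :=
        setLIntegral_mono measurable_const fun t ht => by
          rw [← eLpNorm_two_sq]
          exact pow_le_pow_left₀ zero_le (H.eLpNorm_grad_le i ht.1 R) 2
    _ < ⊤ := by
        rw [setLIntegral_const]
        exact ENNReal.mul_lt_top (by simp) measure_Ioo_lt_top

theorem FlowLimit.integrable_inner_upperHalf (hN : IsCompact N) (H : FlowLimit N h u p G)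
    {ψ : ℝ × Plane → Space} (hψ : Continuous ψ) (hs : HasCompactSupport ψ) :
    Integrable (fun z : ℝ × Plane => ⟪p z.1 z.2, ψ z⟫) (volume.restrict upperHalf) := by
  obtain ⟨B, hB⟩ := hN.isBounded.exists_norm_le
  refine integrable_inner_of_bound (F := fun z : ℝ × Plane => p z.1 z.2) (B := B)
    H.meas.aestronglyMeasurable ?_ hψ hs
  filter_upwards [H.ae_mem_upperHalf hN] with z hz using hB _ hz

theorem FlowLimit.integrable_curvature_upperHalf (hN : IsCompact N)
    (hν : IsUnitNormalField N ν) (H : FlowLimit N h u p G) (hφ : Continuous φ)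
    (hs : HasCompactSupport φ) :
    Integrable (fun z : ℝ × Plane => (∑ i, ⟪fderiv ℝ ν (p z.1 z.2) (G i z.1 z.2), G i z.1 z.2⟫) *
      ⟪ν (p z.1 z.2), φ z⟫) (volume.restrict upperHalf) := by
  obtain ⟨K, hK⟩ := exists_norm_fderiv_le hN hν
  obtain ⟨M, hM⟩ := hφ.bounded_above_of_compact_support hs
  have hdν : Continuous fun y => fderiv ℝ ν y := hν.smooth.continuous_fderiv (by simp)
  have hsq : ∀ i, Integrable (fun z : ℝ × Plane => ‖G i z.1 z.2‖ ^ 2)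
      (volume.restrict (tsupport φ ∩ upperHalf)) := fun i =>
    (H.memLp_grad_upperHalf i hs.isCompact).norm.integrable_sq
  rw [← integrableOn_iff_integrable_of_support_subset (s := tsupport φ) fun z hz => by
    by_contra h0
    exact hz (by simp [image_eq_zero_of_notMem_tsupport h0]), IntegrableOn,
    Measure.restrict_restrict (isClosed_tsupport φ).measurableSet]
  have hp : AEStronglyMeasurable (fun z : ℝ × Plane => p z.1 z.2)
    (volume.restrict (tsupport φ ∩ upperHalf)) := H.meas.aestronglyMeasurable
  have hG : ∀ i, AEStronglyMeasurable (fun z : ℝ × Plane => G i z.1 z.2)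
    (volume.restrict (tsupport φ ∩ upperHalf)) := fun i => (H.meas_grad i).aestronglyMeasurable
  have hA : AEStronglyMeasurable (fun z : ℝ × Plane => fderiv ℝ ν (p z.1 z.2))
    (volume.restrict (tsupport φ ∩ upperHalf)) := hdν.comp_aestronglyMeasurable hp
  refine ((integrable_finsetSum Finset.univ fun i _ => hsq i).const_mul (K * M)).mono' ?_ ?_
  · refine AEStronglyMeasurable.mul ?_
      ((hν.smooth.continuous.comp_aestronglyMeasurable hp).inner hφ.aestronglyMeasurable)
    have happ : Continuous fun q : (Space →L[ℝ] Space) × Space => q.1 q.2 :=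
      isBoundedBilinearMap_apply.continuous
    exact Finset.aestronglyMeasurable_fun_sum _ fun i _ =>
      (happ.comp_aestronglyMeasurable (hA.prodMk (hG i))).inner (hG i)
  · filter_upwards [ae_mono (Measure.restrict_mono inter_subset_right le_rfl)
      (H.ae_mem_upperHalf hN)] with z hz
    have h1 : ‖⟪ν (p z.1 z.2), φ z⟫‖ ≤ M := by
      refine (norm_inner_le_norm _ _).trans ?_
      rw [hν.norm_eq_one _ hz, one_mul]
      exact hM z
    have h2 : ∀ i, ‖⟪fderiv ℝ ν (p z.1 z.2) (G i z.1 z.2), G i z.1 z.2⟫‖ ≤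
        K * ‖G i z.1 z.2‖ ^ 2 := fun i => by
      refine (norm_inner_le_norm _ _).trans ?_
      rw [sq, ← mul_assoc]
      gcongr
      exact (ContinuousLinearMap.le_opNorm _ _).trans (by gcongr; exact hK _ hz)
    rw [norm_mul, mul_right_comm, Finset.mul_sum]
    exact mul_le_mul (norm_sum_le_of_le _ fun i _ => h2 i) h1 (norm_nonneg _)
      (Finset.sum_nonneg fun i _ => by positivity)

theorem FlowLimit.setIntegral_upperHalf (hN : IsCompact N) (hν : IsUnitNormalField N ν)
    (H : FlowLimit N h u p G) (hφ : ContDiff ℝ ∞ φ) (hs : HasCompactSupport φ) :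
    ∫ z in upperHalf, (⟪p z.1 z.2, timeDeriv φ z⟫ + ⟪p z.1 z.2, spaceLap φ z⟫ +
      (∑ i, ⟪fderiv ℝ ν (p z.1 z.2) (G i z.1 z.2), G i z.1 z.2⟫) * ⟪ν (p z.1 z.2), φ z⟫) =
    ∫ t in Ioi 0, limitSlice ν φ (p t) (fun i => G i t) t := by
  have i1 := H.integrable_inner_upperHalf hN (continuous_timeDeriv hφ)
    (hasCompactSupport_timeDeriv hs)
  have i2 := H.integrable_inner_upperHalf hN (continuous_spaceLap hφ)
    (hasCompactSupport_spaceLap hs)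
  have i3 := H.integrable_curvature_upperHalf hN hν hφ.continuous hs
  have i12 := i1.add i2
  have i := i12.add i3
  rw [restrict_upperHalf] at i1 i2 i3 i12 i ⊢
  refine (integral_prod _ i).trans (integral_congr_ae ?_)
  filter_upwards [i1.prod_right_ae, i2.prod_right_ae, i3.prod_right_ae] with t j1 j2 j3
  have j12 : Integrable fun x => ⟪p t x, timeDeriv φ (t, x)⟫ + ⟪p t x, spaceLap φ (t, x)⟫ :=
    j1.add j2
  simp only [Pi.add_apply]
  rw [integral_add j12 j3, integral_add j1 j2, limitSlice]

theorem FlowLimit.isDistributionalSolution (hN : IsCompact N) (hsm : IsSmoothHypersurface N)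
    (hν : IsUnitNormalField N ν) (H : FlowLimit N h u p G)
    (hU : ∀ n, IsSemidiscreteFlow N ν (h n) (u n 0) (u n)) :
    IsDistributionalSolution N ν (p 0) p := by
  refine ⟨H.aesm 0 _, H.ae_mem hN le_rfl, H.meas.aestronglyMeasurable, H.ae_mem_upperHalf hN, G,
    fun i K hK => H.memLp_grad_upperHalf i hK, ?_, fun φ hφ hs => ?_⟩
  · filter_upwards [ae_restrict_mem measurableSet_Ioi] with t ht
    exact H.hasWeakGradient hN ht
  · have e := H.integral_limitSlice hN hsm hν hU hφ hs
    rw [← H.setIntegral_upperHalf hN hν hφ hs] at e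
    simp only [deriv_time_eq hφ, laplacian_eq_sum_secondDeriv hφ]
    exact e

end

end HarmonicFlow

/-! ### The main theorem -/

theorem mainTheorem3 (N : Set HarmonicFlow.Space) (hN : IsCompact N)
    (hN_smooth : HarmonicFlow.IsSmoothHypersurface N) :
    ∃ ε₀ : ℝ, 0 < ε₀ ∧
      ∀ ν : HarmonicFlow.Space → HarmonicFlow.Space, HarmonicFlow.IsUnitNormalField N ν →
      ∀ (h : ℕ → ℝ) (f : ℕ → HarmonicFlow.Grid → HarmonicFlow.Space),
        (∀ n, 0 < h n) → Tendsto h atTop (𝓝 0) → (∀ n j, f n j ∈ N) →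
        (⨆ n, HarmonicFlow.discreteEnergy (h n) (f n)) < ENNReal.ofReal ε₀ →
        (∀ n, ∃ u : ℝ → HarmonicFlow.Grid → HarmonicFlow.Space,
          HarmonicFlow.IsSemidiscreteFlow N ν (h n) (f n) u) ∧
        ∀ u : ℕ → ℝ → HarmonicFlow.Grid → HarmonicFlow.Space,
          (∀ n, HarmonicFlow.IsSemidiscreteFlow N ν (h n) (f n) (u n)) →
          ∃ (σ : ℕ → ℕ) (f₀ : HarmonicFlow.Plane → HarmonicFlow.Space)
            (p : ℝ → HarmonicFlow.Plane → HarmonicFlow.Space),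
            StrictMono σ ∧
            (∀ R : ℝ, 0 < R → HarmonicFlow.TendstoInL2 (Metric.ball 0 R)
              (fun k => HarmonicFlow.interpolant (h (σ k)) (f (σ k))) f₀) ∧
            (∀ t : ℝ, 0 < t → ∀ R : ℝ, 0 < R → HarmonicFlow.TendstoInH1 (Metric.ball 0 R)
              (fun k => HarmonicFlow.interpolant (h (σ k)) (u (σ k) t)) (p t)) ∧
            (HarmonicFlow.TendstoInH1 univ
                (fun k => HarmonicFlow.interpolant (h (σ k)) (f (σ k))) f₀ →
              ∀ t : ℝ, 0 < t → HarmonicFlow.TendstoInH1 univ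
                (fun k => HarmonicFlow.interpolant (h (σ k)) (u (σ k) t)) (p t)) ∧
            HarmonicFlow.IsDistributionalSolution N ν f₀ p := by
  obtain ⟨ε₀, hε₀, H⟩ := HarmonicFlow.exists_energy_threshold hN hN_smooth
  refine ⟨ε₀, hε₀, fun ν hν h f hpos hlim hf hE => ?_⟩
  have key := fun n => H ν hν (h n) (f n) (hpos n) (hf n)
    ((le_iSup (fun n => HarmonicFlow.discreteEnergy (h n) (f n)) n).trans_lt hE)
  refine ⟨fun n => (key n).1, fun u hu => ?_⟩
  have hS : HarmonicFlow.FlowSeq N h u :=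
    { pos := hpos
      lim := hlim
      mem := fun n => (hu n).mem_target
      cont := fun n j t ht => ((hu n).equation t ht j).continuousWithinAt
      bounds := fun n => (key n).2 (u n) (hu n) }
  obtain ⟨σ, p, G, hσ, hL⟩ := hS.exists_flowLimit hN
  have h0 : ∀ n, u n 0 = f n := fun n => funext (hu n).initial
  -- The compactness of the maps includes `t = 0`, so the limit of the initial data is the time
  -- slice `p 0`.
  refine ⟨σ, p 0, p, hσ, fun R _ => ⟨fun k => HarmonicFlow.aesm_interpolant _ _ _, hL.aesm 0 _, ?_⟩,
    fun t ht R _ => hL.tendstoInH1_ball hN ht R,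
    fun hf0 t ht => hL.tendstoInH1_univ hN ?_ ht,
    hL.isDistributionalSolution hN hN_smooth hν fun n => ?_⟩
  · have := hL.tendsto_interpolant le_rfl R
    simp only [Function.comp_apply, h0] at this
    exact this
  · simpa only [Function.comp_apply, h0] using hf0
  · simpa only [Function.comp_apply, h0] using hu (σ n)
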